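/- **Setting.** Let $p$ be odd, $p'$ even with $\gcd(p,p')=1$, $q=e^{-i\pi p'/p}$, $q^{1/2}=e^{-i\pi p'/(2p)}$, and let $\mathcal H=(\mathbb C^p)^{\otimes N}$ with basis $|h_1,\dots,h_N\rangle$, $h_n\in\mathbb Z/p$. Let $v_n$ multiply by $q^{h_n}$ and let $u_n$ lower $h_n$ by one modulo $p$, so that $u_nv_n=q\,v_nu_n$ and $u_n^p=v_n^p=1$. Given bulk parameters $a_n,b_n,c_n,d_n,\alpha_n,\beta_n\in\mathbb C$, put $\gamma_n=a_nc_n/\alpha_n$, $\delta_n=b_nd_n/\beta_n$, $$L_n(\lambda)=\begin{pmatrix}\lambda\alpha_nv_n-\beta_n\lambda^{-1}v_n^{-1}&u_n(q^{-1/2}a_nv_n+q^{1/2}b_nv_n^{-1})\\u_n^{-1}(q^{1/2}c_nv_n+q^{-1/2}d_nv_n^{-1})&\gamma_nv_n/\lambda-\delta_n\lambda v_n^{-1}\end{pmatrix},$$ $M(\lambda)=L_N(\lambda q^{-1/2})\cdots L_1(\lambda q^{-1/2})$ and $\hat M(\lambda)=(-1)^N\sigma^yM(1/\lambda)^{t}\sigma^y$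 ($t$ is the transposition of the $2\times2$ matrix). Given boundary parameters $\zeta_-,\kappa_-,\tau_-\in\mathbb C$, put $$K_-(\lambda)=\frac1{\zeta_--1/\zeta_-}\begin{pmatrix}\frac{\lambda\zeta_-}{q^{1/2}}-\frac{q^{1/2}}{\lambda\zeta_-}&\kappa_-e^{\tau_-}(\frac{\lambda^2}q-\frac q{\lambda^2})\\\kappa_-e^{-\tau_-}(\frac{\lambda^2}q-\frac q{\lambda^2})&\frac{q^{1/2}\zeta_-}\lambda-\frac\lambda{\zeta_-q^{1/2}}\end{pmatrix},\qquad M(\lambda)K_-(\lambda)\hat M(\lambda)=\begin{pmatrix}\mathcal A_-(\lambda)&\mathcal B_-(\lambda)\\\mathcal C_-(\lambda)&\mathcal D_-(\lambda)\end{pmatrix}.$$ With gauge parameters $\alpha,\beta\in\mathbb C$ define $$\mathcal A_-(\lambda|\beta)=\frac{-\frac{\lambda q^{3/2}}\beta\mathcal A_-(\lambda)-\alpha q\mathcal B_-(\lambda)+\frac{1}{\alpha q}\mathcal C_-(\lambda)+\frac{\beta}{\lambda q^{3/2}}\mathcal D_-(\lambda)}{\beta/q^2-q^2/\beta},$$ $$\mathcal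 B_-(\lambda|\beta)=\frac{-\frac{\lambda\beta}{q^{1/2}}\mathcal A_-(\lambda)-\alpha q\mathcal B_-(\lambda)+\frac{\beta^2}{\alpha q}\mathcal C_-(\lambda)+\frac{\beta q^{1/2}}\lambda\mathcal D_-(\lambda)}{\beta-1/\beta},$$ $$\mathcal D_-(\lambda|\beta)=\frac{\frac{\lambda\beta}{q^{1/2}}\mathcal A_-(\lambda)+\alpha q\mathcal B_-(\lambda)-\frac1{\alpha q}\mathcal C_-(\lambda)-\frac{q^{1/2}}{\lambda\beta}\mathcal D_-(\lambda)}{\beta-1/\beta}.$$ Let $\alpha_-,\beta_-\ne0$ be any solution of $(\alpha_--\frac1{\alpha_-})(\beta_-+\frac1{\beta_-})=\frac{\zeta_--1/\zeta_-}{\kappa_-}$, $(\alpha_-+\frac1{\alpha_-})(\beta_--\frac1{\beta_-})=\frac{\zeta_-+1/\zeta_-}{\kappa_-}$, let $a_0\neq0$, and put $$g_-(\lambda)=\frac{(\frac{\lambda\alpha_-}{q^{1/2}}-\frac{q^{1/2}}{\lambda\alpha_-})(\frac{\lambda\beta_-}{q^{1/2}}+\frac{q^{1/2}}{\lambda\beta_-})}{(\alpha_--1/\alpha_-)(\beta_-+1/\beta_-)},\quad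 a(\lambda)=a_0\prod_n\Big(\frac{\beta_n}\lambda+\frac{b_n\alpha_n}{qa_n}\lambda\Big),\quad d(\lambda)=\frac{(-1)^N}{a_0}\prod_n\frac{a_nc_n}{\alpha_n}\Big(\frac1\lambda+\frac{qd_n\alpha_n}{c_n\beta_n}\lambda\Big),$$ $$\mathsf A_-(\lambda)=g_-(\lambda)\,a(\lambda q^{-1/2})\,d(1/(q^{1/2}\lambda)),\qquad \mathsf D_-(\lambda)=\frac{\lambda^2-1/\lambda^2}{\lambda^2/q^2-q^2/\lambda^2}\,\mathsf A_-(q/\lambda),$$ $\mu_{n,+}^2=-q\,a_n\beta_n/(\alpha_nb_n)$ and $\mu_{n,-}^2=-q\,c_n\beta_n/(\alpha_nd_n)$. **Theorem.** For Lebesgue-almost all values of $(\zeta_-,\kappa_-,\tau_-)$, of the bulk parameters and of $(\alpha,\beta)$ (and for every choice of $\alpha_-,\beta_-,a_0$ as above) there are, for all $\beta$ in the orbit $\{q^{2k}\beta\}_{k\in\mathbb Z}$ of the given one, a nonzero covector $\langle\Omega_\beta|$, a nonzero vector $|\Omega_\beta\rangle$ and nonzero numbers $\mathsf b_-(\beta)$,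 $\mathsf b_{-,1}(\beta),\dots,\mathsf b_{-,N}(\beta)$ such that the following holds for all $\beta$ in this orbit and all $\lambda\ne0$. Write $X_n^{(h)}=(\mathsf b_{-,n}(\beta)q^{h})^2+(\mathsf b_{-,n}(\beta)q^{h})^{-2}$ and $$\mathsf b_{\mathbf h}(\lambda|\beta)=\mathsf b_-(\beta)\Big(\frac{\lambda^2}q-\frac q{\lambda^2}\Big)\prod_{a=1}^N\Big(\frac\lambda{\mathsf b_{-,a}(\beta)q^{h_a}}-\frac{\mathsf b_{-,a}(\beta)q^{h_a}}\lambda\Big)\Big(\lambda q^{h_a}\mathsf b_{-,a}(\beta)-\frac1{\lambda q^{h_a}\mathsf b_{-,a}(\beta)}\Big).$$ 1. $\beta\neq0,\pm1,\pm q^2$, and $\langle\Omega_\beta|\mathcal B_-(\lambda|\beta)=\mathsf b_{\mathbf 0}(\lambda|\beta)\langle\Omega_{\beta/q^2}|$, $\mathcal B_-(\lambda|\beta)|\Omega_\beta\rangle=|\Omega_{q^2\beta}\rangle\,\mathsf b_{\mathbf 0}(\lambda|\beta)$. 2. For $\epsilon=\pm1$, all $n,m$ and $h\in\{1,\dots,p-1\}$: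 $\mathsf b_{-,n}^2(\beta)$ is different from $q^{1-2h}\alpha_-^{2\epsilon}$, $-q^{1-2h}\beta_-^{2\epsilon}$, $q^{1-2h}\mu_{m,+}^{2\epsilon}$ and $q^{1-2h}\mu_{m,-}^{2\epsilon}$. 3. The number $\mathsf n_\beta=\big(\prod_{b<a}(X_a^{(0)}-X_b^{(0)})\,\langle\Omega_\beta|\Omega_{\beta q^2}\rangle\big)^{1/2}$ is nonzero, and so are $\mathsf A_-$ and $\mathsf D_-$ at the points $q^{1-k}/\mathsf b_{-,n}(\beta)$, $1\le k\le p-1$. For $\mathbf h\in\{0,\dots,p-1\}^N$ the states $$\langle\beta,\mathbf h|=\frac1{\mathsf n_\beta}\langle\Omega_\beta|\prod_{n=1}^N\prod_{k=1}^{h_n}\frac{\mathcal A_-(q^{1-k}/\mathsf b_{-,n}(\beta)|\beta q^2)}{\mathsf A_-(q^{1-k}/\mathsf b_{-,n}(\beta))},\qquad|\beta,\mathbf h\rangle=\frac1{\mathsf n_{\beta/q^2}}\prod_{n=1}^N\prod_{k=1}^{h_n}\frac{\mathcal D_-(q^{1-k}/\mathsf b_{-,n}(\beta)|\beta)}{\mathsf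 D_-(q^{1-k}/\mathsf b_{-,n}(\beta))}|\Omega_\beta\rangle$$ (for each $n$ the factor $k=1$ acts first) form a basis of the covectors and a basis of the vectors of $\mathcal H$, respectively. 4. $\mathbb I=\sum_{\mathbf h}\prod_{b<a}(X_a^{(h_a)}-X_b^{(h_b)})\,|\beta q^2,\mathbf h\rangle\langle\beta,\mathbf h|$ and $\langle\beta,\mathbf h|\beta q^2,\mathbf k\rangle=\delta_{\mathbf h,\mathbf k}\prod_{b<a}(X_a^{(h_a)}-X_b^{(h_b)})^{-1}$. 5. $\langle\beta,\mathbf h|\mathcal B_-(\lambda|\beta)=\mathsf b_{\mathbf h}(\lambda|\beta)\langle\beta/q^2,\mathbf h|$ and $\mathcal B_-(\lambda|\beta)|\beta,\mathbf h\rangle=|q^2\beta,\mathbf h\rangle\,\mathsf b_{\mathbf h}(\lambda|\beta)$. 6. The pseudo-spectrum is simple: $\mathsf b_{-,n}^{2p}(\beta)\ne\pm1$; $\mathsf b_{-,m}^p(\beta)\neq\mathsf b_{-,n}^p(\beta)$ and $X_n^{(h)}\ne X_m^{(k)}$ for $n\ne m$ and all $h,k\in\{0,\dots,p-1\}$; and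 the functions $\lambda\mapsto\mathsf b_{\mathbf h}(\lambda|\beta)$ are pairwise different. 7. There are nonzero numbers $t_a,t_a'$ ($1\le a\le N$), depending on $\beta$ but not on $\mathbf h$, such that, with $z=\mathsf b_{-,a}(\beta)q^{h_a}$ and $e_a$ the $a$-th unit vector (labels are read modulo $p$), $$\langle\beta,\mathbf h|\mathcal A_-(z^{\pm1}|\beta q^2)=\mathsf A_-(z^{\pm1})\,\theta_\pm\,\langle\beta,\mathbf h\mp e_a|,\qquad\mathcal D_-(z^{\pm1}|\beta)|\beta,\mathbf h\rangle=|\beta,\mathbf h\mp e_a\rangle\,\theta_\pm'\,\mathsf D_-(z^{\pm1}).$$ Here $\theta_\pm=\theta'_\pm=1$ whenever $h_a\mp1\in\{0,\dots,p-1\}$; for the step $p-1\to0$ one has $\theta_-=t_a$, $\theta_-'=t_a'$, and for the step $0\to p-1$ one has $\theta_+=1/t_a$, $\theta_+'=1/t_a'$. -/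

import Mathlib

open MeasureTheory

namespace CyclicReflection

noncomputable section

/-! Throughout, `s : ℂ` stands for `q^{1/2}`, so that `q = s ^ 2`; the values used in the theorem are
the ones fixed by `qHalf`. The spectral parameter is called `lam`. -/

/-- The square root `q^{1/2} = exp(-iπ p'/(2p))` of the root of unity `q = exp(-iπ p'/p)`. -/
def qHalf (p' p : ℕ) : ℂ := Complex.exp (-(Complex.I * Real.pi * (p' / p)) / 2)

/-- Basis labels of the representation space `ℋ = (ℂ^p)^{⊗ N}`. -/
abbrev Config (p N : ℕ) : Type := Fin N → Fin p

/-- Vectors of `ℋ` (columns) and covectors of `ℋ` (rows), in coordinates. The pairing of a covector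
with a vector is the bilinear dot product. -/
abbrev State (p N : ℕ) : Type := Config p N → ℂ

/-- Linear operators on `ℋ`. -/
abbrev Op (p N : ℕ) : Type := Matrix (Config p N) (Config p N) ℂ

/-- Two by two matrices over the auxiliary space with entries in `End ℋ`. -/
abbrev AuxOp (p N : ℕ) : Type := Matrix (Fin 2) (Fin 2) (Op p N)

/-- Inner boundary parameters `ζ₋, κ₋, τ₋`, bulk parameters `a_n, b_n, c_n, d_n, α_n, β_n` and gauge
parameters `α, β`. -/
structure Params (N : ℕ) where
  zeta : ℂ
  kappa : ℂ
  tau : ℂ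
  gaugeAlpha : ℂ
  gaugeBeta : ℂ
  a : Fin N → ℂ
  b : Fin N → ℂ
  c : Fin N → ℂ
  d : Fin N → ℂ
  alpha : Fin N → ℂ
  beta : Fin N → ℂ

/-- The parameters as a point of `ℂ^5 × (ℂ^6)^N`, which carries Lebesgue measure. -/
def Params.ofCoords {N : ℕ} (w : (Fin 5 → ℂ) × (Fin N → Fin 6 → ℂ)) : Params N where
  zeta := w.1 0
  kappa := w.1 1
  tau := w.1 2
  gaugeAlpha := w.1 3
  gaugeBeta := w.1 4
  a n := w.2 n 0
  b n := w.2 n 1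
  c n := w.2 n 2
  d n := w.2 n 3
  alpha n := w.2 n 4
  beta n := w.2 n 5

/-- `γ_n = a_n c_n / α_n`. -/
def Params.gamma {N : ℕ} (P : Params N) (n : Fin N) : ℂ := P.a n * P.c n / P.alpha n

/-- `δ_n = b_n d_n / β_n`. -/
def Params.delta {N : ℕ} (P : Params N) (n : Fin N) : ℂ := P.b n * P.d n / P.beta n

section Operators

variable {p N : ℕ} [NeZero p]

/-- The Weyl generator `v_n`: `v_n |h⟩ = q^{h_n} |h⟩`. -/
def vOp (s : ℂ) (n : Fin N) : Op p N := Matrix.diagonal fun h => (s ^ 2) ^ (h n : ℕ)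

/-- The inverse of `v_n`. -/
def vInvOp (s : ℂ) (n : Fin N) : Op p N := Matrix.diagonal fun h => ((s ^ 2) ^ (h n : ℕ))⁻¹

/-- The Weyl generator `u_n`: it maps `|h⟩` to the basis vector with `h_n` lowered by one modulo `p`,
so that `u_n v_n = q v_n u_n`. -/
def uOp (n : Fin N) : Op p N :=
  Matrix.of fun g h => if g = Function.update h n (h n - 1) then 1 else 0

/-- The inverse of `u_n`. -/
def uInvOp (n : Fin N) : Op p N :=
  Matrix.of fun g h => if g = Function.update h n (h n + 1) then 1 else 0

/-- The Bazhanov-Stroganov Lax operator `L_n(lam)`. -/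
def lax (s : ℂ) (P : Params N) (n : Fin N) (lam : ℂ) : AuxOp p N :=
  !![(lam * P.alpha n) • vOp s n - (P.beta n / lam) • vInvOp s n,
      uOp n * ((s⁻¹ * P.a n) • vOp s n + (s * P.b n) • vInvOp s n);
    uInvOp n * ((s * P.c n) • vOp s n + (s⁻¹ * P.d n) • vInvOp s n),
      (P.gamma n / lam) • vOp s n - (P.delta n * lam) • vInvOp s n]

/-- The bulk monodromy matrix `M(lam) = L_N(lam q^{-1/2}) ⋯ L_1(lam q^{-1/2})`. -/
def monodromy (s : ℂ) (P : Params N) (lam : ℂ) : AuxOp p N :=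
  ((List.ofFn fun n : Fin N => (lax s P n (lam / s) : AuxOp p N)).reverse).prod

/-- A numerical matrix acting on the auxiliary space only. -/
def auxScalar (K : Matrix (Fin 2) (Fin 2) ℂ) : AuxOp p N := K.map (algebraMap ℂ (Op p N))

/-- The Pauli matrix `σ^y`. -/
def sigmaY : Matrix (Fin 2) (Fin 2) ℂ := !![0, -Complex.I; Complex.I, 0]

/-- `M̂(lam) = (-1)^N σ^y M(1/lam)^t σ^y`, the transposition being that of the auxiliary space. -/
def monodromyHat (s : ℂ) (P : Params N) (lam : ℂ) : AuxOp p N :=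
  (-1 : ℂ) ^ N •
    (auxScalar sigmaY * (monodromy s P (1 / lam)).transpose * auxScalar sigmaY)

/-- The boundary matrix `K_-(lam)`. -/
def kMinus (s : ℂ) (P : Params N) (lam : ℂ) : Matrix (Fin 2) (Fin 2) ℂ :=
  (1 / (P.zeta - 1 / P.zeta)) •
    !![lam * P.zeta / s - s / (lam * P.zeta),
        P.kappa * Complex.exp P.tau * (lam ^ 2 / s ^ 2 - s ^ 2 / lam ^ 2);
      P.kappa * Complex.exp (-P.tau) * (lam ^ 2 / s ^ 2 - s ^ 2 / lam ^ 2),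
        s * P.zeta / lam - lam / (P.zeta * s)]

/-- The boundary monodromy matrix `𝒰_-(lam) = M(lam) K_-(lam) M̂(lam)`; its entries are
`𝒜_-, ℬ_-, 𝒞_-, 𝒟_-`. -/
def boundaryMonodromy (s : ℂ) (P : Params N) (lam : ℂ) : AuxOp p N :=
  monodromy s P lam * auxScalar (kMinus s P lam) * monodromyHat s P lam

/-- The gauged generator `𝒜_-(lam|bt)`; here `q = s^2`, `q^{3/2} = s^3`, and `α` is the gauge
parameter of `P`. -/
def gaugedA (s : ℂ) (P : Params N) (lam bt : ℂ) : Op p N :=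
  (bt / (s ^ 2) ^ 2 - (s ^ 2) ^ 2 / bt)⁻¹ •
    (-(lam * s ^ 3 / bt) • boundaryMonodromy s P lam 0 0
      - (P.gaugeAlpha * s ^ 2) • boundaryMonodromy s P lam 0 1
      + (1 / (P.gaugeAlpha * s ^ 2)) • boundaryMonodromy s P lam 1 0
      + (bt / (lam * s ^ 3)) • boundaryMonodromy s P lam 1 1)

/-- The gauged generator `ℬ_-(lam|bt)`. -/
def gaugedB (s : ℂ) (P : Params N) (lam bt : ℂ) : Op p N :=
  (bt - 1 / bt)⁻¹ •
    (-(lam * bt / s) • boundaryMonodromy s P lam 0 0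
      - (P.gaugeAlpha * s ^ 2) • boundaryMonodromy s P lam 0 1
      + (bt ^ 2 / (P.gaugeAlpha * s ^ 2)) • boundaryMonodromy s P lam 1 0
      + (bt * s / lam) • boundaryMonodromy s P lam 1 1)

/-- The gauged generator `𝒟_-(lam|bt)`. -/
def gaugedD (s : ℂ) (P : Params N) (lam bt : ℂ) : Op p N :=
  (bt - 1 / bt)⁻¹ •
    ((lam * bt / s) • boundaryMonodromy s P lam 0 0
      + (P.gaugeAlpha * s ^ 2) • boundaryMonodromy s P lam 0 1
      - (1 / (P.gaugeAlpha * s ^ 2)) • boundaryMonodromy s P lam 1 0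
      - (s / (lam * bt)) • boundaryMonodromy s P lam 1 1)

end Operators

/-- The inner boundary parameters in the form `α₋, β₋`, which are determined by `ζ₋, κ₋` up to
finitely many choices. -/
def IsInnerBoundary {N : ℕ} (P : Params N) (am bm : ℂ) : Prop :=
  am ≠ 0 ∧ bm ≠ 0 ∧
    (am - 1 / am) * (bm + 1 / bm) = (P.zeta - 1 / P.zeta) / P.kappa ∧
    (am + 1 / am) * (bm - 1 / bm) = (P.zeta + 1 / P.zeta) / P.kappa

/-- `μ_{n,+} = i q^{1/2} (a_n β_n / (α_n b_n))^{1/2}`. -/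
def muPlus {N : ℕ} (s : ℂ) (P : Params N) (n : Fin N) : ℂ :=
  Complex.I * s * (P.a n * P.beta n / (P.alpha n * P.b n)) ^ (1 / 2 : ℂ)

/-- `μ_{n,-} = i q^{1/2} (c_n β_n / (α_n d_n))^{1/2}`. -/
def muMinus {N : ℕ} (s : ℂ) (P : Params N) (n : Fin N) : ℂ :=
  Complex.I * s * (P.c n * P.beta n / (P.alpha n * P.d n)) ^ (1 / 2 : ℂ)

/-- The function `g_-(lam)`. -/
def gMinus (s am bm lam : ℂ) : ℂ :=
  (lam * am / s - s / (lam * am)) * (lam * bm / s + s / (lam * bm)) /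
    ((am - 1 / am) * (bm + 1 / bm))

/-- The function `a(lam)`. -/
def aFun {N : ℕ} (s : ℂ) (P : Params N) (a0 lam : ℂ) : ℂ :=
  a0 * ∏ n, (P.beta n / lam + (s ^ 2)⁻¹ * (P.b n * P.alpha n / P.a n) * lam)

/-- The function `d(lam)`. -/
def dFun {N : ℕ} (s : ℂ) (P : Params N) (a0 lam : ℂ) : ℂ :=
  (-1) ^ N / a0 *
    ∏ n, (P.a n * P.c n / P.alpha n *
      (1 / lam + s ^ 2 * (P.d n * P.alpha n / (P.c n * P.beta n)) * lam))

/-- The scalar coefficient `𝖠_-(lam) = g_-(lam) a(lam q^{-1/2}) d(1/(q^{1/2} lam))`. -/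
def coefA {N : ℕ} (s : ℂ) (P : Params N) (am bm a0 lam : ℂ) : ℂ :=
  gMinus s am bm lam * aFun s P a0 (lam / s) * dFun s P a0 (1 / (s * lam))

/-- The scalar coefficient `𝖣_-(lam) = k(lam) 𝖠_-(q/lam)`. -/
def coefD {N : ℕ} (s : ℂ) (P : Params N) (am bm a0 lam : ℂ) : ℂ :=
  (lam ^ 2 - 1 / lam ^ 2) / (lam ^ 2 / (s ^ 2) ^ 2 - (s ^ 2) ^ 2 / lam ^ 2) *
    coefA s P am bm a0 (s ^ 2 / lam)

/-- The orbit `{q^{2k} bt : k ∈ ℤ}` of the gauge parameter, on which the pseudo-eigenstates live. -/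
def gaugeOrbit (s bt : ℂ) : Set ℂ := {x | ∃ k : ℤ, x = (s ^ 2) ^ (2 * k) * bt}

/-- Raw data, as functions of the gauge parameter `bt`: covectors `⟨Ω_bt|`, vectors `|Ω_bt⟩`, and the
numbers `b_-(bt)` and `b_{-,n}(bt)`. -/
structure PseudoData (p N : ℕ) where
  bra : ℂ → State p N
  ket : ℂ → State p N
  lead : ℂ → ℂ
  zero : ℂ → Fin N → ℂ

section Data

variable {p N : ℕ}

/-- `b_{-,n}(bt) q^h`. -/
def PseudoData.shiftedZero (E : PseudoData p N) (s bt : ℂ) (n : Fin N) (h : ℕ) : ℂ :=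
  E.zero bt n * (s ^ 2) ^ h

/-- `X_n^{(h)} = (b_{-,n}(bt) q^h)^2 + 1/(b_{-,n}(bt) q^h)^2`. -/
def PseudoData.X (E : PseudoData p N) (s bt : ℂ) (n : Fin N) (h : ℕ) : ℂ :=
  E.shiftedZero s bt n h ^ 2 + 1 / E.shiftedZero s bt n h ^ 2

/-- The product over `b < a` of `X_a^{(h_a)} - X_b^{(h_b)}`. -/
def PseudoData.vandermonde (E : PseudoData p N) (s bt : ℂ) (h : Fin N → ℕ) : ℂ :=
  ∏ a, ∏ b ∈ Finset.Iio a, (E.X s bt a (h a) - E.X s bt b (h b))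

/-- The pseudo-eigenvalue `b_h(lam|bt)`. -/
def PseudoData.eigenvalue (E : PseudoData p N) (s : ℂ) (h : Fin N → ℕ) (lam bt : ℂ) : ℂ :=
  E.lead bt * (lam ^ 2 / s ^ 2 - s ^ 2 / lam ^ 2) *
    ∏ a, ((lam / E.shiftedZero s bt a (h a) - E.shiftedZero s bt a (h a) / lam) *
      (lam * E.shiftedZero s bt a (h a) - 1 / (lam * E.shiftedZero s bt a (h a))))

/-- The normalization `n_bt`, whose square is the product over `b < a` of `X_a^{(0)} - X_b^{(0)}` times
`⟨Ω_bt|Ω_{bt q²}⟩`. -/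
def PseudoData.norm (E : PseudoData p N) (s bt : ℂ) : ℂ :=
  (E.vandermonde s bt (fun _ => 0) * (E.bra bt ⬝ᵥ E.ket (bt * (s ^ 2) ^ 2))) ^ (1 / 2 : ℂ)

variable [NeZero p]

/-- The product over `n` and over `k = 1, …, h_n` (in increasing order from left to right) of
`𝒜_-(q^{1-k}/b_{-,n}(bt)|bt q²) / 𝖠_-(q^{1-k}/b_{-,n}(bt))`. -/
def PseudoData.leftProduct (E : PseudoData p N) (s : ℂ) (P : Params N) (am bm a0 bt : ℂ)
    (h : Config p N) : Op p N :=
  (List.ofFn fun n : Fin N =>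
    ((List.range (h n : ℕ)).map fun k =>
      (coefA s P am bm a0 (1 / E.shiftedZero s bt n k))⁻¹ •
        (gaugedA s P (1 / E.shiftedZero s bt n k) (bt * (s ^ 2) ^ 2) : Op p N)).prod).prod

/-- The product over `n` and over `k = 1, …, h_n` (in increasing order from right to left, so that
`k = 1` acts first on a vector) of `𝒟_-(q^{1-k}/b_{-,n}(bt)|bt) / 𝖣_-(q^{1-k}/b_{-,n}(bt))`. -/
def PseudoData.rightProduct (E : PseudoData p N) (s : ℂ) (P : Params N) (am bm a0 bt : ℂ)
    (h : Config p N) : Op p N :=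
  (List.ofFn fun n : Fin N =>
    (((List.range (h n : ℕ)).reverse).map fun k =>
      (coefD s P am bm a0 (1 / E.shiftedZero s bt n k))⁻¹ •
        (gaugedD s P (1 / E.shiftedZero s bt n k) bt : Op p N)).prod).prod

/-- The covector `⟨bt, h_1, …, h_N|`. -/
def PseudoData.leftState (E : PseudoData p N) (s : ℂ) (P : Params N) (am bm a0 bt : ℂ)
    (h : Config p N) : State p N :=
  (E.norm s bt)⁻¹ • Matrix.vecMul (E.bra bt) (E.leftProduct s P am bm a0 bt h)

/-- The vector `|bt, h_1, …, h_N⟩`. -/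
def PseudoData.rightState (E : PseudoData p N) (s : ℂ) (P : Params N) (am bm a0 bt : ℂ)
    (h : Config p N) : State p N :=
  (E.norm s (bt / (s ^ 2) ^ 2))⁻¹ •
    Matrix.mulVec (E.rightProduct s P am bm a0 bt h) (E.ket bt)

/-- The label obtained by raising `h_a` by one, cyclically modulo `p`. -/
def raise (h : Config p N) (a : Fin N) : Config p N := Function.update h a (h a + 1)

/-- The label obtained by lowering `h_a` by one, cyclically modulo `p`. -/
def lower (h : Config p N) (a : Fin N) : Config p N := Function.update h a (h a - 1)

/-- The factor picked up by raising `h_a`: it is `1` unless the step goes from `p - 1` to `0`. -/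
def raiseFactor (t : Fin N → ℂ) (h : Config p N) (a : Fin N) : ℂ :=
  if (h a : ℕ) + 1 < p then 1 else t a

/-- The factor picked up by lowering `h_a`: it is `1` unless the step goes from `0` to `p - 1`. -/
def lowerFactor (t : Fin N → ℂ) (h : Config p N) (a : Fin N) : ℂ :=
  if 0 < (h a : ℕ) then 1 else (t a)⁻¹

end Data

end

end CyclicReflection

open CyclicReflection

/-!
# Separation of variables for the cyclic reflection algebra

The proof constructs both bases from the algebra of the gauged generators alone.

*Algebra.* The monodromy matrix `𝒰_-` is obtained from `K_-` by successive dressings with Lax matrices,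
which preserve the reflection equation, the parity relation between `lam` and `1 / lam`, and unitarity
(`reflectionEq_boundaryMonodromy`, `parityEq_boundaryMonodromy`, `boundaryMonodromy_mul`). Contracting
the reflection equation with gauge vectors gives three relations (`ReflectionEq.gauged_comm`,
`ReflectionEq.gauged_exchange`, `ReflectionEq.gauged_comm_mod`): the `ℬ_-` at neighbouring gauge
parameters commute, and the exchange relations of `𝒜_-` with `ℬ_-` and with `𝒜_-` hold modulo terms
with `ℬ_-` on the left. Together with `𝒜_-(q/lam) 𝒜_-(lam) = 𝖠_-(q/lam) 𝖠_-(lam)` modulo such terms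
(`gauged_unitarity`), they are all that is needed. The full transposition exchanges vectors with
covectors and `𝒟_-` with `𝒜_-`, so that one argument serves both sides.

*Pseudo-vacua.* By parity, and because `𝒰_-` is a number at `q^{1/2}` and a multiple of `σ^z` at
`i q^{1/2}`, the operator `ℬ_-(lam|β)` is `lam² / q - q / lam²` times a polynomial of degree `N` in
`lam² + 1 / lam²`. Its coefficients are commuting operators on families of states over the finite orbit
of `β`, so they have a common eigenvector (`exists_pseudo_eigenvector`). Its eigenvalue has `N` zeros
`z_n`, which do not depend on the point of the orbit.

*Ladders.* On a pseudo-eigenvector, `𝒜_-` at the inverse of a zero multiplies this zero by `q` and hence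
raises its label (`Ladder`, `Ladder.IsEig.raise`). The resulting `p ^ N` vectors are nonzero because the
raising can be undone, and linearly independent because their pseudo-eigenvalues have different zeros
(`Ladder.vec_independent`). Raising one label `p` times reproduces the initial state up to a factor
(`Ladder.exists_wrap`). The covector `⟨Ω_β|` is the element dual to `|Ω_{q²β}⟩` in the basis of vectors
(`SpectralData.exists_bra`).

*Pairings.* States with different labels are orthogonal. For the recursion of the diagonal pairings the
matrix element of the monodromy between `⟨β, h|` and `|q²β, h + e_a⟩` is computed from both sides. It is a
Laurent polynomial in `lam` of which all zeros but one are known, and whose extreme coefficients come from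
one operator (`exists_gauged_element_eq`); this gives the Vandermonde ratio
(`SpectralData.bras_dotProduct_ket_raise`).

*General position.* The conditions used above are that certain determinants do not vanish
(`Params.Generic`). These are rational functions on the lines through the point with
`a_n = b_n = c_n = d_n = 0`, `α_n = 2^{n+1}`, `β_n = 1` in the space of bulk parameters. There the `ℬ_-` are
diagonal, with explicit zeros whose moduli differ (`bCoeff_degenerate`), and the determinants
do not vanish. By Fubini's theorem they vanish almost nowhere (`Degenerates.ae_ne_zero`). The separation of
the zeros is a condition on their elementary symmetric functions, which are eigenvalues of operators
(`symOp`, `opEval`).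
-/


namespace CyclicReflection

noncomputable section

/-! ### The reflection equation -/

section Reflection

set_option linter.unusedSectionVars false

variable {𝓡 : Type*} [Ring 𝓡] [Algebra ℂ 𝓡]

/-- The embedding of a `2 × 2` matrix as an operator on the first of two auxiliary spaces. -/
def auxFst (A : Matrix (Fin 2) (Fin 2) 𝓡) : Matrix (Fin 2 × Fin 2) (Fin 2 × Fin 2) 𝓡 :=
  Matrix.of fun x y => if x.2 = y.2 then A x.1 y.1 else 0

/-- The embedding of a `2 × 2` matrix as an operator on the second of two auxiliary spaces. -/
def auxSnd (A : Matrix (Fin 2) (Fin 2) 𝓡) : Matrix (Fin 2 × Fin 2) (Fin 2 × Fin 2) 𝓡 :=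
  Matrix.of fun x y => if x.1 = y.1 then A x.2 y.2 else 0

/-- The six-vertex matrix with weights `a`, `b`, `c`. -/
def sixVertex (𝓡 : Type*) [Ring 𝓡] [Algebra ℂ 𝓡] (a b c : ℂ) :
    Matrix (Fin 2 × Fin 2) (Fin 2 × Fin 2) 𝓡 :=
  Matrix.of fun x y => algebraMap ℂ 𝓡
    (if x = y then (if x.1 = x.2 then a else b) else if x.1 = y.2 ∧ x.2 = y.1 then c else 0)

/-- The `R`-matrix of argument `lam / mu`, multiplied by `q * lam * mu` to clear denominators. -/
def rQuot (𝓡 : Type*) [Ring 𝓡] [Algebra ℂ 𝓡] (q lam mu : ℂ) :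
    Matrix (Fin 2 × Fin 2) (Fin 2 × Fin 2) 𝓡 :=
  sixVertex 𝓡 (q ^ 2 * lam ^ 2 - mu ^ 2) (q * (lam ^ 2 - mu ^ 2)) ((q ^ 2 - 1) * (lam * mu))

/-- The `R`-matrix of argument `lam * mu / q`, multiplied by `q * lam * mu` to clear denominators. -/
def rProd (𝓡 : Type*) [Ring 𝓡] [Algebra ℂ 𝓡] (q lam mu : ℂ) :
    Matrix (Fin 2 × Fin 2) (Fin 2 × Fin 2) 𝓡 :=
  sixVertex 𝓡 (q * (lam ^ 2 * mu ^ 2 - 1)) (lam ^ 2 * mu ^ 2 - q ^ 2) ((q ^ 2 - 1) * (lam * mu))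

/-- The reflection equation for `U`, the value at `lam`, and `V`, the value at `mu`. -/
def ReflectionEq (q lam mu : ℂ) (U V : Matrix (Fin 2) (Fin 2) 𝓡) : Prop :=
  rQuot 𝓡 q lam mu * auxFst U * rProd 𝓡 q lam mu * auxSnd V =
    auxSnd V * rProd 𝓡 q lam mu * auxFst U * rQuot 𝓡 q lam mu

theorem auxFst_mul (A B : Matrix (Fin 2) (Fin 2) 𝓡) : auxFst (A * B) = auxFst A * auxFst B := by
  ext ⟨i, k⟩ ⟨j, l⟩
  fin_cases k <;> fin_cases l <;>
    simp [auxFst, Matrix.mul_apply, Fintype.sum_prod_type]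

theorem auxSnd_mul (A B : Matrix (Fin 2) (Fin 2) 𝓡) : auxSnd (A * B) = auxSnd A * auxSnd B := by
  ext ⟨i, k⟩ ⟨j, l⟩
  fin_cases i <;> fin_cases j <;>
    simp [auxSnd, Matrix.mul_apply, Fintype.sum_prod_type]

theorem auxFst_mul_auxSnd (A B : Matrix (Fin 2) (Fin 2) 𝓡)
    (h : ∀ i j k l, Commute (A i j) (B k l)) : auxFst A * auxSnd B = auxSnd B * auxFst A := by
  ext ⟨i, k⟩ ⟨j, l⟩
  simp [auxFst, auxSnd, Matrix.mul_apply, Fintype.sum_prod_type, (h _ _ _ _).eq]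

/-- Sklyanin's dressing: if `U` solves the reflection equation and `L`, `L'` satisfy the exchange
relations with the six-vertex matrices, then `L U L'` solves the reflection equation. -/
theorem ReflectionEq.dress {q lam mu : ℂ} {U V L₁ L₂ L₁' L₂' : Matrix (Fin 2) (Fin 2) 𝓡}
    (h : ReflectionEq q lam mu U V)
    (h₁ : rQuot 𝓡 q lam mu * auxFst L₁ * auxSnd L₂ = auxSnd L₂ * auxFst L₁ * rQuot 𝓡 q lam mu)
    (h₂ : rQuot 𝓡 q lam mu * auxFst L₁' * auxSnd L₂' =
      auxSnd L₂' * auxFst L₁' * rQuot 𝓡 q lam mu)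
    (h₃ : auxFst L₁' * rProd 𝓡 q lam mu * auxSnd L₂ = auxSnd L₂ * rProd 𝓡 q lam mu * auxFst L₁')
    (h₄ : auxFst L₁ * rProd 𝓡 q lam mu * auxSnd L₂' = auxSnd L₂' * rProd 𝓡 q lam mu * auxFst L₁)
    (hUL : ∀ i j k l, Commute (U i j) (L₂ k l)) (hVL : ∀ i j k l, Commute (L₁ i j) (V k l))
    (hUL' : ∀ i j k l, Commute (U i j) (L₂' k l)) (hVL' : ∀ i j k l, Commute (L₁' i j) (V k l)) :
    ReflectionEq q lam mu (L₁ * U * L₁') (L₂ * V * L₂') := by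
  have c₁ := auxFst_mul_auxSnd U L₂ hUL
  have c₂ := auxFst_mul_auxSnd L₁ V hVL
  have c₃ := auxFst_mul_auxSnd U L₂' hUL'
  have c₄ := auxFst_mul_auxSnd L₁' V hVL'
  unfold ReflectionEq at h ⊢
  simp only [auxFst_mul, auxSnd_mul]
  set R := rQuot 𝓡 q lam mu
  set S := rProd 𝓡 q lam mu
  calc R * (auxFst L₁ * auxFst U * auxFst L₁') * S * (auxSnd L₂ * auxSnd V * auxSnd L₂')
      = R * auxFst L₁ * auxFst U * (auxFst L₁' * S * auxSnd L₂) * auxSnd V * auxSnd L₂' := by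
        simp only [mul_assoc]
    _ = R * auxFst L₁ * (auxFst U * auxSnd L₂) * S * (auxFst L₁' * auxSnd V) * auxSnd L₂' := by
        rw [h₃]; simp only [mul_assoc]
    _ = (R * auxFst L₁ * auxSnd L₂) * auxFst U * S * auxSnd V * (auxFst L₁' * auxSnd L₂') := by
        rw [c₁, c₄]; simp only [mul_assoc]
    _ = auxSnd L₂ * auxFst L₁ * (R * auxFst U * S * auxSnd V) * (auxFst L₁' * auxSnd L₂') := by
        rw [h₁]; simp only [mul_assoc]
    _ = auxSnd L₂ * (auxFst L₁ * auxSnd V) * S * auxFst U * (R * (auxFst L₁' * auxSnd L₂')) := by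
        rw [h]; simp only [mul_assoc]
    _ = auxSnd L₂ * auxSnd V * (auxFst L₁ * S * auxFst U * R * (auxFst L₁' * auxSnd L₂')) := by
        rw [c₂]; simp only [mul_assoc]
    _ = auxSnd L₂ * auxSnd V * (auxFst L₁ * S * auxFst U * (R * auxFst L₁' * auxSnd L₂')) := by
        simp only [mul_assoc]
    _ = auxSnd L₂ * auxSnd V * (auxFst L₁ * S * (auxFst U * auxSnd L₂') * auxFst L₁' * R) := by
        rw [h₂]; simp only [mul_assoc]
    _ = auxSnd L₂ * auxSnd V * ((auxFst L₁ * S * auxSnd L₂') * auxFst U * auxFst L₁' * R) := by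
        rw [c₃]; simp only [mul_assoc]
    _ = auxSnd L₂ * auxSnd V * auxSnd L₂' * S * (auxFst L₁ * auxFst U * auxFst L₁') * R := by
        rw [h₄]; simp only [mul_assoc]

/-- Elements `v`, `u` of an algebra with inverses `vi`, `ui` and `u v = q v u`. -/
structure WeylPair (q : ℂ) (v vi u ui : 𝓡) : Prop where
  v_vi : v * vi = 1
  vi_v : vi * v = 1
  u_ui : u * ui = 1
  ui_u : ui * u = 1
  u_v : u * v = q • (v * u)
  u_vi : u * vi = q⁻¹ • (vi * u)
  ui_v : ui * v = q⁻¹ • (v * ui)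
  ui_vi : ui * vi = q • (vi * ui)

/-- The local Lax matrix in terms of a Weyl pair; the diagonal entry `γ` of the parameters is
`a c / α`, and `δ` is `b d / β`. -/
def weylLax (s a b c d α β : ℂ) (v vi u ui : 𝓡) (lam : ℂ) : Matrix (Fin 2) (Fin 2) 𝓡 :=
  !![(lam * α) • v - (β / lam) • vi, u * ((s⁻¹ * a) • v + (s * b) • vi);
    ui * ((s * c) • v + (s⁻¹ * d) • vi), (a * c / α / lam) • v - (b * d / β * lam) • vi]

/-- The adjugate `σ^y A^t σ^y` of a `2 × 2` matrix. -/
def adj₂ (A : Matrix (Fin 2) (Fin 2) 𝓡) : Matrix (Fin 2) (Fin 2) 𝓡 :=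
  !![A 1 1, -A 0 1; -A 1 0, A 0 0]

theorem auxFst_swap (A : Matrix (Fin 2) (Fin 2) 𝓡) :
    (auxFst A).submatrix Prod.swap Prod.swap = auxSnd A := by
  ext ⟨i, k⟩ ⟨j, l⟩
  simp [auxFst, auxSnd]

theorem auxSnd_swap (A : Matrix (Fin 2) (Fin 2) 𝓡) :
    (auxSnd A).submatrix Prod.swap Prod.swap = auxFst A := by
  ext ⟨i, k⟩ ⟨j, l⟩
  simp [auxFst, auxSnd]

theorem rProd_swap (q lam mu : ℂ) :
    (rProd 𝓡 q lam mu).submatrix Prod.swap Prod.swap = rProd 𝓡 q mu lam := by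
  ext ⟨i, k⟩ ⟨j, l⟩
  fin_cases i <;> fin_cases k <;> fin_cases j <;> fin_cases l <;>
    simp [rProd, sixVertex, mul_comm]

theorem smul_sixVertex (x a b c : ℂ) :
    x • sixVertex 𝓡 a b c = sixVertex 𝓡 (x * a) (x * b) (x * c) := by
  ext ⟨i, k⟩ ⟨j, l⟩
  simp only [sixVertex, Matrix.smul_apply, Matrix.of_apply]
  split_ifs <;> simp [Algebra.algebraMap_eq_smul_one, smul_smul]

/-- Transposition and reversal of the spins in both auxiliary spaces, combined with their exchange,
preserves the `R`-matrix. -/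
theorem adj_exchange {q lam mu : ℂ} {A B : Matrix (Fin 2) (Fin 2) 𝓡}
    (h : rQuot 𝓡 q lam mu * auxFst B * auxSnd A = auxSnd A * auxFst B * rQuot 𝓡 q lam mu) :
    rQuot 𝓡 q lam mu * auxFst (adj₂ A) * auxSnd (adj₂ B) =
      auxSnd (adj₂ B) * auxFst (adj₂ A) * rQuot 𝓡 q lam mu := by
  ext ⟨i, k⟩ ⟨j, l⟩
  have key := congrFun (congrFun h (1 - l, 1 - j)) (1 - k, 1 - i)
  unfold rQuot at *
  generalize q ^ 2 * lam ^ 2 - mu ^ 2 = x at *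
  generalize q * (lam ^ 2 - mu ^ 2) = y at *
  generalize (q ^ 2 - 1) * (lam * mu) = w at *
  fin_cases i <;> fin_cases k <;> fin_cases j <;> fin_cases l <;>
    simp [sixVertex, auxFst, auxSnd, adj₂, Matrix.mul_apply, Fintype.sum_prod_type,
      Algebra.algebraMap_eq_smul_one] at key ⊢ <;>
    first
    | exact key.symm
    | (linear_combination (norm := module) -key)
    | (linear_combination (norm := module) key)

section Exchange

variable {s a b c d α β : ℂ} {v vi u ui : 𝓡}

theorem WeylPair.assoc {q : ℂ} (h : WeylPair q v vi u ui) (x : 𝓡) :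
    v * (vi * x) = x ∧ vi * (v * x) = x ∧ u * (ui * x) = x ∧ ui * (u * x) = x ∧
    u * (v * x) = q • (v * (u * x)) ∧ u * (vi * x) = q⁻¹ • (vi * (u * x)) ∧
    ui * (v * x) = q⁻¹ • (v * (ui * x)) ∧ ui * (vi * x) = q • (vi * (ui * x)) := by
  refine ⟨?_, ?_, ?_, ?_, ?_, ?_, ?_, ?_⟩ <;>
    simp only [← mul_assoc, h.v_vi, h.vi_v, h.u_ui, h.ui_u, h.u_v, h.u_vi, h.ui_v, h.ui_vi,
      one_mul, smul_mul_assoc]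

set_option linter.unusedSimpArgs false in
set_option maxHeartbeats 4000000 in
/-- The exchange relation of the Lax matrices: all entries are compared after moving the powers of
`v` to the left of those of `u`. -/
theorem weylLax_exchange (hs : s ≠ 0) (hα : α ≠ 0) (hβ : β ≠ 0)
    (h : WeylPair (s ^ 2) v vi u ui) {lam mu : ℂ} (hl : lam ≠ 0) (hm : mu ≠ 0) :
    rQuot 𝓡 (s ^ 2) lam mu * auxFst (weylLax s a b c d α β v vi u ui (lam / s)) *
        auxSnd (weylLax s a b c d α β v vi u ui (mu / s)) =
      auxSnd (weylLax s a b c d α β v vi u ui (mu / s)) *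
        auxFst (weylLax s a b c d α β v vi u ui (lam / s)) * rQuot 𝓡 (s ^ 2) lam mu := by
  have e₁ := fun x => (h.assoc x).1
  have e₂ := fun x => (h.assoc x).2.1
  have e₃ := fun x => (h.assoc x).2.2.1
  have e₄ := fun x => (h.assoc x).2.2.2.1
  have e₅ := fun x => (h.assoc x).2.2.2.2.1
  have e₆ := fun x => (h.assoc x).2.2.2.2.2.1
  have e₇ := fun x => (h.assoc x).2.2.2.2.2.2.1
  have e₈ := fun x => (h.assoc x).2.2.2.2.2.2.2
  obtain ⟨A, hA⟩ : ∃ A, A = weylLax s a b c d α β v vi u ui (lam / s) := ⟨_, rfl⟩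
  obtain ⟨B, hB⟩ : ∃ B, B = weylLax s a b c d α β v vi u ui (mu / s) := ⟨_, rfl⟩
  have a₀₀ := congrFun (congrFun hA 0) 0
  have a₀₁ := congrFun (congrFun hA 0) 1
  have a₁₀ := congrFun (congrFun hA 1) 0
  have a₁₁ := congrFun (congrFun hA 1) 1
  have b₀₀ := congrFun (congrFun hB 0) 0
  have b₀₁ := congrFun (congrFun hB 0) 1
  have b₁₀ := congrFun (congrFun hB 1) 0
  have b₁₁ := congrFun (congrFun hB 1) 1
  simp only [weylLax, adj₂, Matrix.of_apply, Matrix.cons_val', Matrix.cons_val_zero,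
    Matrix.cons_val_one, Matrix.cons_val_fin_one] at a₀₀ a₀₁ a₁₀ a₁₁ b₀₀ b₀₁ b₁₀ b₁₁
  rw [← hA, ← hB]
  clear hA hB
  ext ⟨i, k⟩ ⟨j, l⟩
  fin_cases i <;> fin_cases k <;> fin_cases j <;> fin_cases l <;>
  simp [rQuot, sixVertex, auxFst, auxSnd, Matrix.mul_apply,
    Fintype.sum_prod_type, Algebra.algebraMap_eq_smul_one] <;>
  (simp only [a₀₀, a₀₁, a₁₀, a₁₁, b₀₀, b₀₁, b₁₀, b₁₁, mul_add, add_mul, mul_sub, sub_mul, smul_mul_assoc, mul_smul_comm, smul_smul,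
      mul_assoc, smul_add, smul_sub, mul_neg, neg_mul, smul_neg, h.v_vi, h.vi_v, h.u_ui, h.ui_u,
      h.u_v, h.u_vi, h.ui_v, h.ui_vi, e₁, e₂, e₃, e₄, e₅, e₆, e₇, e₈, mul_one, one_mul] <;>
   match_scalars <;> field_simp <;> ring)

/-- Obtained from `weylLax_exchange` at the points `1 / mu`, `1 / lam`. -/
theorem adj_weylLax_exchange (hs : s ≠ 0) (hα : α ≠ 0) (hβ : β ≠ 0)
    (h : WeylPair (s ^ 2) v vi u ui) {lam mu : ℂ} (hl : lam ≠ 0) (hm : mu ≠ 0) :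
    rQuot 𝓡 (s ^ 2) lam mu * auxFst (adj₂ (weylLax s a b c d α β v vi u ui (1 / lam / s))) *
        auxSnd (adj₂ (weylLax s a b c d α β v vi u ui (1 / mu / s))) =
      auxSnd (adj₂ (weylLax s a b c d α β v vi u ui (1 / mu / s))) *
        auxFst (adj₂ (weylLax s a b c d α β v vi u ui (1 / lam / s))) * rQuot 𝓡 (s ^ 2) lam mu := by
  have key := weylLax_exchange (a := a) (b := b) (c := c) (d := d) hs hα hβ h
    (one_div_ne_zero hm) (one_div_ne_zero hl)
  have hR : rQuot 𝓡 (s ^ 2) (1 / mu) (1 / lam) =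
      (1 / (lam * mu) ^ 2) • rQuot 𝓡 (s ^ 2) lam mu := by
    rw [rQuot, rQuot, smul_sixVertex]
    congr 1 <;> field_simp
  rw [hR, smul_mul_assoc, smul_mul_assoc, mul_smul_comm] at key
  refine adj_exchange (smul_right_injective _ ?_ key)
  exact one_div_ne_zero (pow_ne_zero 2 (mul_ne_zero hl hm))

set_option linter.unusedSimpArgs false in
set_option maxHeartbeats 4000000 in
/-- The exchange relation in which the `R`-matrix stands between the two factors. -/
theorem adj_weylLax_exchange_weylLax (hs : s ≠ 0) (hα : α ≠ 0) (hβ : β ≠ 0)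
    (h : WeylPair (s ^ 2) v vi u ui) {lam mu : ℂ} (hl : lam ≠ 0) (hm : mu ≠ 0) :
    auxFst (adj₂ (weylLax s a b c d α β v vi u ui (1 / lam / s))) * rProd 𝓡 (s ^ 2) lam mu *
        auxSnd (weylLax s a b c d α β v vi u ui (mu / s)) =
      auxSnd (weylLax s a b c d α β v vi u ui (mu / s)) * rProd 𝓡 (s ^ 2) lam mu *
        auxFst (adj₂ (weylLax s a b c d α β v vi u ui (1 / lam / s))) := by
  have e₁ := fun x => (h.assoc x).1
  have e₂ := fun x => (h.assoc x).2.1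
  have e₃ := fun x => (h.assoc x).2.2.1
  have e₄ := fun x => (h.assoc x).2.2.2.1
  have e₅ := fun x => (h.assoc x).2.2.2.2.1
  have e₆ := fun x => (h.assoc x).2.2.2.2.2.1
  have e₇ := fun x => (h.assoc x).2.2.2.2.2.2.1
  have e₈ := fun x => (h.assoc x).2.2.2.2.2.2.2
  obtain ⟨A, hA⟩ : ∃ A, A = adj₂ (weylLax s a b c d α β v vi u ui (1 / lam / s)) := ⟨_, rfl⟩
  obtain ⟨B, hB⟩ : ∃ B, B = weylLax s a b c d α β v vi u ui (mu / s) := ⟨_, rfl⟩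
  have a₀₀ := congrFun (congrFun hA 0) 0
  have a₀₁ := congrFun (congrFun hA 0) 1
  have a₁₀ := congrFun (congrFun hA 1) 0
  have a₁₁ := congrFun (congrFun hA 1) 1
  have b₀₀ := congrFun (congrFun hB 0) 0
  have b₀₁ := congrFun (congrFun hB 0) 1
  have b₁₀ := congrFun (congrFun hB 1) 0
  have b₁₁ := congrFun (congrFun hB 1) 1
  simp only [weylLax, adj₂, Matrix.of_apply, Matrix.cons_val', Matrix.cons_val_zero,
    Matrix.cons_val_one, Matrix.cons_val_fin_one] at a₀₀ a₀₁ a₁₀ a₁₁ b₀₀ b₀₁ b₁₀ b₁₁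
  rw [← hA, ← hB]
  clear hA hB
  ext ⟨i, k⟩ ⟨j, l⟩
  fin_cases i <;> fin_cases k <;> fin_cases j <;> fin_cases l <;>
  simp [rProd, sixVertex, auxFst, auxSnd, Matrix.mul_apply,
    Fintype.sum_prod_type, Algebra.algebraMap_eq_smul_one] <;>
  (simp only [a₀₀, a₀₁, a₁₀, a₁₁, b₀₀, b₀₁, b₁₀, b₁₁, mul_add, add_mul, mul_sub, sub_mul, smul_mul_assoc, mul_smul_comm, smul_smul,
      mul_assoc, smul_add, smul_sub, mul_neg, neg_mul, smul_neg, h.v_vi, h.vi_v, h.u_ui, h.ui_u,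
      h.u_v, h.u_vi, h.ui_v, h.ui_vi, e₁, e₂, e₃, e₄, e₅, e₆, e₇, e₈, mul_one, one_mul] <;>
   match_scalars <;> field_simp <;> ring)

theorem weylLax_exchange_adj_weylLax (hs : s ≠ 0) (hα : α ≠ 0) (hβ : β ≠ 0)
    (h : WeylPair (s ^ 2) v vi u ui) {lam mu : ℂ} (hl : lam ≠ 0) (hm : mu ≠ 0) :
    auxFst (weylLax s a b c d α β v vi u ui (lam / s)) * rProd 𝓡 (s ^ 2) lam mu *
        auxSnd (adj₂ (weylLax s a b c d α β v vi u ui (1 / mu / s))) =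
      auxSnd (adj₂ (weylLax s a b c d α β v vi u ui (1 / mu / s))) * rProd 𝓡 (s ^ 2) lam mu *
        auxFst (weylLax s a b c d α β v vi u ui (lam / s)) := by
  have key := congrArg (fun A => A.submatrix Prod.swap Prod.swap)
    (adj_weylLax_exchange_weylLax (a := a) (b := b) (c := c) (d := d) hs hα hβ h hm hl)
  simp only [← Matrix.submatrix_mul_equiv _ _ _ (Equiv.prodComm (Fin 2) (Fin 2)) _,
    Equiv.coe_prodComm, auxFst_swap, auxSnd_swap, rProd_swap] at key
  exact key.symm

end Exchange

end Reflection

end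

end CyclicReflection

namespace CyclicReflection

noncomputable section

/-! ### Gauged generators and their exchange relations -/

section Gauge

variable {𝓡 : Type*} [Ring 𝓡] [Algebra ℂ 𝓡]

/-- The contraction of `U` with the gauge row vector `(1, -x / (α s lam))` and the gauge column vector
`(-lam y / s, -α s²)`. -/
def gauged (s α lam x y : ℂ) (U : Matrix (Fin 2) (Fin 2) 𝓡) : 𝓡 :=
  -(lam * y / s) • U 0 0 - (α * s ^ 2) • U 0 1 + (x * y / (α * s ^ 2)) • U 1 0 +
    (x * s / lam) • U 1 1

/-- The contraction of the reflection equation with a row vector `w` and a column vector `x`. -/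
theorem ReflectionEq.contract {q lam mu : ℂ} {U V : Matrix (Fin 2) (Fin 2) 𝓡}
    (h : ReflectionEq q lam mu U V) (w x : Fin 2 × Fin 2 → ℂ) :
    ∑ i, ∑ j, (w i * x j) •
        (rQuot 𝓡 q lam mu * auxFst U * rProd 𝓡 q lam mu * auxSnd V) i j =
      ∑ i, ∑ j, (w i * x j) •
        (auxSnd V * rProd 𝓡 q lam mu * auxFst U * rQuot 𝓡 q lam mu) i j := by
  rw [h]

theorem eq_of_smul_eq_smul {c : ℂ} (hc : c ≠ 0) {x y : 𝓡} (h : c • x = c • y) : x = y := by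
  simpa [smul_smul, inv_mul_cancel₀ hc] using congrArg (fun z => c⁻¹ • z) h

set_option maxHeartbeats 4000000 in
/-- The gauged `ℬ` generators at neighbouring gauge parameters commute. The reflection equation is
contracted with gauge vectors that the `R`-matrix maps to gauge vectors. -/
theorem ReflectionEq.gauged_comm {s α β lam mu : ℂ} {U V : Matrix (Fin 2) (Fin 2) 𝓡}
    (h : ReflectionEq (s ^ 2) lam mu U V) (hs : s ≠ 0) (hα : α ≠ 0)
    (hl : lam ≠ 0) (hm : mu ≠ 0)
    (h₁ : s ^ 4 * lam ^ 2 - mu ^ 2 ≠ 0) (h₂ : lam ^ 2 * mu ^ 2 - s ^ 4 ≠ 0) :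
    gauged s α lam β β U * gauged s α mu (β / s ^ 4) (β / s ^ 4) V =
      gauged s α mu β β V * gauged s α lam (β / s ^ 4) (β / s ^ 4) U := by
  have key := h.contract
    (fun i => ![α * s * lam, -(β / s ^ 2)] i.1 * ![α * s * mu, -β] i.2)
    (fun j => ![-(lam * (β / s ^ 2)), -(α * s ^ 3)] j.1 * ![-(mu * (β / s ^ 4)), -(α * s ^ 3)] j.2)
  simp [Fintype.sum_prod_type, Matrix.mul_apply, rQuot, rProd, sixVertex, auxFst, auxSnd,
    Algebra.algebraMap_eq_smul_one, smul_smul, add_mul] at key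
  have hK : (s ^ 4 * lam ^ 2 - mu ^ 2) * (lam ^ 2 * mu ^ 2 - s ^ 4) *
      (α * s ^ 2 * lam) * (α * s ^ 2 * mu) ≠ 0 := by simp [h₁, h₂, hs, hα, hl, hm]
  refine eq_of_smul_eq_smul hK ?_
  clear hK h₁ h₂
  simp only [gauged, mul_add, add_mul, mul_sub, sub_mul, smul_mul_assoc, mul_smul_comm]
  linear_combination (norm := skip) (1 : ℂ) • key
  match_scalars <;> field_simp <;> ring

set_option maxHeartbeats 8000000 in
/-- The exchange relation of the gauged `𝒜` and `ℬ` generators, up to terms with `ℬ(lam)` on the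
left. -/
theorem ReflectionEq.gauged_exchange {s α β lam mu : ℂ} {U V : Matrix (Fin 2) (Fin 2) 𝓡}
    (h : ReflectionEq (s ^ 2) lam mu U V) (hs : s ≠ 0) (hα : α ≠ 0) (hβ : β ≠ 0)
    (hl : lam ≠ 0) (hm : mu ≠ 0) (h₁ : s ^ 4 * lam ^ 2 - mu ^ 2 ≠ 0) :
    ∃ Z : 𝓡,
      ((β - s ^ 8 / β) * ((mu ^ 2 + 1 / mu ^ 2) - (lam ^ 2 + 1 / lam ^ 2))) •
          (gauged s α lam β (1 / β) U * gauged s α mu β β V) -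
        (s ^ 4 * (β - 1 / β) * ((mu ^ 2 + 1 / mu ^ 2) - (s ^ 4 / lam ^ 2 + lam ^ 2 / s ^ 4))) •
          (gauged s α mu β β V * gauged s α lam (β / s ^ 4) (s ^ 4 / β) U) =
      gauged s α lam β β U * Z := by
  obtain ⟨x, hx⟩ : ∃ x : Fin 2 × Fin 2 → ℂ, x = fun j =>
    ![![(s ^ 4 * mu ^ 2 - lam ^ 2) * ((-(lam * (s ^ 4 / β))) * (-(mu * (β / s ^ 2)))),
        (s ^ 2 * (mu ^ 2 - lam ^ 2)) * ((-(lam * (s ^ 4 / β))) * (-(α * s ^ 3))) + ((s ^ 4 - 1) *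
          (lam * mu)) * ((-(α * s ^ 3)) * (-(mu * (β / s ^ 2))))],
      ![((s ^ 4 - 1) * (lam * mu)) * ((-(lam * (s ^ 4 / β))) * (-(α * s ^ 3))) + (s ^ 2 *
        (mu ^ 2 - lam ^ 2)) * ((-(α * s ^ 3)) * (-(mu * (β / s ^ 2)))),
        (s ^ 4 * mu ^ 2 - lam ^ 2) * ((-(α * s ^ 3)) * (-(α * s ^ 3)))]] j.1 j.2 := ⟨_, rfl⟩
  have x00 := congrFun hx (0, 0)
  have x01 := congrFun hx (0, 1)
  have x10 := congrFun hx (1, 0)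
  have x11 := congrFun hx (1, 1)
  simp at x00 x01 x10 x11
  have key := h.contract
    (fun i => ![α * s * lam, -(β / s ^ 2)] i.1 * ![α * s * mu, -β] i.2) x
  simp [Fintype.sum_prod_type, Matrix.mul_apply, rQuot, rProd, sixVertex, auxFst, auxSnd,
    Algebra.algebraMap_eq_smul_one, smul_smul, add_mul] at key
  refine ⟨(lam ^ 3 * mu ^ 3 * s ^ 5 * α ^ 2)⁻¹ • ((-(lam / β)) •
    (((α * s * mu) * (lam ^ 2 * mu ^ 2 - s ^ 4) * x (1, 0)) • V 0 0 +
      ((α * s * mu) * ((s ^ 4 - 1) * (lam * mu)) * x (0, 0)) • V 1 0 +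
      ((-(β / s ^ 2)) * (s ^ 2 * (lam ^ 2 * mu ^ 2 - 1)) * x (1, 0)) • V 1 0 +
      ((α * s * mu) * (lam ^ 2 * mu ^ 2 - s ^ 4) * x (1, 1)) • V 0 1 +
      ((α * s * mu) * ((s ^ 4 - 1) * (lam * mu)) * x (0, 1)) • V 1 1 +
      ((-(β / s ^ 2)) * (s ^ 2 * (lam ^ 2 * mu ^ 2 - 1)) * x (1, 1)) • V 1 1) -
    (-(α * s ^ 3)) • (((α * s * mu) * (s ^ 2 * (lam ^ 2 * mu ^ 2 - 1)) * x (0, 0)) • V 0 0 +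
      ((-(β / s ^ 2)) * (lam ^ 2 * mu ^ 2 - s ^ 4) * x (0, 0)) • V 1 0 +
      ((-(β / s ^ 2)) * ((s ^ 4 - 1) * (lam * mu)) * x (1, 0)) • V 0 0 +
      ((α * s * mu) * (s ^ 2 * (lam ^ 2 * mu ^ 2 - 1)) * x (0, 1)) • V 0 1 +
      ((-(β / s ^ 2)) * (lam ^ 2 * mu ^ 2 - s ^ 4) * x (0, 1)) • V 1 1 +
      ((-(β / s ^ 2)) * ((s ^ 4 - 1) * (lam * mu)) * x (1, 1)) • V 0 1)), ?_⟩
  have hK : (s ^ 4 * lam ^ 2 - mu ^ 2) * (α * s ^ 2) ^ 2 * lam ^ 3 * mu ^ 3 ≠ 0 := by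
    simp [h₁, hs, hα, hl, hm]
  refine eq_of_smul_eq_smul hK ?_
  clear hK h₁ hx
  simp only [gauged, mul_add, add_mul, mul_sub, sub_mul, smul_mul_assoc, mul_smul_comm, smul_add,
    smul_sub]
  linear_combination (norm := skip) (β - 1 / β) • key
  rw [x00, x01, x10, x11]
  match_scalars <;> field_simp <;> ring

set_option maxHeartbeats 8000000 in
/-- Two gauged `𝒜` generators with the same gauge parameters commute up to terms with `ℬ` on the
left. -/
theorem ReflectionEq.gauged_comm_mod {s α β lam mu : ℂ} {U V : Matrix (Fin 2) (Fin 2) 𝓡}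
    (h : ReflectionEq (s ^ 2) lam mu U V) (hs : s ≠ 0) (hα : α ≠ 0) (hβ : β ≠ 0)
    (hl : lam ≠ 0) (hm : mu ≠ 0) (h₁ : s ^ 4 * lam ^ 2 - mu ^ 2 ≠ 0) :
    ∃ Z₁ Z₂ : 𝓡,
      ((β - s ^ 4 / β) * (lam ^ 2 * mu ^ 2 - 1)) •
          (gauged s α lam β (1 / β) U * gauged s α mu β (1 / β) V -
            gauged s α mu β (1 / β) V * gauged s α lam β (1 / β) U) =
        gauged s α lam β β U * Z₁ + gauged s α mu β β V * Z₂ := by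
  have key := h.contract
    (fun i => ![α * s * lam, -(β / s ^ 2)] i.1 * ![α * s * mu, -β] i.2)
    (fun j => ![-(lam * (s ^ 2 / β)), -(α * s ^ 3)] j.1 * ![-(mu * (1 / β)), -(α * s ^ 3)] j.2)
  simp [Fintype.sum_prod_type, Matrix.mul_apply, rQuot, rProd, sixVertex, auxFst, auxSnd,
    Algebra.algebraMap_eq_smul_one, smul_smul, add_mul] at key
  refine ⟨(lam * mu * s ^ 5 * α ^ 2)⁻¹ • ((-(lam / β)) •
    (((α * s * mu) * (lam ^ 2 * mu ^ 2 - s ^ 4) * ((-(α * s ^ 3)) * (-(mu * (1 / β))))) • V 0 0 +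
      ((α * s * mu) * ((s ^ 4 - 1) * (lam * mu)) * ((-(lam * (s ^ 2 / β))) * (-(mu *
        (1 / β))))) • V 1 0 +
      ((-(β / s ^ 2)) * (s ^ 2 * (lam ^ 2 * mu ^ 2 - 1)) * ((-(α * s ^ 3)) * (-(mu *
        (1 / β))))) • V 1 0 +
      ((α * s * mu) * (lam ^ 2 * mu ^ 2 - s ^ 4) * ((-(α * s ^ 3)) * (-(α * s ^ 3)))) • V 0 1 +
      ((α * s * mu) * ((s ^ 4 - 1) * (lam * mu)) * ((-(lam * (s ^ 2 / β))) * (-(α *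
        s ^ 3)))) • V 1 1 +
      ((-(β / s ^ 2)) * (s ^ 2 * (lam ^ 2 * mu ^ 2 - 1)) * ((-(α * s ^ 3)) * (-(α *
        s ^ 3)))) • V 1 1) -
    (-(α * s ^ 3)) • (((α * s * mu) * (s ^ 2 * (lam ^ 2 * mu ^ 2 - 1)) * ((-(lam *
      (s ^ 2 / β))) * (-(mu * (1 / β))))) • V 0 0 +
      ((-(β / s ^ 2)) * (lam ^ 2 * mu ^ 2 - s ^ 4) * ((-(lam * (s ^ 2 / β))) * (-(mu *
        (1 / β))))) • V 1 0 +
      ((-(β / s ^ 2)) * ((s ^ 4 - 1) * (lam * mu)) * ((-(α * s ^ 3)) * (-(mu * (1 / β))))) • V 0 0 +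
      ((α * s * mu) * (s ^ 2 * (lam ^ 2 * mu ^ 2 - 1)) * ((-(lam * (s ^ 2 / β))) * (-(α *
        s ^ 3)))) • V 0 1 +
      ((-(β / s ^ 2)) * (lam ^ 2 * mu ^ 2 - s ^ 4) * ((-(lam * (s ^ 2 / β))) * (-(α *
        s ^ 3)))) • V 1 1 +
      ((-(β / s ^ 2)) * ((s ^ 4 - 1) * (lam * mu)) * ((-(α * s ^ 3)) * (-(α * s ^ 3)))) • V 0 1)),
    (-(lam * mu * s ^ 5 * α ^ 2)⁻¹) • ((-(mu / β)) •
    (((α * s * lam) * (lam ^ 2 * mu ^ 2 - s ^ 4) * ((-(α * s ^ 3)) * (-(lam * (1 / β))))) • U 0 0 +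
      ((α * s * lam) * ((s ^ 4 - 1) * (lam * mu)) * ((-(mu * (s ^ 2 / β))) * (-(lam *
        (1 / β))))) • U 1 0 +
      ((-(β / s ^ 2)) * (s ^ 2 * (lam ^ 2 * mu ^ 2 - 1)) * ((-(α * s ^ 3)) * (-(lam *
        (1 / β))))) • U 1 0 +
      ((α * s * lam) * (lam ^ 2 * mu ^ 2 - s ^ 4) * ((-(α * s ^ 3)) * (-(α * s ^ 3)))) • U 0 1 +
      ((α * s * lam) * ((s ^ 4 - 1) * (lam * mu)) * ((-(mu * (s ^ 2 / β))) * (-(α *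
        s ^ 3)))) • U 1 1 +
      ((-(β / s ^ 2)) * (s ^ 2 * (lam ^ 2 * mu ^ 2 - 1)) * ((-(α * s ^ 3)) * (-(α *
        s ^ 3)))) • U 1 1) -
    (-(α * s ^ 3)) • (((α * s * lam) * (s ^ 2 * (lam ^ 2 * mu ^ 2 - 1)) * ((-(mu *
      (s ^ 2 / β))) * (-(lam * (1 / β))))) • U 0 0 +
      ((-(β / s ^ 2)) * (lam ^ 2 * mu ^ 2 - s ^ 4) * ((-(mu * (s ^ 2 / β))) * (-(lam *
        (1 / β))))) • U 1 0 +
      ((-(β / s ^ 2)) * ((s ^ 4 - 1) * (lam * mu)) * ((-(α * s ^ 3)) * (-(lam *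
        (1 / β))))) • U 0 0 +
      ((α * s * lam) * (s ^ 2 * (lam ^ 2 * mu ^ 2 - 1)) * ((-(mu * (s ^ 2 / β))) * (-(α *
        s ^ 3)))) • U 0 1 +
      ((-(β / s ^ 2)) * (lam ^ 2 * mu ^ 2 - s ^ 4) * ((-(mu * (s ^ 2 / β))) * (-(α *
        s ^ 3)))) • U 1 1 +
      ((-(β / s ^ 2)) * ((s ^ 4 - 1) * (lam * mu)) * ((-(α * s ^ 3)) * (-(α *
        s ^ 3)))) • U 0 1)), ?_⟩
  have hK : (s ^ 4 * lam ^ 2 - mu ^ 2) * (α * s ^ 2) ^ 2 * lam * mu ≠ 0 := by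
    simp [h₁, hs, hα, hl, hm]
  refine eq_of_smul_eq_smul hK ?_
  clear hK h₁
  simp only [gauged, mul_add, add_mul, mul_sub, sub_mul, smul_mul_assoc, mul_smul_comm, smul_add,
    smul_sub]
  linear_combination (norm := skip) (β - 1 / β) • key
  match_scalars <;> field_simp <;> ring

/-- The resolution of the identity of the auxiliary space by gauge vectors turns unitarity
`U(q/lam) U(lam) = F` into a product formula for gauged generators. -/
theorem gauged_unitarity {s α lam x y x' y' F : ℂ} {U V : Matrix (Fin 2) (Fin 2) 𝓡}
    (h : V * U = algebraMap ℂ (Matrix (Fin 2) (Fin 2) 𝓡) F) (hs : s ≠ 0) (hα : α ≠ 0)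
    (hl : lam ≠ 0) :
    gauged s α (s ^ 2 / lam) x y' V * gauged s α lam x' y U -
        gauged s α (s ^ 2 / lam) x x' V * gauged s α lam y' y U =
      algebraMap ℂ 𝓡 (F * (x - y) * (x' - y')) := by
  have e : ∀ i j, V i 0 * U 0 j + V i 1 * U 1 j = if i = j then algebraMap ℂ 𝓡 F else 0 := by
    intro i j
    have := congrFun (congrFun h i) j
    rwa [Matrix.mul_apply, Fin.sum_univ_two, Matrix.algebraMap_matrix_apply] at this
  have e₀₀ := e 0 0
  have e₀₁ := e 0 1
  have e₁₀ := e 1 0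
  have e₁₁ := e 1 1
  simp [Algebra.algebraMap_eq_smul_one] at e₀₀ e₀₁ e₁₀ e₁₁
  simp only [gauged, mul_add, add_mul, mul_sub, sub_mul, smul_mul_assoc, mul_smul_comm, smul_add,
    smul_sub, Algebra.algebraMap_eq_smul_one]
  linear_combination (norm := skip) (-y * (x' - y')) • e₀₀ +
    (-(α * s ^ 3 / lam) * (x' - y')) • e₀₁ + (x * y * lam / (α * s ^ 3) * (x' - y')) • e₁₀ +
    (x * (x' - y')) • e₁₁
  match_scalars <;> field_simp <;> ring

end Gauge

section Transpose

set_option linter.unusedSectionVars false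

variable {n : Type*} [Fintype n] [DecidableEq n]

/-- The full transpose of a matrix of operators, in the auxiliary and in the quantum space. -/
def fullTranspose {ι : Type*} (A : Matrix ι ι (Matrix n n ℂ)) : Matrix ι ι (Matrix n n ℂ) :=
  Matrix.of fun i j => (A j i).transpose

theorem fullTranspose_mul {ι : Type*} [Fintype ι] (A B : Matrix ι ι (Matrix n n ℂ)) :
    fullTranspose (A * B) = fullTranspose B * fullTranspose A := by
  refine Matrix.ext fun i j => ?_
  simp [fullTranspose, Matrix.mul_apply, Matrix.transpose_sum]

theorem fullTranspose_auxFst (A : Matrix (Fin 2) (Fin 2) (Matrix n n ℂ)) :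
    fullTranspose (auxFst A) = auxFst (fullTranspose A) := by
  refine Matrix.ext fun ⟨i, k⟩ ⟨j, l⟩ => ?_
  fin_cases k <;> fin_cases l <;> simp [fullTranspose, auxFst]

theorem fullTranspose_auxSnd (A : Matrix (Fin 2) (Fin 2) (Matrix n n ℂ)) :
    fullTranspose (auxSnd A) = auxSnd (fullTranspose A) := by
  refine Matrix.ext fun ⟨i, k⟩ ⟨j, l⟩ => ?_
  fin_cases i <;> fin_cases j <;> simp [fullTranspose, auxSnd]

theorem fullTranspose_sixVertex (a b c : ℂ) :
    fullTranspose (sixVertex (Matrix n n ℂ) a b c) = sixVertex (Matrix n n ℂ) a b c := by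
  refine Matrix.ext fun ⟨i, k⟩ ⟨j, l⟩ => ?_
  fin_cases i <;> fin_cases k <;> fin_cases j <;> fin_cases l <;>
    simp [fullTranspose, sixVertex, Algebra.algebraMap_eq_smul_one]

theorem ReflectionEq.fullTranspose {q lam mu : ℂ} {U V : Matrix (Fin 2) (Fin 2) (Matrix n n ℂ)}
    (h : ReflectionEq q lam mu U V) :
    ReflectionEq q lam mu (fullTranspose U) (fullTranspose V) := by
  have := congrArg CyclicReflection.fullTranspose h
  simp only [fullTranspose_mul, fullTranspose_auxFst, fullTranspose_auxSnd, rQuot, rProd,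
    fullTranspose_sixVertex] at this
  simp only [ReflectionEq, rQuot, rProd, mul_assoc] at this ⊢
  exact this.symm

/-- Transposition exchanges the roles of the gauge row and column vectors; the gauge parameters are
inverted. -/
theorem gauged_transpose {s α lam x y : ℂ} (hs : s ≠ 0) (hα : α ≠ 0) (hx : x ≠ 0) (hy : y ≠ 0)
    (U : Matrix (Fin 2) (Fin 2) (Matrix n n ℂ)) :
    (gauged s α lam x y U).transpose =
      (x * y) • gauged s (-1 / (α * s ^ 4)) lam (1 / y) (1 / x) (fullTranspose U) := by
  simp only [gauged, fullTranspose, Matrix.transpose_add, Matrix.transpose_sub,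
    Matrix.transpose_smul, Matrix.of_apply]
  match_scalars <;> field_simp

end Transpose

end

end CyclicReflection

namespace CyclicReflection

noncomputable section

/-! ### Dressing by a Lax matrix: quantum determinant, parity and commutation -/

section LocalRelations

set_option linter.unusedSimpArgs false

variable {𝓡 : Type*} [Ring 𝓡] [Algebra ℂ 𝓡] {s a b c d α β : ℂ} {v vi u ui : 𝓡}

/-- The local quantum determinant. -/
def localDet (s a b c d α β lam : ℂ) : ℂ :=
  -((β * s / lam + (s ^ 2)⁻¹ * (b * α / a) * (lam / s)) *
    (a * c / α * (s ^ 3 / lam + s ^ 2 * (d * α / (c * β)) * (lam / s ^ 3))))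

theorem adj_weylLax_mul_weylLax (hs : s ≠ 0) (ha : a ≠ 0) (hc : c ≠ 0) (hα : α ≠ 0) (hβ : β ≠ 0)
    (h : WeylPair (s ^ 2) v vi u ui) {lam : ℂ} (hl : lam ≠ 0) :
    adj₂ (weylLax s a b c d α β v vi u ui (lam / s ^ 2 / s)) *
        weylLax s a b c d α β v vi u ui (lam / s) =
      algebraMap ℂ _ (localDet s a b c d α β lam) := by
  have e₁ := fun x => (h.assoc x).1
  have e₂ := fun x => (h.assoc x).2.1
  have e₃ := fun x => (h.assoc x).2.2.1
  have e₄ := fun x => (h.assoc x).2.2.2.1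
  have e₅ := fun x => (h.assoc x).2.2.2.2.1
  have e₆ := fun x => (h.assoc x).2.2.2.2.2.1
  have e₇ := fun x => (h.assoc x).2.2.2.2.2.2.1
  have e₈ := fun x => (h.assoc x).2.2.2.2.2.2.2
  refine Matrix.ext fun i j => ?_
  fin_cases i <;> fin_cases j <;>
  simp [weylLax, adj₂, Matrix.mul_apply, Matrix.algebraMap_matrix_apply,
    Algebra.algebraMap_eq_smul_one] <;>
  (simp only [mul_add, add_mul, mul_sub, sub_mul, smul_mul_assoc, mul_smul_comm, smul_smul,
      mul_assoc, smul_add, smul_sub, mul_neg, neg_mul, smul_neg, h.v_vi, h.vi_v, h.u_ui, h.ui_u,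
      h.u_v, h.u_vi, h.ui_v, h.ui_vi, e₁, e₂, e₃, e₄, e₅, e₆, e₇, e₈, mul_one, one_mul, localDet]
   match_scalars <;> field_simp <;> ring)

theorem weylLax_mul_adj_weylLax (hs : s ≠ 0) (ha : a ≠ 0) (hc : c ≠ 0) (hα : α ≠ 0) (hβ : β ≠ 0)
    (h : WeylPair (s ^ 2) v vi u ui) {lam : ℂ} (hl : lam ≠ 0) :
    weylLax s a b c d α β v vi u ui (lam / s) *
        adj₂ (weylLax s a b c d α β v vi u ui (lam / s ^ 2 / s)) =
      algebraMap ℂ _ (localDet s a b c d α β lam) := by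
  have e₁ := fun x => (h.assoc x).1
  have e₂ := fun x => (h.assoc x).2.1
  have e₃ := fun x => (h.assoc x).2.2.1
  have e₄ := fun x => (h.assoc x).2.2.2.1
  have e₅ := fun x => (h.assoc x).2.2.2.2.1
  have e₆ := fun x => (h.assoc x).2.2.2.2.2.1
  have e₇ := fun x => (h.assoc x).2.2.2.2.2.2.1
  have e₈ := fun x => (h.assoc x).2.2.2.2.2.2.2
  refine Matrix.ext fun i j => ?_
  fin_cases i <;> fin_cases j <;>
  simp [weylLax, adj₂, Matrix.mul_apply, Matrix.algebraMap_matrix_apply,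
    Algebra.algebraMap_eq_smul_one] <;>
  (simp only [mul_add, add_mul, mul_sub, sub_mul, smul_mul_assoc, mul_smul_comm, smul_smul,
      mul_assoc, smul_add, smul_sub, mul_neg, neg_mul, smul_neg, h.v_vi, h.vi_v, h.u_ui, h.ui_u,
      h.u_v, h.u_vi, h.ui_v, h.ui_vi, e₁, e₂, e₃, e₄, e₅, e₆, e₇, e₈, mul_one, one_mul, localDet]
   match_scalars <;> field_simp <;> ring)

/-- The parity relation between `U`, the value at `lam`, and `V`, the value at `1 / lam`. -/
def ParityEq (q lam : ℂ) (U V : Matrix (Fin 2) (Fin 2) 𝓡) : Prop :=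
  (lam ^ 2 / q - q / lam ^ 2) • V =
    !![(lam ^ 2 - 1 / lam ^ 2) • U 1 1 + (1 / q - q) • U 0 0,
        -(q * lam ^ 2 - 1 / (q * lam ^ 2)) • U 0 1;
      -(q * lam ^ 2 - 1 / (q * lam ^ 2)) • U 1 0,
        (lam ^ 2 - 1 / lam ^ 2) • U 0 0 + (1 / q - q) • U 1 1]

set_option maxHeartbeats 8000000 in
/-- The parity relation is preserved by dressing with a Lax matrix. -/
theorem ParityEq.dress (hs : s ≠ 0) (hα : α ≠ 0) (hβ : β ≠ 0)
    (h : WeylPair (s ^ 2) v vi u ui) {lam : ℂ} (hl : lam ≠ 0) {U V : Matrix (Fin 2) (Fin 2) 𝓡}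
    (hU : ParityEq (s ^ 2) lam U V)
    (hc : ∀ i j, v * U i j = U i j * v ∧ vi * U i j = U i j * vi ∧ u * U i j = U i j * u ∧
      ui * U i j = U i j * ui) :
    ParityEq (s ^ 2) lam
      (weylLax s a b c d α β v vi u ui (lam / s) * U *
        adj₂ (weylLax s a b c d α β v vi u ui (1 / lam / s)))
      (weylLax s a b c d α β v vi u ui (1 / lam / s) * V *
        adj₂ (weylLax s a b c d α β v vi u ui (lam / s))) := by
  have e₁ := fun x => (h.assoc x).1
  have e₂ := fun x => (h.assoc x).2.1
  have e₃ := fun x => (h.assoc x).2.2.1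
  have e₄ := fun x => (h.assoc x).2.2.2.1
  have e₅ := fun x => (h.assoc x).2.2.2.2.1
  have e₆ := fun x => (h.assoc x).2.2.2.2.2.1
  have e₇ := fun x => (h.assoc x).2.2.2.2.2.2.1
  have e₈ := fun x => (h.assoc x).2.2.2.2.2.2.2
  have c₁ := fun i j => (hc i j).1
  have c₂ := fun i j => (hc i j).2.1
  have c₃ := fun i j => (hc i j).2.2.1
  have c₄ := fun i j => (hc i j).2.2.2
  have d₁ : ∀ i j x, v * (U i j * x) = U i j * (v * x) := fun i j x => by
    rw [← mul_assoc, c₁, mul_assoc]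
  have d₂ : ∀ i j x, vi * (U i j * x) = U i j * (vi * x) := fun i j x => by
    rw [← mul_assoc, c₂, mul_assoc]
  have d₃ : ∀ i j x, u * (U i j * x) = U i j * (u * x) := fun i j x => by
    rw [← mul_assoc, c₃, mul_assoc]
  have d₄ : ∀ i j x, ui * (U i j * x) = U i j * (ui * x) := fun i j x => by
    rw [← mul_assoc, c₄, mul_assoc]
  unfold ParityEq at hU ⊢
  rw [← smul_mul_assoc, ← mul_smul_comm, hU]
  refine Matrix.ext fun i j => ?_
  fin_cases i <;> fin_cases j <;>
  simp [weylLax, adj₂, Matrix.mul_apply, Fin.sum_univ_two, Matrix.vecMul, dotProduct] <;>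
  (simp only [mul_add, add_mul, mul_sub, sub_mul, smul_mul_assoc, mul_smul_comm, smul_smul,
      mul_assoc, smul_add, smul_sub, mul_neg, neg_mul, smul_neg, h.v_vi, h.vi_v, h.u_ui, h.ui_u,
      h.u_v, h.u_vi, h.ui_v, h.ui_vi, e₁, e₂, e₃, e₄, e₅, e₆, e₇, e₈, mul_one, one_mul,
      c₁, c₂, c₃, c₄, d₁, d₂, d₃, d₄]
   match_scalars <;> field_simp <;> ring)

end LocalRelations

end

end CyclicReflection

namespace CyclicReflection

noncomputable section

/-! ### The Weyl algebra at the sites and the boundary monodromy as a dressed matrix -/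

section Sites

variable {p N : ℕ} [NeZero p] {s : ℂ}

theorem pow_val_add_one {q : ℂ} (hq : q ^ p = 1) (k : Fin p) :
    q ^ ((k + 1 : Fin p) : ℕ) = q ^ (k : ℕ) * q := by
  rw [Fin.val_add, ← pow_eq_pow_mod _ hq, pow_add, Fin.val_one', ← pow_eq_pow_mod _ hq, pow_one]

theorem pow_val_sub_one {q : ℂ} (hq : q ^ p = 1) (k : Fin p) :
    q ^ ((k - 1 : Fin p) : ℕ) * q = q ^ (k : ℕ) := by
  rw [← pow_val_add_one hq, sub_add_cancel]

theorem weylPair_site (hs : s ≠ 0) (hsp : (s ^ 2) ^ p = 1) (n : Fin N) :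
    WeylPair (s ^ 2) (vOp s n : Op p N) (vInvOp s n) (uOp n) (uInvOp n) := by
  have hne : ∀ k : ℕ, (s ^ 2) ^ k ≠ 0 := fun k => pow_ne_zero _ (pow_ne_zero _ hs)
  have hs2 : s ^ 2 ≠ 0 := pow_ne_zero _ hs
  constructor
  · simp only [vOp, vInvOp, Matrix.diagonal_mul_diagonal, mul_inv_cancel₀ (hne _)]
    exact Matrix.diagonal_one
  · simp only [vOp, vInvOp, Matrix.diagonal_mul_diagonal, inv_mul_cancel₀ (hne _)]
    exact Matrix.diagonal_one
  · ext g h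
    simp [uOp, uInvOp, Matrix.mul_apply, Matrix.one_apply]
  · ext g h
    simp [uOp, uInvOp, Matrix.mul_apply, Matrix.one_apply]
  · ext g h
    simp only [vOp, uOp, Matrix.mul_diagonal, Matrix.smul_apply, Matrix.diagonal_mul,
      Matrix.of_apply]
    split_ifs with hg
    · subst hg
      simp [← pow_val_sub_one hsp (h n), mul_comm]
    · simp
  · ext g h
    simp only [vInvOp, uOp, Matrix.mul_diagonal, Matrix.smul_apply, Matrix.diagonal_mul,
      Matrix.of_apply]
    split_ifs with hg
    · subst hg
      simp [← pow_val_sub_one hsp (h n), mul_comm]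
    · simp
  · ext g h
    simp only [vOp, uInvOp, Matrix.mul_diagonal, Matrix.smul_apply, Matrix.diagonal_mul,
      Matrix.of_apply]
    split_ifs with hg
    · subst hg
      simp [pow_val_add_one hsp (h n)]
      field_simp
    · simp
  · ext g h
    simp only [vInvOp, uInvOp, Matrix.mul_diagonal, Matrix.smul_apply, Matrix.diagonal_mul,
      Matrix.of_apply]
    split_ifs with hg
    · subst hg
      simp [pow_val_add_one hsp (h n)]
      field_simp
    · simp

/-- `X` commutes with the Weyl generators of the site `n`. -/
def SiteCommute (s : ℂ) (n : Fin N) (X : Op p N) : Prop :=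
  Commute (vOp s n) X ∧ Commute (vInvOp s n) X ∧ Commute (uOp n) X ∧ Commute (uInvOp n) X

namespace SiteCommute

variable {n m : Fin N} {X Y : Op p N}

theorem mul (hX : SiteCommute s n X) (hY : SiteCommute s n Y) : SiteCommute s n (X * Y) :=
  ⟨hX.1.mul_right hY.1, hX.2.1.mul_right hY.2.1, hX.2.2.1.mul_right hY.2.2.1,
    hX.2.2.2.mul_right hY.2.2.2⟩

theorem add (hX : SiteCommute s n X) (hY : SiteCommute s n Y) : SiteCommute s n (X + Y) :=
  ⟨hX.1.add_right hY.1, hX.2.1.add_right hY.2.1, hX.2.2.1.add_right hY.2.2.1,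
    hX.2.2.2.add_right hY.2.2.2⟩

theorem neg (hX : SiteCommute s n X) : SiteCommute s n (-X) :=
  ⟨hX.1.neg_right, hX.2.1.neg_right, hX.2.2.1.neg_right, hX.2.2.2.neg_right⟩

theorem sub (hX : SiteCommute s n X) (hY : SiteCommute s n Y) : SiteCommute s n (X - Y) := by
  rw [sub_eq_add_neg]
  exact hX.add hY.neg

theorem smul (c : ℂ) (hX : SiteCommute s n X) : SiteCommute s n (c • X) :=
  ⟨hX.1.smul_right c, hX.2.1.smul_right c, hX.2.2.1.smul_right c, hX.2.2.2.smul_right c⟩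

theorem algebraMap (c : ℂ) : SiteCommute s n (algebraMap ℂ (Op p N) c) :=
  ⟨Algebra.commute_algebraMap_right _ _, Algebra.commute_algebraMap_right _ _,
    Algebra.commute_algebraMap_right _ _, Algebra.commute_algebraMap_right _ _⟩

theorem weyl (h : n ≠ m) : SiteCommute s n (vOp s m : Op p N) ∧
    SiteCommute s n (vInvOp s m : Op p N) ∧ SiteCommute s n (uOp m : Op p N) ∧
    SiteCommute s n (uInvOp m : Op p N) := by
  have hd : ∀ f g : Config p N → ℂ, Commute (Matrix.diagonal f) (Matrix.diagonal g) := by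
    intro f g
    simp [Commute, SemiconjBy, Matrix.diagonal_mul_diagonal, mul_comm]
  have hdu : ∀ (f : ℕ → ℂ) (a b : Fin N) (_ : a ≠ b),
      Commute (Matrix.diagonal fun h : Config p N => f (h a)) (uOp b) := by
    intro f a b hab
    ext g h
    simp only [uOp, Matrix.mul_diagonal, Matrix.diagonal_mul, Matrix.of_apply]
    split_ifs with hg
    · subst hg
      simp [Function.update_of_ne hab]
    · simp
  have hdi : ∀ (f : ℕ → ℂ) (a b : Fin N) (_ : a ≠ b),
      Commute (Matrix.diagonal fun h : Config p N => f (h a)) (uInvOp b) := by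
    intro f a b hab
    ext g h
    simp only [uInvOp, Matrix.mul_diagonal, Matrix.diagonal_mul, Matrix.of_apply]
    split_ifs with hg
    · subst hg
      simp [Function.update_of_ne hab]
    · simp
  have hv : ∀ a b : Fin N, a ≠ b → Commute (vOp s a : Op p N) (uOp b) := fun a b =>
    hdu (fun k => (s ^ 2) ^ k) a b
  have hvi : ∀ a b : Fin N, a ≠ b → Commute (vInvOp s a : Op p N) (uOp b) := fun a b =>
    hdu (fun k => ((s ^ 2) ^ k)⁻¹) a b
  have hv' : ∀ a b : Fin N, a ≠ b → Commute (vOp s a : Op p N) (uInvOp b) := fun a b =>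
    hdi (fun k => (s ^ 2) ^ k) a b
  have hvi' : ∀ a b : Fin N, a ≠ b → Commute (vInvOp s a : Op p N) (uInvOp b) := fun a b =>
    hdi (fun k => ((s ^ 2) ^ k)⁻¹) a b
  have huu : Commute (uOp n : Op p N) (uOp m) := by
    ext g k
    simp [uOp, Matrix.mul_apply, Function.update_of_ne h, Function.update_of_ne h.symm,
      Function.update_comm h]
  have hui : Commute (uOp n : Op p N) (uInvOp m) := by
    ext g k
    simp [uOp, uInvOp, Matrix.mul_apply, Function.update_of_ne h, Function.update_of_ne h.symm,
      Function.update_comm h]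
  have hiu : Commute (uInvOp n : Op p N) (uOp m) := by
    ext g k
    simp [uOp, uInvOp, Matrix.mul_apply, Function.update_of_ne h, Function.update_of_ne h.symm,
      Function.update_comm h]
  have hii : Commute (uInvOp n : Op p N) (uInvOp m) := by
    ext g k
    simp [uInvOp, Matrix.mul_apply, Function.update_of_ne h, Function.update_of_ne h.symm,
      Function.update_comm h]
  exact ⟨⟨hd _ _, hd _ _, (hv m n h.symm).symm, (hv' m n h.symm).symm⟩,
    ⟨hd _ _, hd _ _, (hvi m n h.symm).symm, (hvi' m n h.symm).symm⟩,
    ⟨hv n m h, hvi n m h, huu, hiu⟩, ⟨hv' n m h, hvi' n m h, hui, hii⟩⟩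

end SiteCommute

theorem lax_eq_weylLax (P : Params N) (n : Fin N) (lam : ℂ) :
    (lax s P n lam : AuxOp p N) = weylLax s (P.a n) (P.b n) (P.c n) (P.d n) (P.alpha n) (P.beta n)
      (vOp s n) (vInvOp s n) (uOp n) (uInvOp n) lam := rfl

theorem SiteCommute.lax {n m : Fin N} (h : n ≠ m) (P : Params N) (lam : ℂ) (i j : Fin 2) :
    SiteCommute s n ((lax s P m lam : AuxOp p N) i j) := by
  obtain ⟨h₁, h₂, h₃, h₄⟩ := SiteCommute.weyl (p := p) (s := s) h
  fin_cases i <;> fin_cases j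
  · exact (h₁.smul _).sub (h₂.smul _)
  · exact h₃.mul ((h₁.smul _).add (h₂.smul _))
  · exact h₄.mul ((h₁.smul _).add (h₂.smul _))
  · exact (h₁.smul _).sub (h₂.smul _)

theorem SiteCommute.commute_lax {n : Fin N} {X : Op p N} (h : SiteCommute s n X) (P : Params N)
    (lam : ℂ) (i j : Fin 2) : Commute X ((CyclicReflection.lax s P n lam : AuxOp p N) i j) := by
  obtain ⟨h₁, h₂, h₃, h₄⟩ := h
  fin_cases i <;> fin_cases j
  · exact ((h₁.smul_left _).sub_left (h₂.smul_left _)).symm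
  · exact (h₃.mul_left ((h₁.smul_left _).add_left (h₂.smul_left _))).symm
  · exact (h₄.mul_left ((h₁.smul_left _).add_left (h₂.smul_left _))).symm
  · exact ((h₁.smul_left _).sub_left (h₂.smul_left _)).symm

theorem commute_adj₂ {𝓡 : Type*} [Ring 𝓡] {X : 𝓡} {A : Matrix (Fin 2) (Fin 2) 𝓡}
    (h : ∀ i j, Commute X (A i j)) (i j : Fin 2) : Commute X (adj₂ A i j) := by
  fin_cases i <;> fin_cases j
  · exact h 1 1
  · exact (h 0 1).neg_right
  · exact (h 1 0).neg_right
  · exact h 0 0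

/-- The matrix obtained from `K_-(lam)` by dressing with the Lax matrices of a list of sites. -/
def dressed (s : ℂ) (P : Params N) (lam : ℂ) : List (Fin N) → AuxOp p N
  | [] => auxScalar (kMinus s P lam)
  | n :: l => lax s P n (lam / s) * dressed s P lam l * adj₂ (lax s P n (1 / lam / s))

theorem siteCommute_mul_entries {n : Fin N} {A B : AuxOp p N}
    (hA : ∀ i j, SiteCommute s n (A i j)) (hB : ∀ i j, SiteCommute s n (B i j)) (i j : Fin 2) :
    SiteCommute s n ((A * B) i j) := by
  rw [Matrix.mul_apply, Fin.sum_univ_two]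
  exact ((hA _ _).mul (hB _ _)).add ((hA _ _).mul (hB _ _))

theorem siteCommute_adj₂ {n : Fin N} {A : AuxOp p N}
    (hA : ∀ i j, SiteCommute s n (A i j)) (i j : Fin 2) : SiteCommute s n (adj₂ A i j) := by
  fin_cases i <;> fin_cases j
  · exact hA 1 1
  · exact (hA 0 1).neg
  · exact (hA 1 0).neg
  · exact hA 0 0

/-- A matrix dressed with other sites commutes with the Weyl generators of the site `n`. -/
theorem siteCommute_dressed (P : Params N) (lam : ℂ) {n : Fin N} {l : List (Fin N)} (h : n ∉ l)
    (i j : Fin 2) : SiteCommute s n ((dressed s P lam l : AuxOp p N) i j) := by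
  induction l generalizing i j with
  | nil => exact SiteCommute.algebraMap _
  | cons m l ih =>
    have hm : n ≠ m := fun e => h (by simp [e])
    have hl : n ∉ l := fun e => h (by simp [e])
    exact siteCommute_mul_entries (siteCommute_mul_entries (fun i j => SiteCommute.lax hm P _ i j)
      (fun i j => ih hl i j)) (siteCommute_adj₂ fun i j => SiteCommute.lax hm P _ i j) i j

/-- The product of the Lax matrices of a list of sites. -/
def laxProd (s : ℂ) (P : Params N) (lam : ℂ) (l : List (Fin N)) : AuxOp p N :=
  (l.map fun n => (lax s P n (lam / s) : AuxOp p N)).prod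

theorem siteCommute_laxProd (P : Params N) (lam : ℂ) {n : Fin N} {l : List (Fin N)} (h : n ∉ l)
    (i j : Fin 2) : SiteCommute s n ((laxProd s P lam l : AuxOp p N) i j) := by
  induction l generalizing i j with
  | nil =>
    have : (laxProd s P lam [] : AuxOp p N) = algebraMap ℂ _ 1 := by simp [laxProd]
    rw [this, Matrix.algebraMap_matrix_apply]
    split_ifs
    · exact SiteCommute.algebraMap _
    · simpa using SiteCommute.algebraMap (p := p) (s := s) (n := n) 0
  | cons m l ih =>
    have hm : n ≠ m := fun e => h (by simp [e])
    have hl : n ∉ l := fun e => h (by simp [e])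
    have : (laxProd s P lam (m :: l) : AuxOp p N) =
        lax s P m (lam / s) * laxProd s P lam l := by simp [laxProd]
    rw [this]
    exact siteCommute_mul_entries (fun i j => SiteCommute.lax hm P _ i j)
      (fun i j => ih hl i j) i j

theorem adj₂_mul {𝓡 : Type*} [Ring 𝓡] (A B : Matrix (Fin 2) (Fin 2) 𝓡)
    (h : ∀ i j k l, Commute (A i j) (B k l)) : adj₂ (A * B) = adj₂ B * adj₂ A := by
  refine Matrix.ext fun i j => ?_
  fin_cases i <;> fin_cases j <;>
    simp [adj₂, Matrix.mul_apply, Fin.sum_univ_two, (h _ _ _ _).eq, add_comm]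

theorem laxProd_mul_adj₂ (P : Params N) (lam : ℂ) {l : List (Fin N)} (hl : l.Nodup) :
    (laxProd s P lam l * auxScalar (kMinus s P lam) * adj₂ (laxProd s P (1 / lam) l) : AuxOp p N) =
      dressed s P lam l := by
  induction l with
  | nil =>
    have : adj₂ (1 : AuxOp p N) = 1 := by
      refine Matrix.ext fun i j => ?_
      fin_cases i <;> fin_cases j <;> simp [adj₂]
    simp [laxProd, dressed, this]
  | cons n l ih =>
    have hc : ∀ mu : ℂ, (laxProd s P mu (n :: l) : AuxOp p N) =
        lax s P n (mu / s) * laxProd s P mu l := fun mu => by simp [laxProd]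
    rw [dressed, ← ih hl.of_cons, hc, hc, adj₂_mul]
    · simp only [mul_assoc]
    · intro i j k m
      exact ((siteCommute_laxProd P _ (List.nodup_cons.1 hl).1 k m).commute_lax P _ i j).symm

theorem sigmaY_transpose_sigmaY (A : AuxOp p N) :
    auxScalar sigmaY * A.transpose * auxScalar sigmaY = adj₂ A := by
  refine Matrix.ext fun i j => ?_
  fin_cases i <;> fin_cases j <;>
    simp [adj₂, auxScalar, sigmaY, Matrix.mul_apply, Fin.sum_univ_two,
      Algebra.algebraMap_eq_smul_one, smul_smul]

/-- The adjugates that make up `M̂` turn the boundary monodromy into successive dressings of `K_-`. -/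
theorem boundaryMonodromy_eq (P : Params N) (lam : ℂ) :
    (boundaryMonodromy s P lam : AuxOp p N) =
      (-1 : ℂ) ^ N • dressed s P lam (List.finRange N).reverse := by
  have h : ∀ mu : ℂ, (monodromy s P mu : AuxOp p N) = laxProd s P mu (List.finRange N).reverse := by
    intro mu
    rw [monodromy, laxProd, List.ofFn_eq_map, List.map_reverse]
  rw [boundaryMonodromy, monodromyHat, sigmaY_transpose_sigmaY, h, h, mul_smul_comm,
    laxProd_mul_adj₂ _ _ (List.nodup_reverse.2 (List.nodup_finRange N))]

end Sites

end

end CyclicReflection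

namespace CyclicReflection

noncomputable section

/-! ### Algebraic identities of the boundary monodromy -/

section Boundary

set_option linter.unusedSectionVars false

variable {𝓡 : Type*} [Ring 𝓡] [Algebra ℂ 𝓡] {p N : ℕ} [NeZero p] {s : ℂ}

theorem ReflectionEq.map {q lam mu : ℂ} {U V : Matrix (Fin 2) (Fin 2) ℂ}
    (h : ReflectionEq q lam mu U V) :
    ReflectionEq q lam mu (U.map (algebraMap ℂ 𝓡)) (V.map (algebraMap ℂ 𝓡)) := by
  have hF : ∀ A : Matrix (Fin 2) (Fin 2) ℂ, auxFst (A.map (algebraMap ℂ 𝓡)) =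
      (auxFst A).map (algebraMap ℂ 𝓡) := by
    intro A
    ext ⟨i, k⟩ ⟨j, l⟩
    simp only [auxFst, Matrix.of_apply, Matrix.map_apply]
    split_ifs <;> simp
  have hS : ∀ A : Matrix (Fin 2) (Fin 2) ℂ, auxSnd (A.map (algebraMap ℂ 𝓡)) =
      (auxSnd A).map (algebraMap ℂ 𝓡) := by
    intro A
    ext ⟨i, k⟩ ⟨j, l⟩
    simp only [auxSnd, Matrix.of_apply, Matrix.map_apply]
    split_ifs <;> simp
  have hV : ∀ a b c : ℂ, sixVertex 𝓡 a b c = (sixVertex ℂ a b c).map (algebraMap ℂ 𝓡) := by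
    intro a b c
    ext ⟨i, k⟩ ⟨j, l⟩
    simp [sixVertex]
  simp only [ReflectionEq, rQuot, rProd, hF, hS, hV, ← Matrix.map_mul] at h ⊢
  rw [h]

set_option maxHeartbeats 2000000 in
theorem reflectionEq_kMinus (hs : s ≠ 0) {P : Params N} (hz : P.zeta ≠ 0) {lam mu : ℂ}
    (hl : lam ≠ 0) (hm : mu ≠ 0) :
    ReflectionEq (s ^ 2) lam mu (kMinus s P lam) (kMinus s P mu) := by
  unfold kMinus
  generalize 1 / (P.zeta - 1 / P.zeta) = c
  generalize P.kappa * Complex.exp P.tau = k₁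
  generalize P.kappa * Complex.exp (-P.tau) = k₂
  unfold ReflectionEq
  ext ⟨i, k⟩ ⟨j, l⟩
  fin_cases i <;> fin_cases k <;> fin_cases j <;> fin_cases l <;>
    simp [rQuot, rProd, sixVertex, auxFst, auxSnd, Matrix.mul_apply, Fintype.sum_prod_type] <;>
    field_simp <;> ring

theorem ReflectionEq.smul {q lam mu : ℂ} {U V : Matrix (Fin 2) (Fin 2) 𝓡}
    (h : ReflectionEq q lam mu U V) (c d : ℂ) : ReflectionEq q lam mu (c • U) (d • V) := by
  have hF : auxFst (c • U) = c • auxFst U := by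
    ext ⟨i, k⟩ ⟨j, l⟩
    simp [auxFst]
  have hS : auxSnd (d • V) = d • auxSnd V := by
    ext ⟨i, k⟩ ⟨j, l⟩
    simp [auxSnd]
  unfold ReflectionEq at h ⊢
  simp only [hF, hS, Matrix.smul_mul, Matrix.mul_smul, h, smul_smul, mul_comm]

/-- The conditions on the bulk and boundary parameters under which no division by zero occurs in
the definition of the boundary monodromy and of its quantum determinant. -/
structure Params.Regular (P : Params N) : Prop where
  zeta : P.zeta ≠ 0
  kappa : P.kappa ≠ 0
  zeta_sub : P.zeta - 1 / P.zeta ≠ 0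
  gaugeAlpha : P.gaugeAlpha ≠ 0
  a : ∀ n, P.a n ≠ 0
  b : ∀ n, P.b n ≠ 0
  c : ∀ n, P.c n ≠ 0
  d : ∀ n, P.d n ≠ 0
  alpha : ∀ n, P.alpha n ≠ 0
  beta : ∀ n, P.beta n ≠ 0

theorem reflectionEq_dressed (hs : s ≠ 0) (hsp : (s ^ 2) ^ p = 1) {P : Params N} (hP : P.Regular)
    {lam mu : ℂ} (hl : lam ≠ 0) (hm : mu ≠ 0) {l : List (Fin N)} (hn : l.Nodup) :
    ReflectionEq (s ^ 2) lam mu (dressed s P lam l : AuxOp p N) (dressed s P mu l) := by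
  induction l with
  | nil => exact (reflectionEq_kMinus hs hP.zeta hl hm).map
  | cons n l ih =>
    have hw := weylPair_site (p := p) hs hsp n
    have hn' := List.nodup_cons.1 hn
    refine (ih hn.of_cons).dress
      (weylLax_exchange hs (hP.alpha n) (hP.beta n) hw hl hm)
      (adj_weylLax_exchange hs (hP.alpha n) (hP.beta n) hw hl hm)
      (adj_weylLax_exchange_weylLax hs (hP.alpha n) (hP.beta n) hw hl hm)
      (weylLax_exchange_adj_weylLax hs (hP.alpha n) (hP.beta n) hw hl hm) ?_ ?_ ?_ ?_
    · intro i j k m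
      exact (siteCommute_dressed P lam hn'.1 i j).commute_lax P _ k m
    · intro i j k m
      exact ((siteCommute_dressed P mu hn'.1 k m).commute_lax P _ i j).symm
    · intro i j k m
      exact commute_adj₂ (fun a b => (siteCommute_dressed P lam hn'.1 i j).commute_lax P _ a b) k m
    · intro i j k m
      exact (commute_adj₂
        (fun a b => (siteCommute_dressed P mu hn'.1 k m).commute_lax P _ a b) i j).symm

theorem nodup_sites : (List.finRange N).reverse.Nodup :=
  List.nodup_reverse.2 (List.nodup_finRange N)

theorem reflectionEq_boundaryMonodromy (hs : s ≠ 0) (hsp : (s ^ 2) ^ p = 1) {P : Params N}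
    (hP : P.Regular) {lam mu : ℂ} (hl : lam ≠ 0) (hm : mu ≠ 0) :
    ReflectionEq (s ^ 2) lam mu (boundaryMonodromy s P lam : AuxOp p N)
      (boundaryMonodromy s P mu) := by
  rw [boundaryMonodromy_eq, boundaryMonodromy_eq]
  exact (reflectionEq_dressed hs hsp hP hl hm nodup_sites).smul _ _

theorem parityEq_dressed (hs : s ≠ 0) (hsp : (s ^ 2) ^ p = 1) {P : Params N} (hP : P.Regular)
    {lam : ℂ} (hl : lam ≠ 0) {l : List (Fin N)} (hn : l.Nodup) :
    ParityEq (s ^ 2) lam (dressed s P lam l : AuxOp p N) (dressed s P (1 / lam) l) := by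
  induction l with
  | nil =>
    have hz := hP.zeta
    unfold ParityEq
    refine Matrix.ext fun i j => ?_
    fin_cases i <;> fin_cases j <;>
      simp [dressed, auxScalar, kMinus, Algebra.algebraMap_eq_smul_one] <;>
      match_scalars <;> field_simp <;> ring
  | cons n l ih =>
    have hw := weylPair_site (p := p) hs hsp n
    have hn' := List.nodup_cons.1 hn
    have h := (ih hn.of_cons).dress (a := P.a n) (b := P.b n) (c := P.c n) (d := P.d n)
      hs (hP.alpha n) (hP.beta n) hw hl (fun i j => by
        obtain ⟨h₁, h₂, h₃, h₄⟩ := siteCommute_dressed (s := s) (p := p) P lam hn'.1 i j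
        exact ⟨h₁.eq, h₂.eq, h₃.eq, h₄.eq⟩)
    simpa only [dressed, lax_eq_weylLax, one_div_one_div] using h

theorem parityEq_boundaryMonodromy (hs : s ≠ 0) (hsp : (s ^ 2) ^ p = 1) {P : Params N}
    (hP : P.Regular) {lam : ℂ} (hl : lam ≠ 0) :
    ParityEq (s ^ 2) lam (boundaryMonodromy s P lam : AuxOp p N)
      (boundaryMonodromy s P (1 / lam)) := by
  have h := congrArg (fun A => (-1 : ℂ) ^ N • A)
    (parityEq_dressed (p := p) hs hsp hP hl (nodup_sites (N := N)))
  rw [boundaryMonodromy_eq, boundaryMonodromy_eq]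
  unfold ParityEq at h ⊢
  rw [smul_comm, h]
  refine Matrix.ext fun i j => ?_
  fin_cases i <;> fin_cases j <;> simp [smul_add, smul_smul, mul_comm]

/-! ### Unitarity -/

theorem auxScalar_mul (A B : Matrix (Fin 2) (Fin 2) ℂ) :
    (auxScalar (A * B) : AuxOp p N) = auxScalar A * auxScalar B := by
  simp [auxScalar, Matrix.map_mul]

theorem auxScalar_algebraMap (c : ℂ) :
    (auxScalar (algebraMap ℂ _ c) : AuxOp p N) = algebraMap ℂ _ c := by
  refine Matrix.ext fun i j => ?_
  simp only [auxScalar, Matrix.map_apply, Matrix.algebraMap_matrix_apply]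
  split_ifs <;> simp

theorem IsInnerBoundary.sum_sub {P : Params N} {am bm : ℂ} (hP : P.Regular)
    (h : IsInnerBoundary P am bm) :
    (am ^ 2 + 1 / am ^ 2) - (bm ^ 2 + 1 / bm ^ 2) = -1 / P.kappa ^ 2 := by
  obtain ⟨ha, hb, h₁, h₂⟩ := h
  have hz := hP.zeta
  have hk := hP.kappa
  have e : 4 * ((am ^ 2 + 1 / am ^ 2) - (bm ^ 2 + 1 / bm ^ 2)) =
      ((am - 1 / am) * (bm + 1 / bm)) ^ 2 - ((am + 1 / am) * (bm - 1 / bm)) ^ 2 := by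
    field_simp
    ring
  have : 4 * ((am ^ 2 + 1 / am ^ 2) - (bm ^ 2 + 1 / bm ^ 2)) = 4 * (-1 / P.kappa ^ 2) := by
    rw [e, h₁, h₂]
    field_simp
    ring
  exact mul_left_cancel₀ (by norm_num) this

theorem IsInnerBoundary.prod_eq {P : Params N} {am bm : ℂ} (hP : P.Regular)
    (h : IsInnerBoundary P am bm) :
    (am ^ 2 + 1 / am ^ 2) * (bm ^ 2 + 1 / bm ^ 2) =
      (P.zeta ^ 2 + 1 / P.zeta ^ 2) / P.kappa ^ 2 + 4 := by
  obtain ⟨ha, hb, h₁, h₂⟩ := h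
  have hz := hP.zeta
  have hk := hP.kappa
  have e : 2 * ((am ^ 2 + 1 / am ^ 2) * (bm ^ 2 + 1 / bm ^ 2)) =
      ((am - 1 / am) * (bm + 1 / bm)) ^ 2 + ((am + 1 / am) * (bm - 1 / bm)) ^ 2 + 8 := by
    field_simp
    ring
  have : 2 * ((am ^ 2 + 1 / am ^ 2) * (bm ^ 2 + 1 / bm ^ 2)) =
      2 * ((P.zeta ^ 2 + 1 / P.zeta ^ 2) / P.kappa ^ 2 + 4) := by
    rw [e, h₁, h₂]
    field_simp
    ring
  exact mul_left_cancel₀ (by norm_num) this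

theorem kMinus_mul_kMinus (hs : s ≠ 0) {P : Params N} (hP : P.Regular) {am bm lam : ℂ}
    (h : IsInnerBoundary P am bm) (hl : lam ≠ 0) :
    kMinus s P (s ^ 2 / lam) * kMinus s P lam =
      algebraMap ℂ _ (gMinus s am bm lam * gMinus s am bm (s ^ 2 / lam)) := by
  have hA := h.sum_sub hP
  have hB := h.prod_eq hP
  obtain ⟨ha, hb, h₁, -⟩ := h
  have hz := hP.zeta
  have hk := hP.kappa
  have hz' := hP.zeta_sub
  -- The spectral parameter enters only through `T = lam² / q + q / lam²`.
  have hg : gMinus s am bm lam * gMinus s am bm (s ^ 2 / lam) =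
      (((am ^ 2 + 1 / am ^ 2) - (lam ^ 2 / s ^ 2 + s ^ 2 / lam ^ 2)) *
        ((bm ^ 2 + 1 / bm ^ 2) + (lam ^ 2 / s ^ 2 + s ^ 2 / lam ^ 2))) /
        ((P.zeta - 1 / P.zeta) / P.kappa) ^ 2 := by
    rw [← h₁]
    unfold gMinus
    rw [div_mul_div_comm, ← sq]
    congr 1
    field_simp
    ring
  have hg' : gMinus s am bm lam * gMinus s am bm (s ^ 2 / lam) =
      1 / (P.zeta - 1 / P.zeta) ^ 2 * ((P.zeta ^ 2 + 1 / P.zeta ^ 2) -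
        (lam ^ 2 / s ^ 2 + s ^ 2 / lam ^ 2) -
        P.kappa ^ 2 * ((lam ^ 2 / s ^ 2 + s ^ 2 / lam ^ 2) ^ 2 - 4)) := by
    rw [hg]
    have e : ∀ A B T : ℂ, (A - T) * (B + T) = A * B + T * (A - B) - T ^ 2 := fun A B T => by ring
    rw [e, hA, hB, div_pow, div_div_eq_mul_div]
    field_simp
    ring
  rw [hg']
  have e₁ : Complex.exp P.tau * Complex.exp (-P.tau) = 1 := by
    rw [← Complex.exp_add, add_neg_cancel, Complex.exp_zero]
  have e₂ : Complex.exp (-P.tau) = 1 / Complex.exp P.tau := by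
    rw [Complex.exp_neg, one_div]
  have e₃ := Complex.exp_ne_zero P.tau
  unfold kMinus
  rw [e₂]
  generalize Complex.exp P.tau = x at *
  rw [smul_mul_smul_comm, show 1 / (P.zeta - 1 / P.zeta) * (1 / (P.zeta - 1 / P.zeta)) =
    1 / (P.zeta - 1 / P.zeta) ^ 2 by rw [div_mul_div_comm, one_mul, sq]]
  rw [map_mul, ← Algebra.smul_def]
  congr 1
  refine Matrix.ext fun i j => ?_
  fin_cases i <;> fin_cases j <;>
    simp [Matrix.mul_apply, Matrix.algebraMap_matrix_apply] <;> field_simp <;> ring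

/-- The local quantum determinant with the parameters of the site `n`. -/
def siteDet (s : ℂ) (P : Params N) (lam : ℂ) (n : Fin N) : ℂ :=
  localDet s (P.a n) (P.b n) (P.c n) (P.d n) (P.alpha n) (P.beta n) lam

/-- Unitarity of the dressed matrices; every site contributes the quantum determinant of its Lax
matrix. -/
theorem dressed_mul_dressed (hs : s ≠ 0) (hsp : (s ^ 2) ^ p = 1) {P : Params N} (hP : P.Regular)
    {am bm lam : ℂ} (h : IsInnerBoundary P am bm) (hl : lam ≠ 0) (l : List (Fin N)) :
    (dressed s P (s ^ 2 / lam) l * dressed s P lam l : AuxOp p N) =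
      algebraMap ℂ _ (gMinus s am bm lam * gMinus s am bm (s ^ 2 / lam) *
        (l.map fun n => siteDet s P lam n * siteDet s P (s ^ 2 / lam) n).prod) := by
  induction l with
  | nil =>
    simp only [dressed, List.map_nil, List.prod_nil, mul_one]
    rw [← auxScalar_mul, kMinus_mul_kMinus hs hP h hl, auxScalar_algebraMap]
  | cons n l ih =>
    have hw := weylPair_site (p := p) hs hsp n
    have hs2 : s ^ 2 ≠ 0 := pow_ne_zero _ hs
    have e₁ := adj_weylLax_mul_weylLax (b := P.b n) (d := P.d n) hs (hP.a n) (hP.c n)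
      (hP.alpha n) (hP.beta n) hw hl
    have e₂ := weylLax_mul_adj_weylLax (b := P.b n) (d := P.d n) hs (hP.a n) (hP.c n)
      (hP.alpha n) (hP.beta n) hw (div_ne_zero hs2 hl)
    have e₃ : (1 : ℂ) / (s ^ 2 / lam) = lam / s ^ 2 := one_div_div _ _
    have e₄ : s ^ 2 / lam / s ^ 2 = 1 / lam := by field_simp
    rw [e₄] at e₂
    simp only [dressed, lax_eq_weylLax, e₃, List.map_cons, List.prod_cons]
    calc _ = weylLax s (P.a n) (P.b n) (P.c n) (P.d n) (P.alpha n) (P.beta n) (vOp s n)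
              (vInvOp s n) (uOp n) (uInvOp n) (s ^ 2 / lam / s) *
            (dressed s P (s ^ 2 / lam) l *
            (adj₂ (weylLax s (P.a n) (P.b n) (P.c n) (P.d n) (P.alpha n) (P.beta n) (vOp s n)
              (vInvOp s n) (uOp n) (uInvOp n) (lam / s ^ 2 / s)) *
            weylLax s (P.a n) (P.b n) (P.c n) (P.d n) (P.alpha n) (P.beta n) (vOp s n)
              (vInvOp s n) (uOp n) (uInvOp n) (lam / s)) * dressed s P lam l) *
            adj₂ (weylLax s (P.a n) (P.b n) (P.c n) (P.d n) (P.alpha n) (P.beta n) (vOp s n)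
              (vInvOp s n) (uOp n) (uInvOp n) (1 / lam / s)) := by
          simp only [mul_assoc]
      _ = _ := by
          rw [e₁, ← Algebra.commutes, mul_assoc (algebraMap ℂ (AuxOp p N) _), ih, ← map_mul,
            ← Algebra.commutes, mul_assoc, e₂, ← map_mul]
          congr 1
          simp only [siteDet]
          ring

theorem prod_siteDet {P : Params N} {a0 lam : ℂ} (h0 : a0 ≠ 0) (hs : s ≠ 0) (hl : lam ≠ 0) :
    ∏ n, siteDet s P lam n = aFun s P a0 (lam / s) * dFun s P a0 (1 / (s * (s ^ 2 / lam))) := by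
  have e : ∏ n, siteDet s P lam n = ∏ n : Fin N, ((-1) *
      (P.beta n / (lam / s) + (s ^ 2)⁻¹ * (P.b n * P.alpha n / P.a n) * (lam / s)) *
      (P.a n * P.c n / P.alpha n * (1 / (1 / (s * (s ^ 2 / lam))) +
        s ^ 2 * (P.d n * P.alpha n / (P.c n * P.beta n)) * (1 / (s * (s ^ 2 / lam)))))) := by
    refine Finset.prod_congr rfl fun n _ => ?_
    have h₁ : P.beta n / (lam / s) = P.beta n * s / lam := div_div_eq_mul_div _ _ _
    have h₂ : (1 : ℂ) / (1 / (s * (s ^ 2 / lam))) = s ^ 3 / lam := by field_simp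
    have h₃ : 1 / (s * (s ^ 2 / lam)) = lam / s ^ 3 := by field_simp
    rw [h₁, h₂, h₃]
    simp only [siteDet, localDet]
    ring
  rw [e, Finset.prod_mul_distrib, Finset.prod_mul_distrib, aFun, dFun, Finset.prod_const,
    Finset.card_univ, Fintype.card_fin]
  generalize ∏ n : Fin N, (P.beta n / (lam / s) + _) = X
  generalize ∏ n : Fin N, (P.a n * P.c n / P.alpha n * _) = Y
  field_simp

/-- Unitarity of the boundary monodromy: the product at reflected points is a number, which
factorizes through `𝖠_-`. -/
theorem boundaryMonodromy_mul (hs : s ≠ 0) (hsp : (s ^ 2) ^ p = 1) {P : Params N} (hP : P.Regular)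
    {am bm a0 lam : ℂ} (h : IsInnerBoundary P am bm) (h0 : a0 ≠ 0) (hl : lam ≠ 0) :
    (boundaryMonodromy s P (s ^ 2 / lam) * boundaryMonodromy s P lam : AuxOp p N) =
      algebraMap ℂ _ (coefA s P am bm a0 lam * coefA s P am bm a0 (s ^ 2 / lam)) := by
  have hs2 : s ^ 2 ≠ 0 := pow_ne_zero _ hs
  rw [boundaryMonodromy_eq, boundaryMonodromy_eq, smul_mul_smul_comm, ← pow_add, ← two_mul,
    pow_mul, neg_one_sq, one_pow, one_smul, dressed_mul_dressed hs hsp hP h hl]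
  congr 1
  have e : ((List.finRange N).reverse.map fun n =>
      siteDet s P lam n * siteDet s P (s ^ 2 / lam) n).prod =
      (∏ n, siteDet s P lam n) * ∏ n, siteDet s P (s ^ 2 / lam) n := by
    rw [← Finset.prod_mul_distrib, List.map_reverse, List.prod_reverse,
      ← List.ofFn_eq_map, List.prod_ofFn]
  rw [e, prod_siteDet h0 hs hl, prod_siteDet h0 hs (div_ne_zero hs2 hl)]
  have e₂ : s ^ 2 / (s ^ 2 / lam) = lam := by field_simp
  rw [e₂]
  simp only [coefA]
  ring

/-! ### The special points -/

theorem dressed_self (hs : s ≠ 0) (hsp : (s ^ 2) ^ p = 1) {P : Params N} (hP : P.Regular)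
    (l : List (Fin N)) : ∃ c : ℂ, (dressed s P s l : AuxOp p N) = algebraMap ℂ _ c := by
  induction l with
  | nil =>
    refine ⟨1, ?_⟩
    have hz := hP.zeta
    have hz' := hP.zeta_sub
    have e : kMinus s P s = algebraMap ℂ _ 1 := by
      have e₁ : s * P.zeta / s = P.zeta := by field_simp
      have e₂ : s / (P.zeta * s) = 1 / P.zeta := by field_simp
      have e₃ : s / (s * P.zeta) = 1 / P.zeta := by field_simp
      have e₄ : s ^ 2 / s ^ 2 = 1 := by field_simp
      refine Matrix.ext fun i j => ?_
      fin_cases i <;> fin_cases j <;> simp [kMinus, e₁, e₂, e₃, e₄] <;>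
        exact inv_mul_cancel₀ (by simpa using hz')
    simp only [dressed]
    rw [e, auxScalar_algebraMap]
  | cons n l ih =>
    obtain ⟨c, hc⟩ := ih
    have hw := weylPair_site (p := p) hs hsp n
    have e₂ := weylLax_mul_adj_weylLax (b := P.b n) (d := P.d n) hs (hP.a n) (hP.c n)
      (hP.alpha n) (hP.beta n) hw hs
    have e₄ : s / s ^ 2 = 1 / s := by field_simp
    rw [e₄] at e₂
    refine ⟨c * siteDet s P s n, ?_⟩
    simp only [dressed, hc, lax_eq_weylLax]
    rw [← Algebra.commutes, mul_assoc, e₂, ← map_mul, siteDet]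

/-- The Pauli matrix `σ^z`, with operator entries. -/
def sigmaZ (𝓡 : Type*) [Ring 𝓡] : Matrix (Fin 2) (Fin 2) 𝓡 := !![1, 0; 0, -1]

theorem sigmaZ_mul_adj₂_weylLax {a b c d α β : ℂ} {v vi u ui : 𝓡} (x : ℂ) :
    sigmaZ 𝓡 * adj₂ (weylLax s a b c d α β v vi u ui (-x)) =
      -(adj₂ (weylLax s a b c d α β v vi u ui x) * sigmaZ 𝓡) := by
  refine Matrix.ext fun i j => ?_
  fin_cases i <;> fin_cases j <;>
    simp [sigmaZ, adj₂, weylLax, Matrix.mul_apply, Fin.sum_univ_two, div_neg, neg_smul] <;> abel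

theorem dressed_I_mul_self (hs : s ≠ 0) (hsp : (s ^ 2) ^ p = 1) {P : Params N} (hP : P.Regular)
    (l : List (Fin N)) :
    ∃ c : ℂ, (dressed s P (Complex.I * s) l : AuxOp p N) = c • sigmaZ (Op p N) := by
  have hI := Complex.I_ne_zero
  induction l with
  | nil =>
    refine ⟨1 / (P.zeta - 1 / P.zeta) * (Complex.I * (P.zeta + 1 / P.zeta)), ?_⟩
    have hz := hP.zeta
    have e₄ : (Complex.I * s) ^ 2 / s ^ 2 - s ^ 2 / (Complex.I * s) ^ 2 = 0 := by
      rw [mul_pow, Complex.I_sq]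
      field_simp
      ring
    have e₁ : Complex.I * s * P.zeta / s - s / (Complex.I * s * P.zeta) =
        Complex.I * (P.zeta + 1 / P.zeta) := by
      field_simp
      rw [Complex.I_sq]
      ring
    have e₂ : s * P.zeta / (Complex.I * s) - Complex.I * s / (P.zeta * s) =
        -(Complex.I * (P.zeta + 1 / P.zeta)) := by
      field_simp
      rw [Complex.I_sq]
      ring
    have hK : kMinus s P (Complex.I * s) =
        (1 / (P.zeta - 1 / P.zeta)) • !![Complex.I * (P.zeta + 1 / P.zeta), 0;
          0, -(Complex.I * (P.zeta + 1 / P.zeta))] := by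
      rw [kMinus, e₄, e₁, e₂, mul_zero, mul_zero]
    rw [dressed, hK]
    generalize 1 / (P.zeta - 1 / P.zeta) = x
    generalize Complex.I * (P.zeta + 1 / P.zeta) = y
    refine Matrix.ext fun i j => ?_
    fin_cases i <;> fin_cases j <;>
      simp [auxScalar, sigmaZ, Algebra.algebraMap_eq_smul_one]
  | cons n l ih =>
    obtain ⟨c, hc⟩ := ih
    have hw := weylPair_site (p := p) hs hsp n
    have e₂ := weylLax_mul_adj_weylLax (b := P.b n) (d := P.d n) hs (hP.a n) (hP.c n)
      (hP.alpha n) (hP.beta n) hw (mul_ne_zero hI hs)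
    have e₄ : 1 / (Complex.I * s) / s = -(Complex.I * s / s ^ 2 / s) := by
      field_simp
      rw [Complex.I_sq]
      ring
    refine ⟨-(c * siteDet s P (Complex.I * s) n), ?_⟩
    simp only [dressed, hc, lax_eq_weylLax]
    rw [mul_smul_comm, smul_mul_assoc, mul_assoc, e₄, sigmaZ_mul_adj₂_weylLax, mul_neg, ← mul_assoc,
      e₂, siteDet, neg_smul, smul_neg, mul_smul, Algebra.smul_def (localDet _ _ _ _ _ _ _ _)]

theorem boundaryMonodromy_self (hs : s ≠ 0) (hsp : (s ^ 2) ^ p = 1) {P : Params N}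
    (hP : P.Regular) : ∃ c : ℂ, (boundaryMonodromy s P s : AuxOp p N) = algebraMap ℂ _ c := by
  obtain ⟨c, hc⟩ := dressed_self (p := p) hs hsp hP (List.finRange N).reverse
  refine ⟨(-1) ^ N * c, ?_⟩
  rw [boundaryMonodromy_eq, hc, map_mul, Algebra.smul_def]

theorem boundaryMonodromy_I_mul_self (hs : s ≠ 0) (hsp : (s ^ 2) ^ p = 1) {P : Params N}
    (hP : P.Regular) :
    ∃ c : ℂ, (boundaryMonodromy s P (Complex.I * s) : AuxOp p N) = c • sigmaZ (Op p N) := by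
  obtain ⟨c, hc⟩ := dressed_I_mul_self (p := p) hs hsp hP (List.finRange N).reverse
  refine ⟨(-1) ^ N * c, ?_⟩
  rw [boundaryMonodromy_eq, hc, smul_smul]

end Boundary

end

end CyclicReflection

namespace CyclicReflection

noncomputable section

/-! ### Laurent polynomials in the spectral parameter -/

section Laurent

set_option linter.unusedSectionVars false

open Polynomial

variable {𝓡 𝓢 : Type*} [Ring 𝓡] [Algebra ℂ 𝓡] [Ring 𝓢] [Algebra ℂ 𝓢]

/-- Away from `0`, `f lam` is a Laurent polynomial in `lam` with exponents `-n, -n + 2, …, n`; its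
coefficients are those of `P`. -/
def IsLaurent (n : ℕ) (f : ℂ → 𝓡) (P : 𝓡[X]) : Prop :=
  P.natDegree ≤ n ∧ ∀ lam : ℂ, lam ≠ 0 → lam ^ n • f lam = P.eval (algebraMap ℂ 𝓡 (lam ^ 2))

theorem IsLaurent.mul {m n : ℕ} {f g : ℂ → 𝓡} {P Q : 𝓡[X]} (hf : IsLaurent m f P)
    (hg : IsLaurent n g Q) : IsLaurent (m + n) (fun lam => f lam * g lam) (P * Q) := by
  refine ⟨natDegree_mul_le.trans (add_le_add hf.1 hg.1), fun lam hl => ?_⟩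
  rw [eval, eval₂_mul_noncomm _ _ fun k => (Algebra.commutes _ _).symm, ← eval, ← eval,
    ← hf.2 lam hl, ← hg.2 lam hl, smul_mul_smul_comm, pow_add]

theorem IsLaurent.map {n : ℕ} {f : ℂ → 𝓡} {P : 𝓡[X]} (hf : IsLaurent n f P) (φ : 𝓡 →ₗ[ℂ] 𝓢) :
    ∃ Q : 𝓢[X], IsLaurent n (fun lam => φ (f lam)) Q ∧ ∀ k, Q.coeff k = φ (P.coeff k) := by
  have hc : ∀ k, (∑ j ∈ Finset.range (n + 1), monomial j (φ (P.coeff j))).coeff k =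
      φ (P.coeff k) := by
    intro k
    simp only [finsetSum_coeff, coeff_monomial, Finset.sum_ite_eq', Finset.mem_range]
    split_ifs with h
    · rfl
    · rw [coeff_eq_zero_of_natDegree_lt (by have := hf.1; omega), map_zero]
  have hd : (∑ j ∈ Finset.range (n + 1), monomial j (φ (P.coeff j))).natDegree ≤ n := by
    refine natDegree_le_iff_coeff_eq_zero.2 fun k hk => ?_
    rw [hc, coeff_eq_zero_of_natDegree_lt (hf.1.trans_lt hk), map_zero]
  refine ⟨_, ⟨hd, fun lam hl => ?_⟩, hc⟩
  rw [← map_smul, hf.2 lam hl, eval_eq_sum_range' (Nat.lt_succ_of_le hf.1),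
    eval_eq_sum_range' (Nat.lt_succ_of_le hd), map_sum]
  refine Finset.sum_congr rfl fun k _ => ?_
  rw [hc, ← map_pow, ← map_pow, ← Algebra.commutes, ← Algebra.commutes, ← Algebra.smul_def,
    ← Algebra.smul_def, map_smul]

theorem IsLaurent.congr {n : ℕ} {f g : ℂ → 𝓡} {P : 𝓡[X]} (hf : IsLaurent n f P)
    (h : ∀ lam, lam ≠ 0 → g lam = f lam) : IsLaurent n g P :=
  ⟨hf.1, fun lam hl => by rw [h lam hl, hf.2 lam hl]⟩

theorem isLaurent_one {f : ℂ → 𝓡} {A B : 𝓡}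
    (h : ∀ lam : ℂ, lam ≠ 0 → lam • f lam = lam ^ 2 • A + B) : IsLaurent 1 f (C A * X + C B) := by
  refine ⟨natDegree_linear_le, fun lam hl => ?_⟩
  rw [pow_one, h lam hl]
  simp only [eval_add, eval_C_mul, eval_X, eval_C, Algebra.smul_def, Algebra.commutes]

variable {p N : ℕ} [NeZero p] {s : ℂ}

/-- The conjugation after which the four entries of the boundary monodromy are Laurent polynomials
of the same kind. -/
def twist (lam : ℂ) (A : Matrix (Fin 2) (Fin 2) 𝓡) : Matrix (Fin 2) (Fin 2) 𝓡 :=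
  !![lam • A 0 0, A 0 1; A 1 0, lam⁻¹ • A 1 1]

theorem isLaurent_kMinus (hs : s ≠ 0) {P : Params N} (hP : P.Regular) :
    ∃ Q : (AuxOp p N)[X], IsLaurent 2 (fun lam => twist lam (auxScalar (kMinus s P lam))) Q ∧
      ∃ t t' : ℂ, Q.coeff 2 0 1 = algebraMap ℂ _ t ∧ Q.coeff 2 1 0 = algebraMap ℂ _ t' ∧
        Q.coeff 2 1 1 = 0 := by
  have hz := hP.zeta
  obtain ⟨c, k₁, k₂, hK⟩ : ∃ c k₁ k₂ : ℂ, ∀ lam, kMinus s P lam =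
      c • !![lam * P.zeta / s - s / (lam * P.zeta), k₁ * (lam ^ 2 / s ^ 2 - s ^ 2 / lam ^ 2);
        k₂ * (lam ^ 2 / s ^ 2 - s ^ 2 / lam ^ 2), s * P.zeta / lam - lam / (P.zeta * s)] :=
    ⟨_, _, _, fun _ => rfl⟩
  set A₂ : Matrix (Fin 2) (Fin 2) ℂ := c • !![P.zeta / s, k₁ / s ^ 2; k₂ / s ^ 2, 0]
  set A₁ : Matrix (Fin 2) (Fin 2) ℂ := c • !![-(s / P.zeta), 0; 0, -(1 / (P.zeta * s))]
  set A₀ : Matrix (Fin 2) (Fin 2) ℂ := c • !![0, -(k₁ * s ^ 2); -(k₂ * s ^ 2), s * P.zeta]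
  have hQ : ((C (auxScalar A₂) * X ^ 2 + C (auxScalar A₁) * X + C (auxScalar A₀) :
      (AuxOp p N)[X])).coeff 2 = auxScalar A₂ := by
    simp [coeff_C, coeff_X]
  refine ⟨C (auxScalar A₂) * X ^ 2 + C (auxScalar A₁) * X + C (auxScalar A₀), ⟨?_, ?_⟩,
    c * (k₁ / s ^ 2), c * (k₂ / s ^ 2), ?_⟩
  · exact natDegree_quadratic_le
  · intro lam hl
    have e : ∀ A : AuxOp p N, ∀ x : ℂ, A * algebraMap ℂ _ x = x • A := fun A x => by
      rw [← Algebra.commutes, Algebra.smul_def]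
    simp only [eval_add, eval_C_mul, eval_X_pow, eval_X, eval_C, ← map_pow, e]
    refine Matrix.ext fun i j => ?_
    fin_cases i <;> fin_cases j <;>
      simp [twist, auxScalar, hK, A₂, A₁, A₀,
        Algebra.algebraMap_eq_smul_one] <;>
      match_scalars <;> field_simp <;> ring
  · rw [hQ]
    simp [auxScalar, A₂]

theorem isLaurent_weylLax {a b c d α β : ℂ} {v vi u ui : 𝓡} (hs : s ≠ 0) :
    IsLaurent 1 (fun lam => !![weylLax s a b c d α β v vi u ui (lam / s) 0 0,
        lam • weylLax s a b c d α β v vi u ui (lam / s) 0 1;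
        lam⁻¹ • weylLax s a b c d α β v vi u ui (lam / s) 1 0,
        weylLax s a b c d α β v vi u ui (lam / s) 1 1])
      (C !![(α / s) • v, u * ((s⁻¹ * a) • v + (s * b) • vi); 0, -(b * d / β / s) • vi] * X +
        C !![-(β * s) • vi, 0; ui * ((s * c) • v + (s⁻¹ * d) • vi), (a * c / α * s) • v]) := by
  refine isLaurent_one fun lam hl => ?_
  refine Matrix.ext fun i j => ?_
  fin_cases i <;> fin_cases j <;> simp [weylLax, smul_smul, hl, ← sq] <;>
    match_scalars <;> field_simp

theorem isLaurent_adj_weylLax {a b c d α β : ℂ} {v vi u ui : 𝓡} (hs : s ≠ 0) :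
    IsLaurent 1 (fun lam => !![adj₂ (weylLax s a b c d α β v vi u ui (1 / lam / s)) 0 0,
        lam⁻¹ • adj₂ (weylLax s a b c d α β v vi u ui (1 / lam / s)) 0 1;
        lam • adj₂ (weylLax s a b c d α β v vi u ui (1 / lam / s)) 1 0,
        adj₂ (weylLax s a b c d α β v vi u ui (1 / lam / s)) 1 1])
      (C !![(a * c / α * s) • v, 0; -(ui * ((s * c) • v + (s⁻¹ * d) • vi)), -(β * s) • vi] * X +
        C !![-(b * d / β / s) • vi, -(u * ((s⁻¹ * a) • v + (s * b) • vi)); 0, (α / s) • v]) := by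
  refine isLaurent_one fun lam hl => ?_
  refine Matrix.ext fun i j => ?_
  fin_cases i <;> fin_cases j <;> simp [weylLax, adj₂, smul_smul, hl, ← sq] <;>
    match_scalars <;> field_simp

theorem twist_mul_mul {lam : ℂ} (hl : lam ≠ 0) (L A M : Matrix (Fin 2) (Fin 2) 𝓡) :
    twist lam (L * A * M) = !![L 0 0, lam • L 0 1; lam⁻¹ • L 1 0, L 1 1] * twist lam A *
      !![M 0 0, lam⁻¹ • M 0 1; lam • M 1 0, M 1 1] := by
  refine Matrix.ext fun i j => ?_
  fin_cases i <;> fin_cases j <;>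
    simp [twist, Matrix.mul_apply, Fin.sum_univ_two, mul_add, add_mul, smul_smul, hl, smul_add,
      mul_assoc]

/-- The Laurent structure of the dressed matrices. The coefficients of the highest power in the
off-diagonal entries are numbers, and the one in the last entry vanishes. -/
theorem isLaurent_dressed (hs : s ≠ 0) (hsp : (s ^ 2) ^ p = 1) {P : Params N} (hP : P.Regular)
    (l : List (Fin N)) :
    ∃ Q : (AuxOp p N)[X],
      IsLaurent (2 * l.length + 2) (fun lam => twist lam (dressed s P lam l)) Q ∧
      ∃ t t' : ℂ, Q.coeff (2 * l.length + 2) 0 1 = algebraMap ℂ _ t ∧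
        Q.coeff (2 * l.length + 2) 1 0 = algebraMap ℂ _ t' ∧
        Q.coeff (2 * l.length + 2) 1 1 = 0 := by
  induction l with
  | nil => exact isLaurent_kMinus hs hP
  | cons n l ih =>
    obtain ⟨Q, hQ, t, t', h₁, h₂, h₃⟩ := ih
    have hw := weylPair_site (p := p) hs hsp n
    have hL := isLaurent_weylLax (a := P.a n) (b := P.b n) (c := P.c n) (d := P.d n)
      (α := P.alpha n) (β := P.beta n) (v := (vOp s n : Op p N)) (vi := vInvOp s n)
      (u := uOp n) (ui := uInvOp n) hs
    have hM := isLaurent_adj_weylLax (a := P.a n) (b := P.b n) (c := P.c n) (d := P.d n)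
      (α := P.alpha n) (β := P.beta n) (v := (vOp s n : Op p N)) (vi := vInvOp s n)
      (u := uOp n) (ui := uInvOp n) hs
    have e : 1 + (2 * l.length + 2) + 1 = 2 * (n :: l).length + 2 := by
      simp only [List.length_cons]
      omega
    have hprod := (hL.mul hQ).mul hM
    rw [e] at hprod
    refine ⟨_, hprod.congr fun lam hl => ?_, P.alpha n * P.beta n * -t,
      P.b n * P.d n / P.beta n * (P.a n * P.c n / P.alpha n) * -t', ?_⟩
    · simp only [dressed, twist_mul_mul hl, lax_eq_weylLax]
    · rw [← e, coeff_mul_add_eq_of_natDegree_le (natDegree_mul_le.trans (add_le_add hL.1 hQ.1)) hM.1,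
        coeff_mul_add_eq_of_natDegree_le hL.1 hQ.1]
      have hα := hP.alpha n
      simp only [coeff_add, coeff_C_mul, coeff_X_one, mul_one, coeff_C_succ, add_zero]
      have hA := Matrix.eta_fin_two (Q.coeff (2 * l.length + 2))
      rw [h₁, h₂, h₃] at hA
      rw [hA, Matrix.mul_fin_two, Matrix.mul_fin_two]
      refine ⟨?_, ?_, ?_⟩
      · simp [Algebra.algebraMap_eq_smul_one, hw.v_vi, smul_smul]
        field_simp
      · simp [Algebra.algebraMap_eq_smul_one, hw.vi_v, smul_smul]
        field_simp
      · simp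

/-- The Laurent structure of the boundary monodromy. -/
theorem isLaurent_boundaryMonodromy (hs : s ≠ 0) (hsp : (s ^ 2) ^ p = 1) {P : Params N}
    (hP : P.Regular) :
    ∃ Q : (AuxOp p N)[X],
      IsLaurent (2 * N + 2) (fun lam => twist lam (boundaryMonodromy s P lam)) Q ∧
      ∃ t t' : ℂ, Q.coeff (2 * N + 2) 0 1 = algebraMap ℂ _ t ∧
        Q.coeff (2 * N + 2) 1 0 = algebraMap ℂ _ t' ∧ Q.coeff (2 * N + 2) 1 1 = 0 := by
  obtain ⟨Q, hQ, t, t', h₁, h₂, h₃⟩ := isLaurent_dressed hs hsp hP (List.finRange N).reverse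
  rw [List.length_reverse, List.length_finRange] at *
  have hC : (C (algebraMap ℂ (AuxOp p N) ((-1) ^ N)) * Q).natDegree ≤ 2 * N + 2 :=
    (natDegree_C_mul_le _ _).trans hQ.1
  refine ⟨C (algebraMap ℂ _ ((-1) ^ N)) * Q, ⟨hC, fun lam hl => ?_⟩, (-1) ^ N * t, (-1) ^ N * t',
    ?_⟩
  · rw [eval_C_mul, ← hQ.2 lam hl, ← Algebra.smul_def, smul_comm]
    simp only [boundaryMonodromy_eq]
    congr 1
    refine Matrix.ext fun i j => ?_
    fin_cases i <;> fin_cases j <;> simp [twist, smul_smul, mul_comm]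
  · rw [coeff_C_mul, ← Algebra.smul_def]
    simp [h₁, h₂, h₃, Algebra.smul_def]

theorem gauged_eq_twist {α lam x y : ℂ} (hl : lam ≠ 0) (U : Matrix (Fin 2) (Fin 2) 𝓡) :
    gauged s α lam x y U = -(y / s) • twist lam U 0 0 - (α * s ^ 2) • twist lam U 0 1 +
      (x * y / (α * s ^ 2)) • twist lam U 1 0 + (x * s) • twist lam U 1 1 := by
  simp only [gauged, twist, Matrix.of_apply, Matrix.cons_val', Matrix.cons_val_zero,
    Matrix.cons_val_one, Matrix.cons_val_fin_one]
  match_scalars <;> field_simp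

end Laurent

end

end CyclicReflection

namespace CyclicReflection

noncomputable section

/-! ### Zeros and extreme coefficients of matrix elements -/

section LaurentScalar

set_option linter.unusedSectionVars false

open Polynomial

variable {p N : ℕ} [NeZero p] {s : ℂ}

theorem polynomial_eq_of_eval {P Q : ℂ[X]} {S : Set ℂ} (hS : S.Finite)
    (h : ∀ u ∉ S, P.eval u = Q.eval u) : P = Q :=
  eq_of_infinite_eval_eq P Q (hS.infinite_compl.mono fun u hu => h u hu)

theorem eval_reflect_eq {P : ℂ[X]} {n : ℕ} (hP : P.natDegree ≤ n) {u : ℂ} (hu : u ≠ 0) :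
    (P.reflect n).eval u = u ^ n * P.eval u⁻¹ := by
  letI := invertibleOfNonzero (inv_ne_zero hu)
  have h := eval₂_reflect_mul_pow (RingHom.id ℂ) u⁻¹ n P hP
  rw [invOf_eq_inv, inv_inv, inv_pow] at h
  rw [eval, eval, ← h, mul_comm, mul_assoc, inv_mul_cancel₀ (pow_ne_zero _ hu), mul_one]

/-- A palindromic polynomial of degree at most `2 N` is `u ^ N` times a polynomial in `u + 1 / u`. -/
theorem exists_eval_add_inv {S : Set ℂ} (hS : S.Finite) (h0 : (0 : ℂ) ∈ S) (N : ℕ) (R : ℂ[X])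
    (hd : R.natDegree ≤ 2 * N) (h : ∀ u ∉ S, R.eval u = u ^ (2 * N) * R.eval u⁻¹) :
    ∃ Q : ℂ[X], Q.natDegree ≤ N ∧ ∀ u : ℂ, u ≠ 0 → R.eval u = u ^ N * Q.eval (u + u⁻¹) := by
  induction N generalizing R with
  | zero =>
    refine ⟨C (R.coeff 0), by simp, fun u _ => ?_⟩
    rw [eq_C_of_natDegree_le_zero hd]
    simp
  | succ N ih =>
    set c := R.coeff 0 with hc
    have hr : R.reflect (2 * (N + 1)) = R := by
      refine polynomial_eq_of_eval hS fun u hu => ?_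
      rw [eval_reflect_eq hd fun e => hu (by rw [e]; exact h0), h u hu]
    have hc' : R.coeff (2 * (N + 1)) = c := by
      rw [hc]
      conv_rhs => rw [← hr]
      rw [coeff_reflect, revAt_le (Nat.zero_le _), Nat.sub_zero]
    have hm : (X ^ 2 + 1 : ℂ[X]).Monic := by
      simpa using monic_X_pow_add_C (1 : ℂ) two_ne_zero
    have hnd : (X ^ 2 + 1 : ℂ[X]).natDegree = 2 := by
      simpa using natDegree_X_pow_add_C (n := 2) (r := (1 : ℂ))
    have hmd : ((X ^ 2 + 1 : ℂ[X]) ^ (N + 1)).natDegree = 2 * (N + 1) := by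
      rw [hm.natDegree_pow, hnd, mul_comm]
    have hm1 : ((X ^ 2 + 1 : ℂ[X]) ^ (N + 1)).coeff (2 * (N + 1)) = 1 := by
      rw [← hmd]
      exact hm.pow _
    have hm0 : ((X ^ 2 + 1 : ℂ[X]) ^ (N + 1)).coeff 0 = 1 := by
      rw [coeff_zero_eq_eval_zero]
      simp
    set R₁ := R - C c * (X ^ 2 + 1) ^ (N + 1) with hR₁
    have hR₁0 : R₁.coeff 0 = 0 := by
      rw [hR₁, coeff_sub, coeff_C_mul, hm0, hc, mul_one, sub_self]
    have hR₁t : R₁.coeff (2 * (N + 1)) = 0 := by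
      rw [hR₁, coeff_sub, coeff_C_mul, hm1, hc', mul_one, sub_self]
    have hR₁d : R₁.natDegree ≤ 2 * N + 1 := by
      refine natDegree_le_iff_coeff_eq_zero.2 fun k hk => ?_
      rcases (show 2 * (N + 1) ≤ k by omega).eq_or_lt with rfl | hk'
      · exact hR₁t
      · refine coeff_eq_zero_of_natDegree_lt (lt_of_le_of_lt ?_ hk')
        exact (natDegree_sub_le _ _).trans
          (max_le hd ((natDegree_C_mul_le _ _).trans hmd.le))
    have hX : R₁ = R₁.divX * X := by
      conv_lhs => rw [← divX_mul_X_add R₁, hR₁0, map_zero, add_zero]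
    have hR₁e : ∀ u, u * R₁.divX.eval u = R.eval u - c * (u ^ 2 + 1) ^ (N + 1) := by
      intro u
      have := congrArg (eval u) hX
      rw [eval_mul, eval_X] at this
      rw [mul_comm, ← this, hR₁]
      simp
    obtain ⟨Q, hQ, hQe⟩ := ih R₁.divX
      (by rw [natDegree_divX_eq_natDegree_tsub_one]; omega) (fun u hu => by
        have hu0 : u ≠ 0 := fun e => hu (e ▸ h0)
        have h₁ := hR₁e u
        have h₂ := hR₁e u⁻¹
        have h₃ := h u hu
        refine mul_left_cancel₀ hu0 ?_
        have e₁ : R.eval u⁻¹ = u⁻¹ * R₁.divX.eval u⁻¹ + c * (u⁻¹ ^ 2 + 1) ^ (N + 1) := by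
          rw [h₂]; ring
        have e₂ : u ^ (2 * (N + 1)) * (u⁻¹ ^ 2 + 1) ^ (N + 1) = (u ^ 2 + 1) ^ (N + 1) := by
          rw [pow_mul, ← mul_pow]
          congr 1
          field_simp
          ring
        rw [h₁, h₃, e₁, mul_add, mul_left_comm _ c, e₂, add_sub_cancel_right]
        rw [show 2 * (N + 1) = 2 * N + 2 by ring, pow_add]
        field_simp)
    refine ⟨C c * X ^ (N + 1) + Q, ?_, fun u hu => ?_⟩
    · exact (natDegree_add_le _ _).trans
        (max_le (natDegree_C_mul_X_pow_le _ _) (hQ.trans (Nat.le_succ N)))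
    · have e₁ : R.eval u = u * R₁.divX.eval u + c * (u ^ 2 + 1) ^ (N + 1) := by
        rw [hR₁e]; ring
      have e₂ : (u ^ 2 + 1) ^ (N + 1) = u ^ (N + 1) * (u + u⁻¹) ^ (N + 1) := by
        rw [← mul_pow]
        congr 1
        field_simp
      rw [e₁, hQe u hu, e₂]
      simp only [eval_add, eval_mul, eval_C, eval_pow, eval_X]
      ring

theorem exists_sq_eq (u : ℂ) : ∃ lam : ℂ, lam ^ 2 = u :=
  IsAlgClosed.exists_pow_nat_eq u two_pos

theorem IsLaurent.eval_sq {n : ℕ} {f : ℂ → ℂ} {P : ℂ[X]} (hf : IsLaurent n f P) {lam : ℂ}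
    (hl : lam ≠ 0) : P.eval (lam ^ 2) = lam ^ n * f lam := by
  have := hf.2 lam hl
  simpa using this.symm

/-- A Laurent polynomial with the zeros and the reflection symmetry of `ℬ_-` is `lam² / q - q / lam²`
times a polynomial in `lam² + 1 / lam²`. -/
theorem exists_poly_of_parity (hs : s ≠ 0) {f : ℂ → ℂ} {P : ℂ[X]} (hf : IsLaurent (2 * N + 2) f P)
    (h₁ : f s = 0) (h₂ : f (Complex.I * s) = 0)
    (hpar : ∀ lam : ℂ, lam ≠ 0 → (lam ^ 2 / s ^ 2 - s ^ 2 / lam ^ 2) * f (1 / lam) =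
      -(s ^ 2 * lam ^ 2 - 1 / (s ^ 2 * lam ^ 2)) * f lam) :
    ∃ Q : ℂ[X], Q.natDegree ≤ N ∧ ∀ lam : ℂ, lam ≠ 0 →
      f lam = (lam ^ 2 / s ^ 2 - s ^ 2 / lam ^ 2) * Q.eval (lam ^ 2 + 1 / lam ^ 2) := by
  have hI := Complex.I_ne_zero
  have hq : s ^ 2 ≠ 0 := pow_ne_zero _ hs
  have r₁ : P.IsRoot (s ^ 2) := by
    rw [IsRoot, hf.eval_sq hs, h₁, mul_zero]
  obtain ⟨P₁, hP₁⟩ := dvd_iff_isRoot.2 r₁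
  have r₂ : P₁.IsRoot (-s ^ 2) := by
    have h := hf.eval_sq (mul_ne_zero hI hs)
    rw [h₂, mul_zero, mul_pow, Complex.I_sq, neg_one_mul, hP₁, eval_mul] at h
    refine (mul_eq_zero.1 h).resolve_left ?_
    simp only [eval_sub, eval_X, eval_C]
    intro e
    apply hq
    linear_combination -(1 / 2) * e
  obtain ⟨R, hR⟩ := dvd_iff_isRoot.2 r₂
  have hPR : P = (X - C (s ^ 2)) * ((X - C (-s ^ 2)) * R) := by rw [← hR, ← hP₁]
  have hRd : R.natDegree ≤ 2 * N := by
    by_cases hR0 : R = 0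
    · simp [hR0]
    have := hf.1
    rw [hPR, natDegree_mul (X_sub_C_ne_zero _) (mul_ne_zero (X_sub_C_ne_zero _) hR0),
      natDegree_mul (X_sub_C_ne_zero _) hR0, natDegree_X_sub_C, natDegree_X_sub_C] at this
    omega
  have hfR : ∀ lam : ℂ, lam ≠ 0 →
      lam ^ (2 * N + 2) * f lam = ((lam ^ 2) ^ 2 - (s ^ 2) ^ 2) * R.eval (lam ^ 2) := by
    intro lam hl
    rw [← hf.eval_sq hl, hPR]
    simp only [eval_mul, eval_sub, eval_X, eval_C]
    ring
  have hroots : ∀ c : ℂ, {u : ℂ | u ^ 2 = c}.Finite := by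
    intro c
    refine ((nthRoots 2 c).toFinset.finite_toSet).subset fun u hu => ?_
    simpa [mem_nthRoots] using hu
  obtain ⟨Q, hQ, hQe⟩ := exists_eval_add_inv
    (S := {0} ∪ ({u : ℂ | u ^ 2 = (s ^ 2) ^ 2} ∪ {u : ℂ | u ^ 2 = 1 / (s ^ 2) ^ 2}))
    ((Set.finite_singleton _).union ((hroots _).union (hroots _))) (by simp) N R hRd (by
      intro u hu
      simp only [Set.mem_union, Set.mem_singleton_iff, Set.mem_setOf_eq, not_or] at hu
      obtain ⟨hu0, hu1, hu2⟩ := hu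
      obtain ⟨lam, rfl⟩ := exists_sq_eq u
      have hl : lam ≠ 0 := fun e => hu0 (by rw [e]; ring)
      have e₁ := hfR lam hl
      have e₂ := hfR (1 / lam) (one_div_ne_zero hl)
      have e₃ := hpar lam hl
      have hu1' : (lam ^ 2) ^ 2 - (s ^ 2) ^ 2 ≠ 0 := sub_ne_zero.2 hu1
      have hu2' : (s ^ 2) ^ 2 * (lam ^ 2) ^ 2 - 1 ≠ 0 := by
        intro e
        apply hu2
        field_simp
        linear_combination e
      have e₄ : (1 / lam) ^ 2 = (lam ^ 2)⁻¹ := by rw [one_div, inv_pow]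
      rw [e₄] at e₂
      have f₁ : f lam = ((lam ^ 2) ^ 2 - (s ^ 2) ^ 2) * R.eval (lam ^ 2) / lam ^ (2 * N + 2) := by
        rw [← e₁]; field_simp
      have f₂ : f (1 / lam) =
          lam ^ (2 * N + 2) * ((((lam ^ 2)⁻¹) ^ 2 - (s ^ 2) ^ 2) * R.eval (lam ^ 2)⁻¹) := by
        rw [← e₂, one_div, inv_pow]; field_simp
      rw [f₁, f₂] at e₃
      have e₅ : ((lam ^ 2) ^ 2 - (s ^ 2) ^ 2) * ((s ^ 2) ^ 2 * (lam ^ 2) ^ 2 - 1) *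
          R.eval (lam ^ 2) = ((lam ^ 2) ^ 2 - (s ^ 2) ^ 2) * ((s ^ 2) ^ 2 * (lam ^ 2) ^ 2 - 1) *
          ((lam ^ 2) ^ (2 * N) * R.eval (lam ^ 2)⁻¹) := by
        have hp : lam ^ (2 * N + 2) ≠ 0 := pow_ne_zero _ hl
        have e₆ : (lam ^ 2) ^ (2 * N) = (lam ^ (2 * N + 2)) ^ 2 / lam ^ 4 := by
          rw [eq_div_iff (pow_ne_zero _ hl)]
          ring
        rw [e₆]
        generalize lam ^ (2 * N + 2) = w at *
        field_simp at e₃ ⊢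
        linear_combination e₃
      exact mul_left_cancel₀ (mul_ne_zero hu1' hu2') e₅)
  refine ⟨C (s ^ 2) * Q, (natDegree_C_mul_le _ _).trans hQ, fun lam hl => ?_⟩
  have e₁ := hfR lam hl
  rw [hQe _ (pow_ne_zero _ hl)] at e₁
  have hp : lam ^ (2 * N + 2) ≠ 0 := pow_ne_zero _ hl
  refine mul_left_cancel₀ hp ?_
  rw [e₁, eval_C_mul, one_div]
  generalize eval (lam ^ 2 + (lam ^ 2)⁻¹) Q = w
  rw [← pow_mul]
  field_simp
  ring

theorem coeff_quadratic_mul {P : ℂ[X]} {n : ℕ} (hP : P.natDegree ≤ n) (a b : ℂ) :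
    ((C a * X ^ 2 + C b) * P).coeff (n + 2) = a * P.coeff n := by
  have h : P.coeff (n + 2) = 0 := coeff_eq_zero_of_natDegree_lt (by omega)
  rw [add_mul, coeff_add, mul_assoc, coeff_C_mul, coeff_C_mul, h, mul_zero, add_zero,
    coeff_X_pow_mul]

/-- Comparison of the highest coefficients in a relation between the values at `lam` and at
`1 / lam`. -/
theorem coeff_zero_of_inversion (hs : s ≠ 0) {n : ℕ} {f g h : ℂ → ℂ} {F G H : ℂ[X]}
    (hf : IsLaurent n f F) (hg : IsLaurent n g G) (hh : IsLaurent n h H) {x y x' y' : ℂ}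
    (e : ∀ lam : ℂ, lam ≠ 0 → (lam ^ 2 / s ^ 2 - s ^ 2 / lam ^ 2) * f (1 / lam) =
      (x * lam ^ 2 + y / lam ^ 2) * g lam + (x' * lam ^ 2 + y' / lam ^ 2) * h lam) :
    F.coeff 0 = s ^ 2 * (x * G.coeff n + x' * H.coeff n) := by
  have hF : (F.reflect n).natDegree ≤ n := by
    refine natDegree_le_iff_coeff_eq_zero.2 fun k hk => ?_
    rw [coeff_reflect, revAt_eq_self_of_lt hk,
      coeff_eq_zero_of_natDegree_lt (hf.1.trans_lt hk)]
  have key : (C (s ^ 2)⁻¹ * X ^ 2 + C (-s ^ 2)) * F.reflect n =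
      (C x * X ^ 2 + C y) * G + (C x' * X ^ 2 + C y') * H := by
    refine polynomial_eq_of_eval (Set.finite_singleton (0 : ℂ)) fun u hu => ?_
    have hu0 : u ≠ 0 := hu
    obtain ⟨lam, rfl⟩ := exists_sq_eq u
    have hl : lam ≠ 0 := fun e => hu0 (by rw [e]; ring)
    have h₁ := hf.eval_sq (one_div_ne_zero hl)
    have h₂ := e lam hl
    rw [one_div, inv_pow] at h₁
    simp only [eval_add, eval_mul, eval_C, eval_pow, eval_X]
    rw [eval_reflect_eq hf.1 hu0, hg.eval_sq hl, hh.eval_sq hl, h₁]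
    have h₃ : (lam ^ 2) ^ n * (lam⁻¹ ^ n * f lam⁻¹) = lam ^ n * f lam⁻¹ := by
      rw [← pow_mul, two_mul, pow_add, inv_pow]
      field_simp
    rw [h₃]
    have h₄ : (lam ^ 2 / s ^ 2 - s ^ 2 / lam ^ 2) * f lam⁻¹ * (lam ^ n * lam ^ 2) =
        ((x * lam ^ 2 + y / lam ^ 2) * g lam + (x' * lam ^ 2 + y' / lam ^ 2) * h lam) *
          (lam ^ n * lam ^ 2) := by
      rw [← h₂, one_div]
    field_simp at h₄ ⊢
    linear_combination h₄
  have := congrArg (fun A => A.coeff (n + 2)) key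
  simp only [coeff_add, coeff_quadratic_mul hF, coeff_quadratic_mul hg.1,
    coeff_quadratic_mul hh.1] at this
  rw [coeff_reflect, revAt_le le_rfl, Nat.sub_self] at this
  rw [← this]
  field_simp

/-- The entry functional of a `2 × 2` operator matrix. -/
def entryFun (φ : Op p N →ₗ[ℂ] ℂ) (i j : Fin 2) : AuxOp p N →ₗ[ℂ] ℂ where
  toFun A := φ (A i j)
  map_add' A B := by simp
  map_smul' c A := by simp

theorem entryFun_apply (φ : Op p N →ₗ[ℂ] ℂ) (i j : Fin 2) (A : AuxOp p N) :
    entryFun φ i j A = φ (A i j) := rfl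

/-- The matrix elements of the gauged operators between states on which numbers act trivially have
highest and lowest coefficients given by one operator. -/
theorem exists_gauged_element (hs : s ≠ 0) (hsp : (s ^ 2) ^ p = 1) {P : Params N}
    (hP : P.Regular) :
    ∃ a : Op p N, ∀ φ : Op p N →ₗ[ℂ] ℂ, φ 1 = 0 → ∀ α x y : ℂ, ∃ F : ℂ[X],
      IsLaurent (2 * N + 2) (fun lam => φ (gauged s α lam x y (boundaryMonodromy s P lam))) F ∧
        F.coeff (2 * N + 2) = -(y / s) * φ a ∧ F.coeff 0 = x * s ^ 3 * φ a := by
  obtain ⟨Q, hQ, t, t', h₁, h₂, h₃⟩ := isLaurent_boundaryMonodromy (p := p) hs hsp hP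
  refine ⟨Q.coeff (2 * N + 2) 0 0, fun φ hφ α x y => ?_⟩
  have hc : ∀ c : ℂ, φ (algebraMap ℂ _ c) = 0 := fun c => by
    rw [Algebra.algebraMap_eq_smul_one, map_smul, hφ, smul_zero]
  obtain ⟨F, hF, hFc⟩ := hQ.map (-(y / s) • entryFun φ 0 0 - (α * s ^ 2) • entryFun φ 0 1 +
      (x * y / (α * s ^ 2)) • entryFun φ 1 0 + (x * s) • entryFun φ 1 1)
  obtain ⟨F₀₀, hF₀₀, hc₀₀⟩ := hQ.map (entryFun φ 0 0)
  obtain ⟨F₀₁, hF₀₁, hc₀₁⟩ := hQ.map (entryFun φ 0 1)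
  obtain ⟨F₁₀, hF₁₀, hc₁₀⟩ := hQ.map (entryFun φ 1 0)
  obtain ⟨F₁₁, hF₁₁, hc₁₁⟩ := hQ.map (entryFun φ 1 1)
  have hpar : ∀ (lam : ℂ), lam ≠ 0 → ∀ i j,
      (lam ^ 2 / s ^ 2 - s ^ 2 / lam ^ 2) * φ ((boundaryMonodromy s P (1 / lam) : AuxOp p N) i j) =
      φ ((!![(lam ^ 2 - 1 / lam ^ 2) • (boundaryMonodromy s P lam : AuxOp p N) 1 1 +
          (1 / s ^ 2 - s ^ 2) • (boundaryMonodromy s P lam : AuxOp p N) 0 0,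
        -(s ^ 2 * lam ^ 2 - 1 / (s ^ 2 * lam ^ 2)) • (boundaryMonodromy s P lam : AuxOp p N) 0 1;
        -(s ^ 2 * lam ^ 2 - 1 / (s ^ 2 * lam ^ 2)) • (boundaryMonodromy s P lam : AuxOp p N) 1 0,
        (lam ^ 2 - 1 / lam ^ 2) • (boundaryMonodromy s P lam : AuxOp p N) 0 0 +
          (1 / s ^ 2 - s ^ 2) • (boundaryMonodromy s P lam : AuxOp p N) 1 1] :
            AuxOp p N) i j) := by
    intro lam hl i j
    have := parityEq_boundaryMonodromy (p := p) hs hsp hP hl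
    unfold ParityEq at this
    rw [← this, Matrix.smul_apply, map_smul, smul_eq_mul]
  have z₀₁ : F₀₁.coeff 0 = 0 := by
    rw [coeff_zero_of_inversion hs hF₀₁ hF₀₁ hF₀₁ (x := -s ^ 2) (y := 1 / s ^ 2) (x' := 0) (y' := 0),
      hc₀₁, entryFun_apply, h₁, hc]
    · ring
    · intro lam hl
      have := hpar lam hl 0 1
      simp only [entryFun_apply, twist, Matrix.of_apply, Matrix.cons_val', Matrix.cons_val_zero,
        Matrix.cons_val_one, Matrix.cons_val_fin_one, map_smul, smul_eq_mul] at this ⊢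
      rw [this]
      field_simp
      ring
  have z₁₀ : F₁₀.coeff 0 = 0 := by
    rw [coeff_zero_of_inversion hs hF₁₀ hF₁₀ hF₁₀ (x := -s ^ 2) (y := 1 / s ^ 2) (x' := 0) (y' := 0),
      hc₁₀, entryFun_apply, h₂, hc]
    · ring
    · intro lam hl
      have := hpar lam hl 1 0
      simp only [entryFun_apply, twist, Matrix.of_apply, Matrix.cons_val', Matrix.cons_val_zero,
        Matrix.cons_val_one, Matrix.cons_val_fin_one, map_smul, smul_eq_mul] at this ⊢
      rw [this]
      field_simp
      ring
  have z₀₀ : F₀₀.coeff 0 = 0 := by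
    rw [coeff_zero_of_inversion hs hF₀₀ hF₁₁ hF₀₀ (x := 1) (y := -1) (x' := 0)
      (y' := 1 / s ^ 2 - s ^ 2), hc₁₁, entryFun_apply, h₃, map_zero]
    · ring
    · intro lam hl
      have := hpar lam hl 0 0
      simp only [entryFun_apply, twist, Matrix.of_apply, Matrix.cons_val', Matrix.cons_val_zero,
        Matrix.cons_val_one, Matrix.cons_val_fin_one, map_smul, map_add, smul_eq_mul] at this ⊢
      rw [mul_left_comm, this]
      field_simp
      ring
  have z₁₁ : F₁₁.coeff 0 = s ^ 2 * φ (Q.coeff (2 * N + 2) 0 0) := by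
    rw [coeff_zero_of_inversion hs hF₁₁ hF₀₀ hF₁₁ (x := 1) (y := -1) (x' := 1 / s ^ 2 - s ^ 2)
      (y' := 0), hc₁₁, hc₀₀, entryFun_apply, entryFun_apply, h₃, map_zero]
    · ring
    · intro lam hl
      have := hpar lam hl 1 1
      simp only [entryFun_apply, twist, Matrix.of_apply, Matrix.cons_val', Matrix.cons_val_zero,
        Matrix.cons_val_one, Matrix.cons_val_fin_one, map_smul, map_add, smul_eq_mul] at this ⊢
      rw [mul_left_comm, this]
      field_simp
      ring
  refine ⟨F, hF.congr fun lam hl => ?_, ?_, ?_⟩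
  · rw [gauged_eq_twist hl]
    simp [entryFun_apply]
  · rw [hFc]
    simp [entryFun_apply, h₁, h₂, h₃, hc]
  · rw [hc₀₀] at z₀₀
    rw [hc₀₁] at z₀₁
    rw [hc₁₀] at z₁₀
    rw [hc₁₁] at z₁₁
    rw [hFc]
    simp only [LinearMap.add_apply, LinearMap.sub_apply, LinearMap.smul_apply, z₀₀, z₀₁, z₁₀, z₁₁,
      smul_eq_mul]
    ring

/-- At `lam = q^{1/2}` and `lam = i q^{1/2}` the gauged operators act as numbers. -/
theorem gauged_special (hs : s ≠ 0) (hsp : (s ^ 2) ^ p = 1) {P : Params N} (hP : P.Regular)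
    (α x y : ℂ) :
    (∃ c : ℂ, gauged s α s x y (boundaryMonodromy s P s : AuxOp p N) = ((x - y) * c) • 1) ∧
    ∃ c : ℂ, gauged s α (Complex.I * s) x y (boundaryMonodromy s P (Complex.I * s) : AuxOp p N) =
      ((x - y) * c) • 1 := by
  obtain ⟨c, hc⟩ := boundaryMonodromy_self (p := p) hs hsp hP
  obtain ⟨d, hd⟩ := boundaryMonodromy_I_mul_self (p := p) hs hsp hP
  refine ⟨⟨c, ?_⟩, ⟨Complex.I * d, ?_⟩⟩
  · rw [hc]
    simp only [gauged, Algebra.algebraMap_eq_smul_one, Matrix.smul_apply, Matrix.one_apply]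
    simp
    match_scalars
    field_simp
    ring
  · rw [hd]
    simp only [gauged, sigmaZ, Matrix.smul_apply]
    simp
    match_scalars
    field_simp
    rw [Complex.I_sq]
    ring

/-- Every matrix element of `ℬ_-` is `lam² / q - q / lam²` times a polynomial of degree at most `N`
in `lam² + 1 / lam²`. -/
theorem exists_poly_gauged_self (hs : s ≠ 0) (hsp : (s ^ 2) ^ p = 1) {P : Params N}
    (hP : P.Regular) (φ : Op p N →ₗ[ℂ] ℂ) (α β : ℂ) :
    ∃ Q : ℂ[X], Q.natDegree ≤ N ∧ ∀ lam : ℂ, lam ≠ 0 →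
      φ (gauged s α lam β β (boundaryMonodromy s P lam)) =
        (lam ^ 2 / s ^ 2 - s ^ 2 / lam ^ 2) * Q.eval (lam ^ 2 + 1 / lam ^ 2) := by
  obtain ⟨Q, hQ, -⟩ := isLaurent_boundaryMonodromy (p := p) hs hsp hP
  obtain ⟨F, hF, -⟩ := hQ.map (-(β / s) • entryFun φ 0 0 - (α * s ^ 2) • entryFun φ 0 1 +
      (β * β / (α * s ^ 2)) • entryFun φ 1 0 + (β * s) • entryFun φ 1 1)
  obtain ⟨⟨c, hc⟩, ⟨d, hd⟩⟩ := gauged_special (p := p) hs hsp hP α β β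
  refine exists_poly_of_parity hs (hF.congr fun lam hl => ?_) ?_ ?_ fun lam hl => ?_
  · rw [gauged_eq_twist hl]
    simp [entryFun_apply]
  · rw [hc]
    simp
  · rw [hd]
    simp
  · have h := parityEq_boundaryMonodromy (p := p) hs hsp hP hl
    unfold ParityEq at h
    have h' : ∀ i j, (lam ^ 2 / s ^ 2 - s ^ 2 / lam ^ 2) •
        (boundaryMonodromy s P (1 / lam) : AuxOp p N) i j = _ := fun i j =>
      congrFun (congrFun h i) j
    rw [← smul_eq_mul, ← smul_eq_mul, ← map_smul, ← map_smul]
    congr 1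
    simp only [gauged, smul_add, smul_sub]
    rw [smul_comm _ (-(1 / lam * β / s)), smul_comm _ (α * s ^ 2), smul_comm _ (β * β / (α * s ^ 2)),
      smul_comm _ (β * s / (1 / lam)), h', h', h', h']
    simp only [Matrix.of_apply, Matrix.cons_val', Matrix.cons_val_zero,
      Matrix.cons_val_one, Matrix.cons_val_fin_one]
    match_scalars <;> field_simp <;> ring

end LaurentScalar

end

end CyclicReflection

namespace CyclicReflection

noncomputable section

/-! ### Cyclic ladders of pseudo-eigenvectors -/

section LadderTheory

open Filter Topology

/-- The variable `lam² + 1 / lam²` in which the pseudo-eigenvalues are polynomials. -/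
def xVar (lam : ℂ) : ℂ := lam ^ 2 + 1 / lam ^ 2

/-- The number with `N` given zeros, shifted by the labels `h`. -/
def eigenFun {N : ℕ} (q : ℂ) (z : Fin N → ℂ) (ℓ : ℂ) (h : Fin N → ℕ) (mu : ℂ) : ℂ :=
  ℓ * (mu ^ 2 / q - q / mu ^ 2) * ∏ n, (xVar mu - xVar (z n * q ^ h n))

/-- The relations from which a basis of pseudo-eigenvectors is built. The operators `B i` map the
pseudo-eigenvectors at the gauge index `i` to those at `σ i`, with the zeros `z n` (up to powers of
`q`); the operators `A i`, evaluated at the zeros, shift the labels. The relations are those of the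
reflection algebra, restricted to the vectors annihilated by `B i`. -/
structure Ladder (p N : ℕ) (ι V : Type*) [AddCommGroup V] [Module ℂ V] [TopologicalSpace V] where
  q : ℂ
  σ : ι → ι
  B : ι → ℂ → V →ₗ[ℂ] V
  A : ι → ℂ → V →ₗ[ℂ] V
  f : ℂ → ℂ
  z : Fin N → ℂ
  lead : ι → ℂ
  ψ : ι → V
  q_ne : q ≠ 0
  q_pow : q ^ p = 1
  z_ne : ∀ n, z n ≠ 0
  lead_ne : ∀ i, lead i ≠ 0
  ψ_ne : ∀ i, ψ i ≠ 0
  sep : ∀ n m k l, xVar (z n * q ^ k) = xVar (z m * q ^ l) → n = m ∧ k ≡ l [MOD p]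
  nondeg : ∀ n k, (z n * q ^ k) ^ 4 ≠ q ^ 2
  f_ne : ∀ n k, f (z n * q ^ k) ≠ 0
  f_inv_ne : ∀ n k, f (1 / (z n * q ^ k)) ≠ 0
  B_cont : ∀ i v mu, mu ≠ 0 → ContinuousAt (fun mu => B i mu v) mu
  B_A : ∀ i lam v, lam ≠ 0 → B i lam v = 0 → ∀ mu, mu ≠ 0 → q ^ 2 * lam ^ 2 ≠ mu ^ 2 →
    (xVar mu - xVar lam) • B i mu (A i lam v) =
      (xVar mu - xVar (lam / q)) • A (σ i) lam (B i mu v)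
  A_A : ∀ i lam mu v, lam ≠ 0 → mu ≠ 0 → q ^ 2 * lam ^ 2 ≠ mu ^ 2 → lam ^ 2 * mu ^ 2 ≠ 1 →
    B i lam v = 0 → B i mu v = 0 → A i lam (A i mu v) = A i mu (A i lam v)
  A_q_A : ∀ i lam v, lam ≠ 0 → f lam ≠ 0 → B i lam v = 0 →
    A i (q / lam) (A i lam v) = (f lam * f (q / lam)) • v
  B_ψ : ∀ i mu, mu ≠ 0 → B i mu (ψ i) = eigenFun q z (lead i) 0 mu • ψ (σ i)

theorem xVar_inv (lam : ℂ) : xVar (1 / lam) = xVar lam := by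
  simp [xVar, add_comm]

theorem finite_xVar_eq (c : ℂ) : {mu : ℂ | mu ≠ 0 ∧ xVar mu = c}.Finite := by
  classical
  have hP : (Polynomial.X ^ 4 - Polynomial.C c * Polynomial.X ^ 2 + 1 : Polynomial ℂ) ≠ 0 := by
    intro h
    have := congrArg (Polynomial.eval 0) h
    simp at this
  refine ((Polynomial.X ^ 4 - Polynomial.C c * Polynomial.X ^ 2 + 1 :
    Polynomial ℂ).roots.toFinset.finite_toSet).subset ?_
  rintro mu ⟨h0, h⟩
  simp only [Finset.mem_coe, Multiset.mem_toFinset, Polynomial.mem_roots hP, Polynomial.IsRoot]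
  simp only [Polynomial.eval_add, Polynomial.eval_sub, Polynomial.eval_mul, Polynomial.eval_pow,
    Polynomial.eval_X, Polynomial.eval_C, Polynomial.eval_one]
  rw [← h, xVar]
  field_simp
  ring

theorem continuousAt_xVar {mu : ℂ} (h : mu ≠ 0) : ContinuousAt xVar mu := by
  unfold xVar
  exact (continuousAt_id.pow 2).add (continuousAt_const.div (continuousAt_id.pow 2) (pow_ne_zero _ h))

theorem continuousAt_eigenFun {N : ℕ} (q : ℂ) (z : Fin N → ℂ) (ℓ : ℂ) (h : Fin N → ℕ) {mu : ℂ}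
    (hm : mu ≠ 0) : ContinuousAt (eigenFun q z ℓ h) mu := by
  unfold eigenFun
  have h₁ : ContinuousAt (fun mu : ℂ => mu ^ 2) mu := continuousAt_id.pow 2
  refine (continuousAt_const.mul ((h₁.div_const q).sub
    (continuousAt_const.div h₁ (pow_ne_zero _ hm)))).mul ?_
  exact tendsto_finsetProd _ fun n _ => (continuousAt_xVar hm).sub continuousAt_const

namespace Ladder

variable {p N : ℕ} {ι V : Type*} [AddCommGroup V] [Module ℂ V] [TopologicalSpace V]
  (L : Ladder p N ι V)

/-- The zero with its label. -/
def Z (n : Fin N) (k : ℕ) : ℂ := L.z n * L.q ^ k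

theorem Z_ne (n : Fin N) (k : ℕ) : L.Z n k ≠ 0 := mul_ne_zero (L.z_ne n) (pow_ne_zero _ L.q_ne)

theorem Z_succ (n : Fin N) (k : ℕ) : L.Z n (k + 1) = L.q * L.Z n k := by
  simp only [Z, pow_succ]
  ring

theorem Z_add (n : Fin N) (k : ℕ) : L.Z n (k + p) = L.Z n k := by
  simp only [Z, pow_add, L.q_pow, mul_one]

/-- A family of pseudo-eigenvectors with labels `h`. -/
def IsEig (φ : ι → V) (h : Fin N → ℕ) : Prop :=
  ∀ i mu, mu ≠ 0 → L.B i mu (φ i) = eigenFun L.q L.z (L.lead i) h mu • φ (L.σ i)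

variable {L}

theorem f_Z_ne (n : Fin N) (k : ℕ) : L.f (L.Z n k) ≠ 0 := L.f_ne n k

theorem f_inv_Z_ne (n : Fin N) (k : ℕ) : L.f (1 / L.Z n k) ≠ 0 := L.f_inv_ne n k

theorem eigenFun_eq_zero {ℓ mu : ℂ} {h : Fin N → ℕ} (a : Fin N)
    (hx : xVar mu = xVar (L.Z a (h a))) : eigenFun L.q L.z ℓ h mu = 0 := by
  unfold eigenFun
  rw [Finset.prod_eq_zero (Finset.mem_univ a) (by rw [hx]; exact sub_self _), mul_zero]

theorem eigenFun_ne_zero (i : ι) {h : Fin N → ℕ} (n : Fin N) {k : ℕ} (hk : ¬ h n ≡ k [MOD p]) :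
    eigenFun L.q L.z (L.lead i) h (L.Z n k) ≠ 0 := by
  have hq := L.q_ne
  have hZ := L.Z_ne n k
  refine mul_ne_zero (mul_ne_zero (L.lead_ne i) fun e => L.nondeg n k ?_)
    (Finset.prod_ne_zero_iff.2 fun m _ e => ?_)
  · change L.Z n k ^ 4 = _
    field_simp at e
    linear_combination e
  · obtain ⟨rfl, h'⟩ := L.sep _ _ _ _ (sub_eq_zero.1 e)
    exact hk h'.symm

theorem IsEig.kill_inv {φ : ι → V} {h : Fin N → ℕ} (hφ : L.IsEig φ h) (a : Fin N) (i : ι) :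
    L.B i (1 / L.Z a (h a)) (φ i) = 0 := by
  rw [hφ i _ (one_div_ne_zero (L.Z_ne _ _)), eigenFun_eq_zero a (xVar_inv _), zero_smul]

theorem eigenFun_update (ℓ mu : ℂ) (h : Fin N → ℕ) (a : Fin N) (k : ℕ) :
    (xVar mu - xVar (L.Z a k)) * eigenFun L.q L.z ℓ h mu =
      (xVar mu - xVar (L.Z a (h a))) * eigenFun L.q L.z ℓ (Function.update h a k) mu := by
  unfold eigenFun
  rw [← Finset.mul_prod_erase _ _ (Finset.mem_univ a),
    ← Finset.mul_prod_erase _ _ (Finset.mem_univ a)]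
  have : ∏ x ∈ Finset.univ.erase a, (xVar mu - xVar (L.z x * L.q ^ Function.update h a k x)) =
      ∏ x ∈ Finset.univ.erase a, (xVar mu - xVar (L.z x * L.q ^ h x)) :=
    Finset.prod_congr rfl fun x hx => by
      rw [Function.update_of_ne (Finset.ne_of_mem_erase hx)]
  rw [this, Function.update_self]
  simp only [Z]
  ring

/-- Acting with `A` at the inverse of a zero raises the label of this zero. -/
theorem IsEig.raise [T2Space V] [ContinuousSMul ℂ V] {φ : ι → V} {h : Fin N → ℕ}
    (hφ : L.IsEig φ h) (a : Fin N) :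
    L.IsEig (fun i => L.A i (1 / L.Z a (h a)) (φ i)) (Function.update h a (h a + 1)) := by
  intro i mu hm
  set lam := 1 / L.Z a (h a) with hlam
  have hl : lam ≠ 0 := one_div_ne_zero (L.Z_ne _ _)
  have hx : xVar lam = xVar (L.Z a (h a)) := xVar_inv _
  have hx' : xVar (lam / L.q) = xVar (L.Z a (h a + 1)) := by
    rw [Z_succ, ← xVar_inv (L.q * _), hlam, div_div, mul_comm]
  -- Both sides are continuous in `mu`, and they agree outside a finite set.
  have hc₁ := L.B_cont i (L.A i lam (φ i)) mu hm
  have hc₂ : ContinuousAt (fun mu => eigenFun L.q L.z (L.lead i) (Function.update h a (h a + 1)) mu •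
      L.A (L.σ i) lam (φ (L.σ i))) mu :=
    (continuousAt_eigenFun _ _ _ _ hm).smul continuousAt_const
  refine (ContinuousAt.eventuallyEq_nhds_iff_eventuallyEq_nhdsNE hc₁ hc₂).1 ?_ |>.self_of_nhds
  have hfin : ({mu : ℂ | mu ≠ 0 ∧ xVar mu = xVar lam} ∪ ({0} ∪
      {L.q * lam, -(L.q * lam)}) : Set ℂ).Finite :=
    (finite_xVar_eq _).union ((Set.finite_singleton _).union (Set.toFinite _))
  have hev : ∀ᶠ x in 𝓝[≠] mu, x ∉ ({mu : ℂ | mu ≠ 0 ∧ xVar mu = xVar lam} ∪ ({0} ∪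
      {L.q * lam, -(L.q * lam)}) : Set ℂ) := by
    have := (hfin.subset Set.sdiff_subset :
      (({mu : ℂ | mu ≠ 0 ∧ xVar mu = xVar lam} ∪ ({0} ∪
        {L.q * lam, -(L.q * lam)})) \ {mu} : Set ℂ).Finite).isClosed.isOpen_compl.mem_nhds
        (x := mu) (by simp)
    filter_upwards [mem_nhdsWithin_of_mem_nhds this, self_mem_nhdsWithin] with x hx hx'
    intro hmem
    exact hx ⟨hmem, hx'⟩
  filter_upwards [hev] with x hxS
  simp only [Set.mem_union, Set.mem_setOf_eq, Set.mem_singleton_iff, Set.mem_insert_iff,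
    not_or, not_and] at hxS
  obtain ⟨h₁, h₀, h₂, h₃⟩ := hxS
  have h₁' : xVar x - xVar lam ≠ 0 := sub_ne_zero.2 (h₁ h₀)
  have h₄ : L.q ^ 2 * lam ^ 2 ≠ x ^ 2 := by
    intro e
    rw [← mul_pow] at e
    rcases sq_eq_sq_iff_eq_or_eq_neg.1 e with e | e
    · exact h₂ e.symm
    · exact h₃ (by rw [e, neg_neg])
  have key := L.B_A i lam (φ i) hl (hφ.kill_inv a i) x h₀ h₄
  rw [hφ i x h₀, map_smul, smul_smul, hx', eigenFun_update, ← hx, ← smul_smul] at key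
  exact smul_right_injective V h₁' key

variable (L)

/-- The state obtained from `ψ` by raising labels in the order given by a word. -/
def state : List (Fin N) → ι → V
  | [] => L.ψ
  | a :: w => fun i => (L.f (1 / L.Z a (w.count a)))⁻¹ •
      L.A i (1 / L.Z a (w.count a)) (state w i)

variable {L}

theorem IsEig.smul {φ : ι → V} {h : Fin N → ℕ} (hφ : L.IsEig φ h) (c : ℂ) :
    L.IsEig (fun i => c • φ i) h := by
  intro i mu hm
  rw [map_smul, hφ i mu hm, smul_comm]

theorem isEig_state [T2Space V] [ContinuousSMul ℂ V] (w : List (Fin N)) :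
    L.IsEig (L.state w) fun a => w.count a := by
  induction w with
  | nil => exact fun i mu hm => L.B_ψ i mu hm
  | cons a w ih =>
    have := (ih.raise a).smul (L.f (1 / L.Z a (w.count a)))⁻¹
    have e : Function.update (fun a => w.count a) a (w.count a + 1) =
        fun b => (a :: w).count b := by
      ext b
      rcases eq_or_ne b a with rfl | h
      · simp
      · rw [Function.update_of_ne h, List.count_cons_of_ne h.symm]
    rw [e] at this
    exact this

theorem raise_state (a : Fin N) (w : List (Fin N)) (i : ι) :
    L.A i (1 / L.Z a (w.count a)) (L.state w i) =
      L.f (1 / L.Z a (w.count a)) • L.state (a :: w) i := by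
  simp only [state]
  rw [smul_inv_smul₀ (f_inv_Z_ne _ _)]

/-- Since `A (q / lam) * A lam` is a number on vectors annihilated by `B lam`, acting with `A` at the
zero undoes the raising of its label. -/
theorem lower_state [T2Space V] [ContinuousSMul ℂ V] (a : Fin N) (w : List (Fin N)) (i : ι) :
    L.A i (L.Z a (w.count a + 1)) (L.state (a :: w) i) =
      L.f (L.Z a (w.count a + 1)) • L.state w i := by
  have h := L.A_q_A i (1 / L.Z a (w.count a)) (L.state w i) (one_div_ne_zero (L.Z_ne _ _))
    (f_inv_Z_ne _ _) ((isEig_state w).kill_inv a i)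
  have e : L.q / (1 / L.Z a (w.count a)) = L.Z a (w.count a + 1) := by
    rw [Z_succ, div_div_eq_mul_div, div_one]
  rw [e] at h
  simp only [state]
  rw [map_smul, h, smul_smul, ← mul_assoc, inv_mul_cancel₀ (f_inv_Z_ne _ _), one_mul]

/-- Lowering all labels leads back to `ψ`, which is not zero. -/
theorem state_ne_zero [T2Space V] [ContinuousSMul ℂ V] (w : List (Fin N)) (i : ι) :
    L.state w i ≠ 0 := by
  induction w with
  | nil => exact L.ψ_ne i
  | cons a w ih =>
    intro h
    have := lower_state (L := L) a w i
    rw [h, map_zero] at this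
    exact (smul_ne_zero (f_Z_ne a _) ih) this.symm

/-- The raising operators of different labels commute on states that both operators `B` annihilate,
so a state depends only on its labels. -/
theorem state_perm [T2Space V] [ContinuousSMul ℂ V] {w w' : List (Fin N)} (h : w.Perm w') :
    L.state w = L.state w' := by
  induction h with
  | nil => rfl
  | cons a h ih =>
    ext i
    simp only [state, ih, h.count_eq]
  | trans _ _ ih₁ ih₂ => exact ih₁.trans ih₂
  | swap a b w =>
    rcases eq_or_ne a b with rfl | hab
    · rfl
    ext i
    simp only [state, map_smul, List.count_cons_of_ne hab, List.count_cons_of_ne hab.symm]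
    rw [smul_comm]
    congr 2
    have ha := L.Z_ne a (w.count a)
    have hb := L.Z_ne b (w.count b)
    refine L.A_A i _ _ _ (one_div_ne_zero hb) (one_div_ne_zero ha) ?_ ?_
      ((isEig_state w).kill_inv b i) ((isEig_state w).kill_inv a i)
    · intro e
      refine hab (L.sep a b (w.count a + 1) (w.count b) ?_).1
      change xVar (L.Z a (w.count a + 1)) = xVar (L.Z b (w.count b))
      have e' : (L.Z a (w.count a + 1)) ^ 2 = (L.Z b (w.count b)) ^ 2 := by
        rw [Z_succ]
        field_simp at e
        linear_combination e
      rw [xVar, xVar, e']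
    · intro e
      refine hab (L.sep a b (w.count a) (w.count b) ?_).1
      change xVar (L.Z a (w.count a)) = xVar (L.Z b (w.count b))
      have e' : (L.Z a (w.count a)) ^ 2 = 1 / (L.Z b (w.count b)) ^ 2 := by
        field_simp at e ⊢
        linear_combination -e
      rw [xVar, xVar, e', one_div_one_div, add_comm]

variable (L)

/-- A word with prescribed multiplicities. -/
def word (h : Fin N → ℕ) : List (Fin N) :=
  (List.finRange N).flatMap fun a => List.replicate (h a) a

/-- The pseudo-eigenvector with labels `h`. -/
def vec (h : Fin N → ℕ) : ι → V := L.state (word h)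

variable {L}

theorem count_word (h : Fin N → ℕ) (a : Fin N) : (word h).count a = h a := by
  rw [word, List.count_flatMap, ← List.ofFn_eq_map, List.sum_ofFn]
  simp [List.count_replicate]

variable [T2Space V] [ContinuousSMul ℂ V]

theorem state_eq_vec {w : List (Fin N)} {h : Fin N → ℕ} (hw : ∀ a, w.count a = h a) :
    L.state w = L.vec h :=
  state_perm (List.perm_iff_count.2 fun a => by rw [hw, count_word])

theorem isEig_vec (h : Fin N → ℕ) : L.IsEig (L.vec h) h := by
  have := isEig_state (L := L) (word h)
  simp only [count_word] at this
  exact this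

theorem vec_ne_zero (h : Fin N → ℕ) (i : ι) : L.vec h i ≠ 0 := state_ne_zero _ _

theorem raise_vec (h : Fin N → ℕ) (a : Fin N) (i : ι) :
    L.A i (1 / L.Z a (h a)) (L.vec h i) =
      L.f (1 / L.Z a (h a)) • L.vec (Function.update h a (h a + 1)) i := by
  have := raise_state (L := L) a (word h) i
  rw [count_word] at this
  rw [vec, this, state_eq_vec (h := Function.update h a (h a + 1))]
  intro b
  rcases eq_or_ne b a with rfl | hb
  · simp [count_word]
  · rw [Function.update_of_ne hb, List.count_cons_of_ne hb.symm, count_word]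

theorem lower_vec (h : Fin N → ℕ) (a : Fin N) (i : ι) :
    L.A i (L.Z a (h a + 1)) (L.vec (Function.update h a (h a + 1)) i) =
      L.f (L.Z a (h a + 1)) • L.vec h i := by
  have := lower_state (L := L) a (word h) i
  rw [count_word] at this
  rw [vec, vec, ← this, ← vec, state_eq_vec (h := Function.update h a (h a + 1))]
  intro b
  rcases eq_or_ne b a with rfl | hb
  · simp [count_word]
  · rw [Function.update_of_ne hb, List.count_cons_of_ne hb.symm, count_word]

theorem natVal_ne_modEq {x y : Fin p} (h : x ≠ y) : ¬ (x : ℕ) ≡ (y : ℕ) [MOD p] := fun e =>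
  h (Fin.ext (Nat.ModEq.eq_of_lt_of_lt e x.2 y.2))

/-- Applying `B` at a zero carried by one label annihilates all states with this label, so that the
terms of a linear relation can be removed one after the other. -/
theorem vec_independent (T : Finset (Config p N)) (i : ι) (c : Config p N → ℂ)
    (h : ∑ g ∈ T, c g • L.vec (fun a => (g a : ℕ)) i = 0) : ∀ g ∈ T, c g = 0 := by
  induction T using Finset.strongInduction generalizing i c with
  | H T ih =>
    intro g hg
    by_cases hT : ∃ k ∈ T, k ≠ g
    · obtain ⟨k, hk, hkg⟩ := hT
      obtain ⟨n, hn⟩ := Function.ne_iff.1 hkg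
      have h' := congrArg (L.B i (L.Z n (k n))) h
      rw [map_zero, map_sum] at h'
      have h'' : ∑ g ∈ T with g n ≠ k n, (c g *
          eigenFun L.q L.z (L.lead i) (fun a => (g a : ℕ)) (L.Z n (k n))) •
            L.vec (fun a => (g a : ℕ)) (L.σ i) = 0 := by
        rw [← h', Finset.sum_filter]
        refine Finset.sum_congr rfl fun g _ => ?_
        rw [map_smul, isEig_vec _ i _ (L.Z_ne _ _), smul_smul]
        split_ifs with hgn
        · rfl
        · rw [not_not] at hgn
          rw [eigenFun_eq_zero n (by rw [hgn]), mul_zero, zero_smul]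
      have := ih _ (Finset.filter_ssubset.2 ⟨k, hk, by simp⟩) (L.σ i) _ h'' g
        (Finset.mem_filter.2 ⟨hg, hn.symm⟩)
      exact (mul_eq_zero.1 this).resolve_right
        (eigenFun_ne_zero i n (natVal_ne_modEq hn.symm))
    · push Not at hT
      rw [Finset.eq_singleton_iff_unique_mem.2 ⟨hg, hT⟩, Finset.sum_singleton] at h
      exact (smul_eq_zero.1 h).resolve_right (vec_ne_zero _ _)

theorem linearIndependent_vec (i : ι) :
    LinearIndependent ℂ fun g : Config p N => L.vec (fun a => (g a : ℕ)) i := by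
  rw [Fintype.linearIndependent_iff]
  exact fun c hc g => vec_independent Finset.univ i c hc g (Finset.mem_univ g)

theorem span_vec [Module.Finite ℂ V] (hV : Module.finrank ℂ V = Fintype.card (Config p N))
    (i : ι) :
    Submodule.span ℂ (Set.range fun g : Config p N => L.vec (fun a => (g a : ℕ)) i) = ⊤ :=
  (linearIndependent_vec i).span_eq_top_of_card_eq_finrank' hV.symm

/-- The pseudo-eigenvectors are determined by their labels up to factors. -/
theorem exists_smul_vec [Module.Finite ℂ V] (hV : Module.finrank ℂ V = Fintype.card (Config p N))
    {φ : ι → V} {g : Config p N} (hφ : L.IsEig φ fun a => (g a : ℕ)) (i : ι) :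
    ∃ c : ℂ, φ i = c • L.vec (fun a => (g a : ℕ)) i := by
  obtain ⟨c, hc⟩ := (Submodule.mem_span_range_iff_exists_fun ℂ).1
    ((span_vec (L := L) hV i).ge (Submodule.mem_top (x := φ i)))
  have hzero : ∀ k, k ≠ g → c k = 0 := by
    intro k hk
    obtain ⟨n, hn⟩ := Function.ne_iff.1 hk
    have h' := hφ i (L.Z n (g n)) (L.Z_ne _ _)
    rw [eigenFun_eq_zero n rfl, zero_smul, ← hc, map_sum] at h'
    have h'' : ∑ k, (c k * eigenFun L.q L.z (L.lead i) (fun a => (k a : ℕ)) (L.Z n (g n))) •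
        L.vec (fun a => (k a : ℕ)) (L.σ i) = 0 := by
      rw [← h']
      refine Finset.sum_congr rfl fun k _ => ?_
      rw [map_smul, isEig_vec _ i _ (L.Z_ne _ _), smul_smul]
    have := vec_independent Finset.univ (L.σ i) _ h'' k (Finset.mem_univ k)
    exact (mul_eq_zero.1 this).resolve_right (eigenFun_ne_zero i n (natVal_ne_modEq hn))
  refine ⟨c g, ?_⟩
  rw [← hc]
  exact Finset.sum_eq_single g (fun k _ hk => by rw [hzero k hk, zero_smul]) (by simp)

variable [NeZero p]

/-- Raising one label `p` times multiplies a state by a number that does not depend on the other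
labels. -/
theorem exists_wrap [Module.Finite ℂ V] (hV : Module.finrank ℂ V = Fintype.card (Config p N))
    (a : Fin N) (i : ι) :
    ∃ t : ℂ, t ≠ 0 ∧ ∀ w : List (Fin N),
      L.state (w ++ List.replicate p a) i = t • L.state w i := by
  have hφ : L.IsEig (L.state (List.replicate p a)) fun b => ((0 : Config p N) b : ℕ) := by
    intro i mu hm
    rw [isEig_state _ i mu hm]
    congr 1
    unfold eigenFun
    congr 1
    refine Finset.prod_congr rfl fun n _ => ?_
    rcases eq_or_ne a n with rfl | h
    · simp [L.q_pow]
    · simp [List.count_replicate, h]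
  obtain ⟨t, ht⟩ := exists_smul_vec hV hφ i
  have h0 : L.vec (fun b => ((0 : Config p N) b : ℕ)) i = L.state [] i := by
    rw [← state_eq_vec (w := []) (by simp)]
  rw [h0] at ht
  refine ⟨t, ?_, fun w => ?_⟩
  · rintro rfl
    rw [zero_smul] at ht
    exact state_ne_zero _ _ ht
  · induction w with
    | nil => exact ht
    | cons b w ih =>
      have hZ : L.Z b ((w ++ List.replicate p a).count b) = L.Z b (w.count b) := by
        rw [List.count_append]
        rcases eq_or_ne a b with rfl | h
        · rw [List.count_replicate_self, Z_add]
        · rw [List.count_replicate, if_neg (by simpa using h), add_zero]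
      simp only [List.cons_append, state, hZ, ih, map_smul]
      rw [smul_comm]

theorem raise_config {t : Fin N → ℂ} {i : ι}
    (ht : ∀ (a : Fin N) (w : List (Fin N)), L.state (w ++ List.replicate p a) i = t a • L.state w i)
    (h : Config p N) (a : Fin N) :
    L.A i (1 / L.Z a (h a)) (L.vec (fun b => (h b : ℕ)) i) =
      (L.f (1 / L.Z a (h a)) * raiseFactor t h a) • L.vec (fun b => (raise h a b : ℕ)) i := by
  rw [raise_vec (fun b => (h b : ℕ)) a i, mul_smul]
  congr 1
  have hlt := (h a).2
  unfold raiseFactor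
  split_ifs with hc
  · rw [one_smul]
    congr 1
    ext b
    rcases eq_or_ne b a with rfl | hb
    · rw [Function.update_self, raise, Function.update_self, Fin.val_add, Fin.val_one',
        Nat.add_mod_mod, Nat.mod_eq_of_lt hc]
    · rw [Function.update_of_ne hb, raise, Function.update_of_ne hb]
  · have hp : (h a : ℕ) + 1 = p := by omega
    rw [vec, vec, ← ht a, ← vec]
    refine (congrFun (state_eq_vec fun b => ?_) i).symm
    rw [List.count_append, count_word]
    rcases eq_or_ne b a with rfl | hb
    · rw [Function.update_self, raise, Function.update_self, Fin.val_add, Fin.val_one',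
        Nat.add_mod_mod, hp, Nat.mod_self, List.count_replicate_self, zero_add]
    · rw [Function.update_of_ne hb, raise, Function.update_of_ne hb, List.count_replicate,
        if_neg (by simpa using hb.symm), add_zero]

theorem lower_config {t : Fin N → ℂ} {i : ι} (ht0 : ∀ a, t a ≠ 0)
    (ht : ∀ (a : Fin N) (w : List (Fin N)), L.state (w ++ List.replicate p a) i = t a • L.state w i)
    (h : Config p N) (a : Fin N) :
    L.A i (L.Z a (h a)) (L.vec (fun b => (h b : ℕ)) i) =
      (L.f (L.Z a (h a)) * lowerFactor t h a) • L.vec (fun b => (lower h a b : ℕ)) i := by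
  set h' : Fin N → ℕ := fun b => (lower h a b : ℕ) with hh'
  have hlow := lower_vec (L := L) h' a i
  have hsub : ((h a - 1 + 1 : Fin p) : ℕ) = (h a : ℕ) := by rw [sub_add_cancel]
  rw [Fin.val_add, Fin.val_one', Nat.add_mod_mod] at hsub
  have hla : h' a = ((h a - 1 : Fin p) : ℕ) := by rw [hh']; simp [lower]
  rw [← hla] at hsub
  have hlt : h' a < p := by rw [hla]; exact Fin.is_lt _
  unfold lowerFactor
  split_ifs with hc
  · have hp : h' a + 1 < p := by
      by_contra hcon
      have : h' a + 1 = p := by omega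
      rw [this, Nat.mod_self] at hsub
      omega
    rw [Nat.mod_eq_of_lt hp] at hsub
    have e : Function.update h' a (h' a + 1) = fun b => (h b : ℕ) := by
      ext b
      rcases eq_or_ne b a with rfl | hb
      · rw [Function.update_self, hsub]
      · rw [Function.update_of_ne hb, hh']
        simp [lower, Function.update_of_ne hb]
    rw [e, hsub] at hlow
    rw [hlow, mul_one]
  · have h0 : (h a : ℕ) = 0 := by omega
    have hp : h' a + 1 = p := by
      by_contra hcon
      rw [Nat.mod_eq_of_lt (by omega)] at hsub
      omega
    have e : L.vec (Function.update h' a (h' a + 1)) i =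
        t a • L.vec (fun b => (h b : ℕ)) i := by
      rw [vec, vec, ← ht a, ← vec]
      refine (congrFun (state_eq_vec fun b => ?_) i).symm
      rw [List.count_append, count_word]
      rcases eq_or_ne b a with rfl | hb
      · rw [Function.update_self, hp, h0, List.count_replicate_self, zero_add]
      · rw [Function.update_of_ne hb, hh', List.count_replicate, if_neg (by simpa using hb.symm)]
        simp [lower, Function.update_of_ne hb]
    have hZ : L.Z a (h' a + 1) = L.Z a (h a) := by
      rw [h0, show h' a + 1 = 0 + p by omega, Z_add]
    rw [e, hZ, map_smul] at hlow
    rw [mul_comm, mul_smul, ← hlow, inv_smul_smul₀ (ht0 a)]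

end Ladder

end LadderTheory

end

end CyclicReflection

namespace CyclicReflection

noncomputable section

/-! ### The ladders of the gauged operators -/

section RowLadder

variable {p N : ℕ} [NeZero p] {s : ℂ}

/-- The ladder of row vectors of a solution `U` of the reflection equation, with gauge parameters
`b i`. The action is from the right, so that a relation `B_lam Z` is annihilated by the rows that
are annihilated by `B_lam`. -/
def rowLadder {ι : Type*} (U : ℂ → AuxOp p N) (α : ℂ) (b cB : ι → ℂ) (σ : ι → ι) (f : ℂ → ℂ)
    (z : Fin N → ℂ) (lead : ι → ℂ) (ψ : ι → State p N)
    (hs : s ≠ 0) (hsp : (s ^ 2) ^ p = 1) (hα : α ≠ 0) (hb : ∀ i, b i ≠ 0)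
    (hσ : ∀ i, b (σ i) = b i / s ^ 4)
    (hb1 : ∀ i, b i - 1 / b i ≠ 0) (hb2 : ∀ i, b i - s ^ 4 / b i ≠ 0) (hcB : ∀ i, cB i ≠ 0)
    (hz : ∀ n, z n ≠ 0) (hlead : ∀ i, lead i ≠ 0) (hψ : ∀ i, ψ i ≠ 0)
    (sep : ∀ n m k l, xVar (z n * (s ^ 2) ^ k) = xVar (z m * (s ^ 2) ^ l) → n = m ∧ k ≡ l [MOD p])
    (nondeg : ∀ n k, (z n * (s ^ 2) ^ k) ^ 4 ≠ (s ^ 2) ^ 2)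
    (f_ne : ∀ n k, f (z n * (s ^ 2) ^ k) ≠ 0) (f_inv_ne : ∀ n k, f (1 / (z n * (s ^ 2) ^ k)) ≠ 0)
    (hcont : ∀ i g h mu, mu ≠ 0 →
      ContinuousAt (fun mu => gauged s α mu (b i) (b i) (U mu) g h) mu)
    (hRE : ∀ lam mu, lam ≠ 0 → mu ≠ 0 → ReflectionEq (s ^ 2) lam mu (U lam) (U mu))
    (hU : ∀ lam, lam ≠ 0 → f lam ≠ 0 →
      U lam * U (s ^ 2 / lam) = algebraMap ℂ _ (f lam * f (s ^ 2 / lam)))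
    (hBψ : ∀ i mu, mu ≠ 0 → Matrix.vecMul (ψ i) (cB i • gauged s α mu (b i) (b i) (U mu)) =
      eigenFun (s ^ 2) z (lead i) 0 mu • ψ (σ i)) :
    Ladder p N ι (State p N) where
  q := s ^ 2
  σ := σ
  B i mu := (cB i • gauged s α mu (b i) (b i) (U mu)).vecMulLinear
  A i lam := ((b i - 1 / b i)⁻¹ • gauged s α lam (b i) (1 / b i) (U lam)).vecMulLinear
  f := f
  z := z
  lead := lead
  ψ := ψ
  q_ne := pow_ne_zero _ hs
  q_pow := hsp
  z_ne := hz
  lead_ne := hlead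
  ψ_ne := hψ
  sep := sep
  nondeg := nondeg
  f_ne := f_ne
  f_inv_ne := f_inv_ne
  B_cont i v mu hm := by
    simp only [Matrix.vecMulLinear_apply]
    refine continuousAt_pi.2 fun g => ?_
    simp only [Matrix.vecMul, dotProduct, Matrix.smul_apply, smul_eq_mul]
    exact tendsto_finsetSum _ fun h _ =>
      continuousAt_const.mul (continuousAt_const.mul (hcont i h g mu hm))
  B_A i lam v hl hv mu hm hne := by
    simp only [Matrix.vecMulLinear_apply, Matrix.vecMul_smul, smul_eq_zero, hcB i, false_or,
      Matrix.smul_vecMul, Matrix.vecMul_vecMul] at hv ⊢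
    have h₁ : s ^ 4 * lam ^ 2 - mu ^ 2 ≠ 0 := by
      rw [sub_ne_zero]
      convert hne using 2
      ring
    obtain ⟨Z, hZ⟩ := (hRE lam mu hl hm).gauged_exchange hs hα (hb i) hl hm h₁
    have key := congrArg (Matrix.vecMul v) hZ
    rw [← Matrix.vecMul_vecMul, hv, Matrix.zero_vecMul, Matrix.vecMul_sub, sub_eq_zero,
      Matrix.vecMul_smul, Matrix.vecMul_smul] at key
    have hbi := hb i
    have e₁ : b i - s ^ 8 / b i ≠ 0 := by
      have := hb1 (σ i)
      rw [hσ] at this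
      intro e
      apply this
      field_simp at e ⊢
      linear_combination e
    have e₂ : (b i / s ^ 4 - 1 / (b i / s ^ 4))⁻¹ = s ^ 4 * (b i - s ^ 8 / b i)⁻¹ := by
      rw [← inv_inv (s ^ 4), ← mul_inv]
      congr 1
      field_simp
    have e₃ : (1 : ℂ) / (b i / s ^ 4) = s ^ 4 / b i := one_div_div _ _
    have e₄ : xVar (lam / s ^ 2) = s ^ 4 / lam ^ 2 + lam ^ 2 / s ^ 4 := by
      unfold xVar
      field_simp
      ring
    rw [hσ, e₂, e₃, e₄]
    have hb1' := hb1 i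
    have e₅ := congrArg (fun x => ((b i - 1 / b i)⁻¹ * (b i - s ^ 8 / b i)⁻¹ * cB i) • x) key
    simp only [smul_smul] at e₅ ⊢
    unfold xVar
    generalize b i - 1 / b i = d at *
    generalize b i - s ^ 8 / b i = d' at *
    convert e₅ using 2
    · field_simp
    · field_simp
  A_A i lam mu v hl hm hne hne' hv hv' := by
    simp only [Matrix.vecMulLinear_apply, Matrix.vecMul_smul, smul_eq_zero, hcB i, false_or,
      Matrix.smul_vecMul, Matrix.vecMul_vecMul] at hv hv' ⊢
    have h₁ : s ^ 4 * lam ^ 2 - mu ^ 2 ≠ 0 := by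
      rw [sub_ne_zero]
      convert hne using 2
      ring
    obtain ⟨Z₁, Z₂, hZ⟩ := (hRE lam mu hl hm).gauged_comm_mod hs hα (hb i) hl hm h₁
    have key := congrArg (Matrix.vecMul v) hZ
    rw [Matrix.vecMul_add, ← Matrix.vecMul_vecMul, ← Matrix.vecMul_vecMul, hv, hv',
      Matrix.zero_vecMul, Matrix.zero_vecMul, add_zero, Matrix.vecMul_smul, smul_eq_zero,
      Matrix.vecMul_sub, sub_eq_zero] at key
    rw [key.resolve_left (mul_ne_zero (hb2 i) (sub_ne_zero.2 hne'))]
  A_q_A i lam v hl hf hv := by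
    simp only [Matrix.vecMulLinear_apply, Matrix.vecMul_smul, smul_eq_zero, hcB i, false_or,
      Matrix.smul_vecMul, Matrix.vecMul_vecMul] at hv ⊢
    have hq : s ^ 2 ≠ 0 := pow_ne_zero _ hs
    have hl' : s ^ 2 / lam ≠ 0 := div_ne_zero hq hl
    have e₁ : s ^ 2 / (s ^ 2 / lam) = lam := by field_simp
    have h := hU lam hl hf
    nth_rw 1 [← e₁] at h
    have h₂ := gauged_unitarity (x := b i) (y := 1 / b i) (x' := b i) (y' := 1 / b i) h hs hα hl'
    rw [e₁] at h₂
    have key := congrArg (Matrix.vecMul v) h₂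
    rw [Matrix.vecMul_sub, ← Matrix.vecMul_vecMul v (gauged s α lam (b i) (b i) (U lam)), hv,
      Matrix.zero_vecMul, sub_zero] at key
    rw [key, Algebra.algebraMap_eq_smul_one, Matrix.vecMul_smul, Matrix.vecMul_one, smul_smul,
      smul_smul]
    congr 1
    have hb1' := hb1 i
    generalize b i - 1 / b i = d at *
    field_simp
  B_ψ i mu hm := by
    rw [Matrix.vecMulLinear_apply]
    exact hBψ i mu hm

end RowLadder

end

end CyclicReflection

namespace CyclicReflection

noncomputable section

/-! ### Coefficients of the gauged operators and existence of pseudo-eigenvectors -/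

section Existence

open Polynomial

variable {p N : ℕ} [NeZero p] {s : ℂ}

theorem gaugedB_eq (P : Params N) (lam bt : ℂ) : (gaugedB s P lam bt : Op p N) =
    (bt - 1 / bt)⁻¹ • gauged s P.gaugeAlpha lam bt bt (boundaryMonodromy s P lam) := by
  rw [gaugedB, gauged, ← sq]

theorem gaugedA_eq (hs : s ≠ 0) (P : Params N) (lam : ℂ) {bt : ℂ} (hb : bt ≠ 0) :
    (gaugedA s P lam (bt * (s ^ 2) ^ 2) : Op p N) =
      (bt - 1 / bt)⁻¹ •
        gauged s P.gaugeAlpha lam bt (1 / bt) (boundaryMonodromy s P lam) := by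
  have e₁ : bt * (s ^ 2) ^ 2 / (s ^ 2) ^ 2 - (s ^ 2) ^ 2 / (bt * (s ^ 2) ^ 2) = bt - 1 / bt := by
    field_simp
  have e₂ : lam * s ^ 3 / (bt * (s ^ 2) ^ 2) = lam * (1 / bt) / s := by field_simp
  have e₃ : bt * (s ^ 2) ^ 2 / (lam * s ^ 3) = bt * s / lam := by
    rcases eq_or_ne lam 0 with rfl | hl
    · simp
    · field_simp
  have e₄ : bt * (1 / bt) = 1 := by field_simp
  rw [gaugedA, gauged, e₁, e₂, e₃, e₄]

theorem gaugedD_eq (P : Params N) (lam : ℂ) {bt : ℂ} (hb : bt ≠ 0) :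
    (gaugedD s P lam bt : Op p N) =
      -((bt - 1 / bt)⁻¹ •
        gauged s P.gaugeAlpha lam (1 / bt) bt (boundaryMonodromy s P lam)) := by
  have e₃ : (1 / bt) * s / lam = s / (lam * bt) := by
    rcases eq_or_ne lam 0 with rfl | hl
    · simp
    · field_simp
  have e₄ : (1 / bt) * bt = 1 := by field_simp
  rw [gaugedD, gauged, e₃, e₄, ← smul_neg]
  congr 1
  rw [neg_smul]
  abel

theorem gaugedB_entry_eq (hs : s ≠ 0) (hsp : (s ^ 2) ^ p = 1) {P : Params N} (hP : P.Regular)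
    (bt : ℂ) (g h : Config p N) :
    ∃ Q : ℂ[X], Q.natDegree ≤ N ∧ ∀ lam : ℂ, lam ≠ 0 →
      (gaugedB s P lam bt : Op p N) g h =
        (lam ^ 2 / s ^ 2 - s ^ 2 / lam ^ 2) * Q.eval (xVar lam) := by
  obtain ⟨Q, hQ, hQe⟩ := exists_poly_gauged_self (p := p) hs hsp hP
    ((bt - 1 / bt)⁻¹ • Matrix.entryLinearMap ℂ ℂ g h) P.gaugeAlpha bt
  refine ⟨Q, hQ, fun lam hl => ?_⟩
  rw [xVar, ← hQe lam hl, gaugedB_eq]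
  simp

/-- Sample points of the spectral parameter. -/
def node (i : ℕ) : ℂ := ((i + 2 : ℕ) : ℂ)

theorem node_ne_zero (i : ℕ) : node i ≠ 0 := by
  unfold node
  exact_mod_cast Nat.succ_ne_zero (i + 1)

theorem norm_node (i : ℕ) : ‖node i‖ = i + 2 := by
  rw [node, Complex.norm_natCast]
  push_cast
  ring

theorem xVar_eq_iff {lam mu : ℂ} (hl : lam ≠ 0) (hm : mu ≠ 0) :
    xVar lam = xVar mu ↔ lam ^ 2 = mu ^ 2 ∨ lam ^ 2 * mu ^ 2 = 1 := by
  have : (lam ^ 2 - mu ^ 2) * (lam ^ 2 * mu ^ 2 - 1) =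
      (xVar lam - xVar mu) * (lam ^ 2 * mu ^ 2) := by
    unfold xVar
    field_simp
    ring
  rw [← sub_eq_zero, ← sub_eq_zero (a := lam ^ 2), ← sub_eq_zero (a := lam ^ 2 * mu ^ 2),
    ← mul_eq_zero, this, mul_eq_zero]
  simp [hl, hm]

theorem injOn_xVar_node (S : Set ℕ) : S.InjOn fun i => xVar (node i) := by
  intro i _ j _ h
  rcases (xVar_eq_iff (node_ne_zero i) (node_ne_zero j)).1 h with h | h
  · have := congrArg (‖·‖) h
    simp only [norm_pow, norm_node] at this
    have h' := (pow_left_inj₀ (by positivity) (by positivity) two_ne_zero).1 this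
    exact_mod_cast add_right_cancel h'
  · have := congrArg (‖·‖) h
    simp only [norm_mul, norm_pow, norm_node, norm_one] at this
    have hi : (0 : ℝ) ≤ i := Nat.cast_nonneg i
    have hj : (0 : ℝ) ≤ j := Nat.cast_nonneg j
    nlinarith [mul_nonneg hi hj, sq_nonneg ((i : ℝ) * j), mul_nonneg (mul_nonneg hi hj) hi,
      mul_nonneg (mul_nonneg hi hj) hj]

theorem node_factor_ne_zero (hs : ‖s‖ = 1) (i : ℕ) :
    node i ^ 2 / s ^ 2 - s ^ 2 / node i ^ 2 ≠ 0 := by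
  have hs0 : s ≠ 0 := fun h => by simp [h] at hs
  have hi := node_ne_zero i
  intro h
  have h' : node i ^ 4 = s ^ 4 := by
    field_simp at h
    linear_combination h
  have := congrArg (‖·‖) h'
  simp only [norm_pow, norm_node, hs] at this
  have h0 : (0 : ℝ) ≤ i := Nat.cast_nonneg i
  have : ((i : ℝ) + 2) ^ 4 > 1 ^ 4 := pow_lt_pow_left₀ (by linarith) (by norm_num) (by norm_num)
  linarith

/-- The coefficient of `(lam² + 1 / lam²) ^ k` in `ℬ_-(lam|bt) / (lam² / q - q / lam²)`, obtained by
Lagrange interpolation from the sample points. -/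
def bCoeff (s : ℂ) (P : Params N) (bt : ℂ) (k : ℕ) : Op p N :=
  ∑ i ∈ Finset.range (N + 1),
    ((Lagrange.basis (Finset.range (N + 1)) (fun i => xVar (node i)) i).coeff k *
      (node i ^ 2 / s ^ 2 - s ^ 2 / node i ^ 2)⁻¹) • gaugedB s P (node i) bt

theorem bCoeff_apply (hs : ‖s‖ = 1) {P : Params N} {bt : ℂ} {g h : Config p N} {Q : ℂ[X]}
    (hQ : Q.natDegree ≤ N)
    (hQe : ∀ i, (gaugedB s P (node i) bt : Op p N) g h =
      (node i ^ 2 / s ^ 2 - s ^ 2 / node i ^ 2) * Q.eval (xVar (node i))) (k : ℕ) :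
    (bCoeff s P bt k : Op p N) g h = Q.coeff k := by
  have hd : Q.degree < (Finset.range (N + 1)).card := by
    rw [Finset.card_range]
    exact degree_le_natDegree.trans_lt (by exact_mod_cast Nat.lt_succ_of_le hQ)
  rw [Lagrange.eq_interpolate (injOn_xVar_node _) hd, Lagrange.interpolate_apply, finsetSum_coeff,
    bCoeff, Matrix.sum_apply]
  refine Finset.sum_congr rfl fun i _ => ?_
  have := node_factor_ne_zero hs i
  rw [coeff_C_mul, Matrix.smul_apply, hQe, smul_eq_mul]
  generalize node i ^ 2 / s ^ 2 - s ^ 2 / node i ^ 2 = d at *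
  field_simp

theorem norm_ne_zero_of_norm_one (hs : ‖s‖ = 1) : s ≠ 0 := fun h => by simp [h] at hs

theorem gaugedB_eq_sum (hs : ‖s‖ = 1) (hsp : (s ^ 2) ^ p = 1) {P : Params N} (hP : P.Regular)
    (bt : ℂ) {lam : ℂ} (hl : lam ≠ 0) :
    (gaugedB s P lam bt : Op p N) = (lam ^ 2 / s ^ 2 - s ^ 2 / lam ^ 2) •
      ∑ k ∈ Finset.range (N + 1), xVar lam ^ k • bCoeff s P bt k := by
  ext g h
  obtain ⟨Q, hQ, hQe⟩ := gaugedB_entry_eq (norm_ne_zero_of_norm_one hs) hsp hP bt g h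
  rw [hQe lam hl, Matrix.smul_apply, Matrix.sum_apply, smul_eq_mul]
  congr 1
  rw [eval_eq_sum_range' (Nat.lt_succ_of_le hQ)]
  refine Finset.sum_congr rfl fun k _ => ?_
  rw [Matrix.smul_apply, bCoeff_apply hs hQ (fun i => hQe _ (node_ne_zero i)), smul_eq_mul,
    mul_comm]

theorem gaugedB_node_comm (hs : ‖s‖ = 1) (hsp : (s ^ 2) ^ p = 1) {P : Params N} (hP : P.Regular)
    (bt : ℂ) (i j : ℕ) :
    (gaugedB s P (node i) (bt * s ^ 4) * gaugedB s P (node j) bt : Op p N) =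
      gaugedB s P (node j) (bt * s ^ 4) * gaugedB s P (node i) bt := by
  rcases eq_or_ne i j with rfl | hij
  · rfl
  have hs0 := norm_ne_zero_of_norm_one hs
  have hi : (0 : ℝ) ≤ i := Nat.cast_nonneg i
  have hj : (0 : ℝ) ≤ j := Nat.cast_nonneg j
  have h₁ : s ^ 4 * node i ^ 2 - node j ^ 2 ≠ 0 := by
    intro h
    have := congrArg (‖·‖) (sub_eq_zero.1 h)
    simp only [norm_mul, norm_pow, norm_node, hs, one_pow, one_mul] at this
    have h' := (pow_left_inj₀ (by positivity) (by positivity) two_ne_zero).1 this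
    exact hij (by exact_mod_cast add_right_cancel h')
  have h₂ : node i ^ 2 * node j ^ 2 - s ^ 4 ≠ 0 := by
    intro h
    have := congrArg (‖·‖) (sub_eq_zero.1 h)
    simp only [norm_mul, norm_pow, norm_node, hs, one_pow] at this
    nlinarith [mul_nonneg hi hj, sq_nonneg ((i : ℝ) * j), mul_nonneg (mul_nonneg hi hj) hi,
      mul_nonneg (mul_nonneg hi hj) hj]
  have key := (reflectionEq_boundaryMonodromy (p := p) hs0 hsp hP (node_ne_zero i)
    (node_ne_zero j)).gauged_comm (β := bt * s ^ 4) hs0 hP.gaugeAlpha (node_ne_zero i)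
    (node_ne_zero j) h₁ h₂
  rw [mul_div_cancel_right₀ _ (pow_ne_zero 4 hs0)] at key
  simp only [gaugedB_eq, smul_mul_smul_comm, key]

/-- Equality of the coefficients in the commutation relation of the `ℬ_-`. -/
theorem bCoeff_comm (hs : ‖s‖ = 1) (hsp : (s ^ 2) ^ p = 1) {P : Params N} (hP : P.Regular)
    (bt : ℂ) (k l : ℕ) :
    (bCoeff s P (bt * s ^ 4) k * bCoeff s P bt l : Op p N) =
      bCoeff s P (bt * s ^ 4) l * bCoeff s P bt k := by
  simp only [bCoeff, Finset.sum_mul_sum, smul_mul_smul_comm]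
  rw [Finset.sum_comm]
  refine Finset.sum_congr rfl fun i _ => Finset.sum_congr rfl fun j _ => ?_
  rw [gaugedB_node_comm hs hsp hP bt j i, mul_comm]

/-- Finitely many commuting endomorphisms of a nonzero space have a common eigenvector. -/
theorem exists_common_eigenvector {W : Type*} [AddCommGroup W] [Module ℂ W] [Module.Finite ℂ W]
    [Nontrivial W] (T : ℕ → W →ₗ[ℂ] W) (hT : ∀ k l w, T k (T l w) = T l (T k w)) (n : ℕ) :
    ∃ E : Submodule ℂ W, E ≠ ⊥ ∧ (∀ k, ∀ w ∈ E, T k w ∈ E) ∧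
      ∀ k < n, ∃ c : ℂ, ∀ w ∈ E, T k w = c • w := by
  induction n with
  | zero => exact ⟨⊤, top_ne_bot, by simp, by simp⟩
  | succ n ih =>
    obtain ⟨E, hE, hinv, hev⟩ := ih
    haveI : Nontrivial E := (Submodule.nontrivial_iff_ne_bot).2 hE
    obtain ⟨c, hc⟩ := Module.End.exists_eigenvalue ((T n).restrict (hinv n))
    obtain ⟨v, hv⟩ := hc.exists_hasEigenvector
    refine ⟨E ⊓ LinearMap.ker (T n - c • LinearMap.id), ?_, ?_, ?_⟩
    · rw [Submodule.ne_bot_iff]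
      refine ⟨v, ⟨v.2, ?_⟩, ?_⟩
      · have := congrArg Subtype.val hv.apply_eq_smul
        simpa [LinearMap.mem_ker, sub_eq_zero] using this
      · simpa using hv.2
    · rintro k w ⟨hw, hw'⟩
      refine ⟨hinv k w hw, ?_⟩
      simp only [SetLike.mem_coe, LinearMap.mem_ker, LinearMap.sub_apply, LinearMap.smul_apply,
        LinearMap.id_apply, sub_eq_zero] at hw' ⊢
      rw [hT, hw', map_smul]
    · intro k hk
      rcases (Nat.lt_succ_iff_lt_or_eq.1 hk) with hk | rfl
      · obtain ⟨d, hd⟩ := hev k hk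
        exact ⟨d, fun w hw => hd w hw.1⟩
      · refine ⟨c, fun w hw => ?_⟩
        have := hw.2
        simpa [LinearMap.mem_ker, sub_eq_zero] using this

theorem mul_mem_gaugeOrbit (hs : s ≠ 0) {b0 bt : ℂ} (h : bt ∈ gaugeOrbit s b0) :
    bt * s ^ 4 ∈ gaugeOrbit s b0 := by
  obtain ⟨k, rfl⟩ := h
  refine ⟨k + 1, ?_⟩
  rw [mul_add, zpow_add₀ (pow_ne_zero _ hs), mul_one, mul_right_comm, mul_assoc, mul_assoc]
  congr 2
  rw [show (2 : ℤ) = ((2 : ℕ) : ℤ) from rfl, zpow_natCast]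
  ring

theorem div_mem_gaugeOrbit (hs : s ≠ 0) {b0 bt : ℂ} (h : bt ∈ gaugeOrbit s b0) :
    bt / s ^ 4 ∈ gaugeOrbit s b0 := by
  obtain ⟨k, rfl⟩ := h
  refine ⟨k - 1, ?_⟩
  rw [mul_sub, zpow_sub₀ (pow_ne_zero _ hs), mul_one, div_mul_eq_mul_div]
  congr 1
  rw [show (2 : ℤ) = ((2 : ℕ) : ℤ) from rfl, zpow_natCast]
  ring

theorem self_mem_gaugeOrbit (s b0 : ℂ) : b0 ∈ gaugeOrbit s b0 := ⟨0, by simp⟩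

theorem gaugeOrbit_induction (hs : s ≠ 0) {b0 : ℂ} {C : ℂ → Prop} (h0 : C b0)
    (h : ∀ bt ∈ gaugeOrbit s b0, C bt ↔ C (bt * s ^ 4)) : ∀ bt ∈ gaugeOrbit s b0, C bt := by
  rintro bt ⟨k, rfl⟩
  have hq : s ^ 2 ≠ 0 := pow_ne_zero _ hs
  have e : ∀ k : ℤ, (s ^ 2) ^ (2 * (k + 1)) * b0 = (s ^ 2) ^ (2 * k) * b0 * s ^ 4 := by
    intro k
    have e₂ : (s ^ 2) ^ (2 : ℤ) = s ^ 4 := by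
      rw [show (2 : ℤ) = ((2 : ℕ) : ℤ) from rfl, zpow_natCast]
      ring
    rw [mul_add, zpow_add₀ hq, mul_one, e₂]
    ring
  induction k with
  | zero => simpa using h0
  | succ k ih =>
    rw [e]
    exact (h _ ⟨_, rfl⟩).1 ih
  | pred k ih =>
    rw [h _ ⟨_, rfl⟩, ← e, sub_add_cancel]
    exact ih

theorem finite_gaugeOrbit (hs : s ≠ 0) (hsp : (s ^ 2) ^ p = 1) (b0 : ℂ) :
    (gaugeOrbit s b0).Finite := by
  have : gaugeOrbit s b0 ⊆ (fun k : ℕ => (s ^ 2) ^ k * b0) '' (Finset.range p : Set ℕ) := by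
    rintro bt ⟨k, rfl⟩
    have hp : (0 : ℤ) < p := by exact_mod_cast NeZero.pos p
    have h0 := Int.emod_nonneg (2 * k) hp.ne'
    have h1 := Int.emod_lt_of_pos (2 * k) hp
    refine ⟨((2 * k) % p).toNat, by simp; omega, ?_⟩
    have hq : s ^ 2 ≠ 0 := pow_ne_zero _ hs
    have : (s ^ 2) ^ (2 * k) = (s ^ 2) ^ ((2 * k) % (p : ℤ)) := by
      conv_lhs => rw [← Int.emod_add_mul_ediv (2 * k) p, zpow_add₀ hq, zpow_mul, zpow_natCast, hsp,
        one_zpow, mul_one]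
    simp only [this]
    congr 1
    rw [← zpow_natCast, Int.toNat_of_nonneg h0]
  exact ((Finset.finite_toSet _).image _).subset this

theorem exists_xVar_eq (x : ℂ) : ∃ z : ℂ, z ≠ 0 ∧ xVar z = x := by
  obtain ⟨d, hd⟩ := exists_sq_eq (x ^ 2 - 4)
  obtain ⟨z, hz⟩ := exists_sq_eq ((x + d) / 2)
  have h : z ^ 2 * ((x - d) / 2) = 1 := by
    rw [hz]
    linear_combination -(1 / 4) * hd
  have hz0 : z ≠ 0 := by
    rintro rfl
    simp at h
  refine ⟨z, hz0, ?_⟩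
  have h2 : 1 / z ^ 2 = (x - d) / 2 := by
    rw [← h, mul_comm, mul_div_cancel_right₀ _ (pow_ne_zero 2 hz0)]
  rw [xVar, h2, hz]
  ring

/-- Existence of pseudo-eigenvectors: a common eigenvector of the coefficients, which act on families
of states over the orbit of the gauge parameter. Their leading coefficients being invertible, no
member of the family vanishes, and the pseudo-eigenvalue has `N` zeros. -/
theorem exists_pseudo_eigenvector (hs : ‖s‖ = 1) (hsp : (s ^ 2) ^ p = 1) {P : Params N}
    (hP : P.Regular)
    (hdet : ∀ bt ∈ gaugeOrbit s P.gaugeBeta, (bCoeff s P bt N : Op p N).det ≠ 0) :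
    ∃ (ℓ : ℂ) (z : Fin N → ℂ) (ψ : ℂ → State p N), ℓ ≠ 0 ∧ (∀ n, z n ≠ 0) ∧
      ∀ bt ∈ gaugeOrbit s P.gaugeBeta, ψ bt ≠ 0 ∧
        (∀ k ≤ N, Matrix.mulVec (bCoeff s P bt k) (ψ bt) =
          (C ℓ * ∏ n, (X - C (xVar (z n)))).coeff k • ψ (bt * s ^ 4)) ∧
        ∀ mu, mu ≠ 0 → Matrix.mulVec (gaugedB s P mu bt) (ψ bt) =
          eigenFun (s ^ 2) z ℓ 0 mu • ψ (bt * s ^ 4) := by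
  classical
  have hs0 := norm_ne_zero_of_norm_one hs
  set O := gaugeOrbit s P.gaugeBeta with hO
  have hfin : Finite O := (finite_gaugeOrbit (p := p) hs0 hsp P.gaugeBeta)
  let pred : O → O := fun i => ⟨i / s ^ 4, div_mem_gaugeOrbit hs0 i.2⟩
  let succ : O → O := fun i => ⟨i * s ^ 4, mul_mem_gaugeOrbit hs0 i.2⟩
  have hps : ∀ i, pred (succ i) = i := fun i => Subtype.ext (by
    simp only [pred, succ]
    exact mul_div_cancel_right₀ _ (pow_ne_zero 4 hs0))
  let T : ℕ → (O → State p N) →ₗ[ℂ] (O → State p N) := fun k =>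
    { toFun := fun Ψ i => Matrix.mulVec (bCoeff s P (pred i) k) (Ψ (pred i))
      map_add' := fun Ψ Φ => by
        ext i : 1
        simp [Matrix.mulVec_add]
      map_smul' := fun c Ψ => by
        ext i : 1
        simp [Matrix.mulVec_smul] }
  have hT : ∀ k l w, T k (T l w) = T l (T k w) := by
    intro k l w
    ext i : 1
    simp only [T, LinearMap.coe_mk, AddHom.coe_mk, Matrix.mulVec_mulVec]
    have e : (pred i : ℂ) = (pred (pred i) : ℂ) * s ^ 4 :=
      (div_mul_cancel₀ _ (pow_ne_zero 4 hs0)).symm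
    rw [e, bCoeff_comm hs hsp hP]
  haveI : Nonempty O := ⟨⟨_, self_mem_gaugeOrbit s _⟩⟩
  obtain ⟨E, hE, -, hev⟩ := exists_common_eigenvector T hT (N + 1)
  obtain ⟨Ψ, hΨ, hΨ0⟩ := (Submodule.ne_bot_iff _).1 hE
  choose! c hc using hev
  have hev : ∀ k ≤ N, ∀ i : O,
      Matrix.mulVec (bCoeff s P i k) (Ψ i) = c k • Ψ (succ i) := by
    intro k hk i
    have := congrFun (hc k (Nat.lt_succ_of_le hk) Ψ hΨ) (succ i)
    simp only [T, LinearMap.coe_mk, AddHom.coe_mk, hps, Pi.smul_apply] at this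
    exact this
  have hinj : ∀ i : O, ∀ v : State p N, Matrix.mulVec (bCoeff s P i N) v = 0 → v = 0 := by
    intro i v hv
    by_contra h
    exact hdet i i.2 (Matrix.exists_mulVec_eq_zero_iff.1 ⟨v, h, hv⟩)
  have hcN : c N ≠ 0 := by
    intro h
    refine hΨ0 (funext fun i => hinj i _ ?_)
    rw [hev N le_rfl, h, zero_smul]
  have hstep : ∀ i : O, Ψ i = 0 ↔ Ψ (succ i) = 0 := by
    intro i
    constructor
    · intro h
      have := hev N le_rfl i
      rw [h, Matrix.mulVec_zero] at this
      exact (smul_eq_zero.1 this.symm).resolve_left hcN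
    · intro h
      exact hinj i _ (by rw [hev N le_rfl, h, smul_zero])
  -- The family over the orbit, extended by zero.
  let ψ : ℂ → State p N := fun bt => if h : bt ∈ O then Ψ ⟨bt, h⟩ else 0
  have hψ : ∀ i : O, ψ i = Ψ i := fun i => by simp [ψ]
  have hψ' : ∀ i : O, ψ (i * s ^ 4) = Ψ (succ i) := fun i => hψ (succ i)
  have hne : ∀ bt ∈ O, ψ bt ≠ 0 := by
    by_contra hcon
    push Not at hcon
    obtain ⟨bt, hbt, h0⟩ := hcon
    apply hΨ0
    have key : ∀ bt ∈ O, (ψ P.gaugeBeta = 0 ↔ ψ bt = 0) :=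
      gaugeOrbit_induction hs0 Iff.rfl fun bt hbt => by
        have := hstep ⟨bt, hbt⟩
        rw [← hψ, ← hψ'] at this
        exact iff_congr Iff.rfl this
    ext i : 1
    rw [← hψ]
    exact (key i i.2).1 ((key bt hbt).2 h0)
  -- The zeros are found by factoring the polynomial with coefficients `c k`.
  set F : ℂ[X] := ∑ k ∈ Finset.range (N + 1), monomial k (c k) with hF
  have hFc : ∀ k ≤ N, F.coeff k = c k := by
    intro k hk
    simp only [hF, finsetSum_coeff, coeff_monomial, Finset.sum_ite_eq', Finset.mem_range]
    rw [if_pos (Nat.lt_succ_of_le hk)]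
  have hFd : F.natDegree = N := by
    refine le_antisymm (natDegree_sum_le_of_forall_le _ _ fun k hk => ?_) ?_
    · exact (natDegree_monomial_le _).trans (Nat.lt_succ_iff.1 (Finset.mem_range.1 hk))
    · exact le_natDegree_of_ne_zero (by rw [hFc N le_rfl]; exact hcN)
  have hsplit := IsAlgClosed.splits F
  have hcard : F.roots.toList.length = N := by
    rw [Multiset.length_toList, ← hsplit.natDegree_eq_card_roots, hFd]
  let x : Fin N → ℂ := fun n => F.roots.toList.get (Fin.cast hcard.symm n)
  choose z hz0 hz using fun n => exists_xVar_eq (x n)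
  have hFx : F = C (c N) * ∏ n, (X - C (xVar (z n))) := by
    have h₁ := hsplit.eq_prod_roots
    have h₂ : F.leadingCoeff = c N := by rw [leadingCoeff, hFd, hFc N le_rfl]
    rw [h₂] at h₁
    rw [h₁]
    congr 1
    simp only [hz, x]
    rw [← List.prod_ofFn]
    conv_lhs => rw [← Multiset.coe_toList (F.roots)]
    rw [Multiset.map_coe, Multiset.prod_coe]
    congr 1
    refine List.ext_get (by simp [hcard]) fun n h₁ h₂ => ?_
    simp
  refine ⟨c N, z, ψ, hcN, hz0, fun bt hbt => ⟨hne bt hbt, fun k hk => ?_, fun mu hm => ?_⟩⟩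
  · rw [← hFx, hFc k hk]
    have := hev k hk ⟨bt, hbt⟩
    rw [← hψ, ← hψ'] at this
    exact this
  · rw [gaugedB_eq_sum hs hsp hP bt hm, Matrix.smul_mulVec, Matrix.sum_mulVec]
    have h₁ : ∀ k ∈ Finset.range (N + 1), Matrix.mulVec (xVar mu ^ k • bCoeff s P bt k) (ψ bt) =
        (F.coeff k * xVar mu ^ k) • ψ (bt * s ^ 4) := by
      intro k hk
      have hk' := Nat.lt_succ_iff.1 (Finset.mem_range.1 hk)
      rw [Matrix.smul_mulVec, hFc k hk', mul_comm, mul_smul]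
      congr 1
      have := hev k hk' ⟨bt, hbt⟩
      rw [← hψ, ← hψ'] at this
      exact this
    rw [Finset.sum_congr rfl h₁, ← Finset.sum_smul, smul_smul,
      ← eval_eq_sum_range' (by rw [hFd]; exact Nat.lt_succ_self N), hFx, eigenFun]
    congr 1
    rw [eval_mul, eval_C, eval_prod]
    simp only [eval_sub, eval_X, eval_C, Pi.zero_apply, pow_zero, mul_one]
    ring

end Existence

end

end CyclicReflection

namespace CyclicReflection

noncomputable section

/-! ### Matrix elements of the gauged operators determined by their zeros -/

section Elements

open Polynomial

variable {p N : ℕ} [NeZero p] {s : ℂ}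

theorem sub_mul_sub_inv {u v : ℂ} (hu : u ≠ 0) (hv : v ≠ 0) :
    (u - v) * (u - 1 / v) = u * ((u + 1 / u) - (v + 1 / v)) := by
  field_simp
  ring

/-- A matrix element of a gauged operator between states that are orthogonal is a Laurent polynomial
with `2 N + 2` zeros in `lam ^ 2`. When all of them but one are known, the last one and the normalization
follow from the highest and lowest coefficients, which are given by one operator. -/
theorem exists_gauged_element_eq (hs : s ≠ 0) (hsp : (s ^ 2) ^ p = 1) {P : Params N}
    (hP : P.Regular) :
    ∃ M : Op p N, ∀ φ : Op p N →ₗ[ℂ] ℂ, φ 1 = 0 → ∀ (α x y : ℂ) (w : Fin N → ℂ) (a : Fin N) (ρ : ℂ),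
      ρ ≠ 0 → ρ ^ 4 ≠ s ^ 4 →
      (∀ n, n ≠ a → w n ≠ 0 ∧ w n ^ 4 ≠ 1 ∧ w n ^ 4 ≠ s ^ 4 ∧ w n ^ 4 * s ^ 4 ≠ 1 ∧
        xVar ρ ≠ xVar (w n) ∧ ∀ m, m ≠ a → m ≠ n → xVar (w m) ≠ xVar (w n)) →
      φ (gauged s α ρ x y (boundaryMonodromy s P ρ)) = 0 →
      (∀ n, n ≠ a → φ (gauged s α (w n) x y (boundaryMonodromy s P (w n))) = 0 ∧
        φ (gauged s α (1 / w n) x y (boundaryMonodromy s P (1 / w n))) = 0) →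
      ∀ lam : ℂ, lam ≠ 0 → φ (gauged s α lam x y (boundaryMonodromy s P lam)) =
        φ M * ((lam ^ 4 - s ^ 4) * (lam ^ 2 - ρ ^ 2) * (-(y / s) * lam ^ 2 + x / (s * ρ ^ 2)) /
          lam ^ 4) * ∏ n ∈ Finset.univ.erase a, (xVar lam - xVar (w n)) := by
  obtain ⟨M, hM⟩ := exists_gauged_element (p := p) hs hsp hP
  refine ⟨M, fun φ hφ α x y w a ρ hρ hρ4 hw h₁ h₂ lam hl => ?_⟩
  obtain ⟨F, hF, htop, hbot⟩ := hM φ hφ α x y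
  obtain ⟨⟨c, hc⟩, ⟨d, hd⟩⟩ := gauged_special (p := p) hs hsp hP α x y
  have hroot : ∀ mu : ℂ, mu ≠ 0 → φ (gauged s α mu x y (boundaryMonodromy s P mu)) = 0 →
      F.IsRoot (mu ^ 2) := by
    intro mu hm h
    rw [IsRoot, hF.eval_sq hm, h, mul_zero]
  -- At `lam = s` and `lam = i s` the operators are numbers, which vanish between orthogonal states.
  have hIs : (Complex.I * s) ^ 2 = -s ^ 2 := by
    rw [mul_pow, Complex.I_sq]
    ring
  -- The known zeros, in the variable `lam ^ 2`.
  let ι := Fin 3 ⊕ ({n : Fin N // n ≠ a} × Bool)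
  let r : ι → ℂ := Sum.elim ![s ^ 2, -s ^ 2, ρ ^ 2]
    fun i => if i.2 then w i.1 ^ 2 else 1 / w i.1 ^ 2
  have hr : ∀ i, F.IsRoot (r i) := by
    rintro (i | ⟨⟨n, hn⟩, b⟩)
    · fin_cases i
      · exact hroot s hs (by rw [hc, map_smul, hφ, smul_zero])
      · have := hroot (Complex.I * s) (mul_ne_zero Complex.I_ne_zero hs)
          (by rw [hd, map_smul, hφ, smul_zero])
        rw [hIs] at this
        exact this
      · exact hroot ρ hρ h₁
    · cases b
      · have := hroot (1 / w n) (one_div_ne_zero (hw n hn).1) (h₂ n hn).2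
        rw [one_div_pow] at this
        simpa [r] using this
      · simpa [r] using hroot (w n) (hw n hn).1 (h₂ n hn).1
  have hinj : Function.Injective r := by
    refine Function.Injective.sumElim ?_ ?_ ?_
    · have e₁ : s ^ 2 ≠ -s ^ 2 := fun e => pow_ne_zero 2 hs (by linear_combination e / 2)
      have e₂ : s ^ 2 ≠ ρ ^ 2 := fun e => hρ4 (by linear_combination (-s ^ 2 - ρ ^ 2) * e)
      have e₃ : -s ^ 2 ≠ ρ ^ 2 := fun e => hρ4 (by linear_combination (s ^ 2 - ρ ^ 2) * e)
      intro i j hij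
      fin_cases i <;> fin_cases j <;> simp_all [eq_comm]
    · rintro ⟨⟨n, hn⟩, b⟩ ⟨⟨m, hm⟩, b'⟩ h
      have hx : ∀ (v : ℂ) (b : Bool), xVar v =
          (if b then v ^ 2 else 1 / v ^ 2) + 1 / (if b then v ^ 2 else 1 / v ^ 2) := by
        intro v b
        cases b <;> simp [xVar, add_comm]
      have hnm : n = m := by
        by_contra hne
        refine (hw m hm).2.2.2.2.2 n hn hne ?_
        simp only at h
        rw [hx (w n) b, hx (w m) b', h]
      subst hnm
      have h4 := (hw n hn).2.1
      have h0 := (hw n hn).1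
      have : b = b' := by
        cases b <;> cases b' <;> simp only [Bool.false_eq_true, if_true, if_false] at h ⊢ <;>
          exfalso <;> apply h4 <;> field_simp at h <;> first | exact h | exact h.symm
      rw [this]
    · rintro i ⟨⟨n, hn⟩, b⟩ h
      obtain ⟨h0, h4, h4s, h4s', hx, -⟩ := hw n hn
      fin_cases i <;> cases b <;>
        simp only [Bool.false_eq_true, if_true, if_false, Fin.zero_eta, Fin.mk_one,
          Fin.reduceFinMk, Matrix.cons_val_zero, Matrix.cons_val_one, Matrix.cons_val] at h
      · apply h4s'
        field_simp at h
        linear_combination (w n ^ 2 * s ^ 2 + 1) * h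
      · exact h4s (by linear_combination (-s ^ 2 - w n ^ 2) * h)
      · apply h4s'
        field_simp at h
        linear_combination (w n ^ 2 * s ^ 2 - 1) * (-h)
      · exact h4s (by linear_combination (s ^ 2 - w n ^ 2) * h)
      · refine hx ?_
        rw [xVar, xVar, h, one_div_one_div, add_comm]
      · refine hx ?_
        rw [xVar, xVar, h]
  have hdvd : ∏ i, (X - C (r i)) ∣ F :=
    Fintype.prod_dvd_of_coprime (pairwise_coprime_X_sub_C hinj) fun i => dvd_iff_isRoot.2 (hr i)
  obtain ⟨H, hH⟩ := hdvd
  set G : ℂ[X] := ∏ i, (X - C (r i)) with hG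
  have hGm : G.Monic := monic_prod_of_monic _ _ fun i _ => monic_X_sub_C _
  have hcard : Fintype.card ι = 2 * N + 1 := by
    have := a.pos
    simp only [ι, Fintype.card_sum, Fintype.card_prod, Fintype.card_fin, Fintype.card_bool,
      Fintype.card_subtype_compl, Fintype.card_subtype_eq]
    omega
  have hGd : G.natDegree = 2 * N + 1 := by
    rw [hG, natDegree_prod_of_monic _ _ fun i _ => monic_X_sub_C _]
    simp [hcard]
  have hHd : H.natDegree ≤ 1 := by
    rcases eq_or_ne H 0 with rfl | hH0
    · simp
    have := hF.1
    rw [hH, hGm.natDegree_mul' hH0, hGd] at this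
    omega
  have hGe : ∀ u, G.eval u = (u ^ 2 - s ^ 4) * (u - ρ ^ 2) *
      ∏ n ∈ Finset.univ.erase a, (u - w n ^ 2) * (u - 1 / w n ^ 2) := by
    intro u
    rw [hG, eval_prod, Fintype.prod_sum_type, Fin.prod_univ_three, Fintype.prod_prod_type]
    simp only [Fintype.prod_bool, r, Sum.elim_inl, Sum.elim_inr, eval_sub, eval_X, eval_C,
      Matrix.cons_val_zero, Matrix.cons_val_one, Matrix.cons_val, if_true, Bool.false_eq_true,
      if_false]
    rw [Finset.prod_subtype (Finset.univ.erase a) (p := fun n => n ≠ a) (by simp)]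
    ring
  have hG0 : G.coeff 0 = s ^ 4 * ρ ^ 2 := by
    rw [coeff_zero_eq_eval_zero, hGe, Finset.prod_eq_one]
    · ring
    · intro n hn
      have := (hw n (Finset.ne_of_mem_erase hn)).1
      field_simp
      ring
  have hH1 : H.coeff 1 = -(y / s) * φ M := by
    rw [← htop, hH, show 2 * N + 2 = (2 * N + 1) + 1 by ring, coeff_mul_add_eq_of_natDegree_le hGd.le hHd,
      ← hGd, hGm.coeff_natDegree, one_mul]
  have hH0 : H.coeff 0 = x / (s * ρ ^ 2) * φ M := by
    have := hbot
    rw [hH, mul_coeff_zero, hG0] at this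
    field_simp
    have h3 : s ^ 3 * (H.coeff 0 * s * ρ ^ 2) = s ^ 3 * (x * φ M) := by linear_combination this
    exact mul_left_cancel₀ (pow_ne_zero 3 hs) h3
  have hHe : H.eval (lam ^ 2) = φ M * (-(y / s) * lam ^ 2 + x / (s * ρ ^ 2)) := by
    rw [eval_eq_sum_range' (Nat.lt_succ_of_le hHd), Finset.sum_range_succ, Finset.sum_range_one,
      hH0, hH1]
    ring
  have key := hF.eval_sq hl
  rw [hH, eval_mul, hHe, hGe] at key
  have hprod : ∏ n ∈ Finset.univ.erase a, (lam ^ 2 - w n ^ 2) * (lam ^ 2 - 1 / w n ^ 2) =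
      (lam ^ 2) ^ (N - 1) * ∏ n ∈ Finset.univ.erase a, (xVar lam - xVar (w n)) := by
    rw [Finset.prod_congr rfl fun n hn => sub_mul_sub_inv (pow_ne_zero 2 hl)
      (pow_ne_zero 2 (hw n (Finset.ne_of_mem_erase hn)).1), Finset.prod_mul_distrib,
      Finset.prod_const, Finset.card_erase_of_mem (Finset.mem_univ a), Finset.card_fin]
    rfl
  rw [hprod] at key
  have hN : lam ^ (2 * N + 2) = (lam ^ 2) ^ (N - 1) * lam ^ 4 := by
    rw [← pow_mul, ← pow_add]
    congr 1
    have := a.pos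
    omega
  rw [hN] at key
  have hl' : (lam ^ 2) ^ (N - 1) * lam ^ 4 ≠ 0 :=
    mul_ne_zero (pow_ne_zero _ (pow_ne_zero _ hl)) (pow_ne_zero _ hl)
  refine mul_left_cancel₀ hl' ?_
  rw [← key]
  field_simp

end Elements

/-! ### Zeros of the scalar coefficients -/

section Coefficients

variable {N : ℕ} {s : ℂ}

theorem sq_cpow_half (x : ℂ) : (x ^ (1 / 2 : ℂ)) ^ 2 = x := by
  have := Complex.cpow_nat_inv_pow x two_ne_zero
  rwa [show (((2 : ℕ) : ℂ))⁻¹ = 1 / 2 by norm_num] at this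

theorem muPlus_sq (P : Params N) (n : Fin N) :
    muPlus s P n ^ 2 = -s ^ 2 * (P.a n * P.beta n / (P.alpha n * P.b n)) := by
  rw [muPlus, mul_pow, mul_pow, Complex.I_sq, sq_cpow_half]
  ring

theorem muMinus_sq (P : Params N) (n : Fin N) :
    muMinus s P n ^ 2 = -s ^ 2 * (P.c n * P.beta n / (P.alpha n * P.d n)) := by
  rw [muMinus, mul_pow, mul_pow, Complex.I_sq, sq_cpow_half]
  ring

theorem coefA_ne_zero (hs : s ≠ 0) {P : Params N} (hP : P.Regular) {am bm a0 : ℂ}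
    (h : IsInnerBoundary P am bm) (h0 : a0 ≠ 0) {lam : ℂ} (hl : lam ≠ 0)
    (h₁ : lam ^ 2 * am ^ 2 ≠ s ^ 2) (h₂ : lam ^ 2 * bm ^ 2 ≠ -s ^ 2)
    (h₃ : ∀ n, lam ^ 2 ≠ s ^ 2 * muPlus s P n ^ 2)
    (h₄ : ∀ n, lam ^ 2 * muMinus s P n ^ 2 ≠ s ^ 2) : coefA s P am bm a0 lam ≠ 0 := by
  obtain ⟨ha, hb, e, -⟩ := h
  refine mul_ne_zero (mul_ne_zero ?_ ?_) ?_
  · rw [gMinus]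
    refine div_ne_zero (mul_ne_zero ?_ ?_) ?_
    · intro hc
      apply h₁
      field_simp at hc
      linear_combination hc
    · intro hc
      apply h₂
      field_simp at hc
      linear_combination hc
    · rw [e]
      exact div_ne_zero hP.zeta_sub hP.kappa
  · refine mul_ne_zero h0 (Finset.prod_ne_zero_iff.2 fun n _ hc => h₃ n ?_)
    have ha := hP.a n
    have hb := hP.b n
    have hα := hP.alpha n
    rw [muPlus_sq]
    field_simp at hc ⊢
    linear_combination hc
  · refine mul_ne_zero (div_ne_zero (pow_ne_zero _ (by norm_num)) h0)
      (Finset.prod_ne_zero_iff.2 fun n _ => mul_ne_zero ?_ fun h0 => h₄ n ?_)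
    · exact div_ne_zero (mul_ne_zero (hP.a n) (hP.c n)) (hP.alpha n)
    have hc := hP.c n
    have hd := hP.d n
    have hα := hP.alpha n
    have hβ := hP.beta n
    rw [muMinus_sq]
    have hc' : lam ^ 2 * P.c n * P.beta n + P.alpha n * P.d n = 0 := by
      refine (mul_eq_zero.1 ?_).resolve_left hs
      field_simp at h0
      linear_combination h0
    field_simp
    linear_combination -hc'

theorem coefD_ne_zero (hs : s ≠ 0) {P : Params N} {am bm a0 lam : ℂ} (hl : lam ≠ 0)
    (h₁ : lam ^ 4 ≠ 1) (h₂ : lam ^ 4 ≠ s ^ 8) (h : coefA s P am bm a0 (s ^ 2 / lam) ≠ 0) :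
    coefD s P am bm a0 lam ≠ 0 := by
  refine mul_ne_zero (div_ne_zero ?_ ?_) h
  · intro hc
    apply h₁
    field_simp at hc
    linear_combination hc
  · intro hc
    apply h₂
    field_simp at hc
    linear_combination hc

theorem coefD_mul (hs : s ≠ 0) {P : Params N} {am bm a0 lam : ℂ} (hl : lam ≠ 0)
    (h : coefD s P am bm a0 lam ≠ 0) :
    coefD s P am bm a0 lam * coefD s P am bm a0 (s ^ 2 / lam) =
      coefA s P am bm a0 lam * coefA s P am bm a0 (s ^ 2 / lam) := by
  obtain ⟨h₁, -⟩ := mul_ne_zero_iff.1 h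
  obtain ⟨h₁, h₂⟩ := div_ne_zero_iff.1 h₁
  have e₁ : s ^ 2 / (s ^ 2 / lam) = lam := by field_simp
  have e₂ : (s ^ 2 / lam) ^ 2 - 1 / (s ^ 2 / lam) ^ 2 =
      -(lam ^ 2 / (s ^ 2) ^ 2 - (s ^ 2) ^ 2 / lam ^ 2) := by
    field_simp
    ring
  have e₃ : (s ^ 2 / lam) ^ 2 / (s ^ 2) ^ 2 - (s ^ 2) ^ 2 / (s ^ 2 / lam) ^ 2 =
      -(lam ^ 2 - 1 / lam ^ 2) := by
    field_simp
    ring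
  unfold coefD
  rw [e₁, e₂, e₃]
  generalize lam ^ 2 / (s ^ 2) ^ 2 - (s ^ 2) ^ 2 / lam ^ 2 = x at *
  generalize lam ^ 2 - 1 / lam ^ 2 = y at *
  field_simp

end Coefficients

end

end CyclicReflection

namespace CyclicReflection

noncomputable section

/-! ### The two ladders of a generic boundary monodromy -/

section Spectral

variable {p N : ℕ} [NeZero p] {s : ℂ} {P : Params N} {am bm a0 ℓ : ℂ} {z : Fin N → ℂ}
  {ψ : ℂ → State p N}

theorem fullTranspose_algebraMap (c : ℂ) :
    fullTranspose (algebraMap ℂ (AuxOp p N) c) = algebraMap ℂ (AuxOp p N) c := by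
  refine Matrix.ext fun i j => ?_
  fin_cases i <;> fin_cases j <;>
    simp [fullTranspose, Algebra.algebraMap_eq_smul_one, Matrix.smul_apply]

/-- Parameters in general position, with right pseudo-eigenvectors `ψ bt` whose pseudo-eigenvalue has
leading coefficient `ℓ` and zeros `z n`. -/
structure SpectralData (s : ℂ) (P : Params N) (am bm a0 ℓ : ℂ) (z : Fin N → ℂ)
    (ψ : ℂ → State p N) : Prop where
  norm_s : ‖s‖ = 1
  prim : IsPrimitiveRoot (s ^ 2) p
  odd : Odd p
  regular : P.Regular
  inner : IsInnerBoundary P am bm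
  a0_ne : a0 ≠ 0
  beta_ne : P.gaugeBeta ≠ 0
  beta_pow : P.gaugeBeta ^ (2 * p) ≠ 1
  lead_ne : ℓ ≠ 0
  z_ne : ∀ n, z n ≠ 0
  z_pow : ∀ n, z n ^ (4 * p) ≠ 1
  z_sep : ∀ n m, n ≠ m → z n ^ (2 * p) ≠ z m ^ (2 * p) ∧ z n ^ (2 * p) * z m ^ (2 * p) ≠ 1
  z_am : ∀ n (j e : ℤ), (e = 1 ∨ e = -1) → z n ^ 2 ≠ (s ^ 2) ^ j * am ^ (2 * e)
  z_bm : ∀ n (j e : ℤ), (e = 1 ∨ e = -1) → z n ^ 2 ≠ -((s ^ 2) ^ j * bm ^ (2 * e))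
  z_muPlus : ∀ n m (j e : ℤ), (e = 1 ∨ e = -1) → z n ^ 2 ≠ (s ^ 2) ^ j * muPlus s P m ^ (2 * e)
  z_muMinus : ∀ n m (j e : ℤ), (e = 1 ∨ e = -1) → z n ^ 2 ≠ (s ^ 2) ^ j * muMinus s P m ^ (2 * e)
  ket_ne : ∀ bt ∈ gaugeOrbit s P.gaugeBeta, ψ bt ≠ 0
  ket_eig : ∀ bt ∈ gaugeOrbit s P.gaugeBeta, ∀ mu, mu ≠ 0 →
    Matrix.mulVec (gaugedB s P mu bt) (ψ bt) = eigenFun (s ^ 2) z ℓ 0 mu • ψ (bt * s ^ 4)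

namespace SpectralData

theorem s_ne (D : SpectralData s P am bm a0 ℓ z ψ) : s ≠ 0 := norm_ne_zero_of_norm_one D.norm_s

theorem q_pow (D : SpectralData s P am bm a0 ℓ z ψ) : (s ^ 2) ^ p = 1 := D.prim.pow_eq_one

theorem q_pow_pow (D : SpectralData s P am bm a0 ℓ z ψ) (k : ℕ) : ((s ^ 2) ^ k) ^ p = 1 := by
  rw [← pow_mul, mul_comm, pow_mul, D.q_pow, one_pow]

theorem orbit_ne (D : SpectralData s P am bm a0 ℓ z ψ) {bt : ℂ}
    (h : bt ∈ gaugeOrbit s P.gaugeBeta) : bt ≠ 0 := by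
  obtain ⟨k, rfl⟩ := h
  exact mul_ne_zero (zpow_ne_zero _ (pow_ne_zero _ D.s_ne)) D.beta_ne

theorem orbit_pow (D : SpectralData s P am bm a0 ℓ z ψ) {bt : ℂ}
    (h : bt ∈ gaugeOrbit s P.gaugeBeta) : bt ^ (2 * p) ≠ 1 := by
  obtain ⟨k, rfl⟩ := h
  have e : ((s ^ 2) ^ (2 * k)) ^ (2 * p) = 1 := by
    rw [← zpow_natCast, ← zpow_mul, show 2 * k * ((2 * p : ℕ) : ℤ) = (p : ℤ) * (4 * k) by
      push_cast
      ring, zpow_mul, zpow_natCast, D.q_pow, one_zpow]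
  rw [mul_pow, e, one_mul]
  exact D.beta_pow

theorem orbit_sq_ne (D : SpectralData s P am bm a0 ℓ z ψ) {bt : ℂ}
    (h : bt ∈ gaugeOrbit s P.gaugeBeta) (k : ℕ) : bt ^ 2 ≠ (s ^ 2) ^ k := by
  intro e
  apply D.orbit_pow h
  rw [pow_mul, e, D.q_pow_pow]

theorem orbit_sq_mul_ne (D : SpectralData s P am bm a0 ℓ z ψ) {bt : ℂ}
    (h : bt ∈ gaugeOrbit s P.gaugeBeta) (k : ℕ) : bt ^ 2 * (s ^ 2) ^ k ≠ 1 := by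
  intro e
  apply D.orbit_pow h
  have := congrArg (· ^ p) e
  simp only [mul_pow, D.q_pow_pow, mul_one, one_pow] at this
  rw [pow_mul]
  exact this

theorem orbit_sub_ne (D : SpectralData s P am bm a0 ℓ z ψ) {bt : ℂ}
    (h : bt ∈ gaugeOrbit s P.gaugeBeta) : bt - 1 / bt ≠ 0 := by
  have h0 := D.orbit_ne h
  intro e
  apply D.orbit_sq_ne h 0
  field_simp at e
  linear_combination e

theorem zq_ne (D : SpectralData s P am bm a0 ℓ z ψ) (n : Fin N) (k : ℕ) : z n * (s ^ 2) ^ k ≠ 0 :=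
  mul_ne_zero (D.z_ne n) (pow_ne_zero _ (pow_ne_zero _ D.s_ne))

theorem zq_pow (D : SpectralData s P am bm a0 ℓ z ψ) (n : Fin N) (k i : ℕ) :
    (z n * (s ^ 2) ^ k) ^ (i * p) = z n ^ (i * p) := by
  rw [mul_pow, mul_comm i p, pow_mul ((s ^ 2) ^ k), D.q_pow_pow, one_pow, mul_one]

theorem zq_four_ne (D : SpectralData s P am bm a0 ℓ z ψ) (n : Fin N) (k i : ℕ) :
    (z n * (s ^ 2) ^ k) ^ 4 ≠ (s ^ 2) ^ i := by
  intro e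
  have := congrArg (· ^ p) e
  simp only [← pow_mul (z n * (s ^ 2) ^ k), D.q_pow_pow, D.zq_pow] at this
  exact D.z_pow n this

theorem zq_four_mul_ne (D : SpectralData s P am bm a0 ℓ z ψ) (n : Fin N) (k i : ℕ) :
    (z n * (s ^ 2) ^ k) ^ 4 * (s ^ 2) ^ i ≠ 1 := by
  intro e
  have := congrArg (· ^ p) e
  simp only [mul_pow _ ((s ^ 2) ^ i), ← pow_mul (z n * (s ^ 2) ^ k), D.q_pow_pow, D.zq_pow,
    one_pow, mul_one] at this
  exact D.z_pow n this

theorem sep (D : SpectralData s P am bm a0 ℓ z ψ) (n m : Fin N) (k l : ℕ)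
    (h : xVar (z n * (s ^ 2) ^ k) = xVar (z m * (s ^ 2) ^ l)) : n = m ∧ k ≡ l [MOD p] := by
  rcases (xVar_eq_iff (D.zq_ne n k) (D.zq_ne m l)).1 h with h | h
  · have hnm : n = m := by
      by_contra hne
      have := congrArg (· ^ p) h
      simp only [← pow_mul (z n * (s ^ 2) ^ k), ← pow_mul (z m * (s ^ 2) ^ l), D.zq_pow] at this
      exact (D.z_sep n m hne).1 this
    subst hnm
    refine ⟨rfl, ?_⟩
    rw [mul_pow, mul_pow] at h
    have h' := mul_left_cancel₀ (pow_ne_zero 2 (D.z_ne n)) h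
    rw [← pow_mul (s ^ 2) k, ← pow_mul (s ^ 2) l, ← pow_mod_orderOf _ (k * 2),
      ← pow_mod_orderOf _ (l * 2), ← D.prim.eq_orderOf] at h'
    have h' := D.prim.pow_inj (Nat.mod_lt _ (NeZero.pos p)) (Nat.mod_lt _ (NeZero.pos p)) h'
    exact Nat.ModEq.cancel_right_of_coprime ((Nat.coprime_two_right).2 D.odd) h'
  · exfalso
    have := congrArg (· ^ p) h
    simp only [mul_pow ((z n * (s ^ 2) ^ k) ^ 2), ← pow_mul (z n * (s ^ 2) ^ k),
      ← pow_mul (z m * (s ^ 2) ^ l), D.zq_pow, one_pow] at this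
    rcases eq_or_ne n m with rfl | hne
    · apply D.z_pow n
      rw [← this, ← pow_add]
      congr 1
      ring
    · exact (D.z_sep n m hne).2 this

theorem coefA_zq_ne (D : SpectralData s P am bm a0 ℓ z ψ) (n : Fin N) (k : ℕ) :
    coefA s P am bm a0 (z n * (s ^ 2) ^ k) ≠ 0 := by
  have hs := D.s_ne
  have hq : s ^ 2 ≠ 0 := pow_ne_zero _ hs
  have key : ∀ j : ℤ, ∀ x, (z n * (s ^ 2) ^ k) ^ 2 = (s ^ 2) ^ j * x →
      z n ^ 2 = (s ^ 2) ^ (j - 2 * k) * x := by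
    intro j x h
    rw [zpow_sub₀ hq, mul_comm 2 (k : ℤ), zpow_mul, zpow_natCast, div_mul_eq_mul_div, ← h]
    field_simp
  have hZ := D.zq_ne n k
  generalize z n * (s ^ 2) ^ k = Z at *
  refine coefA_ne_zero hs D.regular D.inner D.a0_ne hZ (fun h => ?_) (fun h => ?_)
    (fun m h => ?_) fun m h => ?_
  · refine D.z_am n (1 - 2 * k) (-1) (Or.inr rfl) (key 1 _ ?_)
    rw [zpow_one, ← h, mul_assoc, show (2 : ℤ) * -1 = -((2 : ℕ) : ℤ) by norm_num, zpow_neg,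
      zpow_natCast, mul_inv_cancel₀ (pow_ne_zero 2 D.inner.1), mul_one]
  · refine D.z_bm n (1 - 2 * k) (-1) (Or.inr rfl) ?_
    rw [← mul_neg]
    refine key 1 _ ?_
    rw [zpow_one, mul_neg, ← neg_mul, ← h, mul_assoc, show (2 : ℤ) * -1 = -((2 : ℕ) : ℤ) by norm_num,
      zpow_neg, zpow_natCast, mul_inv_cancel₀ (pow_ne_zero 2 D.inner.2.1), mul_one]
  · refine D.z_muPlus n m (1 - 2 * k) 1 (Or.inl rfl) (key 1 _ ?_)
    rw [zpow_one, h]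
    norm_cast
  · refine D.z_muMinus n m (1 - 2 * k) (-1) (Or.inr rfl) (key 1 _ ?_)
    have h0 : muMinus s P m ^ 2 ≠ 0 := by
      intro h0
      rw [h0, mul_zero] at h
      exact hq h.symm
    rw [zpow_one, ← h, mul_assoc, show (2 : ℤ) * -1 = -((2 : ℕ) : ℤ) by norm_num, zpow_neg,
      zpow_natCast, mul_inv_cancel₀ h0, mul_one]

theorem coefA_inv_zq_ne (D : SpectralData s P am bm a0 ℓ z ψ) (n : Fin N) (k : ℕ) :
    coefA s P am bm a0 (1 / (z n * (s ^ 2) ^ k)) ≠ 0 := by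
  have hs := D.s_ne
  have hq : s ^ 2 ≠ 0 := pow_ne_zero _ hs
  have key : ∀ x, (z n * (s ^ 2) ^ k) ^ 2 * (s ^ 2) = x →
      z n ^ 2 = (s ^ 2) ^ (-1 - 2 * k : ℤ) * x := by
    intro x h
    rw [zpow_sub₀ hq, mul_comm 2 (k : ℤ), zpow_mul, zpow_natCast, ← h, zpow_neg_one]
    field_simp
  have hZ := D.zq_ne n k
  generalize z n * (s ^ 2) ^ k = Z at *
  refine coefA_ne_zero hs D.regular D.inner D.a0_ne (one_div_ne_zero hZ) (fun h => ?_) (fun h => ?_)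
    (fun m h => ?_) fun m h => ?_
  · refine D.z_am n (-1 - 2 * k) 1 (Or.inl rfl) (key _ ?_)
    rw [show (2 : ℤ) * 1 = ((2 : ℕ) : ℤ) by norm_num, zpow_natCast, ← h, one_div_pow,
      ← mul_assoc, mul_one_div_cancel (pow_ne_zero 2 hZ), one_mul]
  · refine D.z_bm n (-1 - 2 * k) 1 (Or.inl rfl) ?_
    rw [← mul_neg]
    refine key _ ?_
    rw [show (2 : ℤ) * 1 = ((2 : ℕ) : ℤ) by norm_num, zpow_natCast, ← neg_eq_iff_eq_neg.2 h,
      one_div_pow, mul_neg, ← mul_assoc, mul_one_div_cancel (pow_ne_zero 2 hZ), one_mul]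
  · refine D.z_muPlus n m (-1 - 2 * k) (-1) (Or.inr rfl) (key _ ?_)
    have h0 : muPlus s P m ^ 2 ≠ 0 := by
      intro h0
      rw [h0, mul_zero] at h
      exact pow_ne_zero 2 (one_div_ne_zero hZ) h
    rw [show (2 : ℤ) * -1 = -((2 : ℕ) : ℤ) by norm_num, zpow_neg, zpow_natCast]
    rw [one_div_pow] at h
    generalize muPlus s P m ^ 2 = y at *
    field_simp at h ⊢
    linear_combination -h
  · refine D.z_muMinus n m (-1 - 2 * k) 1 (Or.inl rfl) (key _ ?_)
    rw [show (2 : ℤ) * 1 = ((2 : ℕ) : ℤ) by norm_num, zpow_natCast, ← h, one_div_pow,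
      ← mul_assoc, mul_one_div_cancel (pow_ne_zero 2 hZ), one_mul]

theorem coefD_inv_zq_ne (D : SpectralData s P am bm a0 ℓ z ψ) (n : Fin N) (k : ℕ) :
    coefD s P am bm a0 (1 / (z n * (s ^ 2) ^ k)) ≠ 0 := by
  have hs := D.s_ne
  have hZ := D.zq_ne n k
  refine coefD_ne_zero hs (one_div_ne_zero hZ) (fun h => ?_) (fun h => ?_) ?_
  · apply D.zq_four_ne n k 0
    rw [pow_zero]
    generalize z n * (s ^ 2) ^ k = Z at *
    field_simp at h
    exact h.symm
  · apply D.zq_four_mul_ne n k 4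
    rw [← pow_mul s 2 4]
    generalize z n * (s ^ 2) ^ k = Z at *
    field_simp at h
    exact h.symm
  · have e : s ^ 2 / (1 / (z n * (s ^ 2) ^ k)) = z n * (s ^ 2) ^ (k + 1) := by
      field_simp
      ring
    rw [e]
    exact D.coefA_zq_ne n _

theorem coefD_zq_ne (D : SpectralData s P am bm a0 ℓ z ψ) (n : Fin N) (k : ℕ) :
    coefD s P am bm a0 (z n * (s ^ 2) ^ k) ≠ 0 := by
  have hs := D.s_ne
  have hZ := D.zq_ne n k
  refine coefD_ne_zero hs hZ (fun h => ?_) (fun h => ?_) ?_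
  · exact D.zq_four_ne n k 0 (by rw [pow_zero, h])
  · apply D.zq_four_ne n k 4
    rw [h, ← pow_mul]
  · have e : s ^ 2 / (z n * (s ^ 2) ^ k) = 1 / (z n * (s ^ 2) ^ (k + (p - 1))) := by
      have hp : (s ^ 2) ^ (p - 1) * s ^ 2 = 1 := by
        rw [← pow_succ, Nat.sub_add_cancel (NeZero.pos p), D.q_pow]
      have hq : (s ^ 2) ^ (p - 1) ≠ 0 := pow_ne_zero _ (pow_ne_zero _ hs)
      rw [pow_add]
      generalize (s ^ 2) ^ (p - 1) = y at *
      generalize (s ^ 2) ^ k = x at *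
      have hx : x ≠ 0 := (mul_ne_zero_iff.1 hZ).2
      have hz := D.z_ne n
      field_simp
      linear_combination hp
    rw [e]
    exact D.coefA_inv_zq_ne n _

theorem boundaryMonodromy_mul' (D : SpectralData s P am bm a0 ℓ z ψ) {lam : ℂ} (hl : lam ≠ 0) :
    (boundaryMonodromy s P lam * boundaryMonodromy s P (s ^ 2 / lam) : AuxOp p N) =
      algebraMap ℂ _ (coefA s P am bm a0 lam * coefA s P am bm a0 (s ^ 2 / lam)) := by
  have hs := D.s_ne
  have e : s ^ 2 / (s ^ 2 / lam) = lam := by field_simp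
  have := boundaryMonodromy_mul (p := p) hs D.q_pow D.regular D.inner D.a0_ne
    (lam := s ^ 2 / lam) (div_ne_zero (pow_ne_zero _ hs) hl)
  rw [e] at this
  rw [this, mul_comm]

/-- The ladder of covectors. -/
def leftLadder (D : SpectralData s P am bm a0 ℓ z ψ) (bra : ℂ → State p N)
    (hne : ∀ bt ∈ gaugeOrbit s P.gaugeBeta, bra bt ≠ 0)
    (heig : ∀ bt ∈ gaugeOrbit s P.gaugeBeta, ∀ mu, mu ≠ 0 →
      Matrix.vecMul (bra bt) (gaugedB s P mu bt) = eigenFun (s ^ 2) z ℓ 0 mu • bra (bt / s ^ 4)) :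
    Ladder p N (gaugeOrbit s P.gaugeBeta) (State p N) :=
  rowLadder (fun lam => boundaryMonodromy s P lam) P.gaugeAlpha (fun i => (i : ℂ))
    (fun i => ((i : ℂ) - 1 / (i : ℂ))⁻¹) (fun i => ⟨i / s ^ 4, div_mem_gaugeOrbit D.s_ne i.2⟩)
    (coefA s P am bm a0) z (fun _ => ℓ) (fun i => bra i) D.s_ne D.q_pow D.regular.gaugeAlpha
    (fun i => D.orbit_ne i.2) (fun _ => rfl) (fun i => D.orbit_sub_ne i.2)
    (fun i => by
      have h0 := D.orbit_ne i.2
      intro e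
      apply D.orbit_sq_ne i.2 2
      field_simp at e
      linear_combination e)
    (fun i => inv_ne_zero (D.orbit_sub_ne i.2)) D.z_ne (fun _ => D.lead_ne) (fun i => hne i i.2)
    D.sep (fun n k => D.zq_four_ne n k 2) D.coefA_zq_ne D.coefA_inv_zq_ne
    (fun i g h mu hm => by
      obtain ⟨Q, -, hQ⟩ := exists_poly_gauged_self (p := p) D.s_ne D.q_pow D.regular
        (Matrix.entryLinearMap ℂ ℂ g h) P.gaugeAlpha i
      refine ContinuousAt.congr (f := fun lam : ℂ => (lam ^ 2 / s ^ 2 - s ^ 2 / lam ^ 2) *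
        Q.eval (lam ^ 2 + 1 / lam ^ 2)) ?_ ?_
      · have h₁ : ContinuousAt (fun mu : ℂ => mu ^ 2) mu := continuousAt_id.pow 2
        exact ((h₁.div_const _).sub (continuousAt_const.div h₁ (pow_ne_zero _ hm))).mul
          (Q.continuous.continuousAt.comp (continuousAt_xVar hm))
      · filter_upwards [isOpen_ne.mem_nhds hm] with lam hl
        rw [← hQ lam hl]
        rfl)
    (fun lam mu hl hm => reflectionEq_boundaryMonodromy D.s_ne D.q_pow D.regular hl hm)
    (fun lam hl _ => D.boundaryMonodromy_mul' hl)
    (fun i mu hm => by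
      rw [← gaugedB_eq]
      exact heig i i.2 mu hm)

/-- `-1 / (α s ^ 4)` plays the role of the gauge parameter `α` for the transposed operators. -/
theorem gaugeAlpha_ne (D : SpectralData s P am bm a0 ℓ z ψ) :
    -1 / (P.gaugeAlpha * s ^ 4) ≠ 0 :=
  div_ne_zero (by norm_num) (mul_ne_zero D.regular.gaugeAlpha (pow_ne_zero _ D.s_ne))

theorem gaugedB_transpose (D : SpectralData s P am bm a0 ℓ z ψ) {bt : ℂ}
    (h : bt ∈ gaugeOrbit s P.gaugeBeta) (lam : ℂ) :
    (gaugedB s P lam bt : Op p N).transpose = ((bt - 1 / bt)⁻¹ * (bt * bt)) •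
      gauged s (-1 / (P.gaugeAlpha * s ^ 4)) lam (1 / bt) (1 / bt)
        (fullTranspose (boundaryMonodromy s P lam)) := by
  rw [gaugedB_eq, Matrix.transpose_smul, gauged_transpose D.s_ne D.regular.gaugeAlpha (D.orbit_ne h)
    (D.orbit_ne h), smul_smul]

theorem gaugedD_transpose (D : SpectralData s P am bm a0 ℓ z ψ) {bt : ℂ}
    (h : bt ∈ gaugeOrbit s P.gaugeBeta) (lam : ℂ) :
    (gaugedD s P lam bt : Op p N).transpose = (1 / bt - 1 / (1 / bt))⁻¹ •
      gauged s (-1 / (P.gaugeAlpha * s ^ 4)) lam (1 / bt) (1 / (1 / bt))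
        (fullTranspose (boundaryMonodromy s P lam)) := by
  have h0 := D.orbit_ne h
  rw [gaugedD_eq P lam h0, Matrix.transpose_neg, Matrix.transpose_smul,
    gauged_transpose D.s_ne D.regular.gaugeAlpha (one_div_ne_zero h0) h0, smul_smul, ← neg_smul]
  congr 1
  rw [one_div_mul_cancel h0, mul_one, ← inv_neg, neg_sub, one_div_one_div]

/-- The ladder of vectors, on which the transposed operators act from the right. -/
def rightLadder (D : SpectralData s P am bm a0 ℓ z ψ) :
    Ladder p N (gaugeOrbit s P.gaugeBeta) (State p N) :=
  rowLadder (fun lam => fullTranspose (boundaryMonodromy s P lam)) (-1 / (P.gaugeAlpha * s ^ 4))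
    (fun i => 1 / (i : ℂ)) (fun i => ((i : ℂ) - 1 / (i : ℂ))⁻¹ * ((i : ℂ) * (i : ℂ)))
    (fun i => ⟨i * s ^ 4, mul_mem_gaugeOrbit D.s_ne i.2⟩)
    (coefD s P am bm a0) z (fun _ => ℓ) (fun i => ψ i) D.s_ne D.q_pow D.gaugeAlpha_ne
    (fun i => one_div_ne_zero (D.orbit_ne i.2)) (fun i => by simp [div_eq_mul_inv, mul_comm])
    (fun i => by
      have := D.orbit_sub_ne i.2
      rw [one_div_one_div, ← neg_sub]
      exact neg_ne_zero.2 this)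
    (fun i => by
      have h0 := D.orbit_ne i.2
      intro e
      apply D.orbit_sq_mul_ne i.2 2
      field_simp at e
      linear_combination -e)
    (fun i => mul_ne_zero (inv_ne_zero (D.orbit_sub_ne i.2))
      (mul_ne_zero (D.orbit_ne i.2) (D.orbit_ne i.2))) D.z_ne (fun _ => D.lead_ne)
    (fun i => D.ket_ne i i.2) D.sep (fun n k => D.zq_four_ne n k 2) D.coefD_zq_ne
    D.coefD_inv_zq_ne
    (fun i g h mu hm => by
      have h0 := D.orbit_ne i.2
      have hc : ((i : ℂ) - 1 / (i : ℂ))⁻¹ * ((i : ℂ) * (i : ℂ)) ≠ 0 :=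
        mul_ne_zero (inv_ne_zero (D.orbit_sub_ne i.2)) (mul_ne_zero h0 h0)
      obtain ⟨Q, -, hQ⟩ := gaugedB_entry_eq (p := p) D.s_ne D.q_pow D.regular i h g
      refine ContinuousAt.congr (f := fun lam : ℂ =>
        (((i : ℂ) - 1 / (i : ℂ))⁻¹ * ((i : ℂ) * (i : ℂ)))⁻¹ *
          ((lam ^ 2 / s ^ 2 - s ^ 2 / lam ^ 2) * Q.eval (xVar lam))) ?_ ?_
      · have h₁ : ContinuousAt (fun mu : ℂ => mu ^ 2) mu := continuousAt_id.pow 2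
        exact continuousAt_const.mul (((h₁.div_const _).sub (continuousAt_const.div h₁
          (pow_ne_zero _ hm))).mul (Q.continuous.continuousAt.comp (continuousAt_xVar hm)))
      · filter_upwards [isOpen_ne.mem_nhds hm] with lam hl
        rw [← hQ lam hl, ← Matrix.transpose_apply (gaugedB s P lam (i : ℂ)),
          D.gaugedB_transpose i.2, Matrix.smul_apply, smul_eq_mul, inv_mul_cancel_left₀ hc])
    (fun lam mu hl hm =>
      (reflectionEq_boundaryMonodromy D.s_ne D.q_pow D.regular hl hm).fullTranspose)
    (fun lam hl hf => by
      rw [← fullTranspose_mul, boundaryMonodromy_mul D.s_ne D.q_pow D.regular D.inner D.a0_ne hl,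
        coefD_mul D.s_ne hl hf]
      exact fullTranspose_algebraMap _)
    (fun i mu hm => by
      rw [← D.gaugedB_transpose i.2, Matrix.vecMul_transpose]
      exact D.ket_eig i i.2 mu hm)

theorem rightLadder_B (D : SpectralData s P am bm a0 ℓ z ψ) (i : gaugeOrbit s P.gaugeBeta) (mu : ℂ)
    (v : State p N) : D.rightLadder.B i mu v = Matrix.mulVec (gaugedB s P mu i) v := by
  rw [← Matrix.vecMul_transpose, D.gaugedB_transpose i.2]
  rfl

theorem rightLadder_A (D : SpectralData s P am bm a0 ℓ z ψ) (i : gaugeOrbit s P.gaugeBeta) (mu : ℂ)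
    (v : State p N) : D.rightLadder.A i mu v = Matrix.mulVec (gaugedD s P mu i) v := by
  rw [← Matrix.vecMul_transpose, D.gaugedD_transpose i.2]
  rfl

theorem leftLadder_B (D : SpectralData s P am bm a0 ℓ z ψ) {bra : ℂ → State p N} {hne heig}
    (i : gaugeOrbit s P.gaugeBeta) (mu : ℂ) (v : State p N) :
    (D.leftLadder bra hne heig).B i mu v = Matrix.vecMul v (gaugedB s P mu i) := by
  rw [gaugedB_eq]
  rfl

theorem leftLadder_A (D : SpectralData s P am bm a0 ℓ z ψ) {bra : ℂ → State p N} {hne heig}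
    (i : gaugeOrbit s P.gaugeBeta) (mu : ℂ) (v : State p N) :
    (D.leftLadder bra hne heig).A i mu v =
      Matrix.vecMul v (gaugedA s P mu (i * (s ^ 2) ^ 2)) := by
  rw [gaugedA_eq D.s_ne P mu (D.orbit_ne i.2)]
  rfl

end SpectralData

end Spectral

end

end CyclicReflection

namespace CyclicReflection

noncomputable section

/-! ### Pairings of the left and right pseudo-eigenstates -/

section Pairing

variable {p N : ℕ} [NeZero p] {s : ℂ} {P : Params N} {am bm a0 ℓ : ℂ} {z : Fin N → ℂ}
  {ψ : ℂ → State p N}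

theorem fin_add_one_ne (hp : 1 < p) (x : Fin p) : x + 1 ≠ x := by
  intro h
  have h' := congrArg Fin.val (add_eq_left.1 h)
  rw [Fin.val_one', Fin.val_zero, Nat.mod_eq_of_lt hp] at h'
  omega

theorem fin_add_two_ne (hp : 2 < p) (x : Fin p) : x + 1 + 1 ≠ x := by
  intro h
  rw [add_assoc] at h
  have h' := congrArg Fin.val (add_eq_left.1 h)
  rw [Fin.val_add, Fin.val_one', Fin.val_zero, Nat.mod_eq_of_lt (by omega : 1 < p),
    Nat.mod_eq_of_lt hp] at h'
  omega

theorem finrank_state : Module.finrank ℂ (State p N) = Fintype.card (Config p N) :=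
  Module.finrank_fintype_fun_eq_card ℂ

/-- The product of the differences `x a - x b` over `b < a`. -/
def vandermondeProd (x : Fin N → ℂ) : ℂ := ∏ a, ∏ b ∈ Finset.Iio a, (x a - x b)

/-- As a function of one of its variables, the Vandermonde product is a multiple of the product of the
differences with the others. -/
theorem exists_vandermondeProd_update (x : Fin N → ℂ) (a : Fin N) :
    ∃ K : ℂ, ∀ t : ℂ, vandermondeProd (Function.update x a t) =
      K * ∏ n ∈ Finset.univ.erase a, (t - x n) := by
  refine ⟨(∏ c ∈ Finset.univ.erase a, ∏ b ∈ (Finset.Iio c).erase a, (x c - x b)) *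
    ∏ n ∈ Finset.univ.erase a, (if n < a then 1 else -1), fun t => ?_⟩
  have h₁ : ∏ b ∈ Finset.Iio a, (Function.update x a t a - Function.update x a t b) =
      ∏ n ∈ Finset.univ.erase a, (if n < a then t - x n else 1) := by
    rw [← Finset.prod_filter]
    refine Finset.prod_congr ?_ fun b hb => ?_
    · ext b
      simp only [Finset.mem_Iio, Finset.mem_filter, Finset.mem_erase, Finset.mem_univ, and_true]
      exact ⟨fun h => ⟨h.ne, h⟩, fun h => h.2⟩
    · rw [Function.update_self, Function.update_of_ne (Finset.mem_filter.1 hb).2.ne]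
  have h₂ : ∀ c ∈ Finset.univ.erase a,
      ∏ b ∈ Finset.Iio c, (Function.update x a t c - Function.update x a t b) =
        (∏ b ∈ (Finset.Iio c).erase a, (x c - x b)) * (if c < a then 1 else -(t - x c)) := by
    intro c hc
    have hca := Finset.ne_of_mem_erase hc
    have h₃ : ∏ b ∈ (Finset.Iio c).erase a, (Function.update x a t c - Function.update x a t b) =
        ∏ b ∈ (Finset.Iio c).erase a, (x c - x b) :=
      Finset.prod_congr rfl fun b hb => by
        rw [Function.update_of_ne hca, Function.update_of_ne (Finset.ne_of_mem_erase hb)]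
    rcases lt_or_gt_of_ne hca with h | h
    · rw [if_pos h, mul_one, ← h₃, Finset.erase_eq_of_notMem]
      simpa using h.le
    · rw [if_neg h.not_gt, ← h₃, ← Finset.prod_erase_mul _ _ (Finset.mem_Iio.2 h),
        Function.update_self, Function.update_of_ne hca, neg_sub]
  rw [vandermondeProd, ← Finset.mul_prod_erase _ _ (Finset.mem_univ a), h₁,
    Finset.prod_congr rfl h₂, Finset.prod_mul_distrib, mul_left_comm, mul_assoc]
  congr 1
  rw [← Finset.prod_mul_distrib, ← Finset.prod_mul_distrib]
  refine Finset.prod_congr rfl fun n _ => ?_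
  split_ifs <;> ring

/-- The matrix element between two states, as a functional of the operator. -/
def element (u v : State p N) : Op p N →ₗ[ℂ] ℂ where
  toFun M := u ⬝ᵥ Matrix.mulVec M v
  map_add' M M' := by rw [Matrix.add_mulVec, dotProduct_add]
  map_smul' c M := by rw [Matrix.smul_mulVec, dotProduct_smul, RingHom.id_apply]

theorem element_apply (u v : State p N) (M : Op p N) :
    element u v M = u ⬝ᵥ Matrix.mulVec M v := rfl

theorem element_one (u v : State p N) : element u v 1 = u ⬝ᵥ v := by
  rw [element_apply, Matrix.one_mulVec]

namespace SpectralData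

/-- The next point of the orbit. -/
def next (D : SpectralData s P am bm a0 ℓ z ψ) (i : gaugeOrbit s P.gaugeBeta) :
    gaugeOrbit s P.gaugeBeta := ⟨i * s ^ 4, mul_mem_gaugeOrbit D.s_ne i.2⟩

/-- The previous point of the orbit. -/
def prev (D : SpectralData s P am bm a0 ℓ z ψ) (i : gaugeOrbit s P.gaugeBeta) :
    gaugeOrbit s P.gaugeBeta := ⟨i / s ^ 4, div_mem_gaugeOrbit D.s_ne i.2⟩

theorem next_prev (D : SpectralData s P am bm a0 ℓ z ψ) (i : gaugeOrbit s P.gaugeBeta) :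
    D.next (D.prev i) = i := Subtype.ext (div_mul_cancel₀ _ (pow_ne_zero 4 D.s_ne))

theorem prev_next (D : SpectralData s P am bm a0 ℓ z ψ) (i : gaugeOrbit s P.gaugeBeta) :
    D.prev (D.next i) = i := Subtype.ext (mul_div_cancel_right₀ _ (pow_ne_zero 4 D.s_ne))

/-- The right pseudo-eigenvectors, with arbitrary normalization. -/
def ket (D : SpectralData s P am bm a0 ℓ z ψ) (h : Config p N) (i : gaugeOrbit s P.gaugeBeta) :
    State p N := D.rightLadder.vec (fun a => (h a : ℕ)) i

theorem mulVec_ket (D : SpectralData s P am bm a0 ℓ z ψ) (h : Config p N)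
    (i : gaugeOrbit s P.gaugeBeta) {mu : ℂ} (hm : mu ≠ 0) :
    Matrix.mulVec (gaugedB s P mu i) (D.ket h i) =
      eigenFun (s ^ 2) z ℓ (fun a => (h a : ℕ)) mu • D.ket h (D.next i) := by
  rw [← D.rightLadder_B]
  exact Ladder.isEig_vec _ i mu hm

theorem linearIndependent_ket (D : SpectralData s P am bm a0 ℓ z ψ)
    (i : gaugeOrbit s P.gaugeBeta) : LinearIndependent ℂ fun h : Config p N => D.ket h i :=
  Ladder.linearIndependent_vec i

theorem span_ket (D : SpectralData s P am bm a0 ℓ z ψ) (i : gaugeOrbit s P.gaugeBeta) :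
    Submodule.span ℂ (Set.range fun h : Config p N => D.ket h i) = ⊤ :=
  Ladder.span_vec finrank_state i

theorem ext_ket (D : SpectralData s P am bm a0 ℓ z ψ) (i : gaugeOrbit s P.gaugeBeta)
    {u v : State p N} (h : ∀ k, u ⬝ᵥ D.ket k i = v ⬝ᵥ D.ket k i) : u = v := by
  refine dotProduct_eq _ _ fun w => ?_
  have hw : w ∈ Submodule.span ℂ (Set.range fun h : Config p N => D.ket h i) := by
    rw [D.span_ket i]
    trivial
  induction hw using Submodule.span_induction with
  | mem x hx =>
    obtain ⟨k, rfl⟩ := hx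
    exact h k
  | zero => simp
  | add x y _ _ hx hy => rw [dotProduct_add, dotProduct_add, hx, hy]
  | smul c x _ hx => rw [dotProduct_smul, dotProduct_smul, hx]

/-- The pseudo-vacuum covectors are the elements dual to the pseudo-vacuum in the bases of right
pseudo-eigenvectors. -/
theorem exists_bra (D : SpectralData s P am bm a0 ℓ z ψ) :
    ∃ bra : ℂ → State p N, ∀ (i : gaugeOrbit s P.gaugeBeta) (h : Config p N),
      bra i ⬝ᵥ D.ket h (D.next i) = if h = 0 then 1 else 0 := by
  have key : ∀ i : gaugeOrbit s P.gaugeBeta, ∃ u : State p N, ∀ h : Config p N,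
      u ⬝ᵥ D.ket h i = if h = 0 then 1 else 0 := by
    intro i
    let R : Op p N := Matrix.of fun g h => D.ket h i g
    have hR : IsUnit R := Matrix.linearIndependent_cols_iff_isUnit.1 (D.linearIndependent_ket i)
    refine ⟨R⁻¹ 0, fun h => ?_⟩
    have := congrFun (congrFun (Matrix.nonsing_inv_mul R
      ((Matrix.isUnit_iff_isUnit_det _).1 hR)) 0) h
    rw [Matrix.mul_apply, Matrix.one_apply] at this
    simp only [eq_comm (a := h)]
    exact this
  choose u hu using key
  classical
  refine ⟨fun bt => if h : bt ∈ gaugeOrbit s P.gaugeBeta then u (D.next ⟨bt, h⟩) else 0,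
    fun i h => ?_⟩
  simp only [i.2, dif_pos]
  exact hu _ h

theorem bra_ne (D : SpectralData s P am bm a0 ℓ z ψ) {bra : ℂ → State p N}
    (hb : ∀ (i : gaugeOrbit s P.gaugeBeta) (h : Config p N),
      bra i ⬝ᵥ D.ket h (D.next i) = if h = 0 then 1 else 0) :
    ∀ bt ∈ gaugeOrbit s P.gaugeBeta, bra bt ≠ 0 := by
  intro bt hbt h0
  have := hb ⟨bt, hbt⟩ 0
  rw [h0, zero_dotProduct, if_pos rfl] at this
  exact zero_ne_one this

theorem bra_eig (D : SpectralData s P am bm a0 ℓ z ψ) {bra : ℂ → State p N}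
    (hb : ∀ (i : gaugeOrbit s P.gaugeBeta) (h : Config p N),
      bra i ⬝ᵥ D.ket h (D.next i) = if h = 0 then 1 else 0) :
    ∀ bt ∈ gaugeOrbit s P.gaugeBeta, ∀ mu, mu ≠ 0 →
      Matrix.vecMul (bra bt) (gaugedB s P mu bt) = eigenFun (s ^ 2) z ℓ 0 mu • bra (bt / s ^ 4) := by
  intro bt hbt mu hm
  set i : gaugeOrbit s P.gaugeBeta := ⟨bt, hbt⟩ with hi
  refine D.ext_ket i fun h => ?_
  have h₁ := hb (D.prev i) h
  rw [D.next_prev] at h₁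
  have h₂ : bra (bt / s ^ 4) ⬝ᵥ D.ket h i = if h = 0 then 1 else 0 := h₁
  rw [← Matrix.dotProduct_mulVec, D.mulVec_ket h i hm, dotProduct_smul, smul_dotProduct, h₂, hb i]
  split_ifs with h0
  · subst h0
    rfl
  · simp

variable {bra : ℂ → State p N}

section

variable (D : SpectralData s P am bm a0 ℓ z ψ)
  (hb : ∀ (i : gaugeOrbit s P.gaugeBeta) (h : Config p N),
    bra i ⬝ᵥ D.ket h (D.next i) = if h = 0 then 1 else 0)

/-- The ladder of covectors that starts from the pseudo-vacuum covectors. -/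
def braLadder : Ladder p N (gaugeOrbit s P.gaugeBeta) (State p N) :=
  D.leftLadder bra (D.bra_ne hb) (D.bra_eig hb)

/-- The left pseudo-eigenvectors, with arbitrary normalization. -/
def bras (h : Config p N) (i : gaugeOrbit s P.gaugeBeta) : State p N :=
  (D.braLadder hb).vec (fun a => (h a : ℕ)) i

theorem vecMul_bras (h : Config p N) (i : gaugeOrbit s P.gaugeBeta) {mu : ℂ} (hm : mu ≠ 0) :
    Matrix.vecMul (D.bras hb h i) (gaugedB s P mu i) =
      eigenFun (s ^ 2) z ℓ (fun a => (h a : ℕ)) mu • D.bras hb h (D.prev i) := by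
  rw [← D.leftLadder_B (hne := D.bra_ne hb) (heig := D.bra_eig hb)]
  exact Ladder.isEig_vec (L := D.braLadder hb) _ i mu hm

theorem bras_zero (i : gaugeOrbit s P.gaugeBeta) : D.bras hb 0 i = bra i := by
  rw [bras, ← Ladder.state_eq_vec (L := D.braLadder hb) (w := []) (by simp)]
  rfl

theorem ket_zero (i : gaugeOrbit s P.gaugeBeta) : D.ket 0 i = ψ i := by
  rw [ket, ← Ladder.state_eq_vec (L := D.rightLadder) (w := []) (by simp)]
  rfl

/-- Both states are pseudo-eigenvectors of the same operator, and their pseudo-eigenvalues have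
different zeros. -/
theorem bras_dotProduct_ket {h k : Config p N} (hk : h ≠ k) (i : gaugeOrbit s P.gaugeBeta) :
    D.bras hb h i ⬝ᵥ D.ket k (D.next i) = 0 := by
  obtain ⟨n, hn⟩ := Function.ne_iff.1 hk
  have hZ := D.zq_ne n (k n)
  have h₁ := D.vecMul_bras hb h (D.next i) hZ
  have h₂ := D.mulVec_ket k (D.next i) hZ
  have h₃ : eigenFun (s ^ 2) z ℓ (fun a => (k a : ℕ)) (z n * (s ^ 2) ^ (k n : ℕ)) = 0 :=
    Ladder.eigenFun_eq_zero (L := D.rightLadder) n rfl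
  have h₄ : eigenFun (s ^ 2) z ℓ (fun a => (h a : ℕ)) (z n * (s ^ 2) ^ (k n : ℕ)) ≠ 0 :=
    Ladder.eigenFun_ne_zero (L := D.rightLadder) i n (Ladder.natVal_ne_modEq hn)
  rw [h₃, zero_smul] at h₂
  have h₅ := Matrix.dotProduct_mulVec (D.bras hb h (D.next i))
    (gaugedB s P (z n * (s ^ 2) ^ (k n : ℕ)) (D.next i)) (D.ket k (D.next i))
  rw [h₁, h₂, dotProduct_zero, smul_dotProduct, D.prev_next, smul_eq_mul] at h₅
  exact (mul_eq_zero.1 h₅.symm).resolve_left h₄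

theorem exists_bras_shift (i : gaugeOrbit s P.gaugeBeta) :
    ∃ t : Fin N → ℂ, (∀ a, t a ≠ 0) ∧ ∀ (h : Config p N) (a : Fin N),
      Matrix.vecMul (D.bras hb h i) (gaugedA s P (z a * (s ^ 2) ^ (h a : ℕ)) (i * (s ^ 2) ^ 2)) =
        (coefA s P am bm a0 (z a * (s ^ 2) ^ (h a : ℕ)) * lowerFactor t h a) •
          D.bras hb (lower h a) i ∧
      Matrix.vecMul (D.bras hb h i)
          (gaugedA s P (1 / (z a * (s ^ 2) ^ (h a : ℕ))) (i * (s ^ 2) ^ 2)) =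
        (coefA s P am bm a0 (1 / (z a * (s ^ 2) ^ (h a : ℕ))) * raiseFactor t h a) •
          D.bras hb (raise h a) i := by
  choose t ht0 ht using fun a => Ladder.exists_wrap (L := D.braLadder hb) finrank_state a i
  refine ⟨t, ht0, fun h a => ⟨?_, ?_⟩⟩
  · rw [← D.leftLadder_A (hne := D.bra_ne hb) (heig := D.bra_eig hb)]
    exact Ladder.lower_config (L := D.braLadder hb) ht0 ht h a
  · rw [← D.leftLadder_A (hne := D.bra_ne hb) (heig := D.bra_eig hb)]
    exact Ladder.raise_config (L := D.braLadder hb) ht h a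

theorem exists_ket_shift (i : gaugeOrbit s P.gaugeBeta) :
    ∃ t : Fin N → ℂ, (∀ a, t a ≠ 0) ∧ ∀ (h : Config p N) (a : Fin N),
      Matrix.mulVec (gaugedD s P (z a * (s ^ 2) ^ (h a : ℕ)) i) (D.ket h i) =
        (coefD s P am bm a0 (z a * (s ^ 2) ^ (h a : ℕ)) * lowerFactor t h a) •
          D.ket (lower h a) i ∧
      Matrix.mulVec (gaugedD s P (1 / (z a * (s ^ 2) ^ (h a : ℕ))) i) (D.ket h i) =
        (coefD s P am bm a0 (1 / (z a * (s ^ 2) ^ (h a : ℕ))) * raiseFactor t h a) •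
          D.ket (raise h a) i := by
  choose t ht0 ht using fun a => Ladder.exists_wrap (L := D.rightLadder) finrank_state a i
  refine ⟨t, ht0, fun h a => ⟨?_, ?_⟩⟩
  · rw [← D.rightLadder_A]
    exact Ladder.lower_config (L := D.rightLadder) ht0 ht h a
  · rw [← D.rightLadder_A]
    exact Ladder.raise_config (L := D.rightLadder) ht h a

/-- The recursion of the pairings in one label: the same matrix element of the monodromy is computed
from the action of `𝒜_-` on the covector and from the action of `𝒟_-` on the vector. -/
theorem bras_dotProduct_ket_raise (i : gaugeOrbit s P.gaugeBeta) (h : Config p N) (a : Fin N)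
    (ha : (h a : ℕ) + 1 < p) :
    (D.bras hb (raise h a) i ⬝ᵥ D.ket (raise h a) (D.next i)) *
        ∏ n ∈ Finset.univ.erase a, (xVar (z a * (s ^ 2) ^ ((h a : ℕ) + 1)) -
          xVar (z n * (s ^ 2) ^ (h n : ℕ))) =
      (D.bras hb h i ⬝ᵥ D.ket h (D.next i)) *
        ∏ n ∈ Finset.univ.erase a, (xVar (z a * (s ^ 2) ^ (h a : ℕ)) -
          xVar (z n * (s ^ 2) ^ (h n : ℕ))) := by
  have hs := D.s_ne
  have hp2 : 2 < p := by
    obtain ⟨k, hk⟩ := D.odd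
    omega
  have hp1 : 1 < p := by omega
  set h' := raise h a with hh'
  have hh'a : h' a = h a + 1 := by simp [hh', raise]
  have hh'v : (h' a : ℕ) = (h a : ℕ) + 1 := by
    rw [hh'a, Fin.val_add, Fin.val_one', Nat.add_mod_mod, Nat.mod_eq_of_lt ha]
  have hh'n : ∀ n, n ≠ a → h' n = h n := fun n hn => by simp [hh', raise, Function.update_of_ne hn]
  have hlow : lower h' a = h := by
    ext n
    rcases eq_or_ne n a with rfl | hn
    · simp [lower, hh'a]
    · simp [lower, Function.update_of_ne hn, hh'n n hn]
  have hne : h ≠ h' := fun e => fin_add_one_ne hp1 (h a) (by rw [← hh'a, ← e])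
  set u := D.bras hb h i with hu
  set v := D.ket h' (D.next i) with hv
  obtain ⟨M, hM⟩ := exists_gauged_element_eq (p := p) hs D.q_pow D.regular
  have hφ : element u v 1 = 0 := by
    rw [element_one]
    exact D.bras_dotProduct_ket hb hne i
  set w : Fin N → ℂ := fun n => z n * (s ^ 2) ^ (h n : ℕ) with hw
  have hsq : s ^ 4 = (s ^ 2) ^ 2 := by ring
  have hw0 : ∀ n, w n ≠ 0 := fun n => D.zq_ne n _
  have hsep : ∀ m n, m ≠ n → ∀ k : ℕ, xVar (z m * (s ^ 2) ^ k) ≠ xVar (w n) := fun m n hmn k e =>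
    hmn (D.sep _ _ _ _ e).1
  have hwn : ∀ ρ : ℂ, (∃ k : ℕ, xVar ρ = xVar (z a * (s ^ 2) ^ k)) → ∀ n, n ≠ a →
      w n ≠ 0 ∧ w n ^ 4 ≠ 1 ∧ w n ^ 4 ≠ s ^ 4 ∧ w n ^ 4 * s ^ 4 ≠ 1 ∧
        xVar ρ ≠ xVar (w n) ∧ ∀ m, m ≠ a → m ≠ n → xVar (w m) ≠ xVar (w n) := by
    rintro ρ ⟨k, hk⟩ n hn
    refine ⟨hw0 n, ?_, ?_, ?_, ?_, fun m _ hm => hsep m n hm _⟩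
    · have := D.zq_four_ne n (h n) 0
      rwa [pow_zero] at this
    · rw [hsq]
      exact D.zq_four_ne n (h n) 2
    · rw [hsq]
      exact D.zq_four_mul_ne n (h n) 2
    · rw [hk]
      exact hsep a n hn.symm k
  have hd := D.orbit_sub_ne i.2
  have hd' := D.orbit_sub_ne (D.next i).2
  have hi := D.orbit_ne i.2
  have hj := D.orbit_ne (D.next i).2
  have hA : ∀ lam, element u v (gauged s P.gaugeAlpha lam i (1 / (i : ℂ))
      (boundaryMonodromy s P lam)) = ((i : ℂ) - 1 / (i : ℂ)) *
        (Matrix.vecMul u (gaugedA s P lam (i * (s ^ 2) ^ 2)) ⬝ᵥ v) := by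
    intro lam
    rw [← Matrix.dotProduct_mulVec, ← element_apply, gaugedA_eq hs P lam hi, map_smul, smul_eq_mul,
      mul_inv_cancel_left₀ hd]
  have hD : ∀ lam, element u v (gauged s P.gaugeAlpha lam (1 / (D.next i : ℂ)) (D.next i)
      (boundaryMonodromy s P lam)) = -((D.next i : ℂ) - 1 / (D.next i : ℂ)) *
        (u ⬝ᵥ Matrix.mulVec (gaugedD s P lam (D.next i)) v) := by
    intro lam
    rw [← element_apply, gaugedD_eq P lam hj, map_neg, map_smul, smul_eq_mul, neg_mul_neg,
      mul_inv_cancel_left₀ hd']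
  obtain ⟨t, -, ht⟩ := D.exists_bras_shift hb i
  obtain ⟨t', -, ht'⟩ := D.exists_ket_shift (D.next i)
  -- The element of `𝒜_-` at the inverse of the zero with label `h a`.
  have ha4 := D.zq_four_ne a (h a) 2
  rw [← hsq] at ha4
  have h₁ := hM (element u v) hφ P.gaugeAlpha i (1 / (i : ℂ)) w a (w a) (hw0 a) ha4
    (hwn _ ⟨_, rfl⟩)
    (by
      rw [hA, (ht h a).1, smul_dotProduct, D.bras_dotProduct_ket hb, smul_zero, mul_zero]
      intro e
      refine fin_add_two_ne hp2 (h a - 1) ?_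
      rw [sub_add_cancel, ← hh'a, ← e]
      simp [lower])
    (fun n hn => by
      refine ⟨?_, ?_⟩
      · rw [hA, (ht h n).1, smul_dotProduct, D.bras_dotProduct_ket hb, smul_zero, mul_zero]
        intro e
        refine fin_add_one_ne hp1 (h a) ?_
        rw [← hh'a, ← e]
        simp [lower, Function.update_of_ne hn.symm]
      · rw [hA, (ht h n).2, smul_dotProduct, D.bras_dotProduct_ket hb, smul_zero, mul_zero]
        intro e
        refine fin_add_one_ne hp1 (h a) ?_
        rw [← hh'a, ← e]
        simp [raise, Function.update_of_ne hn.symm])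
    (1 / w a) (one_div_ne_zero (hw0 a))
  rw [hA, (ht h a).2, raiseFactor, if_pos ha, mul_one, smul_dotProduct, smul_eq_mul, xVar_inv] at h₁
  -- The element of `𝒟_-` at the zero with label `h a + 1`.
  have hZ' := D.zq_ne a (h' a)
  have hwh : ∀ n, n ≠ a → w n = z n * (s ^ 2) ^ (h' n : ℕ) := fun n hn => by
    simp only [hw, hh'n n hn]
  have h₂ := hM (element u v) hφ P.gaugeAlpha (1 / (D.next i : ℂ)) (D.next i) w a
    (1 / (z a * (s ^ 2) ^ (h' a : ℕ))) (one_div_ne_zero hZ')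
    (by
      intro e
      apply D.zq_four_mul_ne a (h' a) 2
      rw [← hsq]
      generalize z a * (s ^ 2) ^ (h' a : ℕ) = Z at *
      field_simp at e
      exact e.symm)
    (hwn _ ⟨_, xVar_inv _⟩)
    (by
      rw [hD, (ht' h' a).2, dotProduct_smul, D.bras_dotProduct_ket hb, smul_zero, mul_zero]
      intro e
      refine fin_add_two_ne hp2 (h a) ?_
      rw [← hh'a]
      conv_rhs => rw [e]
      simp [raise])
    (fun n hn => by
      rw [hwh n hn]
      refine ⟨?_, ?_⟩
      · rw [hD, (ht' h' n).1, dotProduct_smul, D.bras_dotProduct_ket hb, smul_zero, mul_zero]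
        intro e
        refine fin_add_one_ne hp1 (h a) ?_
        rw [← hh'a]
        conv_rhs => rw [e]
        simp [lower, Function.update_of_ne hn.symm]
      · rw [hD, (ht' h' n).2, dotProduct_smul, D.bras_dotProduct_ket hb, smul_zero, mul_zero]
        intro e
        refine fin_add_one_ne hp1 (h a) ?_
        rw [← hh'a]
        conv_rhs => rw [e]
        simp [raise, Function.update_of_ne hn.symm])
    (z a * (s ^ 2) ^ (h' a : ℕ)) hZ'
  have hpos : 0 < (h' a : ℕ) := by omega
  rw [hD, (ht' h' a).1, lowerFactor, if_pos hpos, mul_one, dotProduct_smul, smul_eq_mul, hlow] at h₂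
  have hZe : z a * (s ^ 2) ^ (h' a : ℕ) = s ^ 2 * w a := by
    rw [hh'v, pow_succ]
    ring
  rw [← hh'v]
  rw [hZe] at h₂ ⊢
  -- Both elements are multiples of the same number, which is eliminated.
  have hc := D.coefA_inv_zq_ne a (h a)
  have hk := D.coefD_zq_ne a (h' a)
  rw [hZe] at hk
  change coefA s P am bm a0 (1 / w a) ≠ 0 at hc
  change _ = _ * ∏ n ∈ Finset.univ.erase a, (xVar (w a) - xVar (w n))
  change _ * ∏ n ∈ Finset.univ.erase a, (xVar (s ^ 2 * w a) - xVar (w n)) = _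
  have hw4 := D.zq_four_ne a (h a) 0
  rw [pow_zero] at hw4
  change w a ^ 4 ≠ 1 at hw4
  have hwa := hw0 a
  have e₁ : s ^ 2 / (s ^ 2 * w a) = 1 / w a := by field_simp
  have hk₁ : (s ^ 2 * w a) ^ 2 - 1 / (s ^ 2 * w a) ^ 2 ≠ 0 := by
    unfold coefD at hk
    exact (div_ne_zero_iff.1 (mul_ne_zero_iff.1 hk).1).1
  unfold coefD at h₂
  rw [e₁] at h₂
  generalize coefA s P am bm a0 (1 / w a) = cA at *
  generalize ∏ n ∈ Finset.univ.erase a, (xVar (w a) - xVar (w n)) = P0 at *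
  generalize ∏ n ∈ Finset.univ.erase a, (xVar (s ^ 2 * w a) - xVar (w n)) = P1 at *
  change _ = _ at h₁
  generalize (element u v) M = m at *
  generalize D.bras hb h' i ⬝ᵥ v = M' at *
  generalize u ⬝ᵥ D.ket h (D.next i) = M₀ at *
  generalize w a = y at *
  generalize (i : ℂ) = b at *
  generalize (D.next i : ℂ) = b' at *
  have hy4 : y ^ 2 - 1 / y ^ 2 ≠ 0 := by
    intro e
    apply hw4
    field_simp at e
    linear_combination e
  have hcA : cA * M' = m * P0 * ((1 / y ^ 4 - s ^ 4) * (1 / y ^ 2 - y ^ 2) * y ^ 2 / s) := by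
    refine mul_left_cancel₀ hd ?_
    have e₂ : ((1 / y) ^ 4 - s ^ 4) * ((1 / y) ^ 2 - y ^ 2) *
        (-(1 / b / s) * (1 / y) ^ 2 + b / (s * y ^ 2)) / (1 / y) ^ 4 =
        (b - 1 / b) * ((1 / y ^ 4 - s ^ 4) * (1 / y ^ 2 - y ^ 2) * y ^ 2 / s) := by
      field_simp
      ring
    rw [e₂] at h₁
    linear_combination h₁
  have hcD : cA * M₀ = m * P1 * ((1 / y ^ 4 - s ^ 4) * (1 / y ^ 2 - y ^ 2) * y ^ 2 / s) := by
    have e₂ : ((s ^ 2 * y) ^ 4 - s ^ 4) * ((s ^ 2 * y) ^ 2 - (1 / (s ^ 2 * y)) ^ 2) *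
        (-(b' / s) * (s ^ 2 * y) ^ 2 + 1 / b' / (s * (1 / (s ^ 2 * y)) ^ 2)) / (s ^ 2 * y) ^ 4 =
        -(b' - 1 / b') * ((s ^ 2 * y) ^ 2 - 1 / (s ^ 2 * y) ^ 2) *
          (((s ^ 2 * y) ^ 4 - s ^ 4) / (s * (s ^ 2 * y) ^ 2)) := by
      field_simp
      ring
    have e₃ : (s ^ 2 * y) ^ 2 / (s ^ 2) ^ 2 - (s ^ 2) ^ 2 / (s ^ 2 * y) ^ 2 = y ^ 2 - 1 / y ^ 2 := by
      field_simp
    rw [e₂, e₃] at h₂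
    have e₄ : ((s ^ 2 * y) ^ 4 - s ^ 4) / (s * (s ^ 2 * y) ^ 2) * (y ^ 2 - 1 / y ^ 2) =
        (1 / y ^ 4 - s ^ 4) * (1 / y ^ 2 - y ^ 2) * y ^ 2 / s := by
      field_simp
      ring
    rw [← e₄]
    generalize (s ^ 2 * y) ^ 2 - 1 / (s ^ 2 * y) ^ 2 = k₁ at *
    generalize y ^ 2 - 1 / y ^ 2 = k₂ at *
    generalize ((s ^ 2 * y) ^ 4 - s ^ 4) / (s * (s ^ 2 * y) ^ 2) = W at *
    generalize b' - 1 / b' = d' at *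
    have e₅ : d' * k₁ * (cA * M₀) = d' * k₁ * (m * P1 * (W * k₂)) := by
      have e₆ := div_mul_cancel₀ k₁ hy4
      linear_combination -k₂ * h₂ - d' * cA * M₀ * e₆
    exact mul_left_cancel₀ (mul_ne_zero hd' hk₁) e₅
  refine mul_left_cancel₀ hc ?_
  rw [← mul_assoc, hcA, ← mul_assoc, hcD]
  ring

/-- The pairings are inverse to Vandermonde products, by induction on the labels starting from the
pairing `1` of the pseudo-vacua. -/
theorem bras_dotProduct_ket_self (i : gaugeOrbit s P.gaugeBeta) (h : Config p N) :
    (D.bras hb h i ⬝ᵥ D.ket h (D.next i)) *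
        vandermondeProd (fun n => xVar (z n * (s ^ 2) ^ (h n : ℕ))) =
      vandermondeProd (fun n => xVar (z n)) := by
  induction hsum : ∑ n, (h n : ℕ) using Nat.strong_induction_on generalizing h with
  | _ m ih =>
  by_cases h0 : h = 0
  · subst h0
    rw [bras_zero, hb i 0, if_pos rfl, one_mul]
    simp
  obtain ⟨a, ha⟩ := Function.ne_iff.1 h0
  have hpos : 0 < (h a : ℕ) := Fin.pos_iff_ne_zero.2 ha
  have hlt := (h a).2
  set g : Config p N := Function.update h a ⟨(h a : ℕ) - 1, by omega⟩ with hg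
  have hga : (g a : ℕ) = (h a : ℕ) - 1 := by simp [hg]
  have hgn : ∀ n, n ≠ a → g n = h n := fun n hn => by simp [hg, Function.update_of_ne hn]
  have hgr : raise g a = h := by
    ext n
    rcases eq_or_ne n a with rfl | hn
    · rw [raise, Function.update_self, Fin.val_add, Fin.val_one', Nat.add_mod_mod, hga,
        Nat.sub_add_cancel hpos, Nat.mod_eq_of_lt hlt]
    · rw [raise, Function.update_of_ne hn, hgn n hn]
  have hgs : ∑ n, (g n : ℕ) < m := by
    rw [← hsum]
    refine Finset.sum_lt_sum (fun n _ => ?_) ⟨a, Finset.mem_univ a, by omega⟩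
    rcases eq_or_ne n a with rfl | hn
    · omega
    · rw [hgn n hn]
  have key := D.bras_dotProduct_ket_raise hb i g a (by omega)
  rw [hgr, hga, Nat.sub_add_cancel hpos] at key
  rw [← ih _ hgs g rfl]
  obtain ⟨K, hK⟩ := exists_vandermondeProd_update
    (fun n => xVar (z n * (s ^ 2) ^ (g n : ℕ))) a
  have h₁ := hK (xVar (z a * (s ^ 2) ^ (h a : ℕ)))
  have h₂ := hK (xVar (z a * (s ^ 2) ^ (g a : ℕ)))
  rw [Function.update_eq_self] at h₂
  have e : Function.update (fun n => xVar (z n * (s ^ 2) ^ (g n : ℕ))) a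
      (xVar (z a * (s ^ 2) ^ (h a : ℕ))) = fun n => xVar (z n * (s ^ 2) ^ (h n : ℕ)) := by
    ext n
    rcases eq_or_ne n a with rfl | hn
    · rw [Function.update_self]
    · rw [Function.update_of_ne hn, hgn n hn]
  rw [e] at h₁
  rw [h₁, h₂, hga]
  linear_combination K * key

end

end SpectralData

end Pairing

end

end CyclicReflection

namespace CyclicReflection

noncomputable section

/-! ### The separated bases in general position -/

section Words

variable {p N : ℕ} [NeZero p] {ι : Type*}

/-- The product of the operators that raise the labels in order, acting on a row. -/
theorem exists_vecMul_eq_state (L : Ladder p N ι (State p N)) (i : ι) (M : Fin N → ℕ → Op p N)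
    (hM : ∀ n w, Matrix.vecMul (L.state w i) (M n (w.count n)) = L.state (n :: w) i)
    (h : Fin N → ℕ) (l : List (Fin N)) (hl : l.Nodup) (w : List (Fin N))
    (hw : ∀ n ∈ l, w.count n = 0) :
    ∃ w' : List (Fin N), (∀ n, w'.count n = w.count n + if n ∈ l then h n else 0) ∧
      Matrix.vecMul (L.state w i) (l.map fun n => ((List.range (h n)).map (M n)).prod).prod =
        L.state w' i := by
  have block : ∀ (n : Fin N) (k : ℕ) (w : List (Fin N)), w.count n = 0 →
      Matrix.vecMul (L.state w i) ((List.range k).map (M n)).prod =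
        L.state (List.replicate k n ++ w) i := by
    intro n k w hw
    induction k with
    | zero => simp
    | succ k ih =>
      have hc : (List.replicate k n ++ w).count n = k := by simp [hw]
      have := hM n (List.replicate k n ++ w)
      rw [hc] at this
      rw [List.range_succ, List.map_append, List.prod_append, ← Matrix.vecMul_vecMul, ih,
        List.map_singleton, List.prod_singleton, this, List.replicate_succ, List.cons_append]
  induction l generalizing w with
  | nil => exact ⟨w, by simp, by simp⟩
  | cons a l ih =>
    obtain ⟨ha, hl⟩ := List.nodup_cons.1 hl
    obtain ⟨w', h₁, h₂⟩ := ih hl (List.replicate (h a) a ++ w) fun n hn => by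
      have hna : a ≠ n := fun e => ha (e ▸ hn)
      simp [List.count_replicate, hna, hw n (List.mem_cons_of_mem _ hn)]
    refine ⟨w', fun n => ?_, ?_⟩
    · rw [h₁, List.count_append, List.count_replicate]
      rcases eq_or_ne a n with rfl | hna
      · simp [ha, add_comm]
      · simp [hna, hna.symm]
    · rw [List.map_cons, List.prod_cons, ← Matrix.vecMul_vecMul,
        block a (h a) w (hw a List.mem_cons_self), h₂]

/-- The product of the operators that raise the labels in order, acting on a column. -/
theorem exists_mulVec_eq_state (L : Ladder p N ι (State p N)) (i : ι) (M : Fin N → ℕ → Op p N)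
    (hM : ∀ n w, Matrix.mulVec (M n (w.count n)) (L.state w i) = L.state (n :: w) i)
    (h : Fin N → ℕ) (l : List (Fin N)) (hl : l.Nodup) :
    ∃ w : List (Fin N), (∀ n, w.count n = if n ∈ l then h n else 0) ∧
      Matrix.mulVec (l.map fun n => ((List.range (h n)).reverse.map (M n)).prod).prod
        (L.state [] i) = L.state w i := by
  have block : ∀ (n : Fin N) (k : ℕ) (w : List (Fin N)), w.count n = 0 →
      Matrix.mulVec ((List.range k).reverse.map (M n)).prod (L.state w i) =
        L.state (List.replicate k n ++ w) i := by
    intro n k w hw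
    induction k with
    | zero => simp
    | succ k ih =>
      have hc : (List.replicate k n ++ w).count n = k := by simp [hw]
      have := hM n (List.replicate k n ++ w)
      rw [hc] at this
      rw [List.range_succ, List.reverse_append, List.reverse_singleton, List.singleton_append,
        List.map_cons, List.prod_cons, ← Matrix.mulVec_mulVec, ih, this, List.replicate_succ,
        List.cons_append]
  induction l with
  | nil => exact ⟨[], by simp, by simp⟩
  | cons a l ih =>
    obtain ⟨ha, hl⟩ := List.nodup_cons.1 hl
    obtain ⟨w, h₁, h₂⟩ := ih hl
    refine ⟨List.replicate (h a) a ++ w, fun n => ?_, ?_⟩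
    · rw [List.count_append, List.count_replicate, h₁]
      rcases eq_or_ne a n with rfl | hna
      · simp [ha]
      · simp [hna, hna.symm]
    · rw [List.map_cons, List.prod_cons, ← Matrix.mulVec_mulVec, h₂,
        block a (h a) w (by rw [h₁, if_neg ha])]

end Words

section Separation

variable {p N : ℕ} [NeZero p] {s : ℂ} {P : Params N} {am bm a0 ℓ : ℂ} {z : Fin N → ℂ}
  {ψ : ℂ → State p N}

namespace SpectralData

theorem vandermondeProd_ne (D : SpectralData s P am bm a0 ℓ z ψ) :
    vandermondeProd (fun n => xVar (z n)) ≠ 0 := by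
  refine Finset.prod_ne_zero_iff.2 fun a _ => Finset.prod_ne_zero_iff.2 fun b hb e => ?_
  have := (D.sep a b 0 0 (by simpa using sub_eq_zero.1 e)).1
  exact (Finset.mem_Iio.1 hb).ne this.symm

/-- The pseudo-vacua and zeros, as functions of the gauge parameter. -/
def pseudoData (bra ψ : ℂ → State p N) (ℓ : ℂ) (z : Fin N → ℂ) : PseudoData p N where
  bra := bra
  ket := ψ
  lead _ := ℓ
  zero _ := z

variable {bra : ℂ → State p N}

theorem eigenvalue_eq (D : SpectralData s P am bm a0 ℓ z ψ) (h : Fin N → ℕ) {lam : ℂ}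
    (hl : lam ≠ 0) (bt : ℂ) :
    (pseudoData bra ψ ℓ z).eigenvalue s h lam bt = eigenFun (s ^ 2) z ℓ h lam := by
  rw [PseudoData.eigenvalue, eigenFun]
  congr 1
  refine Finset.prod_congr rfl fun n _ => ?_
  have hZ := D.zq_ne n (h n)
  change (lam / (z n * (s ^ 2) ^ h n) - z n * (s ^ 2) ^ h n / lam) *
    (lam * (z n * (s ^ 2) ^ h n) - 1 / (lam * (z n * (s ^ 2) ^ h n))) = _
  generalize z n * (s ^ 2) ^ h n = Z at *
  unfold xVar
  field_simp
  ring

theorem leftState_eq (D : SpectralData s P am bm a0 ℓ z ψ)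
    (hb : ∀ (i : gaugeOrbit s P.gaugeBeta) (h : Config p N),
      bra i ⬝ᵥ D.ket h (D.next i) = if h = 0 then 1 else 0)
    (i : gaugeOrbit s P.gaugeBeta) (h : Config p N) :
    Matrix.vecMul (bra i) ((pseudoData bra ψ ℓ z).leftProduct s P am bm a0 i h) =
      D.bras hb h i := by
  have key := exists_vecMul_eq_state (D.braLadder hb) i
    (fun n k => (coefA s P am bm a0 (1 / (z n * (s ^ 2) ^ k)))⁻¹ •
      (gaugedA s P (1 / (z n * (s ^ 2) ^ k)) (i * (s ^ 2) ^ 2) : Op p N)) (fun n w => ?_)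
    (fun n => (h n : ℕ)) (List.finRange N) (List.nodup_finRange N) [] (by simp)
  · obtain ⟨w, hw, e⟩ := key
    rw [bras, ← Ladder.state_eq_vec (L := D.braLadder hb) (w := w) (by simpa using hw), ← e,
      PseudoData.leftProduct, List.ofFn_eq_map]
    rfl
  · rw [Matrix.vecMul_smul, ← D.leftLadder_A (hne := D.bra_ne hb) (heig := D.bra_eig hb)]
    rfl

theorem rightState_eq (D : SpectralData s P am bm a0 ℓ z ψ)
    (i : gaugeOrbit s P.gaugeBeta) (h : Config p N) :
    Matrix.mulVec ((pseudoData bra ψ ℓ z).rightProduct s P am bm a0 i h) (ψ i) = D.ket h i := by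
  have key := exists_mulVec_eq_state D.rightLadder i
    (fun n k => (coefD s P am bm a0 (1 / (z n * (s ^ 2) ^ k)))⁻¹ •
      (gaugedD s P (1 / (z n * (s ^ 2) ^ k)) i : Op p N)) (fun n w => ?_)
    (fun n => (h n : ℕ)) (List.finRange N) (List.nodup_finRange N)
  · obtain ⟨w, hw, e⟩ := key
    rw [ket, ← Ladder.state_eq_vec (L := D.rightLadder) (w := w) (by simpa using hw), ← e,
      PseudoData.rightProduct, List.ofFn_eq_map]
    rfl
  · rw [Matrix.smul_mulVec, ← D.rightLadder_A]
    rfl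

/-- In general position, separation of variables holds. -/
theorem separation (D : SpectralData s P am bm a0 ℓ z ψ) (q : ℂ) (hq : q = s ^ 2) :
    ∃ (E : PseudoData p N) (cL cR : ℂ → Fin N → ℂ), ∀ bt ∈ gaugeOrbit s P.gaugeBeta,
        -- the gauged operators are defined at `bt`
        (bt ≠ 0 ∧ bt ≠ 1 ∧ bt ≠ -1 ∧ bt ≠ q ^ 2 ∧ bt ≠ -q ^ 2) ∧
        -- left and right pseudo-eigenstates
        (E.bra bt ≠ 0 ∧ E.ket bt ≠ 0 ∧
          ∀ lam : ℂ, lam ≠ 0 →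
            Matrix.vecMul (E.bra bt) (gaugedB s P lam bt) =
                E.eigenvalue s (fun _ => 0) lam bt • E.bra (bt / q ^ 2) ∧
              Matrix.mulVec (gaugedB s P lam bt) (E.ket bt) =
                E.eigenvalue s (fun _ => 0) lam bt • E.ket (q ^ 2 * bt)) ∧
        -- the conditions on the zeros
        (E.lead bt ≠ 0 ∧ (∀ n, E.zero bt n ≠ 0) ∧
          ∀ n m : Fin N, ∀ h ∈ Finset.Icc 1 (p - 1), ∀ e : ℤ, e = 1 ∨ e = -1 →
            E.zero bt n ^ 2 ≠ q ^ (1 - 2 * (h : ℤ)) * am ^ (2 * e) ∧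
            E.zero bt n ^ 2 ≠ -(q ^ (1 - 2 * (h : ℤ)) * bm ^ (2 * e)) ∧
            E.zero bt n ^ 2 ≠ q ^ (1 - 2 * (h : ℤ)) * muPlus s P m ^ (2 * e) ∧
            E.zero bt n ^ 2 ≠ q ^ (1 - 2 * (h : ℤ)) * muMinus s P m ^ (2 * e)) ∧
        -- the denominators in the definition of the states do not vanish
        (E.norm s bt ≠ 0 ∧
          ∀ n : Fin N, ∀ k : ℕ, k + 1 < p →
            coefA s P am bm a0 (1 / E.shiftedZero s bt n k) ≠ 0 ∧
            coefD s P am bm a0 (1 / E.shiftedZero s bt n k) ≠ 0) ∧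
        -- left and right bases
        (LinearIndependent ℂ (fun h : Config p N => E.leftState s P am bm a0 bt h) ∧
          Submodule.span ℂ (Set.range fun h : Config p N => E.leftState s P am bm a0 bt h) = ⊤ ∧
          LinearIndependent ℂ (fun h : Config p N => E.rightState s P am bm a0 bt h) ∧
          Submodule.span ℂ (Set.range fun h : Config p N => E.rightState s P am bm a0 bt h) = ⊤) ∧
        -- decomposition of the identity
        ((1 : Op p N) =
          ∑ h : Config p N, E.vandermonde s bt (fun n => (h n : ℕ)) •
            Matrix.vecMulVec (E.rightState s P am bm a0 (bt * q ^ 2) h)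
              (E.leftState s P am bm a0 bt h)) ∧
        -- pairings of left and right states
        (∀ h k : Config p N,
          E.leftState s P am bm a0 bt h ⬝ᵥ E.rightState s P am bm a0 (bt * q ^ 2) k =
            if h = k then 1 / E.vandermonde s bt (fun n => (h n : ℕ)) else 0) ∧
        -- pseudo-diagonal action of the gauged operator `ℬ_-`
        (∀ lam : ℂ, lam ≠ 0 → ∀ h : Config p N,
          Matrix.vecMul (E.leftState s P am bm a0 bt h) (gaugedB s P lam bt) =
              E.eigenvalue s (fun n => (h n : ℕ)) lam bt •
                E.leftState s P am bm a0 (bt / q ^ 2) h ∧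
            Matrix.mulVec (gaugedB s P lam bt) (E.rightState s P am bm a0 bt h) =
              E.eigenvalue s (fun n => (h n : ℕ)) lam bt •
                E.rightState s P am bm a0 (q ^ 2 * bt) h) ∧
        -- simplicity of the pseudo-spectrum
        ((∀ n, E.zero bt n ^ (2 * p) ≠ 1 ∧ E.zero bt n ^ (2 * p) ≠ -1) ∧
          (∀ n m, n ≠ m → E.zero bt m ^ p ≠ E.zero bt n ^ p) ∧
          (∀ n m, n ≠ m → ∀ h k : Fin p, E.X s bt n h ≠ E.X s bt m k) ∧
          (∀ h k : Config p N,
            (∀ lam : ℂ, lam ≠ 0 →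
              E.eigenvalue s (fun n => (h n : ℕ)) lam bt =
                E.eigenvalue s (fun n => (k n : ℕ)) lam bt) → h = k)) ∧
        -- shift action of `𝒜_-` on the left states and of `𝒟_-` on the right states, at the zeros
        ((∀ a, cL bt a ≠ 0 ∧ cR bt a ≠ 0) ∧
          ∀ (h : Config p N) (a : Fin N) (z : ℂ), z = E.shiftedZero s bt a (h a) →
            Matrix.vecMul (E.leftState s P am bm a0 bt h) (gaugedA s P z (bt * q ^ 2)) =
                (coefA s P am bm a0 z * lowerFactor (cL bt) h a) •
                  E.leftState s P am bm a0 bt (lower h a) ∧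
              Matrix.vecMul (E.leftState s P am bm a0 bt h) (gaugedA s P (1 / z) (bt * q ^ 2)) =
                (coefA s P am bm a0 (1 / z) * raiseFactor (cL bt) h a) •
                  E.leftState s P am bm a0 bt (raise h a) ∧
              Matrix.mulVec (gaugedD s P z bt) (E.rightState s P am bm a0 bt h) =
                (coefD s P am bm a0 z * lowerFactor (cR bt) h a) •
                  E.rightState s P am bm a0 bt (lower h a) ∧
              Matrix.mulVec (gaugedD s P (1 / z) bt) (E.rightState s P am bm a0 bt h) =
                (coefD s P am bm a0 (1 / z) * raiseFactor (cR bt) h a) •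
                  E.rightState s P am bm a0 bt (raise h a)) := by
  subst hq
  obtain ⟨bra, hb⟩ := D.exists_bra
  choose cL hcL0 hcL using D.exists_bras_shift hb
  choose cR hcR0 hcR using D.exists_ket_shift
  set V0 := vandermondeProd (fun n => xVar (z n)) with hV0
  have hV0' : V0 ≠ 0 := D.vandermondeProd_ne
  set ν : ℂ := V0 ^ (1 / 2 : ℂ) with hν
  have hν2 : ν ^ 2 = V0 := sq_cpow_half V0
  have hν0 : ν ≠ 0 := by
    rintro h
    rw [h] at hν2
    exact hV0' (by rw [← hν2]; ring)
  classical
  set E := pseudoData bra ψ ℓ z with hE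
  have hnext : ∀ i : gaugeOrbit s P.gaugeBeta, (i : ℂ) * (s ^ 2) ^ 2 = (D.next i : ℂ) := by
    intro i
    change (i : ℂ) * (s ^ 2) ^ 2 = i * s ^ 4
    ring
  have hnext' : ∀ i : gaugeOrbit s P.gaugeBeta, (s ^ 2) ^ 2 * (i : ℂ) = (D.next i : ℂ) := by
    intro i
    rw [mul_comm, hnext]
  have hprev : ∀ i : gaugeOrbit s P.gaugeBeta, (i : ℂ) / (s ^ 2) ^ 2 = (D.prev i : ℂ) := by
    intro i
    change (i : ℂ) / (s ^ 2) ^ 2 = i / s ^ 4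
    ring
  have hnorm : ∀ i : gaugeOrbit s P.gaugeBeta, E.norm s i = ν := by
    intro i
    have h₁ : bra i ⬝ᵥ ψ (D.next i) = 1 := by
      rw [← D.ket_zero, hb i 0, if_pos rfl]
    have h₂ : E.vandermonde s i (fun _ => 0) = V0 := by
      change vandermondeProd (fun n => xVar (z n * (s ^ 2) ^ 0)) = V0
      simp [hV0]
    rw [PseudoData.norm, h₂, hnext]
    change (V0 * (bra i ⬝ᵥ ψ (D.next i))) ^ (1 / 2 : ℂ) = ν
    rw [h₁, mul_one]
  have hL : ∀ (i : gaugeOrbit s P.gaugeBeta) (h : Config p N),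
      E.leftState s P am bm a0 i h = ν⁻¹ • D.bras hb h i := by
    intro i h
    rw [PseudoData.leftState, hnorm, ← D.leftState_eq hb]
    rfl
  have hR : ∀ (i : gaugeOrbit s P.gaugeBeta) (h : Config p N),
      E.rightState s P am bm a0 i h = ν⁻¹ • D.ket h i := by
    intro i h
    rw [PseudoData.rightState, hprev, hnorm, ← D.rightState_eq (bra := bra)]
    rfl
  have hVh : ∀ (i : gaugeOrbit s P.gaugeBeta) (h : Config p N),
      (D.bras hb h i ⬝ᵥ D.ket h (D.next i)) * E.vandermonde s i (fun n => (h n : ℕ)) = V0 :=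
    fun i h => D.bras_dotProduct_ket_self hb i h
  have hV : ∀ (i : gaugeOrbit s P.gaugeBeta) (h : Config p N),
      E.vandermonde s i (fun n => (h n : ℕ)) ≠ 0 := by
    intro i h e
    have := hVh i h
    rw [e, mul_zero] at this
    exact hV0' this.symm
  have hpair : ∀ (i : gaugeOrbit s P.gaugeBeta) (h k : Config p N),
      E.leftState s P am bm a0 i h ⬝ᵥ E.rightState s P am bm a0 (i * (s ^ 2) ^ 2) k =
        if h = k then 1 / E.vandermonde s i (fun n => (h n : ℕ)) else 0 := by
    intro i h k
    rw [hnext, hL, hR, smul_dotProduct, dotProduct_smul]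
    split_ifs with hk
    · subst hk
      have h₁ := hVh i h
      have h₂ := hV i h
      rw [smul_eq_mul, smul_eq_mul, eq_div_iff h₂, mul_assoc, mul_assoc, h₁, ← hν2]
      field_simp
    · rw [D.bras_dotProduct_ket hb hk, smul_zero, smul_zero]
  have hLI : ∀ i : gaugeOrbit s P.gaugeBeta,
      LinearIndependent ℂ (fun h : Config p N => E.leftState s P am bm a0 i h) := by
    intro i
    have := (Ladder.linearIndependent_vec (L := D.braLadder hb) i).units_smul
      fun _ => Units.mk0 ν⁻¹ (inv_ne_zero hν0)
    rw [funext (hL i)]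
    exact this
  have hRI : ∀ i : gaugeOrbit s P.gaugeBeta,
      LinearIndependent ℂ (fun h : Config p N => E.rightState s P am bm a0 i h) := by
    intro i
    have := (D.linearIndependent_ket i).units_smul fun _ => Units.mk0 ν⁻¹ (inv_ne_zero hν0)
    rw [funext (hR i)]
    exact this
  refine ⟨E, fun bt => if h : bt ∈ gaugeOrbit s P.gaugeBeta then cL ⟨bt, h⟩ else 0,
    fun bt => if h : bt ∈ gaugeOrbit s P.gaugeBeta then cR ⟨bt, h⟩ else 0, fun bt hbt => ?_⟩
  have hcLi : (if h : bt ∈ gaugeOrbit s P.gaugeBeta then cL ⟨bt, h⟩ else 0) = cL ⟨bt, hbt⟩ :=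
    dif_pos hbt
  have hcRi : (if h : bt ∈ gaugeOrbit s P.gaugeBeta then cR ⟨bt, h⟩ else 0) = cR ⟨bt, hbt⟩ :=
    dif_pos hbt
  simp only [hcLi, hcRi]
  obtain ⟨i, rfl⟩ : ∃ i : gaugeOrbit s P.gaugeBeta, bt = i := ⟨⟨bt, hbt⟩, rfl⟩
  refine ⟨⟨D.orbit_ne hbt, ?_, ?_, ?_, ?_⟩, ⟨D.bra_ne hb _ hbt, D.ket_ne _ hbt, ?_⟩,
    ⟨D.lead_ne, D.z_ne, ?_⟩, ⟨?_, ?_⟩, ⟨hLI i, ?_, hRI i, ?_⟩, ?_, hpair i, ?_, ⟨?_, ?_, ?_, ?_⟩,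
    ⟨fun a => ⟨hcL0 i a, hcR0 i a⟩, ?_⟩⟩
  · exact fun e => D.orbit_sq_ne hbt 0 (by rw [e]; ring)
  · exact fun e => D.orbit_sq_ne hbt 0 (by rw [e]; ring)
  · exact fun e => D.orbit_sq_ne hbt 4 (by rw [e]; ring)
  · exact fun e => D.orbit_sq_ne hbt 4 (by rw [e]; ring)
  · intro lam hl
    have h₁ := D.bra_eig hb _ hbt lam hl
    have h₂ := D.ket_eig _ hbt lam hl
    have e₁ : (i : ℂ) / s ^ 4 = i / (s ^ 2) ^ 2 := by ring
    have e₂ : (i : ℂ) * s ^ 4 = (s ^ 2) ^ 2 * i := by ring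
    rw [e₁] at h₁
    rw [e₂] at h₂
    rw [D.eigenvalue_eq _ hl]
    exact ⟨h₁, h₂⟩
  · exact fun n m h _ e he => ⟨D.z_am n _ e he, D.z_bm n _ e he, D.z_muPlus n m _ e he,
      D.z_muMinus n m _ e he⟩
  · rw [hnorm]
    exact hν0
  · exact fun n k _ => ⟨D.coefA_inv_zq_ne n k, D.coefD_inv_zq_ne n k⟩
  · exact (hLI i).span_eq_top_of_card_eq_finrank' finrank_state.symm
  · exact (hRI i).span_eq_top_of_card_eq_finrank' finrank_state.symm
  · let R : Op p N := Matrix.of fun g h => E.rightState s P am bm a0 (i * (s ^ 2) ^ 2) h g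
    let L : Op p N := Matrix.of fun h g =>
      E.vandermonde s i (fun n => (h n : ℕ)) * E.leftState s P am bm a0 i h g
    have hLR : L * R = 1 := by
      ext h k
      rw [Matrix.mul_apply, Matrix.one_apply]
      have := hpair i h k
      simp only [L, R, Matrix.of_apply, mul_assoc]
      rw [← Finset.mul_sum]
      change _ * (E.leftState s P am bm a0 i h ⬝ᵥ _) = _
      rw [this]
      split_ifs
      · exact mul_one_div_cancel (hV i h)
      · exact mul_zero _
    rw [← mul_eq_one_comm.1 hLR]
    ext g g'
    rw [Matrix.mul_apply, Matrix.sum_apply]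
    refine Finset.sum_congr rfl fun h _ => ?_
    simp only [L, R, Matrix.of_apply, Matrix.smul_apply, Matrix.vecMulVec_apply, smul_eq_mul]
    ring
  · intro lam hl h
    rw [D.eigenvalue_eq _ hl, hprev, hnext', hL, hL, hR, hR, Matrix.smul_vecMul,
      Matrix.mulVec_smul, D.vecMul_bras hb h i hl, D.mulVec_ket h i hl, smul_comm,
      smul_comm ν⁻¹]
    exact ⟨rfl, rfl⟩
  · intro n
    have h4 := D.z_pow n
    rw [show 4 * p = 2 * p * 2 by ring, pow_mul] at h4
    exact ⟨fun e => h4 (by rw [show E.zero i n = z n from rfl] at e; rw [e]; ring),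
      fun e => h4 (by rw [show E.zero i n = z n from rfl] at e; rw [e]; ring)⟩
  · intro n m hnm e
    refine (D.z_sep n m hnm).1 ?_
    change z m ^ p = z n ^ p at e
    rw [mul_comm 2 p, pow_mul, pow_mul, e]
  · intro n m hnm h k e
    exact hnm (D.sep n m h k e).1
  · intro h k e
    by_contra hk
    obtain ⟨n, hn⟩ := Function.ne_iff.1 hk
    have hZ := D.zq_ne n (k n)
    have := e _ hZ
    rw [D.eigenvalue_eq _ hZ, D.eigenvalue_eq _ hZ] at this
    have h₃ : eigenFun (s ^ 2) z ℓ (fun a => (k a : ℕ)) (z n * (s ^ 2) ^ (k n : ℕ)) = 0 :=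
      Ladder.eigenFun_eq_zero (L := D.rightLadder) n rfl
    rw [h₃] at this
    exact Ladder.eigenFun_ne_zero (L := D.rightLadder) i n (Ladder.natVal_ne_modEq hn) this
  · rintro h a Z rfl
    obtain ⟨h₁, h₂⟩ := hcL i h a
    obtain ⟨h₃, h₄⟩ := hcR i h a
    change Matrix.vecMul _ (gaugedA s P (z a * (s ^ 2) ^ (h a : ℕ)) _) = _ ∧
      Matrix.vecMul _ (gaugedA s P (1 / (z a * (s ^ 2) ^ (h a : ℕ))) _) = _ ∧
      Matrix.mulVec (gaugedD s P (z a * (s ^ 2) ^ (h a : ℕ)) _) _ = _ ∧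
      Matrix.mulVec (gaugedD s P (1 / (z a * (s ^ 2) ^ (h a : ℕ))) _) _ = _
    simp only [hL, hR, Matrix.smul_vecMul, Matrix.mulVec_smul, h₁, h₂, h₃, h₄]
    exact ⟨smul_comm _ _ _, smul_comm _ _ _, smul_comm _ _ _, smul_comm _ _ _⟩

end SpectralData

end Separation

end

end CyclicReflection

namespace CyclicReflection

noncomputable section

/-! ### Degeneration of the bulk parameters along lines -/

section Degeneration

open Filter Polynomial

/-- The parameters as coordinates: boundary and gauge parameters, and bulk parameters. -/
abbrev Coords (N : ℕ) : Type := (Fin 5 → ℂ) × (Fin N → Fin 6 → ℂ)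

/-- The degenerate bulk parameters `a = b = c = d = 0`, `α_n = 2 ^ (n + 1)`, `β_n = 1`, at which the
operator `ℬ_-` is diagonal with simple spectrum. -/
def bulkBase (N : ℕ) : Fin N → Fin 6 → ℂ := fun n => ![0, 0, 0, 0, 2 ^ ((n : ℕ) + 1), 1]

variable {N : ℕ}

/-- The line of bulk parameters through the degenerate ones, in the direction given by `w`. -/
def bulkLine (w : Coords N) (t : ℂ) : Coords N := (w.1, bulkBase N + t • w.2)

/-- A measurable function of the parameters which is rational on almost all lines through the
degenerate parameters and is regular there with value `f0`, which may depend on the line. -/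
def Degenerates (f f0 : Coords N → ℂ) : Prop :=
  Measurable f ∧ ∀ᵐ w : Coords N, ∃ P Q : ℂ[X], Q.eval 0 ≠ 0 ∧ P.eval 0 = f0 w * Q.eval 0 ∧
    ∀ᶠ t in cofinite, f (bulkLine w t) * Q.eval t = P.eval t

theorem eventually_cofinite_eval_ne {P : ℂ[X]} (hP : P ≠ 0) :
    ∀ᶠ t in cofinite, P.eval t ≠ 0 := by
  rw [eventually_cofinite]
  refine (P.roots.toFinset.finite_toSet).subset fun t ht => ?_
  simp only [Set.mem_setOf_eq, not_not] at ht
  simpa [hP] using ht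

/-- Fubini's theorem for a family of almost everywhere conditions on lines. -/
theorem exists_ae_of_ae_line {W : Type*} [MeasurableSpace W] (μ : Measure W) [SFinite μ]
    {f : W → ℝ → ℂ} (hf : Measurable fun x : W × ℝ => f x.1 x.2)
    (h : ∀ᵐ w ∂μ, ∀ᵐ t : ℝ, f w t ≠ 0) : ∃ t : ℝ, t ≠ 0 ∧ ∀ᵐ w ∂μ, f w t ≠ 0 := by
  have hm : MeasurableSet {x : W × ℝ | f x.1 x.2 ≠ 0} := hf (measurableSet_singleton 0).compl
  have h' := (Measure.ae_ae_comm (p := fun w t => f w t ≠ 0) hm).1 h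
  have h0 : ∀ᵐ t : ℝ, t ≠ 0 := (Set.countable_singleton (0 : ℝ)).ae_notMem volume
  exact (h0.and h').exists

theorem isAddHaarMeasure_bulk :
    (volume : Measure (Fin N → Fin 6 → ℂ)).IsAddHaarMeasure :=
  Measure.pi.isAddHaarMeasure _

theorem isAddHaarMeasure_coords : (volume : Measure (Coords N)).IsAddHaarMeasure :=
  have := isAddHaarMeasure_bulk (N := N)
  Measure.prod.instIsAddHaarMeasure _ _

/-- A measurable function that has few zeros on the lines in a fixed direction vanishes almost
nowhere. -/
theorem ae_ne_zero_of_direction {f : Coords N → ℂ} (hf : Measurable f) (e : Coords N)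
    (h : ∀ w, ∀ᵐ t : ℝ, f (w + t • e) ≠ 0) : ∀ᵐ w : Coords N, f w ≠ 0 := by
  obtain ⟨t, -, ht⟩ := exists_ae_of_ae_line (W := Coords N) volume (f := fun w t => f (w + t • e))
    (hf.comp (by fun_prop)) (Eventually.of_forall h)
  have := isAddHaarMeasure_coords (N := N)
  have := (measurePreserving_add_right (volume : Measure (Coords N)) (-(t • e))).quasiMeasurePreserving.ae ht
  filter_upwards [this] with w hw
  rwa [neg_add_cancel_right] at hw

theorem ae_real_of_cofinite {C : ℂ → Prop} (h : ∀ᶠ t in cofinite, C t) : ∀ᵐ t : ℝ, C t := by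
  have hfin : {t : ℝ | ¬ C t}.Finite :=
    Set.Finite.preimage Complex.ofReal_injective.injOn (eventually_cofinite.1 h)
  filter_upwards [hfin.countable.ae_notMem volume] with t ht
  simpa using ht

namespace Degenerates

variable {f g f0 g0 : Coords N → ℂ}

/-- A function that degenerates to an almost everywhere nonzero function is almost everywhere
nonzero: on almost every line it has finitely many zeros, and almost every homothety with centre at
the degenerate parameters is then admissible. -/
theorem ae_ne_zero (h : Degenerates f f0) (h0 : ∀ᵐ w, f0 w ≠ 0) : ∀ᵐ w, f w ≠ 0 := by
  have hline : ∀ᵐ w : Coords N, ∀ᵐ t : ℝ, f (bulkLine w t) ≠ 0 := by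
    filter_upwards [h.2, h0] with w ⟨P, Q, hQ, hP, he⟩ hw
    refine ae_real_of_cofinite (C := fun t => f (bulkLine w t) ≠ 0) ?_
    have hP0 : P ≠ 0 := by
      rintro rfl
      rw [eval_zero] at hP
      exact mul_ne_zero hw hQ hP.symm
    filter_upwards [he, eventually_cofinite_eval_ne hP0] with t ht hPt hf
    rw [hf, zero_mul] at ht
    exact hPt ht.symm
  have hm : Measurable fun x : Coords N × ℝ => bulkLine x.1 (x.2 : ℂ) := by
    unfold bulkLine
    fun_prop
  obtain ⟨t, ht0, ht⟩ := exists_ae_of_ae_line (W := Coords N) volume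
    (f := fun w t => f (bulkLine w t)) (h.1.comp hm) hline
  have := isAddHaarMeasure_bulk (N := N)
  -- The chosen line parameter is scaled back to `1`.
  have hq₁ : Measure.QuasiMeasurePreserving (fun v : Fin N → Fin 6 → ℂ => t⁻¹ • v) :=
    Measure.quasiMeasurePreserving_smul volume (inv_ne_zero ht0)
  have hq₂ : Measure.QuasiMeasurePreserving
      (fun v : Fin N → Fin 6 → ℂ => t⁻¹ • (v + -bulkBase N)) :=
    hq₁.comp (measurePreserving_add_right volume (-bulkBase N)).quasiMeasurePreserving
  have hq : Measure.QuasiMeasurePreserving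
      (fun w : Coords N => (w.1, t⁻¹ • (w.2 + -bulkBase N))) :=
    QuasiMeasurePreserving.prodMap (Measure.QuasiMeasurePreserving.id volume) hq₂
  filter_upwards [hq.ae ht] with w hw
  have e : bulkLine (w.1, t⁻¹ • (w.2 + -bulkBase N)) (t : ℂ) = w := by
    refine Prod.ext rfl ?_
    simp only [bulkLine]
    rw [Complex.coe_smul, smul_inv_smul₀ ht0]
    abel
  rwa [e] at hw

theorem of_fst {f : (Fin 5 → ℂ) → ℂ} (hf : Measurable f) :
    Degenerates (N := N) (fun w => f w.1) fun w => f w.1 :=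
  ⟨hf.comp measurable_fst, Eventually.of_forall fun w => ⟨C (f w.1), 1, by simp, by simp,
    Eventually.of_forall fun t => by simp [bulkLine]⟩⟩

theorem const (c : ℂ) : Degenerates (N := N) (fun _ => c) fun _ => c :=
  of_fst (f := fun _ => c) measurable_const

theorem coord (n : Fin N) (i : Fin 6) :
    Degenerates (fun w : Coords N => w.2 n i) fun _ => bulkBase N n i :=
  ⟨by fun_prop, Eventually.of_forall fun w => ⟨C (bulkBase N n i) + X * C (w.2 n i), 1, by simp,
    by simp, Eventually.of_forall fun t => by simp [bulkLine]; exact mul_comm _ _⟩⟩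

/-- The ratio of two coordinates that vanish at the degenerate parameters is constant on lines. -/
theorem ratio (n : Fin N) {i j : Fin 6} (hi : bulkBase N n i = 0) (hj : bulkBase N n j = 0) :
    Degenerates (fun w : Coords N => w.2 n i / w.2 n j) fun w => w.2 n i / w.2 n j := by
  refine ⟨by fun_prop, Eventually.of_forall fun w => ⟨C (w.2 n i / w.2 n j), 1, by simp, by simp,
    ?_⟩⟩
  have h0 : ∀ᶠ t : ℂ in cofinite, t ≠ 0 := (Set.finite_singleton 0).eventually_cofinite_notMem
  filter_upwards [h0] with t ht
  simp [bulkLine, hi, hj, mul_div_mul_left _ _ ht]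

theorem add (hf : Degenerates f f0) (hg : Degenerates g g0) :
    Degenerates (fun w => f w + g w) fun w => f0 w + g0 w := by
  refine ⟨hf.1.add hg.1, ?_⟩
  filter_upwards [hf.2, hg.2] with w ⟨P, Q, hQ, hP, he⟩ ⟨P', Q', hQ', hP', he'⟩
  refine ⟨P * Q' + P' * Q, Q * Q', ?_, ?_, ?_⟩
  · rw [eval_mul]
    exact mul_ne_zero hQ hQ'
  · simp only [eval_add, eval_mul, hP, hP']
    ring
  · filter_upwards [he, he'] with t ht ht'
    simp only [eval_add, eval_mul, ← ht, ← ht']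
    ring

theorem mul (hf : Degenerates f f0) (hg : Degenerates g g0) :
    Degenerates (fun w => f w * g w) fun w => f0 w * g0 w := by
  refine ⟨hf.1.mul hg.1, ?_⟩
  filter_upwards [hf.2, hg.2] with w ⟨P, Q, hQ, hP, he⟩ ⟨P', Q', hQ', hP', he'⟩
  refine ⟨P * P', Q * Q', ?_, ?_, ?_⟩
  · rw [eval_mul]
    exact mul_ne_zero hQ hQ'
  · simp only [eval_mul, hP, hP']
    ring
  · filter_upwards [he, he'] with t ht ht'
    simp only [eval_mul, ← ht, ← ht']
    ring

theorem neg (hf : Degenerates f f0) : Degenerates (fun w => -f w) fun w => -f0 w := by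
  simpa using (const (-1)).mul hf

theorem sub (hf : Degenerates f f0) (hg : Degenerates g g0) :
    Degenerates (fun w => f w - g w) fun w => f0 w - g0 w := by
  simpa [sub_eq_add_neg] using hf.add hg.neg

theorem inv (hf : Degenerates f f0) (h0 : ∀ᵐ w, f0 w ≠ 0) :
    Degenerates (fun w => (f w)⁻¹) fun w => (f0 w)⁻¹ := by
  refine ⟨hf.1.inv, ?_⟩
  filter_upwards [hf.2, h0] with w ⟨P, Q, hQ, hP, he⟩ hw
  have hP0 : P.eval 0 ≠ 0 := by
    rw [hP]
    exact mul_ne_zero hw hQ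
  refine ⟨Q, P, hP0, ?_, ?_⟩
  · rw [hP, inv_mul_cancel_left₀ hw]
  · have : P ≠ 0 := by
      rintro rfl
      simp at hP0
    filter_upwards [he, eventually_cofinite_eval_ne this] with t ht hPt
    rw [← ht] at hPt ⊢
    rw [inv_mul_cancel_left₀ (mul_ne_zero_iff.1 hPt).1]

theorem div (hf : Degenerates f f0) (hg : Degenerates g g0) (h0 : ∀ᵐ w, g0 w ≠ 0) :
    Degenerates (fun w => f w / g w) fun w => f0 w / g0 w := by
  simpa [div_eq_mul_inv] using hf.mul (hg.inv h0)

theorem div_const (hf : Degenerates f f0) (c : ℂ) :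
    Degenerates (fun w => f w / c) fun w => f0 w / c := by
  simpa [div_eq_mul_inv] using hf.mul (const c⁻¹)

theorem sum {ι : Type*} (S : Finset ι) {f f0 : ι → Coords N → ℂ}
    (h : ∀ i ∈ S, Degenerates (f i) (f0 i)) :
    Degenerates (fun w => ∑ i ∈ S, f i w) fun w => ∑ i ∈ S, f0 i w := by
  classical
  induction S using Finset.induction_on with
  | empty => simpa using const 0
  | insert a S ha ih =>
    simp only [Finset.sum_insert ha]
    exact (h a (Finset.mem_insert_self _ _)).add (ih fun i hi => h i (Finset.mem_insert_of_mem hi))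

theorem prod {ι : Type*} (S : Finset ι) {f f0 : ι → Coords N → ℂ}
    (h : ∀ i ∈ S, Degenerates (f i) (f0 i)) :
    Degenerates (fun w => ∏ i ∈ S, f i w) fun w => ∏ i ∈ S, f0 i w := by
  classical
  induction S using Finset.induction_on with
  | empty => simpa using const 1
  | insert a S ha ih =>
    simp only [Finset.prod_insert ha]
    exact (h a (Finset.mem_insert_self _ _)).mul (ih fun i hi => h i (Finset.mem_insert_of_mem hi))

theorem pow (hf : Degenerates f f0) (k : ℕ) :
    Degenerates (fun w => f w ^ k) fun w => f0 w ^ k := by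
  simpa using prod (Finset.range k) fun _ _ => hf

end Degenerates

/-- Entrywise degeneration of a family of matrices. -/
def MatrixDegenerates {m n : Type*} (F F0 : Coords N → Matrix m n ℂ) : Prop :=
  ∀ i j, Degenerates (fun w => F w i j) fun w => F0 w i j

namespace MatrixDegenerates

variable {n : Type*} [Fintype n] [DecidableEq n] {F F0 G G0 : Coords N → Matrix n n ℂ}
  {f f0 : Coords N → ℂ}

omit [Fintype n] [DecidableEq n] in
theorem const (A : Matrix n n ℂ) : MatrixDegenerates (N := N) (fun _ => A) fun _ => A :=
  fun i j => Degenerates.const (A i j)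

omit [Fintype n] [DecidableEq n] in
theorem add (hF : MatrixDegenerates F F0) (hG : MatrixDegenerates G G0) :
    MatrixDegenerates (fun w => F w + G w) fun w => F0 w + G0 w :=
  fun i j => (hF i j).add (hG i j)

omit [Fintype n] [DecidableEq n] in
theorem sub (hF : MatrixDegenerates F F0) (hG : MatrixDegenerates G G0) :
    MatrixDegenerates (fun w => F w - G w) fun w => F0 w - G0 w :=
  fun i j => (hF i j).sub (hG i j)

omit [Fintype n] [DecidableEq n] in
theorem smul (hf : Degenerates f f0) (hF : MatrixDegenerates F F0) :
    MatrixDegenerates (fun w => f w • F w) fun w => f0 w • F0 w :=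
  fun i j => hf.mul (hF i j)

omit [DecidableEq n] in
theorem mul (hF : MatrixDegenerates F F0) (hG : MatrixDegenerates G G0) :
    MatrixDegenerates (fun w => F w * G w) fun w => F0 w * G0 w := by
  intro i j
  simp only [Matrix.mul_apply]
  exact Degenerates.sum _ fun k _ => (hF i k).mul (hG k j)

omit [Fintype n] [DecidableEq n] in
theorem sum {ι : Type*} (S : Finset ι) {F F0 : ι → Coords N → Matrix n n ℂ}
    (h : ∀ i ∈ S, MatrixDegenerates (F i) (F0 i)) :
    MatrixDegenerates (fun w => ∑ i ∈ S, F i w) fun w => ∑ i ∈ S, F0 i w := by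
  intro i j
  simp only [Matrix.sum_apply]
  exact Degenerates.sum _ fun k hk => h k hk i j

theorem listProd {ι : Type*} (l : List ι) {F F0 : ι → Coords N → Matrix n n ℂ}
    (h : ∀ i ∈ l, MatrixDegenerates (F i) (F0 i)) :
    MatrixDegenerates (fun w => (l.map fun i => F i w).prod) fun w =>
      (l.map fun i => F0 i w).prod := by
  induction l with
  | nil => simpa using const (1 : Matrix n n ℂ)
  | cons a l ih =>
    simp only [List.map_cons, List.prod_cons]
    exact (h a List.mem_cons_self).mul (ih fun i hi => h i (List.mem_cons_of_mem _ hi))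

theorem pow (hF : MatrixDegenerates F F0) (k : ℕ) :
    MatrixDegenerates (fun w => F w ^ k) fun w => F0 w ^ k := by
  simpa using listProd (List.replicate k ()) (F := fun _ => F) (F0 := fun _ => F0) fun _ _ => hF

theorem det (hF : MatrixDegenerates F F0) :
    Degenerates (fun w => (F w).det) fun w => (F0 w).det := by
  simp only [Matrix.det_apply']
  exact Degenerates.sum _ fun σ _ => (Degenerates.const _).mul (Degenerates.prod _ fun i _ => hF _ _)

theorem inv (hF : MatrixDegenerates F F0) (h0 : ∀ᵐ w, (F0 w).det ≠ 0) :
    MatrixDegenerates (fun w => (F w)⁻¹) fun w => (F0 w)⁻¹ := by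
  simp only [Matrix.inv_def, Ring.inverse_eq_inv']
  refine smul (hF.det.inv h0) fun i j => ?_
  simp only [Matrix.adjugate_apply]
  refine det fun k l => ?_
  rcases eq_or_ne k j with rfl | hk
  · simp only [Matrix.updateRow_self]
    exact Degenerates.const _
  · simp only [Matrix.updateRow_ne hk]
    exact hF k l

end MatrixDegenerates

end Degeneration

end

end CyclicReflection

namespace CyclicReflection

noncomputable section

/-! ### The gauged operators at the degenerate parameters -/

section DegenerateOperators

open Polynomial

variable {p N : ℕ} [NeZero p]

/-- The parameters with the given boundary and gauge parameters and degenerate bulk parameters. -/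
def baseParams (w : Coords N) : Params N := Params.ofCoords (w.1, bulkBase N)

/-- Entrywise degeneration of two by two matrices of operators. -/
def AuxDegenerates (F F0 : Coords N → AuxOp p N) : Prop :=
  ∀ i j, MatrixDegenerates (fun w => F w i j) fun w => F0 w i j

theorem AuxDegenerates.const (A : AuxOp p N) : AuxDegenerates (fun _ => A) fun _ => A :=
  fun i j => MatrixDegenerates.const (A i j)

theorem AuxDegenerates.mul {F F0 G G0 : Coords N → AuxOp p N} (hF : AuxDegenerates F F0)
    (hG : AuxDegenerates G G0) : AuxDegenerates (fun w => F w * G w) fun w => F0 w * G0 w := by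
  intro i j
  simp only [Matrix.mul_apply, Fin.sum_univ_two]
  exact ((hF i 0).mul (hG 0 j)).add ((hF i 1).mul (hG 1 j))

theorem AuxDegenerates.listProd {ι : Type*} (l : List ι) {F F0 : ι → Coords N → AuxOp p N}
    (h : ∀ i ∈ l, AuxDegenerates (F i) (F0 i)) :
    AuxDegenerates (fun w => (l.map fun i => F i w).prod) fun w => (l.map fun i => F0 i w).prod := by
  induction l with
  | nil => simpa using AuxDegenerates.const (1 : AuxOp p N)
  | cons a l ih =>
    simp only [List.map_cons, List.prod_cons]
    exact (h a List.mem_cons_self).mul (ih fun i hi => h i (List.mem_cons_of_mem _ hi))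

theorem auxDegenerates_lax (s : ℂ) (n : Fin N) (lam : ℂ) :
    AuxDegenerates (p := p) (fun w => lax s (Params.ofCoords w) n lam)
      fun w => lax s (baseParams w) n lam := by
  have ha : Degenerates (fun w : Coords N => (Params.ofCoords w).a n)
    fun w => (baseParams w).a n := Degenerates.coord n 0
  have hb : Degenerates (fun w : Coords N => (Params.ofCoords w).b n)
    fun w => (baseParams w).b n := Degenerates.coord n 1
  have hc : Degenerates (fun w : Coords N => (Params.ofCoords w).c n)
    fun w => (baseParams w).c n := Degenerates.coord n 2
  have hd : Degenerates (fun w : Coords N => (Params.ofCoords w).d n)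
    fun w => (baseParams w).d n := Degenerates.coord n 3
  have hα : Degenerates (fun w : Coords N => (Params.ofCoords w).alpha n)
    fun w => (baseParams w).alpha n := Degenerates.coord n 4
  have hβ : Degenerates (fun w : Coords N => (Params.ofCoords w).beta n)
    fun w => (baseParams w).beta n := Degenerates.coord n 5
  have hγ := (ha.mul hc).div hα (Filter.Eventually.of_forall fun w => by
    simp [baseParams, Params.ofCoords, bulkBase])
  have hδ := (hb.mul hd).div hβ (Filter.Eventually.of_forall fun w => by
    simp [baseParams, Params.ofCoords, bulkBase])
  intro i j
  fin_cases i <;> fin_cases j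
  · exact (MatrixDegenerates.smul ((Degenerates.const lam).mul hα) (.const _)).sub
      (.smul (hβ.div_const lam) (.const _))
  · exact (MatrixDegenerates.const _).mul ((MatrixDegenerates.smul ((Degenerates.const s⁻¹).mul ha)
      (.const _)).add (.smul ((Degenerates.const s).mul hb) (.const _)))
  · exact (MatrixDegenerates.const _).mul ((MatrixDegenerates.smul ((Degenerates.const s).mul hc)
      (.const _)).add (.smul ((Degenerates.const s⁻¹).mul hd) (.const _)))
  · exact (MatrixDegenerates.smul (hγ.div_const lam) (.const _)).sub
      (.smul (hδ.mul (.const lam)) (.const _))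

theorem auxDegenerates_monodromy (s lam : ℂ) :
    AuxDegenerates (p := p) (N := N) (fun w => monodromy s (Params.ofCoords w) lam)
      fun w => monodromy s (baseParams w) lam := by
  simp only [monodromy, List.ofFn_eq_map, ← List.map_reverse]
  exact AuxDegenerates.listProd _ fun n _ => auxDegenerates_lax s n (lam / s)

theorem auxDegenerates_boundaryMonodromy (s lam : ℂ) :
    AuxDegenerates (p := p) (N := N) (fun w => boundaryMonodromy s (Params.ofCoords w) lam)
      fun w => boundaryMonodromy s (baseParams w) lam := by
  unfold boundaryMonodromy monodromyHat
  refine ((auxDegenerates_monodromy s lam).mul ?_).mul ?_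
  · intro i j
    have hK : Measurable fun x : Fin 5 → ℂ =>
        kMinus s (Params.ofCoords (x, bulkBase N)) lam i j := by
      fin_cases i <;> fin_cases j <;>
        simp only [kMinus, Params.ofCoords, Matrix.smul_apply, Matrix.of_apply, Fin.zero_eta,
          Fin.mk_one, Matrix.cons_val_zero, Matrix.cons_val_one, Matrix.cons_val', smul_eq_mul,
          Matrix.cons_val_fin_one] <;> fun_prop
    have h := Degenerates.of_fst (N := N) hK
    intro g h'
    have := (MatrixDegenerates.smul h (.const (1 : Op p N))) g h'
    simp only [auxScalar, Matrix.map_apply, Algebra.algebraMap_eq_smul_one]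
    exact this
  · have h := ((AuxDegenerates.const (p := p) (N := N) (auxScalar sigmaY)).mul
      (F := _) (G := fun w => (monodromy s (Params.ofCoords w) (1 / lam)).transpose)
      (G0 := fun w => (monodromy s (baseParams w) (1 / lam)).transpose)
      (fun i j => auxDegenerates_monodromy s (1 / lam) j i)).mul
      (AuxDegenerates.const (auxScalar sigmaY))
    exact fun i j => MatrixDegenerates.smul (Degenerates.const ((-1) ^ N)) (h i j)

theorem matrixDegenerates_gaugedB (s lam c : ℂ) :
    MatrixDegenerates (N := N)
      (fun w => (gaugedB s (Params.ofCoords w) lam (c * w.1 4) : Op p N))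
      fun w => gaugedB s (baseParams w) lam (c * w.1 4) := by
  have hU := auxDegenerates_boundaryMonodromy (p := p) (N := N) s lam
  have h : ∀ f : (Fin 5 → ℂ) → ℂ, Measurable f →
      Degenerates (N := N) (fun w => f w.1) fun w => f w.1 := fun f hf => Degenerates.of_fst hf
  exact MatrixDegenerates.smul (h (fun x => (c * x 4 - 1 / (c * x 4))⁻¹) (by fun_prop))
    ((((MatrixDegenerates.smul (h (fun x => -(lam * (c * x 4) / s)) (by fun_prop)) (hU 0 0)).sub
      (MatrixDegenerates.smul (h (fun x => x 3 * s ^ 2) (by fun_prop)) (hU 0 1))).add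
      (MatrixDegenerates.smul (h (fun x => (c * x 4) ^ 2 / (x 3 * s ^ 2)) (by fun_prop))
        (hU 1 0))).add
      (MatrixDegenerates.smul (h (fun x => (c * x 4) * s / lam) (by fun_prop)) (hU 1 1)))

theorem matrixDegenerates_bCoeff (s c : ℂ) (k : ℕ) :
    MatrixDegenerates (N := N) (fun w => (bCoeff s (Params.ofCoords w) (c * w.1 4) k : Op p N))
      fun w => bCoeff s (baseParams w) (c * w.1 4) k := by
  unfold bCoeff
  exact MatrixDegenerates.sum _ fun i _ =>
    MatrixDegenerates.smul (Degenerates.const _) (matrixDegenerates_gaugedB s (node i) c)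

/-- The two by two matrix with a single entry in the upper left corner. -/
def corner (A : Op p N) : AuxOp p N := !![A, 0; 0, 0]

theorem corner_mul_listProd {ι : Type*} (D : ι → Op p N) (X : Op p N) (l : List ι) :
    corner X * (l.map fun n => corner (D n)).prod = corner (X * (l.map D).prod) := by
  induction l generalizing X with
  | nil => simp
  | cons a l ih =>
    have h : corner X * corner (D a) = corner (X * D a) := by
      simp only [corner]
      refine Matrix.ext fun i j => ?_
      fin_cases i <;> fin_cases j <;> simp [Matrix.mul_apply, Fin.sum_univ_two]
    rw [List.map_cons, List.prod_cons, ← mul_assoc, h, ih, List.map_cons, List.prod_cons, mul_assoc]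

/-- The diagonal entries of the degenerate Lax operator. -/
def diagEntry (s : ℂ) (P : Params N) (n : Fin N) (lam : ℂ) (h : Config p N) : ℂ :=
  lam * P.alpha n * (s ^ 2) ^ (h n : ℕ) - P.beta n / lam * ((s ^ 2) ^ (h n : ℕ))⁻¹

theorem monodromy_degenerate {s : ℂ} {P : Params N} (hN : N ≠ 0)
    (h : ∀ n, P.a n = 0 ∧ P.b n = 0 ∧ P.c n = 0 ∧ P.d n = 0) (lam : ℂ) :
    (monodromy s P lam : AuxOp p N) =
      corner (Matrix.diagonal fun g => ∏ n, diagEntry s P n (lam / s) g) := by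
  have hlax : ∀ n, (lax s P n (lam / s) : AuxOp p N) =
      corner (Matrix.diagonal (diagEntry s P n (lam / s))) := by
    intro n
    obtain ⟨ha, hb, hc, hd⟩ := h n
    have h₁ : (lam / s * P.alpha n) • (vOp s n : Op p N) - (P.beta n / (lam / s)) • vInvOp s n =
        Matrix.diagonal (diagEntry s P n (lam / s)) := by
      rw [vOp, vInvOp, ← Matrix.diagonal_smul, ← Matrix.diagonal_smul, Matrix.diagonal_sub]
      rfl
    rw [lax, h₁, Params.gamma, Params.delta, ha, hb, hc, hd]
    simp [corner]
  have hprod : ∀ l : List (Fin N), (l.map fun n =>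
      (Matrix.diagonal (diagEntry s P n (lam / s)) : Op p N)).prod =
        Matrix.diagonal fun g => (l.map fun n => diagEntry s P n (lam / s) g).prod := by
    intro l
    induction l with
    | nil => simp
    | cons a l ih =>
      simp only [List.map_cons, List.prod_cons, ih, Matrix.diagonal_mul_diagonal]
  obtain ⟨a, l, hl⟩ : ∃ a l, (List.finRange N).reverse = a :: l := by
    refine List.exists_cons_of_ne_nil ?_
    simpa using hN
  rw [monodromy, List.ofFn_eq_map, ← List.map_reverse]
  have e : ∀ g : Config p N, ∏ n, diagEntry s P n (lam / s) g =
      ((List.finRange N).reverse.map fun n => diagEntry s P n (lam / s) g).prod := by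
    intro g
    rw [List.map_reverse, List.prod_reverse, ← List.ofFn_eq_map, List.prod_ofFn]
  simp only [e, hlax]
  rw [← hprod, hl, List.map_cons, List.prod_cons, corner_mul_listProd, List.map_cons,
    List.prod_cons]

/-- The zeros of `ℬ_-`, in the variable `lam ^ 2 + 1 / lam ^ 2`, at the degenerate parameters. -/
def baseZero (s : ℂ) (P : Params N) (n : Fin N) (k : ℕ) : ℂ :=
  P.alpha n / P.beta n * (s ^ 2) ^ (2 * k) / s ^ 2 +
    1 / (P.alpha n / P.beta n * (s ^ 2) ^ (2 * k) / s ^ 2)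

/-- The leading coefficient of `ℬ_-` at the degenerate parameters. -/
def baseLead (s : ℂ) (P : Params N) (bt : ℂ) : ℂ :=
  (bt - 1 / bt)⁻¹ * (-(P.gaugeAlpha * s ^ 2)) *
    (P.kappa * Complex.exp P.tau / (P.zeta - 1 / P.zeta)) * ∏ n, (P.alpha n * P.beta n)

theorem gaugedB_degenerate {s : ℂ} (hs : s ≠ 0) {P : Params N} (hN : N ≠ 0)
    (h : ∀ n, P.a n = 0 ∧ P.b n = 0 ∧ P.c n = 0 ∧ P.d n = 0)
    (hα : ∀ n, P.alpha n ≠ 0) (hβ : ∀ n, P.beta n ≠ 0) {lam : ℂ} (hl : lam ≠ 0) (bt : ℂ) :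
    (gaugedB s P lam bt : Op p N) = Matrix.diagonal fun g =>
      (lam ^ 2 / s ^ 2 - s ^ 2 / lam ^ 2) *
        (baseLead s P bt * ∏ n, (xVar lam - baseZero s P n (g n))) := by
  set K := kMinus s P lam 0 1 with hK
  have hsy : ∀ X : Op p N, (auxScalar sigmaY * (corner X).transpose * auxScalar sigmaY : AuxOp p N) =
      !![0, 0; 0, X] := by
    intro X
    refine Matrix.ext fun i j => ?_
    fin_cases i <;> fin_cases j <;>
      simp [corner, auxScalar, sigmaY, Matrix.mul_apply, Fin.sum_univ_two,
        Algebra.algebraMap_eq_smul_one, smul_smul]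
  have hU : (boundaryMonodromy s P lam : AuxOp p N) = !![0, Matrix.diagonal fun g =>
      (-1) ^ N * K * ∏ n, (diagEntry s P n (lam / s) g * diagEntry s P n (1 / lam / s) g); 0, 0] := by
    rw [boundaryMonodromy, monodromyHat, monodromy_degenerate hN h, monodromy_degenerate hN h, hsy]
    have e : (Matrix.diagonal fun g : Config p N => (-1) ^ N * K *
        ∏ n, (diagEntry s P n (lam / s) g * diagEntry s P n (1 / lam / s) g)) =
        ((-1 : ℂ) ^ N * K) • ((Matrix.diagonal fun g => ∏ n, diagEntry s P n (lam / s) g) *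
          Matrix.diagonal fun g => ∏ n, diagEntry s P n (1 / lam / s) g) := by
      rw [Matrix.diagonal_mul_diagonal, ← Matrix.diagonal_smul]
      congr 1
      ext g
      simp [Finset.prod_mul_distrib]
    rw [e, Matrix.eta_fin_two (auxScalar (kMinus s P lam) : AuxOp p N)]
    refine Matrix.ext fun i j => ?_
    fin_cases i <;> fin_cases j <;>
      simp [corner, auxScalar, Matrix.mul_apply, Fin.sum_univ_two, ← hK,
        Algebra.algebraMap_eq_smul_one, smul_smul]
  have hKe : K = P.kappa * Complex.exp P.tau / (P.zeta - 1 / P.zeta) *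
      (lam ^ 2 / s ^ 2 - s ^ 2 / lam ^ 2) := by
    rw [hK, kMinus]
    simp
    ring
  have hfac : ∀ g : Config p N, (-1) ^ N *
      ∏ n, (diagEntry s P n (lam / s) g * diagEntry s P n (1 / lam / s) g) =
        (∏ n, (P.alpha n * P.beta n)) * ∏ n, (xVar lam - baseZero s P n (g n)) := by
    intro g
    have : (-1 : ℂ) ^ N = ∏ _n : Fin N, (-1 : ℂ) := by simp
    rw [this, ← Finset.prod_mul_distrib, ← Finset.prod_mul_distrib]
    refine Finset.prod_congr rfl fun n _ => ?_
    have h₁ := hα n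
    have h₂ := hβ n
    have h₃ : (s ^ 2) ^ (g n : ℕ) ≠ 0 := pow_ne_zero _ (pow_ne_zero _ hs)
    rw [diagEntry, diagEntry, xVar, baseZero, mul_comm 2 (g n : ℕ), pow_mul (s ^ 2)]
    generalize (s ^ 2) ^ (g n : ℕ) = y at *
    field_simp
    ring
  rw [gaugedB, hU]
  simp only [Matrix.of_apply, Matrix.cons_val_zero, Matrix.cons_val_one, Matrix.cons_val',
    Matrix.cons_val_fin_one, smul_zero, zero_sub, add_zero]
  rw [← neg_smul, smul_smul, ← Matrix.diagonal_smul]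
  congr 1
  ext g
  rw [Pi.smul_apply, smul_eq_mul, mul_assoc ((-1) ^ N), mul_left_comm ((-1) ^ N), hfac, hKe,
    baseLead]
  ring

theorem bCoeff_degenerate {s : ℂ} (hs : ‖s‖ = 1) {P : Params N} (hN : N ≠ 0)
    (h : ∀ n, P.a n = 0 ∧ P.b n = 0 ∧ P.c n = 0 ∧ P.d n = 0)
    (hα : ∀ n, P.alpha n ≠ 0) (hβ : ∀ n, P.beta n ≠ 0) (bt : ℂ) (k : ℕ) :
    (bCoeff s P bt k : Op p N) = Matrix.diagonal fun g =>
      (C (baseLead s P bt) * ∏ n, (X - C (baseZero s P n (g n)))).coeff k := by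
  have hs0 := norm_ne_zero_of_norm_one hs
  have hdeg : ∀ g : Config p N,
      (C (baseLead s P bt) * ∏ n, (X - C (baseZero s P n (g n)))).natDegree ≤ N := by
    intro g
    refine (natDegree_C_mul_le _ _).trans ?_
    rw [natDegree_prod_of_monic _ _ fun n _ => monic_X_sub_C _]
    simp
  ext g g'
  rcases eq_or_ne g g' with rfl | hg
  · rw [Matrix.diagonal_apply_eq]
    refine bCoeff_apply hs (hdeg g) (fun i => ?_) k
    rw [gaugedB_degenerate hs0 hN h hα hβ (node_ne_zero i), Matrix.diagonal_apply_eq, eval_mul,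
      eval_C, eval_prod]
    simp
  · rw [Matrix.diagonal_apply_ne _ hg, bCoeff_apply hs (Q := 0) (by simp) (fun i => ?_) k, coeff_zero]
    rw [gaugedB_degenerate hs0 hN h hα hβ (node_ne_zero i), Matrix.diagonal_apply_ne _ hg]
    simp

end DegenerateOperators

end

end CyclicReflection

namespace CyclicReflection

noncomputable section

/-! ### Symmetric functions of the zeros -/

section OperatorPolynomials

open Polynomial

variable {p N : ℕ} [NeZero p]

/-- A symmetric polynomial is a polynomial in the coefficients of the polynomial with the given
zeros. -/
theorem exists_eval_coeff_eq {F : MvPolynomial (Fin N) ℂ} (hF : F.IsSymmetric) :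
    ∃ G : MvPolynomial (Fin N) ℂ, ∀ x : Fin N → ℂ,
      MvPolynomial.eval (fun i : Fin N => (∏ n, (X - C (x n))).coeff (N - (i + 1))) G =
        MvPolynomial.eval x F := by
  obtain ⟨G, hG⟩ := MvPolynomial.esymmAlgHom_surjective (σ := Fin N) ℂ (n := N) (by simp) ⟨F, hF⟩
  refine ⟨MvPolynomial.aeval
    (fun i : Fin N => MvPolynomial.C ((-1) ^ ((i : ℕ) + 1)) * MvPolynomial.X i) G, fun x => ?_⟩
  have hG' : MvPolynomial.aeval (fun i : Fin N => MvPolynomial.esymm (Fin N) ℂ (i + 1)) G = F := by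
    rw [← MvPolynomial.esymmAlgHom_apply, hG]
  have hc : ∀ i : Fin N, (∏ n, (X - C (x n))).coeff (N - (i + 1)) =
      (-1) ^ ((i : ℕ) + 1) * MvPolynomial.eval x (MvPolynomial.esymm (Fin N) ℂ (i + 1)) := by
    intro i
    have h₁ := Multiset.prod_X_sub_C_coeff (Finset.univ.val.map x) (k := N - (i + 1)) (by simp)
    have h₂ : Multiset.card (Finset.univ.val.map x) - (N - (i + 1)) = i + 1 := by
      have := i.isLt
      simp only [Multiset.card_map, Finset.card_val, Finset.card_univ, Fintype.card_fin]
      omega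
    rw [h₂, Multiset.map_map, ← MvPolynomial.aeval_esymm_eq_multiset_esymm (Fin N) ℂ] at h₁
    rw [← MvPolynomial.coe_aeval_eq_eval]
    exact h₁
  rw [← hG', ← MvPolynomial.coe_aeval_eq_eval, ← MvPolynomial.coe_aeval_eq_eval]
  simp only [RingHom.coe_coe, MvPolynomial.aeval_def (R := ℂ) (S₁ := MvPolynomial (Fin N) ℂ)]
  change MvPolynomial.aeval _ (MvPolynomial.aeval _ G) = MvPolynomial.aeval _ (MvPolynomial.aeval _ G)
  rw [← AlgHom.comp_apply, ← AlgHom.comp_apply, MvPolynomial.comp_aeval, MvPolynomial.comp_aeval]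
  congr 2
  ext i
  rw [map_mul, MvPolynomial.aeval_C, MvPolynomial.aeval_X, hc, ← mul_assoc]
  simp [← mul_pow, MvPolynomial.aeval_eq_eval]

/-- The product of the differences of the values at the variables of the Dickson polynomial `D_p`,
which is characterized by `D_p(x + 1/x) = x ^ p + 1 / x ^ p`. -/
def sepPoly (p N : ℕ) : MvPolynomial (Fin N) ℂ :=
  ∏ n, ∏ m, if n = m then 1 else
    (aeval (MvPolynomial.X n) (dickson 1 (1 : ℂ) p) - aeval (MvPolynomial.X m) (dickson 1 (1 : ℂ) p))

theorem isSymmetric_sepPoly (p N : ℕ) : (sepPoly p N).IsSymmetric := by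
  intro e
  rw [sepPoly, map_prod]
  simp only [map_prod]
  have h : ∀ n m, MvPolynomial.rename e (if n = m then 1 else
      (aeval (MvPolynomial.X n) (dickson 1 (1 : ℂ) p) -
        aeval (MvPolynomial.X m) (dickson 1 (1 : ℂ) p)) : MvPolynomial (Fin N) ℂ) =
      if e n = e m then 1 else
        (aeval (MvPolynomial.X (e n)) (dickson 1 (1 : ℂ) p) -
          aeval (MvPolynomial.X (e m)) (dickson 1 (1 : ℂ) p)) := by
    intro n m
    simp only [e.apply_eq_iff_eq]
    split_ifs
    · exact map_one _
    · rw [map_sub, ← aeval_algHom_apply, ← aeval_algHom_apply, MvPolynomial.rename_X,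
        MvPolynomial.rename_X]
  simp only [h]
  rw [Equiv.prod_comp e fun n => ∏ m, if n = e m then (1 : MvPolynomial (Fin N) ℂ) else
    (aeval (MvPolynomial.X n) (dickson 1 (1 : ℂ) p) -
      aeval (MvPolynomial.X (e m)) (dickson 1 (1 : ℂ) p))]
  refine Finset.prod_congr rfl fun n _ => ?_
  exact Equiv.prod_comp e fun m => if n = m then (1 : MvPolynomial (Fin N) ℂ) else
    (aeval (MvPolynomial.X n) (dickson 1 (1 : ℂ) p) -
      aeval (MvPolynomial.X m) (dickson 1 (1 : ℂ) p))

theorem eval_sepPoly_ne_zero {x : Fin N → ℂ} : MvPolynomial.eval x (sepPoly p N) ≠ 0 ↔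
    ∀ n m, n ≠ m → (dickson 1 (1 : ℂ) p).eval (x n) ≠ (dickson 1 (1 : ℂ) p).eval (x m) := by
  have h : ∀ n, MvPolynomial.eval x (aeval (MvPolynomial.X n) (dickson 1 (1 : ℂ) p)) =
      (dickson 1 (1 : ℂ) p).eval (x n) := by
    intro n
    rw [← MvPolynomial.coe_aeval_eq_eval]
    change MvPolynomial.aeval x _ = _
    rw [← aeval_algHom_apply, MvPolynomial.aeval_X, coe_aeval_eq_eval]
  simp only [sepPoly, map_prod, Finset.prod_ne_zero_iff, Finset.mem_univ, forall_true_left]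
  refine forall_congr' fun n => forall_congr' fun m => ?_
  split_ifs with hnm
  · simp [hnm]
  · simp [hnm, h, sub_ne_zero]

/-- `sepPoly` as a polynomial in the coefficients of the monic polynomial with the given zeros. -/
def sepCoeffPoly (p N : ℕ) : MvPolynomial (Fin N) ℂ :=
  (exists_eval_coeff_eq (isSymmetric_sepPoly p N)).choose

theorem eval_sepCoeffPoly (x : Fin N → ℂ) :
    MvPolynomial.eval (fun i : Fin N => (∏ n, (X - C (x n))).coeff (N - (i + 1)))
      (sepCoeffPoly p N) = MvPolynomial.eval x (sepPoly p N) :=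
  (exists_eval_coeff_eq (isSymmetric_sepPoly p N)).choose_spec x

/-- The value of a polynomial at operators which need not commute; the factors of every monomial are
multiplied in increasing order of the variables. -/
def opEval (G : MvPolynomial (Fin N) ℂ) (T : Fin N → Op p N) : Op p N :=
  ∑ d ∈ G.support, G.coeff d • ((List.finRange N).map fun i => T i ^ d i).prod

theorem pow_mulVec_eq {T : Op p N} {c : ℂ} {v : State p N} (h : Matrix.mulVec T v = c • v) (k : ℕ) :
    Matrix.mulVec (T ^ k) v = c ^ k • v := by
  induction k with
  | zero => simp
  | succ k ih => rw [pow_succ, ← Matrix.mulVec_mulVec, h, Matrix.mulVec_smul, ih, smul_smul, pow_succ']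

theorem opEval_mulVec (G : MvPolynomial (Fin N) ℂ) {T : Fin N → Op p N} {e : Fin N → ℂ}
    {v : State p N} (h : ∀ i, Matrix.mulVec (T i) v = e i • v) :
    Matrix.mulVec (opEval G T) v = MvPolynomial.eval e G • v := by
  have hl : ∀ (d : Fin N →₀ ℕ) (l : List (Fin N)),
      Matrix.mulVec (l.map fun i => T i ^ d i).prod v = (l.map fun i => e i ^ d i).prod • v := by
    intro d l
    induction l with
    | nil => simp
    | cons a l ih =>
      rw [List.map_cons, List.prod_cons, ← Matrix.mulVec_mulVec, ih, Matrix.mulVec_smul,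
        pow_mulVec_eq (h a), smul_smul, List.map_cons, List.prod_cons, mul_comm]
  rw [opEval, Matrix.sum_mulVec, MvPolynomial.eval_eq', Finset.sum_smul]
  refine Finset.sum_congr rfl fun d _ => ?_
  rw [Matrix.smul_mulVec, hl, smul_smul, ← List.ofFn_eq_map, List.prod_ofFn]

theorem opEval_diagonal (G : MvPolynomial (Fin N) ℂ) (e : Fin N → Config p N → ℂ) :
    opEval G (fun i => Matrix.diagonal (e i)) =
      Matrix.diagonal fun g => MvPolynomial.eval (fun i => e i g) G := by
  have hl : ∀ (d : Fin N →₀ ℕ) (l : List (Fin N)),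
      (l.map fun i => (Matrix.diagonal (e i) : Op p N) ^ d i).prod =
        Matrix.diagonal fun g => (l.map fun i => e i g ^ d i).prod := by
    intro d l
    induction l with
    | nil => simp
    | cons a l ih =>
      rw [List.map_cons, List.prod_cons, ih, Matrix.diagonal_pow, Matrix.diagonal_mul_diagonal]
      rfl
  simp only [opEval, hl]
  ext g g'
  rw [Matrix.sum_apply]
  rcases eq_or_ne g g' with rfl | hg
  · simp only [Matrix.smul_apply, Matrix.diagonal_apply_eq, MvPolynomial.eval_eq', smul_eq_mul]
    refine Finset.sum_congr rfl fun d _ => ?_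
    rw [← List.ofFn_eq_map, List.prod_ofFn]
  · simp [Matrix.diagonal_apply_ne _ hg]

theorem MatrixDegenerates.opEval (G : MvPolynomial (Fin N) ℂ) {T T0 : Coords N → Fin N → Op p N}
    (h : ∀ i, MatrixDegenerates (fun w => T w i) fun w => T0 w i) :
    MatrixDegenerates (fun w => opEval G (T w)) fun w => opEval G (T0 w) := by
  unfold CyclicReflection.opEval
  exact MatrixDegenerates.sum _ fun d _ => MatrixDegenerates.smul (Degenerates.const _)
    (MatrixDegenerates.listProd _ fun i _ => (h i).pow (d i))

theorem eval_dickson_xVar {z : ℂ} (hz : z ≠ 0) :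
    (dickson 1 (1 : ℂ) p).eval (xVar z) = z ^ (2 * p) + 1 / z ^ (2 * p) := by
  rw [xVar, dickson_one_one_eval_add_inv _ _ (mul_one_div_cancel (pow_ne_zero 2 hz)), one_div_pow,
    ← pow_mul]

/-- The operators that act on the pseudo-eigenvectors as the coefficients of the monic polynomial of
the zeros. -/
def symOp (s : ℂ) (P : Params N) (bt : ℂ) (i : Fin N) : Op p N :=
  (bCoeff s P bt N)⁻¹ * bCoeff s P bt (N - (i + 1))

/-- The operator polynomial `ℬ_-` at the value `x` of the variable `lam ^ 2 + 1 / lam ^ 2`, without its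
trivial factor. -/
def bEval (s : ℂ) (P : Params N) (bt x : ℂ) : Op p N :=
  ∑ k ∈ Finset.range (N + 1), x ^ k • bCoeff s P bt k

/-- The numbers `q ^ j r + 1 / (q ^ j r)`, which the zeros of the pseudo-eigenvalue avoid for
suitable `r`. -/
def probe (s r : ℂ) (j : ℤ) : ℂ := (s ^ 2) ^ j * r + 1 / ((s ^ 2) ^ j * r)

/-- One of the two roots of `r + 1 / r = A`. -/
def joukowskiInv (A : ℂ) : ℂ := (A + (A ^ 2 - 4) ^ (1 / 2 : ℂ)) / 2

theorem joukowskiInv_spec (A : ℂ) :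
    joukowskiInv A ≠ 0 ∧ joukowskiInv A + 1 / joukowskiInv A = A := by
  have h := sq_cpow_half (A ^ 2 - 4)
  have e : joukowskiInv A * (A - joukowskiInv A) = 1 := by
    rw [joukowskiInv]
    linear_combination -h / 4
  have h0 : joukowskiInv A ≠ 0 := left_ne_zero_of_mul_eq_one e
  refine ⟨h0, ?_⟩
  field_simp
  linear_combination -e

/-- The two roots, for `e = 1` and `e = -1`, of `A ^ 2 + A / κ ^ 2 = (ζ ^ 2 + 1 / ζ ^ 2) / κ ^ 2 + 4`.
They are the numbers `α₋ ^ 2 + 1 / α₋ ^ 2` and `-(β₋ ^ 2 + 1 / β₋ ^ 2)`, in a measurable form that does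
not refer to the choice of `α₋, β₋`. -/
def innerRoot (zeta kappa : ℂ) (e : ℤ) : ℂ :=
  (-1 / kappa ^ 2 + e * (1 / kappa ^ 4 +
    4 * ((zeta ^ 2 + 1 / zeta ^ 2) / kappa ^ 2 + 4)) ^ (1 / 2 : ℂ)) / 2

theorem innerRoot_spec (zeta kappa : ℂ) {e : ℤ} (he : e = 1 ∨ e = -1) :
    innerRoot zeta kappa e ^ 2 + innerRoot zeta kappa e / kappa ^ 2 =
      (zeta ^ 2 + 1 / zeta ^ 2) / kappa ^ 2 + 4 := by
  have h := sq_cpow_half (1 / kappa ^ 4 + 4 * ((zeta ^ 2 + 1 / zeta ^ 2) / kappa ^ 2 + 4))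
  rw [innerRoot]
  generalize (1 / kappa ^ 4 + 4 * ((zeta ^ 2 + 1 / zeta ^ 2) / kappa ^ 2 + 4)) ^ (1 / 2 : ℂ) = x at *
  have hk : (1 / kappa ^ 4 : ℂ) = (1 / kappa ^ 2) ^ 2 := by ring
  have he' : (e : ℂ) ^ 2 = 1 := by rcases he with rfl | rfl <;> simp
  rw [hk] at h
  simp only [div_eq_mul_inv, one_mul] at *
  generalize (kappa ^ 2)⁻¹ = y at *
  generalize (zeta ^ 2 + (zeta ^ 2)⁻¹) = Z at *
  linear_combination x ^ 2 / 4 * he' + h / 4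

theorem eq_innerRoot {zeta kappa A : ℂ} (h : A ^ 2 + A / kappa ^ 2 =
    (zeta ^ 2 + 1 / zeta ^ 2) / kappa ^ 2 + 4) :
    ∃ e : ℤ, (e = 1 ∨ e = -1) ∧ A = innerRoot zeta kappa e := by
  have hx := sq_cpow_half (1 / kappa ^ 4 + 4 * ((zeta ^ 2 + 1 / zeta ^ 2) / kappa ^ 2 + 4))
  simp only [innerRoot]
  generalize (1 / kappa ^ 4 + 4 * ((zeta ^ 2 + 1 / zeta ^ 2) / kappa ^ 2 + 4)) ^ (1 / 2 : ℂ) = x at *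
  have e : (2 * A + 1 / kappa ^ 2 - x) * (2 * A + 1 / kappa ^ 2 + x) = 0 := by
    have hk : (1 / kappa ^ 4 : ℂ) = (1 / kappa ^ 2) ^ 2 := by ring
    rw [hk] at hx
    simp only [div_eq_mul_inv, one_mul] at *
    linear_combination 4 * h - hx
  rcases mul_eq_zero.1 e with e | e
  · exact ⟨1, Or.inl rfl, by push_cast; linear_combination e / 2⟩
  · exact ⟨-1, Or.inr rfl, by push_cast; linear_combination e / 2⟩

end OperatorPolynomials

end

end CyclicReflection

namespace CyclicReflection

noncomputable section

/-! ### Parameters in general position -/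

section Generic

open Polynomial

variable {p N : ℕ} [NeZero p] {s : ℂ} {P : Params N}

/-- Conditions on the parameters under which the pseudo-spectrum is simple and avoids the zeros of the
coefficients `𝖠_-` and `𝖣_-`. The zeros of the pseudo-eigenvalue are not functions of the parameters; the
conditions on them are expressed by determinants of operators for which the pseudo-eigenvector is an
eigenvector. -/
structure Params.Generic (p : ℕ) [NeZero p] (s : ℂ) (P : Params N) : Prop where
  regular : P.Regular
  beta_ne : P.gaugeBeta ≠ 0
  beta_pow : P.gaugeBeta ^ (2 * p) ≠ 1
  det_lead : ∀ k : ℕ, (bCoeff s P ((s ^ 2) ^ k * P.gaugeBeta) N : Op p N).det ≠ 0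
  det_sep : (opEval (sepCoeffPoly p N) (symOp s P P.gaugeBeta) : Op p N).det ≠ 0
  det_one : ∀ j, (bEval s P P.gaugeBeta (probe s 1 j) : Op p N).det ≠ 0
  det_neg_one : ∀ j, (bEval s P P.gaugeBeta (probe s (-1) j) : Op p N).det ≠ 0
  det_inner : ∀ j e, e = 1 ∨ e = -1 → (bEval s P P.gaugeBeta
    (probe s (joukowskiInv (innerRoot P.zeta P.kappa e)) j) : Op p N).det ≠ 0
  det_muPlus : ∀ j m, (bEval s P P.gaugeBeta
    (probe s (-s ^ 2 * (P.a m * P.beta m / (P.alpha m * P.b m))) j) : Op p N).det ≠ 0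
  det_muMinus : ∀ j m, (bEval s P P.gaugeBeta
    (probe s (-s ^ 2 * (P.c m * P.beta m / (P.alpha m * P.d m))) j) : Op p N).det ≠ 0

theorem exists_nat_of_mem_gaugeOrbit (hs : s ≠ 0) (hsp : (s ^ 2) ^ p = 1) {b0 bt : ℂ}
    (h : bt ∈ gaugeOrbit s b0) : ∃ k : ℕ, bt = (s ^ 2) ^ k * b0 := by
  obtain ⟨k, rfl⟩ := h
  have hp : (0 : ℤ) < p := by exact_mod_cast NeZero.pos p
  have hq : s ^ 2 ≠ 0 := pow_ne_zero _ hs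
  refine ⟨((2 * k) % (p : ℤ)).toNat, ?_⟩
  have : (s ^ 2) ^ (2 * k) = (s ^ 2) ^ ((2 * k) % (p : ℤ)) := by
    conv_lhs => rw [← Int.emod_add_mul_ediv (2 * k) p, zpow_add₀ hq, zpow_mul, zpow_natCast, hsp,
      one_zpow, mul_one]
  rw [this, ← zpow_natCast (s ^ 2), Int.toNat_of_nonneg (Int.emod_nonneg _ hp.ne')]

/-- A zero that avoids all values `q ^ j r + 1 / (q ^ j r)` avoids all `q ^ j a` with
`a + 1 / a = r + 1 / r`. -/
theorem sq_ne_of_probe (hs : s ≠ 0) {z r a : ℂ} (hr : r ≠ 0) (ha : a ≠ 0)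
    (h : a + 1 / a = r + 1 / r) (hp : ∀ j, xVar z ≠ probe s r j) (j : ℤ) :
    z ^ 2 ≠ (s ^ 2) ^ j * a := by
  intro e
  have hq : ∀ j : ℤ, (s ^ 2) ^ j ≠ 0 := fun j => zpow_ne_zero _ (pow_ne_zero _ hs)
  have hf : (a - r) * (a * r - 1) = 0 := by
    field_simp at h
    linear_combination h
  rcases mul_eq_zero.1 hf with h' | h'
  · refine hp j ?_
    rw [xVar, probe, e, sub_eq_zero.1 h']
  · refine hp (-j) ?_
    have ha' : a = 1 / r := by
      field_simp
      linear_combination h'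
    have := hq j
    rw [xVar, probe, e, ha', zpow_neg]
    field_simp
    ring

theorem mulVec_ne_zero_of_det {A : Op p N} (hA : A.det ≠ 0) {v : State p N} (hv : v ≠ 0) :
    Matrix.mulVec A v ≠ 0 := by
  intro h
  exact hA (Matrix.exists_mulVec_eq_zero_iff.1 ⟨v, hv, h⟩)

/-- In general position there are pseudo-eigenvectors whose zeros satisfy the conditions for the
construction of the separated bases. They do not depend on the choice of `α₋, β₋, a₀`. -/
theorem Params.Generic.exists_spectralData (h : P.Generic p s) (hs : ‖s‖ = 1)
    (hq : IsPrimitiveRoot (s ^ 2) p) (hp : Odd p) : ∃ (ℓ : ℂ) (z : Fin N → ℂ) (ψ : ℂ → State p N),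
      ∀ am bm a0 : ℂ, IsInnerBoundary P am bm → a0 ≠ 0 → SpectralData s P am bm a0 ℓ z ψ := by
  have hs0 := norm_ne_zero_of_norm_one hs
  have hsp := hq.pow_eq_one
  obtain ⟨ℓ, z, ψ, hℓ, hz, hψ⟩ := exists_pseudo_eigenvector hs hsp h.regular (fun bt hbt => by
    obtain ⟨k, rfl⟩ := exists_nat_of_mem_gaugeOrbit (p := p) hs0 hsp hbt
    exact h.det_lead k)
  obtain ⟨hψ0, hc, -⟩ := hψ _ (self_mem_gaugeOrbit s P.gaugeBeta)
  set Q : ℂ[X] := ∏ n, (X - C (xVar (z n))) with hQ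
  have hQm : Q.Monic := monic_prod_of_monic _ _ fun n _ => monic_X_sub_C _
  have hQd : Q.natDegree = N := by
    rw [hQ, natDegree_prod_of_monic _ _ fun n _ => monic_X_sub_C _]
    simp
  have hcN : Q.coeff N = 1 := by rw [← hQd]; exact hQm.coeff_natDegree
  -- Avoided values of `lam ^ 2 + 1 / lam ^ 2`.
  have avoid : ∀ x, (bEval s P P.gaugeBeta x : Op p N).det ≠ 0 → ∀ n, xVar (z n) ≠ x := by
    rintro x hx n rfl
    refine mulVec_ne_zero_of_det hx hψ0 ?_
    have : ∀ k ∈ Finset.range (N + 1), Matrix.mulVec (xVar (z n) ^ k • bCoeff s P P.gaugeBeta k)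
        (ψ P.gaugeBeta) = ((C ℓ * Q).coeff k * xVar (z n) ^ k) • ψ (P.gaugeBeta * s ^ 4) := by
      intro k hk
      rw [Matrix.smul_mulVec, hc k (Nat.lt_succ_iff.1 (Finset.mem_range.1 hk)), smul_smul, mul_comm]
    rw [bEval, Matrix.sum_mulVec, Finset.sum_congr rfl this, ← Finset.sum_smul,
      ← eval_eq_sum_range' (Nat.lt_succ_of_le ((natDegree_C_mul_le _ _).trans hQd.le)), eval_mul, hQ,
      eval_prod, Finset.prod_eq_zero (Finset.mem_univ n) (by simp), mul_zero, zero_smul]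
  have key : ∀ {r a : ℂ}, r ≠ 0 → a ≠ 0 → a + 1 / a = r + 1 / r →
      (∀ j, (bEval s P P.gaugeBeta (probe s r j) : Op p N).det ≠ 0) → ∀ n (j : ℤ),
        z n ^ 2 ≠ (s ^ 2) ^ j * a :=
    fun hr ha hra hd n j => sq_ne_of_probe hs0 hr ha hra (fun j => avoid _ (hd j) n) j
  have zpow_two : ∀ (x : ℂ) (e : ℤ), (e = 1 ∨ e = -1) → x ≠ 0 → x ^ (2 * e) ≠ 0 ∧
      x ^ (2 * e) + 1 / x ^ (2 * e) = x ^ 2 + 1 / x ^ 2 := by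
    intro x e he hx
    refine ⟨zpow_ne_zero _ hx, ?_⟩
    rcases he with rfl | rfl
    · norm_cast
    · rw [show (2 : ℤ) * -1 = -((2 : ℕ) : ℤ) by norm_num, zpow_neg, zpow_natCast, one_div, inv_inv,
        one_div, add_comm]
  -- The values of the Dickson polynomial at the zeros are distinct.
  have hsep : ∀ n m, n ≠ m →
      z n ^ (2 * p) + 1 / z n ^ (2 * p) ≠ z m ^ (2 * p) + 1 / z m ^ (2 * p) := by
    have hlead : IsUnit (bCoeff s P P.gaugeBeta N : Op p N).det := by
      have := h.det_lead 0
      rw [pow_zero, one_mul] at this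
      exact this.isUnit
    have hT : ∀ i : Fin N, Matrix.mulVec (symOp s P P.gaugeBeta i) (ψ P.gaugeBeta) =
        Q.coeff (N - (i + 1)) • ψ P.gaugeBeta := by
      intro i
      have h₁ : ψ (P.gaugeBeta * s ^ 4) =
          ℓ⁻¹ • Matrix.mulVec (bCoeff s P P.gaugeBeta N) (ψ P.gaugeBeta) := by
        rw [hc N le_rfl, coeff_C_mul, hcN, mul_one, inv_smul_smul₀ hℓ]
      rw [symOp, ← Matrix.mulVec_mulVec, hc _ (Nat.sub_le _ _), h₁, Matrix.mulVec_smul,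
        Matrix.mulVec_smul, Matrix.mulVec_mulVec, Matrix.nonsing_inv_mul _ hlead, Matrix.one_mulVec,
        smul_smul, coeff_C_mul, mul_comm ℓ, mul_assoc, mul_inv_cancel₀ hℓ, mul_one]
    have h₂ := mulVec_ne_zero_of_det h.det_sep hψ0
    rw [opEval_mulVec _ hT, hQ, eval_sepCoeffPoly] at h₂
    have h₃ := eval_sepPoly_ne_zero.1 (left_ne_zero_of_smul h₂)
    intro n m hnm
    rw [← eval_dickson_xVar (hz n), ← eval_dickson_xVar (hz m)]
    exact h₃ n m hnm
  refine ⟨ℓ, z, ψ, fun am bm a0 hin ha0 => ?_⟩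
  have hS := hin.sum_sub h.regular
  have hPr := hin.prod_eq h.regular
  have hinner : ∀ A, A ^ 2 + A / P.kappa ^ 2 = (P.zeta ^ 2 + 1 / P.zeta ^ 2) / P.kappa ^ 2 + 4 →
      ∃ r, r ≠ 0 ∧ A = r + 1 / r ∧
        ∀ j, (bEval s P P.gaugeBeta (probe s r j) : Op p N).det ≠ 0 := by
    intro A hA
    obtain ⟨e, he, hAe⟩ := eq_innerRoot hA
    refine ⟨_, (joukowskiInv_spec A).1, (joukowskiInv_spec A).2.symm, fun j => ?_⟩
    rw [hAe]
    exact h.det_inner j e he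
  have hmu : ∀ μ : ℂ, μ ≠ 0 → (∀ j, (bEval s P P.gaugeBeta (probe s (μ ^ 2) j) : Op p N).det ≠ 0) →
      ∀ n (j e : ℤ), (e = 1 ∨ e = -1) → z n ^ 2 ≠ (s ^ 2) ^ j * μ ^ (2 * e) := by
    intro μ hμ hd n j e he
    obtain ⟨h0, h1⟩ := zpow_two μ e he hμ
    exact key (pow_ne_zero 2 hμ) h0 h1 hd n j
  have hR := h.regular
  refine
    { norm_s := hs, prim := hq, odd := hp, regular := hR, inner := hin, a0_ne := ha0
      beta_ne := h.beta_ne, beta_pow := h.beta_pow, lead_ne := hℓ, z_ne := hz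
      z_pow := fun n hn => ?_
      z_sep := fun n m hnm => ⟨fun e => ?_, fun e => ?_⟩
      z_am := fun n j e he => ?_
      z_bm := fun n j e he => ?_
      z_muPlus := fun n m j e he => ?_
      z_muMinus := fun n m j e he => ?_
      ket_ne := fun bt hbt => (hψ bt hbt).1
      ket_eig := fun bt hbt => (hψ bt hbt).2.2 }
  · -- If `z ^ (4 p) = 1`, then `z ^ 2` or, `p` being odd, `-z ^ 2` is a power of `q`.
    have e : ((z n ^ 2) ^ p - 1) * ((-z n ^ 2) ^ p - 1) = 0 := by
      rw [hp.neg_pow]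
      have : z n ^ (4 * p) = ((z n ^ 2) ^ p) ^ 2 := by
        rw [← pow_mul, ← pow_mul]
        congr 1
        ring
      rw [this] at hn
      linear_combination -hn
    rcases mul_eq_zero.1 e with e | e
    · obtain ⟨i, -, hi⟩ := hq.eq_pow_of_pow_eq_one (sub_eq_zero.1 e)
      refine key one_ne_zero one_ne_zero rfl h.det_one n i ?_
      rw [zpow_natCast, hi, mul_one]
    · obtain ⟨i, -, hi⟩ := hq.eq_pow_of_pow_eq_one (sub_eq_zero.1 e)
      refine key (neg_ne_zero.2 one_ne_zero) (neg_ne_zero.2 one_ne_zero) rfl h.det_neg_one n i ?_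
      rw [zpow_natCast, hi, mul_neg, mul_one, neg_neg]
  · exact hsep n m hnm (by rw [e])
  · refine hsep n m hnm ?_
    have e₁ : z m ^ (2 * p) = 1 / z n ^ (2 * p) :=
      eq_one_div_of_mul_eq_one_right e
    rw [e₁, one_div_one_div, add_comm]
  · obtain ⟨r, hr, hA, hd⟩ := hinner (am ^ 2 + 1 / am ^ 2) (by
      rw [← hPr]
      rw [neg_div] at hS
      linear_combination (am ^ 2 + 1 / am ^ 2) * hS)
    obtain ⟨h0, h1⟩ := zpow_two am e he hin.1
    exact key hr h0 (h1.trans hA) hd n j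
  · obtain ⟨r, hr, hA, hd⟩ := hinner (-(bm ^ 2 + 1 / bm ^ 2)) (by
      rw [← hPr]
      rw [neg_div] at hS
      linear_combination -(bm ^ 2 + 1 / bm ^ 2) * hS)
    obtain ⟨h0, h1⟩ := zpow_two bm e he hin.2.1
    rw [← mul_neg]
    refine key hr (neg_ne_zero.2 h0) ?_ hd n j
    rw [← hA, ← h1, one_div, one_div, inv_neg]
    ring
  · refine hmu _ (fun h0 => ?_) (fun j => ?_) n j e he
    · have := muPlus_sq (s := s) P m
      rw [h0, zero_pow two_ne_zero] at this
      exact mul_ne_zero (neg_ne_zero.2 (pow_ne_zero 2 hs0)) (div_ne_zero (mul_ne_zero (hR.a m)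
        (hR.beta m)) (mul_ne_zero (hR.alpha m) (hR.b m))) this.symm
    · rw [muPlus_sq]
      exact h.det_muPlus j m
  · refine hmu _ (fun h0 => ?_) (fun j => ?_) n j e he
    · have := muMinus_sq (s := s) P m
      rw [h0, zero_pow two_ne_zero] at this
      exact mul_ne_zero (neg_ne_zero.2 (pow_ne_zero 2 hs0)) (div_ne_zero (mul_ne_zero (hR.c m)
        (hR.beta m)) (mul_ne_zero (hR.alpha m) (hR.d m))) this.symm
    · rw [muMinus_sq]
      exact h.det_muMinus j m

end Generic

end

end CyclicReflection

namespace CyclicReflection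

noncomputable section

/-! ### Almost all parameters are in general position -/

section AlmostEverywhere

open Polynomial Filter

variable {p N : ℕ} [NeZero p] {s : ℂ}

theorem ae_eval_ne_zero {Q : ℂ[X]} (hQ : Q ≠ 0) : ∀ᵐ x : ℂ, Q.eval x ≠ 0 := by
  have hfin : {x : ℂ | ¬ Q.eval x ≠ 0}.Finite := eventually_cofinite.1 (eventually_cofinite_eval_ne hQ)
  filter_upwards [hfin.countable.ae_notMem volume] with x hx
  simpa using hx

theorem ae_fst_eval_ne_zero {Q : ℂ[X]} (hQ : Q ≠ 0) (i : Fin 5) :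
    ∀ᵐ w : Coords N, Q.eval (w.1 i) ≠ 0 :=
  ((Measure.quasiMeasurePreserving_eval (fun _ : Fin 5 => (volume : Measure ℂ)) i).comp
    Measure.quasiMeasurePreserving_fst).ae (ae_eval_ne_zero hQ)

theorem ae_fst_ne (i : Fin 5) (c : ℂ) : ∀ᵐ w : Coords N, w.1 i ≠ c := by
  filter_upwards [ae_fst_eval_ne_zero (X_sub_C_ne_zero c) i] with w hw
  simpa [sub_eq_zero] using hw

theorem ae_snd_ne_mul (n : Fin N) {i j : Fin 6} (hij : i ≠ j) (c : ℂ) :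
    ∀ᵐ w : Coords N, w.2 n i ≠ c * w.2 n j := by
  have := ae_ne_zero_of_direction (f := fun w : Coords N => w.2 n i - c * w.2 n j) (by fun_prop)
    (0, Pi.single n (Pi.single i 1)) fun w => by
      refine ae_real_of_cofinite
        (C := fun t => (w + t • ((0, Pi.single n (Pi.single i 1)) : Coords N)).2 n i -
          c * (w + t • ((0, Pi.single n (Pi.single i 1)) : Coords N)).2 n j ≠ 0) ?_
      filter_upwards [(Set.finite_singleton (c * w.2 n j - w.2 n i)).eventually_cofinite_notMem]
        with t ht h
      apply ht
      simp only [Prod.snd_add, Prod.smul_snd, Pi.add_apply, Pi.smul_apply, Pi.single_eq_same,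
        Pi.single_eq_of_ne hij.symm, smul_eq_mul, mul_one, mul_zero, add_zero] at h
      rw [Set.mem_singleton_iff]
      linear_combination h
  filter_upwards [this] with w hw
  exact sub_ne_zero.1 hw

theorem ae_snd_ne_zero (n : Fin N) (i : Fin 6) : ∀ᵐ w : Coords N, w.2 n i ≠ 0 := by
  obtain ⟨j, hj⟩ := exists_ne i
  filter_upwards [ae_snd_ne_mul n hj.symm 0] with w hw
  rwa [zero_mul] at hw

theorem ae_regular : ∀ᵐ w : Coords N, (Params.ofCoords w).Regular := by
  have h : ∀ᵐ w : Coords N, ∀ n i, w.2 n i ≠ 0 :=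
    ae_all_iff.2 fun n => ae_all_iff.2 fun i => ae_snd_ne_zero n i
  filter_upwards [h, ae_fst_ne 0 0, ae_fst_ne 0 1, ae_fst_ne 0 (-1), ae_fst_ne 1 0, ae_fst_ne 3 0]
    with w h h₁ h₂ h₃ h₄ h₅
  refine ⟨h₁, h₄, fun e => ?_, h₅, fun n => h n 0, fun n => h n 1, fun n => h n 2, fun n => h n 3,
    fun n => h n 4, fun n => h n 5⟩
  have e' : (w.1 0 - 1) * (w.1 0 + 1) = 0 := by
    simp only [Params.ofCoords] at e
    field_simp at e
    linear_combination e
  rcases mul_eq_zero.1 e' with e' | e'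
  · exact h₂ (sub_eq_zero.1 e')
  · exact h₃ (eq_neg_of_add_eq_zero_left e')

theorem ae_beta_pow (p : ℕ) [NeZero p] : ∀ᵐ w : Coords N, w.1 4 ^ (2 * p) ≠ 1 := by
  have : (X ^ (2 * p) - 1 : ℂ[X]) ≠ 0 := X_pow_sub_C_ne_zero (by have := NeZero.pos p; omega) 1
  filter_upwards [ae_fst_eval_ne_zero this 4] with w hw
  simpa [sub_eq_zero] using hw

theorem gauge_sub_ne_zero (hs : s ≠ 0) (hsp : (s ^ 2) ^ p = 1) {x : ℂ} (hx : x ≠ 0)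
    (hxp : x ^ (2 * p) ≠ 1) (k : ℕ) : (s ^ 2) ^ k * x - 1 / ((s ^ 2) ^ k * x) ≠ 0 := by
  have h0 : (s ^ 2) ^ k * x ≠ 0 := mul_ne_zero (pow_ne_zero _ (pow_ne_zero _ hs)) hx
  intro e
  have e' : ((s ^ 2) ^ k * x) ^ 2 = 1 := by
    generalize (s ^ 2) ^ k * x = y at *
    field_simp at e
    linear_combination e
  apply hxp
  have : ((s ^ 2) ^ k * x) ^ (2 * p) = 1 := by rw [pow_mul, e', one_pow]
  rwa [mul_pow, ← pow_mul (s ^ 2) k, show k * (2 * p) = p * (2 * k) by ring, pow_mul (s ^ 2) p, hsp,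
    one_pow, one_mul] at this

theorem ae_gauge (hs : s ≠ 0) (hsp : (s ^ 2) ^ p = 1) : ∀ᵐ w : Coords N, ∀ k : ℕ,
    (s ^ 2) ^ k * w.1 4 - 1 / ((s ^ 2) ^ k * w.1 4) ≠ 0 := by
  filter_upwards [ae_fst_ne 4 0, ae_beta_pow p] with w h₁ h₂ k
  exact gauge_sub_ne_zero hs hsp h₁ h₂ k

/-! ### Chains of positive length -/

theorem ae_baseLead (hs : s ≠ 0) (hsp : (s ^ 2) ^ p = 1) : ∀ᵐ w : Coords N, ∀ k : ℕ,
    baseLead s (baseParams w) ((s ^ 2) ^ k * w.1 4) ≠ 0 := by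
  filter_upwards [ae_gauge hs hsp, ae_regular] with w h hR k
  refine mul_ne_zero (mul_ne_zero (mul_ne_zero (inv_ne_zero (h k))
    (neg_ne_zero.2 (mul_ne_zero hR.gaugeAlpha (pow_ne_zero 2 hs))))
    (div_ne_zero (mul_ne_zero hR.kappa (Complex.exp_ne_zero _)) hR.zeta_sub)) ?_
  exact Finset.prod_ne_zero_iff.2 fun n _ => by simp [baseParams, Params.ofCoords, bulkBase]

theorem bCoeff_baseParams (hs : ‖s‖ = 1) (hN : N ≠ 0) (w : Coords N) (bt : ℂ) (k : ℕ) :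
    (bCoeff s (baseParams w) bt k : Op p N) = Matrix.diagonal fun g =>
      (C (baseLead s (baseParams w) bt) *
        ∏ n, (X - C (baseZero s (baseParams w) n (g n)))).coeff k :=
  bCoeff_degenerate hs hN (fun n => by simp [baseParams, Params.ofCoords, bulkBase])
    (fun n => by simp [baseParams, Params.ofCoords, bulkBase])
    (fun n => by simp [baseParams, Params.ofCoords, bulkBase]) bt k

theorem coeff_prod_X_sub_C (x : Fin N → ℂ) : (∏ n, (X - C (x n))).coeff N = 1 := by
  have hm : (∏ n, (X - C (x n))).Monic := monic_prod_of_monic _ _ fun n _ => monic_X_sub_C _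
  have hd : (∏ n, (X - C (x n))).natDegree = N := by
    rw [natDegree_prod_of_monic _ _ fun n _ => monic_X_sub_C _]
    simp
  have := hm.coeff_natDegree
  rwa [hd] at this

theorem bCoeff_baseParams_last (hs : ‖s‖ = 1) (hN : N ≠ 0) (w : Coords N) (bt : ℂ) :
    (bCoeff s (baseParams w) bt N : Op p N) =
      Matrix.diagonal fun _ => baseLead s (baseParams w) bt := by
  simp only [bCoeff_baseParams hs hN, coeff_C_mul, coeff_prod_X_sub_C, mul_one]

theorem ae_det_bCoeff_baseParams (hs : ‖s‖ = 1) (hsp : (s ^ 2) ^ p = 1) (hN : N ≠ 0) :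
    ∀ᵐ w : Coords N, ∀ k : ℕ,
      (bCoeff s (baseParams w) ((s ^ 2) ^ k * w.1 4) N : Op p N).det ≠ 0 := by
  filter_upwards [ae_baseLead (norm_ne_zero_of_norm_one hs) hsp] with w hw k
  rw [bCoeff_baseParams_last hs hN, Matrix.det_diagonal]
  exact Finset.prod_ne_zero_iff.2 fun _ _ => hw k

theorem ae_det_lead (hs : ‖s‖ = 1) (hsp : (s ^ 2) ^ p = 1) (hN : N ≠ 0) :
    ∀ᵐ w : Coords N, ∀ k : ℕ,
      (bCoeff s (Params.ofCoords w) ((s ^ 2) ^ k * w.1 4) N : Op p N).det ≠ 0 := by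
  refine ae_all_iff.2 fun k => ((matrixDegenerates_bCoeff s _ N).det).ae_ne_zero ?_
  filter_upwards [ae_det_bCoeff_baseParams hs hsp hN] with w hw
  exact hw k

theorem baseZero_baseParams (w : Coords N) (n : Fin N) (k : ℕ) :
    baseZero s (baseParams w) n k = 2 ^ ((n : ℕ) + 1) * (s ^ 2) ^ (2 * k) / s ^ 2 +
      1 / (2 ^ ((n : ℕ) + 1) * (s ^ 2) ^ (2 * k) / s ^ 2) := by
  simp [baseZero, baseParams, Params.ofCoords, bulkBase]

theorem norm_baseVar (hs : ‖s‖ = 1) (n : Fin N) (k : ℕ) :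
    ‖(2 ^ ((n : ℕ) + 1) * (s ^ 2) ^ (2 * k) / s ^ 2 : ℂ)‖ = 2 ^ ((n : ℕ) + 1) := by
  simp [hs]

theorem add_inv_eq_iff {x y : ℂ} (hx : x ≠ 0) (hy : y ≠ 0) :
    x + 1 / x = y + 1 / y ↔ x = y ∨ x * y = 1 := by
  have : (x - y) * (x * y - 1) = (x + 1 / x - (y + 1 / y)) * (x * y) := by
    field_simp
    ring
  rw [← sub_eq_zero, ← sub_eq_zero (a := x), ← sub_eq_zero (a := x * y), ← mul_eq_zero, this,
    mul_eq_zero]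
  simp [hx, hy]

/-- At the degenerate parameters the `p`-th powers of the zeros are `2 ^ ((n + 1) p)`, whatever the
labels are. -/
theorem eval_sepPoly_baseZero_ne_zero (hs : ‖s‖ = 1) (hsp : (s ^ 2) ^ p = 1) (w : Coords N)
    (g : Config p N) : MvPolynomial.eval (fun n => baseZero s (baseParams w) n (g n))
      (sepPoly p N) ≠ 0 := by
  have hs0 : s ^ 2 ≠ 0 := pow_ne_zero _ (norm_ne_zero_of_norm_one hs)
  rw [eval_sepPoly_ne_zero]
  have h : ∀ n : Fin N, (dickson 1 (1 : ℂ) p).eval (baseZero s (baseParams w) n (g n)) =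
      2 ^ (((n : ℕ) + 1) * p) + 1 / 2 ^ (((n : ℕ) + 1) * p) := by
    intro n
    have h0 : (2 ^ ((n : ℕ) + 1) * (s ^ 2) ^ (2 * (g n : ℕ)) / s ^ 2 : ℂ) ≠ 0 :=
      div_ne_zero (mul_ne_zero (pow_ne_zero _ two_ne_zero) (pow_ne_zero _ hs0)) hs0
    have e : (2 ^ ((n : ℕ) + 1) * (s ^ 2) ^ (2 * (g n : ℕ)) / s ^ 2 : ℂ) ^ p =
        2 ^ (((n : ℕ) + 1) * p) := by
      rw [div_pow, mul_pow, hsp, ← pow_mul (s ^ 2), mul_comm _ p, pow_mul _ p, hsp, one_pow, div_one,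
        mul_one, ← pow_mul]
    rw [baseZero_baseParams, dickson_one_one_eval_add_inv _ _ (mul_one_div_cancel h0), one_div_pow, e]
  intro n m hnm
  rw [h, h, Ne, add_inv_eq_iff (pow_ne_zero _ two_ne_zero) (pow_ne_zero _ two_ne_zero)]
  have hp := NeZero.pos p
  rintro (e | e)
  · have e' : 2 ^ (((n : ℕ) + 1) * p) = 2 ^ (((m : ℕ) + 1) * p) := by exact_mod_cast e
    have := Nat.eq_of_mul_eq_mul_right hp (Nat.pow_right_injective le_rfl e')
    exact hnm (Fin.ext (by omega))
  · rw [← pow_add] at e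
    have e' : 2 ^ (((n : ℕ) + 1) * p + ((m : ℕ) + 1) * p) = 1 := by exact_mod_cast e
    rw [Nat.pow_eq_one] at e'
    simp [hp.ne'] at e'

theorem ae_det_sep (hs : ‖s‖ = 1) (hsp : (s ^ 2) ^ p = 1) (hN : N ≠ 0) : ∀ᵐ w : Coords N,
    (opEval (sepCoeffPoly p N) (symOp s (Params.ofCoords w) (w.1 4)) : Op p N).det ≠ 0 := by
  have hlead := ae_det_bCoeff_baseParams (p := p) hs hsp hN
  have hB : ∀ k, MatrixDegenerates
      (fun w : Coords N => (bCoeff s (Params.ofCoords w) (w.1 4) k : Op p N))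
      fun w => bCoeff s (baseParams w) (w.1 4) k := by
    intro k
    have := matrixDegenerates_bCoeff (p := p) (N := N) s 1 k
    simpa only [one_mul] using this
  have hlead₀ : ∀ᵐ w : Coords N, (bCoeff s (baseParams w) (w.1 4) N : Op p N).det ≠ 0 := by
    filter_upwards [hlead] with w hw
    have := hw 0
    rwa [pow_zero, one_mul] at this
  refine (MatrixDegenerates.opEval (sepCoeffPoly p N) fun i =>
    ((hB N).inv hlead₀).mul (hB (N - (i + 1)))).det.ae_ne_zero ?_
  filter_upwards [hlead₀] with w hw
  have hT : ∀ i : Fin N, (bCoeff s (baseParams w) (w.1 4) N : Op p N)⁻¹ *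
      bCoeff s (baseParams w) (w.1 4) (N - (i + 1)) = Matrix.diagonal fun g =>
        (∏ n, (X - C (baseZero s (baseParams w) n (g n)))).coeff (N - (i + 1)) := by
    intro i
    have : (bCoeff s (baseParams w) (w.1 4) (N - (i + 1)) : Op p N) =
        bCoeff s (baseParams w) (w.1 4) N * Matrix.diagonal fun g =>
          (∏ n, (X - C (baseZero s (baseParams w) n (g n)))).coeff (N - (i + 1)) := by
      rw [bCoeff_baseParams_last hs hN, Matrix.diagonal_mul_diagonal, bCoeff_baseParams hs hN]
      simp only [coeff_C_mul]
    rw [this, ← mul_assoc, Matrix.nonsing_inv_mul _ hw.isUnit, one_mul]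
  simp only [hT]
  rw [opEval_diagonal, Matrix.det_diagonal]
  refine Finset.prod_ne_zero_iff.2 fun g _ => ?_
  rw [eval_sepCoeffPoly]
  exact eval_sepPoly_baseZero_ne_zero hs hsp w g

/-- The values `probe s r j` are almost everywhere avoided by the zeros if, at the degenerate
parameters, `r` is almost everywhere different from every given number of norm different
from `1`. -/
theorem ae_det_probe (hs : ‖s‖ = 1) (hsp : (s ^ 2) ^ p = 1) (hN : N ≠ 0) {r r0 : Coords N → ℂ}
    (hr : Degenerates r r0) (h0 : ∀ᵐ w, r0 w ≠ 0) (hr0 : ∀ c : ℂ, ‖c‖ ≠ 1 → ∀ᵐ w, r0 w ≠ c) :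
    ∀ᵐ w : Coords N, ∀ j,
      (bEval s (Params.ofCoords w) (w.1 4) (probe s (r w) j) : Op p N).det ≠ 0 := by
  have hs0 : s ^ 2 ≠ 0 := pow_ne_zero _ (norm_ne_zero_of_norm_one hs)
  refine ae_all_iff.2 fun j => ?_
  have hB : ∀ k, MatrixDegenerates
      (fun w : Coords N => (bCoeff s (Params.ofCoords w) (w.1 4) k : Op p N))
      fun w => bCoeff s (baseParams w) (w.1 4) k := by
    intro k
    have := matrixDegenerates_bCoeff (p := p) (N := N) s 1 k
    simpa only [one_mul] using this
  have hj : (s ^ 2) ^ j ≠ 0 := zpow_ne_zero _ hs0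
  have hpr : Degenerates (fun w => probe s (r w) j) fun w => probe s (r0 w) j := by
    have h₁ := (Degenerates.const ((s ^ 2) ^ j)).mul hr
    refine h₁.add ((Degenerates.const 1).div h₁ ?_)
    filter_upwards [h0] with w hw using mul_ne_zero hj hw
  refine (MatrixDegenerates.sum (Finset.range (N + 1)) fun k _ =>
    MatrixDegenerates.smul (hpr.pow k) (hB k)).det.ae_ne_zero ?_
  have hne : ∀ᵐ w, ∀ (n : Fin N) (k : ℕ),
      probe s (r0 w) j ≠ baseZero s (baseParams w) n k := by
    refine ae_all_iff.2 fun n => ae_all_iff.2 fun k => ?_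
    have hy := norm_baseVar hs n k
    have hnorm : ((2 : ℝ) ^ ((n : ℕ) + 1)) ≠ 1 := (one_lt_pow₀ one_lt_two (Nat.succ_ne_zero _)).ne'
    simp only [baseZero_baseParams]
    generalize (2 ^ ((n : ℕ) + 1) * (s ^ 2) ^ (2 * k) / s ^ 2 : ℂ) = y at *
    have hy0 : y ≠ 0 := by
      rw [← norm_ne_zero_iff, hy]
      positivity
    have hjn : ‖(s ^ 2) ^ j‖ = 1 := by simp [hs]
    have c₁ : ‖y / (s ^ 2) ^ j‖ ≠ 1 := by rwa [norm_div, hy, hjn, div_one]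
    have c₂ : ‖1 / ((s ^ 2) ^ j * y)‖ ≠ 1 := by
      rw [norm_div, norm_mul, hy, hjn, norm_one, one_mul, one_div, Ne, inv_eq_one]
      exact hnorm
    filter_upwards [h0, hr0 _ c₁, hr0 _ c₂] with w hw h₁ h₂
    rw [probe, Ne, add_inv_eq_iff (mul_ne_zero hj hw) hy0, not_or]
    refine ⟨fun e => h₁ ?_, fun e => h₂ ?_⟩
    · rw [← e, mul_div_cancel_left₀ _ hj]
    · rw [eq_div_iff (mul_ne_zero hj hy0), ← e]
      ring
  filter_upwards [hne, ae_baseLead (norm_ne_zero_of_norm_one hs) hsp] with w hw hl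
  have hl := hl 0
  rw [pow_zero, one_mul] at hl
  have e : (∑ k ∈ Finset.range (N + 1),
      probe s (r0 w) j ^ k • bCoeff s (baseParams w) (w.1 4) k : Op p N) =
        Matrix.diagonal fun g => baseLead s (baseParams w) (w.1 4) *
          ∏ n, (probe s (r0 w) j - baseZero s (baseParams w) n (g n)) := by
    simp only [bCoeff_baseParams hs hN, ← Matrix.diagonal_smul]
    ext g g'
    rw [Matrix.sum_apply]
    rcases eq_or_ne g g' with rfl | hg
    · have hd : (C (baseLead s (baseParams w) (w.1 4)) *
          ∏ n, (X - C (baseZero s (baseParams w) n (g n)))).natDegree < N + 1 := by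
        refine Nat.lt_succ_of_le ((natDegree_C_mul_le _ _).trans ?_)
        rw [natDegree_prod_of_monic _ _ fun n _ => monic_X_sub_C _]
        simp
      have he := eval_eq_sum_range' hd (probe s (r0 w) j)
      rw [eval_mul, eval_C, eval_prod] at he
      simp only [eval_sub, eval_X, eval_C] at he
      simp only [Matrix.diagonal_apply_eq, Pi.smul_apply, smul_eq_mul, he]
      exact Finset.sum_congr rfl fun k _ => mul_comm _ _
    · simp [Matrix.diagonal_apply_ne _ hg]
  rw [e, Matrix.det_diagonal]
  exact Finset.prod_ne_zero_iff.2 fun g _ => mul_ne_zero hl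
    (Finset.prod_ne_zero_iff.2 fun n _ => sub_ne_zero.2 (hw n _))

theorem ae_det_probe_const (hs : ‖s‖ = 1) (hsp : (s ^ 2) ^ p = 1) (hN : N ≠ 0) {r : ℂ}
    (hr : ‖r‖ = 1) : ∀ᵐ w : Coords N, ∀ j,
      (bEval s (Params.ofCoords w) (w.1 4) (probe s r j) : Op p N).det ≠ 0 :=
  ae_det_probe hs hsp hN (Degenerates.const r)
    (Eventually.of_forall fun _ => norm_ne_zero_of_norm_one hr)
    fun c hc => Eventually.of_forall fun _ e => hc (by rw [← e, hr])

theorem ae_innerRoot_ne (A : ℂ) {e : ℤ} (he : e = 1 ∨ e = -1) :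
    ∀ᵐ w : Coords N, innerRoot (w.1 0) (w.1 1) e ≠ A := by
  -- The equation for the root is a polynomial equation of degree four for `ζ`.
  have h := ae_ne_zero_of_direction (N := N)
    (f := fun w => w.1 0 ^ 4 + 1 - w.1 0 ^ 2 * ((A ^ 2 - 4) * w.1 1 ^ 2 + A)) (by fun_prop)
    (Pi.single 0 1, 0) fun w => by
      set B := (A ^ 2 - 4) * w.1 1 ^ 2 + A with hB
      set Q : ℂ[X] := (X + C (w.1 0)) ^ 4 + 1 - (X + C (w.1 0)) ^ 2 * C B with hQ
      have hQ0 : Q ≠ 0 := by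
        intro h0
        have := congrArg (eval (-w.1 0)) h0
        simp [hQ] at this
      have := ae_real_of_cofinite (eventually_cofinite_eval_ne hQ0)
      filter_upwards [this] with t ht h
      apply ht
      rw [← h]
      simp [hQ, hB]
      ring
  filter_upwards [h, ae_fst_ne 0 0, ae_fst_ne 1 0] with w hw h₁ h₂ e'
  have hi := innerRoot_spec (w.1 0) (w.1 1) he
  rw [e'] at hi
  apply hw
  field_simp at hi
  linear_combination -hi

theorem ae_det_probe_inner (hs : ‖s‖ = 1) (hsp : (s ^ 2) ^ p = 1) (hN : N ≠ 0) {e : ℤ}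
    (he : e = 1 ∨ e = -1) : ∀ᵐ w : Coords N, ∀ j, (bEval s (Params.ofCoords w) (w.1 4)
      (probe s (joukowskiInv (innerRoot (w.1 0) (w.1 1) e)) j) : Op p N).det ≠ 0 := by
  have hm : Measurable fun x : Fin 5 → ℂ => joukowskiInv (innerRoot (x 0) (x 1) e) := by
    unfold joukowskiInv innerRoot
    fun_prop
  refine ae_det_probe hs hsp hN (Degenerates.of_fst hm)
    (Eventually.of_forall fun w => (joukowskiInv_spec _).1) fun c _ => ?_
  filter_upwards [ae_innerRoot_ne (c + 1 / c) he] with w hw h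
  apply hw
  rw [← h, (joukowskiInv_spec _).2]

/-- The numbers `μ_{n,±} ^ 2` have well-defined limits along the lines to the degenerate parameters,
which contain the ratio of the two coordinates that tend to zero. -/
theorem ae_det_probe_ratio (hs : ‖s‖ = 1) (hsp : (s ^ 2) ^ p = 1) (n : Fin N) {i j : Fin 6}
    (hij : i ≠ j) (hi : bulkBase N n i = 0) (hj : bulkBase N n j = 0) : ∀ᵐ w : Coords N, ∀ k,
      (bEval s (Params.ofCoords w) (w.1 4)
        (probe s (-s ^ 2 * (w.2 n i * w.2 n 5 / (w.2 n 4 * w.2 n j))) k) : Op p N).det ≠ 0 := by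
  have hs0 : s ^ 2 ≠ 0 := pow_ne_zero _ (norm_ne_zero_of_norm_one hs)
  have h4 : bulkBase N n 4 = 2 ^ ((n : ℕ) + 1) := rfl
  have h5 : bulkBase N n 5 = 1 := rfl
  have hK : -s ^ 2 * (1 / 2 ^ ((n : ℕ) + 1)) ≠ 0 := by simpa using hs0
  have hD := (Degenerates.const (-s ^ 2)).mul ((Degenerates.ratio n hi hj).mul
    ((Degenerates.coord n 5).div (Degenerates.coord n 4)
      (Eventually.of_forall fun _ => by rw [h4]; exact pow_ne_zero _ two_ne_zero)))
  have e : ∀ w : Coords N, w.2 n i * w.2 n 5 / (w.2 n 4 * w.2 n j) =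
      w.2 n i / w.2 n j * (w.2 n 5 / w.2 n 4) := by
    intro w
    rw [div_mul_div_comm, mul_comm (w.2 n 4)]
  simp only [e]
  have hN : N ≠ 0 := fun h => by
    have := n.isLt
    omega
  refine ae_det_probe hs hsp hN hD ?_ fun c _ => ?_
  · filter_upwards [ae_snd_ne_zero n i, ae_snd_ne_zero n j] with w h₁ h₂
    rw [h4, h5, mul_left_comm]
    exact mul_ne_zero (div_ne_zero h₁ h₂) hK
  · filter_upwards [ae_snd_ne_zero n j, ae_snd_ne_mul n hij (c / (-s ^ 2 * (1 / 2 ^ ((n : ℕ) + 1))))]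
      with w h₁ h₂ h
    apply h₂
    rw [h4, h5, mul_left_comm] at h
    rw [← h, mul_div_cancel_right₀ _ hK, div_mul_cancel₀ _ h₁]

theorem ae_generic_of_ne_zero (hs : ‖s‖ = 1) (hsp : (s ^ 2) ^ p = 1) (hN : N ≠ 0) :
    ∀ᵐ w : Coords N, (Params.ofCoords w).Generic p s := by
  have h₁ : ∀ᵐ w : Coords N, ∀ m j, (bEval s (Params.ofCoords w) (w.1 4)
      (probe s (-s ^ 2 * (w.2 m 0 * w.2 m 5 / (w.2 m 4 * w.2 m 1))) j) : Op p N).det ≠ 0 :=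
    ae_all_iff.2 fun m => ae_det_probe_ratio hs hsp m (by decide) rfl rfl
  have h₂ : ∀ᵐ w : Coords N, ∀ m j, (bEval s (Params.ofCoords w) (w.1 4)
      (probe s (-s ^ 2 * (w.2 m 2 * w.2 m 5 / (w.2 m 4 * w.2 m 3))) j) : Op p N).det ≠ 0 :=
    ae_all_iff.2 fun m => ae_det_probe_ratio hs hsp m (by decide) rfl rfl
  filter_upwards [ae_regular, ae_fst_ne 4 0, ae_beta_pow p, ae_det_lead hs hsp hN,
    ae_det_sep hs hsp hN, ae_det_probe_const hs hsp hN norm_one,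
    ae_det_probe_const (r := -1) hs hsp hN (by simp), ae_det_probe_inner hs hsp hN (Or.inl rfl),
    ae_det_probe_inner hs hsp hN (Or.inr rfl), h₁, h₂] with w g₁ g₂ g₃ g₄ g₅ g₆ g₇ g₈ g₉ g₁₀ g₁₁
  exact
    { regular := g₁, beta_ne := g₂, beta_pow := g₃, det_lead := g₄, det_sep := g₅, det_one := g₆
      det_neg_one := g₇
      det_inner := fun j e he => by
        rcases he with rfl | rfl
        · exact g₈ j
        · exact g₉ j
      det_muPlus := fun j m => g₁₀ m j
      det_muMinus := fun j m => g₁₁ m j }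

/-! ### The chain of length zero -/

/-- Without bulk the boundary monodromy is the boundary matrix, so that `ℬ_-` is the contraction of
`K_-` with the gauge vectors. -/
theorem gaugedB_length_zero (hs : s ≠ 0) {P : Params 0} (hζ : P.zeta ≠ 0) (hα : P.gaugeAlpha ≠ 0) {bt : ℂ} (hb : bt ≠ 0)
    {lam : ℂ} (hl : lam ≠ 0) :
    (gaugedB s P lam bt : Op p 0) = ((lam ^ 2 / s ^ 2 - s ^ 2 / lam ^ 2) *
      ((bt - 1 / bt)⁻¹ * (1 / (P.zeta - 1 / P.zeta)) * bt *
        (-P.zeta + P.kappa * ((-(P.gaugeAlpha * s ^ 2 * Complex.exp P.tau) +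
          bt ^ 2 / (P.gaugeAlpha * s ^ 2) * Complex.exp (-P.tau)) / bt)))) • 1 := by
  have hU : (boundaryMonodromy s P lam : AuxOp p 0) = auxScalar (kMinus s P lam) := by
    have hsy : (auxScalar sigmaY * auxScalar sigmaY : AuxOp p 0) = 1 := by
      refine Matrix.ext fun i j => ?_
      fin_cases i <;> fin_cases j <;>
        simp [auxScalar, sigmaY, Matrix.mul_apply, Fin.sum_univ_two,
          Algebra.algebraMap_eq_smul_one, smul_smul]
    simp [boundaryMonodromy, monodromyHat, monodromy, hsy]
  rw [gaugedB, hU]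
  simp only [auxScalar, kMinus, Matrix.map_apply, Matrix.smul_apply, Matrix.of_apply,
    Matrix.cons_val_zero, Matrix.cons_val_one, Matrix.cons_val', Matrix.cons_val_fin_one,
    Algebra.algebraMap_eq_smul_one, smul_smul, ← sub_smul, ← add_smul]
  congr 1
  simp only [smul_eq_mul]
  generalize (bt - 1 / bt)⁻¹ = x
  generalize 1 / (P.zeta - 1 / P.zeta) = y
  field_simp
  ring

theorem ae_generic_length_zero (hs : ‖s‖ = 1) (hsp : (s ^ 2) ^ p = 1) :
    ∀ᵐ w : Coords 0, (Params.ofCoords w).Generic p s := by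
  have hs0 := norm_ne_zero_of_norm_one hs
  have hc : ∀ᵐ w : Coords 0, ∀ k : ℕ, -w.1 0 + w.1 1 * ((-(w.1 3 * s ^ 2 * Complex.exp (w.1 2)) +
      ((s ^ 2) ^ k * w.1 4) ^ 2 / (w.1 3 * s ^ 2) * Complex.exp (-w.1 2)) /
        ((s ^ 2) ^ k * w.1 4)) ≠ 0 := by
    refine ae_all_iff.2 fun k => ae_ne_zero_of_direction (by fun_prop) (Pi.single 0 1, 0) fun w => ?_
    set R := w.1 1 * ((-(w.1 3 * s ^ 2 * Complex.exp (w.1 2)) +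
      ((s ^ 2) ^ k * w.1 4) ^ 2 / (w.1 3 * s ^ 2) * Complex.exp (-w.1 2)) /
        ((s ^ 2) ^ k * w.1 4)) with hR
    have := ae_real_of_cofinite (Set.finite_singleton (R - w.1 0)).eventually_cofinite_notMem
    filter_upwards [this] with t ht h
    apply ht
    rw [Set.mem_singleton_iff]
    have : -(w.1 0 + t) + R = 0 := by
      rw [← h, hR]
      simp
    linear_combination -this
  filter_upwards [ae_regular, ae_fst_ne 4 0, ae_beta_pow p, ae_gauge hs0 hsp, hc]
    with w hR h4 hp hg hc
  have hlead : ∀ k : ℕ,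
      (bCoeff s (Params.ofCoords w) ((s ^ 2) ^ k * w.1 4) 0 : Op p 0).det ≠ 0 := by
    intro k
    have hbt : (s ^ 2) ^ k * w.1 4 ≠ 0 := mul_ne_zero (pow_ne_zero _ (pow_ne_zero _ hs0)) h4
    rw [Matrix.det_unique, bCoeff_apply (Q := C _) hs (natDegree_C _).le (fun i => by
      rw [gaugedB_length_zero hs0 hR.zeta hR.gaugeAlpha hbt (node_ne_zero i), Matrix.smul_apply,
        Matrix.one_apply_eq, smul_eq_mul, mul_one, eval_C]) 0, coeff_C_zero]
    exact mul_ne_zero (mul_ne_zero (mul_ne_zero (inv_ne_zero (hg k))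
      (one_div_ne_zero hR.zeta_sub)) hbt) (hc k)
  have hprobe : ∀ x, (bEval s (Params.ofCoords w) (w.1 4) x : Op p 0).det ≠ 0 := by
    intro x
    have := hlead 0
    rw [pow_zero, one_mul] at this
    simpa [bEval] using this
  exact
    { regular := hR, beta_ne := h4, beta_pow := hp, det_lead := hlead
      det_sep := by
        have hT : symOp s (Params.ofCoords w) (Params.ofCoords w).gaugeBeta =
          fun i : Fin 0 => (Matrix.diagonal (i.elim0) : Op p 0) := funext fun i => i.elim0
        rw [hT, opEval_diagonal, Matrix.det_diagonal]
        refine Finset.prod_ne_zero_iff.2 fun g _ => ?_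
        have h := eval_sepPoly_ne_zero (p := p) (x := (Fin.elim0 : Fin 0 → ℂ)) |>.2 fun n => n.elim0
        rw [← eval_sepCoeffPoly] at h
        convert h
      det_one := fun j => hprobe _, det_neg_one := fun j => hprobe _
      det_inner := fun j e _ => hprobe _, det_muPlus := fun j m => hprobe _
      det_muMinus := fun j m => hprobe _ }

theorem ae_generic (hs : ‖s‖ = 1) (hsp : (s ^ 2) ^ p = 1) :
    ∀ᵐ w : Coords N, (Params.ofCoords w).Generic p s := by
  rcases eq_or_ne N 0 with rfl | hN
  · exact ae_generic_length_zero hs hsp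
  · exact ae_generic_of_ne_zero hs hsp hN

end AlmostEverywhere

/-! ### The root of unity -/

section RootOfUnity

theorem norm_qHalf (p' p : ℕ) : ‖qHalf p' p‖ = 1 := by
  have : -(Complex.I * Real.pi * (p' / p)) / 2 = ((-(Real.pi * (p' / p)) / 2 : ℝ) : ℂ) * Complex.I := by
    push_cast
    ring
  rw [qHalf, this, Complex.norm_exp_ofReal_mul_I]

theorem isPrimitiveRoot_qHalf_sq {p' p : ℕ} [NeZero p] (hp : Odd p) (hp' : Even p')
    (hcop : Nat.Coprime p' p) : IsPrimitiveRoot (qHalf p' p ^ 2) p := by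
  obtain ⟨k, rfl⟩ := hp'
  have hk : Nat.Coprime k p := Nat.Coprime.coprime_dvd_left ⟨2, by ring⟩ hcop
  have h := (Complex.isPrimitiveRoot_exp_of_coprime k p (NeZero.ne p) hk).inv
  have e : qHalf (k + k) p ^ 2 = (Complex.exp (2 * Real.pi * Complex.I * (k / p)))⁻¹ := by
    rw [qHalf, ← Complex.exp_nat_mul, ← Complex.exp_neg]
    congr 1
    push_cast
    ring
  rwa [e]

end RootOfUnity

end

end CyclicReflection

theorem mainTheorem2 (p' p N : ℕ) [NeZero p] (hp : Odd p) (hp' : Even p')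
    (hcop : Nat.Coprime p' p) :
    ∀ᵐ w : (Fin 5 → ℂ) × (Fin N → Fin 6 → ℂ),
      ∀ (P : Params N) (s q : ℂ), P = Params.ofCoords w → s = qHalf p' p → q = s ^ 2 →
      ∀ am bm a0 : ℂ, IsInnerBoundary P am bm → a0 ≠ 0 →
      ∃ (E : PseudoData p N) (cL cR : ℂ → Fin N → ℂ), ∀ bt ∈ gaugeOrbit s P.gaugeBeta,
        -- the gauged operators are defined at `bt`
        (bt ≠ 0 ∧ bt ≠ 1 ∧ bt ≠ -1 ∧ bt ≠ q ^ 2 ∧ bt ≠ -q ^ 2) ∧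
        -- left and right pseudo-eigenstates
        (E.bra bt ≠ 0 ∧ E.ket bt ≠ 0 ∧
          ∀ lam : ℂ, lam ≠ 0 →
            Matrix.vecMul (E.bra bt) (gaugedB s P lam bt) =
                E.eigenvalue s (fun _ => 0) lam bt • E.bra (bt / q ^ 2) ∧
              Matrix.mulVec (gaugedB s P lam bt) (E.ket bt) =
                E.eigenvalue s (fun _ => 0) lam bt • E.ket (q ^ 2 * bt)) ∧
        -- the conditions on the zeros
        (E.lead bt ≠ 0 ∧ (∀ n, E.zero bt n ≠ 0) ∧
          ∀ n m : Fin N, ∀ h ∈ Finset.Icc 1 (p - 1), ∀ e : ℤ, e = 1 ∨ e = -1 →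
            E.zero bt n ^ 2 ≠ q ^ (1 - 2 * (h : ℤ)) * am ^ (2 * e) ∧
            E.zero bt n ^ 2 ≠ -(q ^ (1 - 2 * (h : ℤ)) * bm ^ (2 * e)) ∧
            E.zero bt n ^ 2 ≠ q ^ (1 - 2 * (h : ℤ)) * muPlus s P m ^ (2 * e) ∧
            E.zero bt n ^ 2 ≠ q ^ (1 - 2 * (h : ℤ)) * muMinus s P m ^ (2 * e)) ∧
        -- the denominators in the definition of the states do not vanish
        (E.norm s bt ≠ 0 ∧
          ∀ n : Fin N, ∀ k : ℕ, k + 1 < p →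
            coefA s P am bm a0 (1 / E.shiftedZero s bt n k) ≠ 0 ∧
            coefD s P am bm a0 (1 / E.shiftedZero s bt n k) ≠ 0) ∧
        -- left and right bases
        (LinearIndependent ℂ (fun h : Config p N => E.leftState s P am bm a0 bt h) ∧
          Submodule.span ℂ (Set.range fun h : Config p N => E.leftState s P am bm a0 bt h) = ⊤ ∧
          LinearIndependent ℂ (fun h : Config p N => E.rightState s P am bm a0 bt h) ∧
          Submodule.span ℂ (Set.range fun h : Config p N => E.rightState s P am bm a0 bt h) = ⊤) ∧
        -- decomposition of the identity
        ((1 : Op p N) =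
          ∑ h : Config p N, E.vandermonde s bt (fun n => (h n : ℕ)) •
            Matrix.vecMulVec (E.rightState s P am bm a0 (bt * q ^ 2) h)
              (E.leftState s P am bm a0 bt h)) ∧
        -- pairings of left and right states
        (∀ h k : Config p N,
          E.leftState s P am bm a0 bt h ⬝ᵥ E.rightState s P am bm a0 (bt * q ^ 2) k =
            if h = k then 1 / E.vandermonde s bt (fun n => (h n : ℕ)) else 0) ∧
        -- pseudo-diagonal action of the gauged operator `ℬ_-`
        (∀ lam : ℂ, lam ≠ 0 → ∀ h : Config p N,
          Matrix.vecMul (E.leftState s P am bm a0 bt h) (gaugedB s P lam bt) =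
              E.eigenvalue s (fun n => (h n : ℕ)) lam bt •
                E.leftState s P am bm a0 (bt / q ^ 2) h ∧
            Matrix.mulVec (gaugedB s P lam bt) (E.rightState s P am bm a0 bt h) =
              E.eigenvalue s (fun n => (h n : ℕ)) lam bt •
                E.rightState s P am bm a0 (q ^ 2 * bt) h) ∧
        -- simplicity of the pseudo-spectrum
        ((∀ n, E.zero bt n ^ (2 * p) ≠ 1 ∧ E.zero bt n ^ (2 * p) ≠ -1) ∧
          (∀ n m, n ≠ m → E.zero bt m ^ p ≠ E.zero bt n ^ p) ∧
          (∀ n m, n ≠ m → ∀ h k : Fin p, E.X s bt n h ≠ E.X s bt m k) ∧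
          (∀ h k : Config p N,
            (∀ lam : ℂ, lam ≠ 0 →
              E.eigenvalue s (fun n => (h n : ℕ)) lam bt =
                E.eigenvalue s (fun n => (k n : ℕ)) lam bt) → h = k)) ∧
        -- shift action of `𝒜_-` on the left states and of `𝒟_-` on the right states, at the zeros
        ((∀ a, cL bt a ≠ 0 ∧ cR bt a ≠ 0) ∧
          ∀ (h : Config p N) (a : Fin N) (z : ℂ), z = E.shiftedZero s bt a (h a) →
            Matrix.vecMul (E.leftState s P am bm a0 bt h) (gaugedA s P z (bt * q ^ 2)) =
                (coefA s P am bm a0 z * lowerFactor (cL bt) h a) •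
                  E.leftState s P am bm a0 bt (lower h a) ∧
              Matrix.vecMul (E.leftState s P am bm a0 bt h) (gaugedA s P (1 / z) (bt * q ^ 2)) =
                (coefA s P am bm a0 (1 / z) * raiseFactor (cL bt) h a) •
                  E.leftState s P am bm a0 bt (raise h a) ∧
              Matrix.mulVec (gaugedD s P z bt) (E.rightState s P am bm a0 bt h) =
                (coefD s P am bm a0 z * lowerFactor (cR bt) h a) •
                  E.rightState s P am bm a0 bt (lower h a) ∧
              Matrix.mulVec (gaugedD s P (1 / z) bt) (E.rightState s P am bm a0 bt h) =
                (coefD s P am bm a0 (1 / z) * raiseFactor (cR bt) h a) •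
                  E.rightState s P am bm a0 bt (raise h a)) := by
  have hs := norm_qHalf p' p
  have hq := isPrimitiveRoot_qHalf_sq hp hp' hcop
  filter_upwards [ae_generic (p := p) (N := N) hs hq.pow_eq_one] with w hw
  rintro P s q rfl rfl hqs am bm a0 hin ha0
  obtain ⟨ℓ, z, ψ, hD⟩ := hw.exists_spectralData hs hq hp
  exact (hD am bm a0 hin ha0).separation _ hqs
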